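/- Let $p$ be a prime number and let $k$ be a field of characteristic $p$ that is $F$-finite, i.e. $[k:k^p]<\infty$. A *normal projective variety* over $k$ is a normal integral closed subscheme of some $\mathbb{P}^n_k$. For a Weil divisor $D$ on such a variety $X$, $\mathcal{O}_X(D)$ denotes the sheaf of $\mathcal{O}_X$-modules whose sections over an open set $U$ are the rational functions $f$ such that $f=0$ or $(\operatorname{div} f+D)|_U\ge 0$. For an integer $e\ge 1$ let $F^e:X\to X$ be the $e$-th iterate of the absolute Frobenius morphism. Let $\Delta$ be an effective $\mathbb{Q}$-divisor on a normal projective variety $X$ over $k$. * $(X,\Delta)$ is *globally sharply $F$-split* if there is an integer $e\ge 1$ such that the composition $\mathcal{O}_X\to F^e_*\mathcal{O}_X\hookrightarrow F^e_*\mathcal{O}_X(\lceil (p^e-1)\Delta\rceil)$ of the $e$-times iterated Frobenius map with the natural inclusion splits as a homomorphism of $\mathcal{O}_X$-modules. * $(X,\Delta)$ is *globally $F$-regular* if for every effective Weil divisor $D$ on $X$ there is an integer $e\ge 1$ such that the composition $\mathcal{O}_X\to F^e_*\mathcal{O}_X\hookrightarrow F^e_*\mathcal{O}_X(\lceil (p^e-1)\Delta\rceil+D)$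 splits as a homomorphism of $\mathcal{O}_X$-modules. **Proposition 3.1.** Let $X$ be a normal projective variety over $k$ and $\Delta$ an effective $\mathbb{Q}$-divisor on $X$. Let $r\ge 1$, let $\mathcal{L}_1,\dots,\mathcal{L}_r$ be line bundles on $X$, put $V=\bigoplus_{i=1}^r\mathcal{L}_i$, and let $\pi:\mathbb{P}_X(V)=\operatorname{Proj}_X\big(\bigoplus_{m\ge 0}S^mV\big)\to X$ be the associated projective bundle. Then $\mathbb{P}_X(V)$ is a normal projective variety over $k$ (via $\pi$ and the structure morphism of $X$) and $\pi$ is flat. Let $\pi^*\Delta$ be the pullback of $\Delta$ by the flat morphism $\pi$: if $\Delta=\sum_i d_i D_i$ with prime divisors $D_i$, then $\pi^*\Delta=\sum_i d_i\,[\pi^{-1}(D_i)]$, where $[\pi^{-1}(D_i)]$ is the divisor of the scheme-theoretic inverse image, each component being counted with its multiplicity. Moreover: 1. if $(X,\Delta)$ is globally $F$-regular, then $(\mathbb{P}_X(V),\pi^*\Delta)$ is globally $F$-regular; 2. if $(X,\Delta)$ is globally sharply $F$-split, then $(\mathbb{P}_X(V),\pi^*\Delta)$ is globally sharply $F$-split.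 -/

import Mathlib

open CategoryTheory AlgebraicGeometry Limits TopologicalSpace Opposite

universe u

noncomputable section

/-- The ring endomorphism `x ↦ x ^ (p ^ e)` of a commutative ring in which `p = 0`. -/
def frobPow (p : ℕ) [Fact p.Prime] (e : ℕ) {R : Type*} [CommRing R] (h : (p : R) = 0) :
    R →+* R where
  toFun x := x ^ p ^ e
  map_one' := one_pow _
  map_mul' x y := mul_pow x y _
  map_zero' := zero_pow (pow_ne_zero _ (Fact.out : p.Prime).ne_zero)
  map_add' x y := by
    rcases subsingleton_or_nontrivial R with hR | hR
    · exact Subsingleton.elim _ _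
    · have : CharP R p := (CharP.charP_iff_prime_eq_zero Fact.out).2 h
      exact add_pow_char_pow x y p e

theorem natCast_section_eq_zero {X : Scheme.{u}} {p : ℕ} (h : (p : Γ(X, ⊤)) = 0) (U : X.Opens) :
    (p : Γ(X, U)) = 0 := by
  have := congrArg (X.presheaf.map (homOfLE (le_top : U ≤ ⊤)).op).hom h
  simpa using this

/-- The `e`-th iterate of the absolute Frobenius morphism. -/
def absFrobenius (X : Scheme.{u}) (p : ℕ) [Fact p.Prime] (e : ℕ) (h : (p : Γ(X, ⊤)) = 0) :
    X ⟶ X where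
  base := 𝟙 _
  c := { app := fun U => CommRingCat.ofHom (frobPow p e (natCast_section_eq_zero h U.unop))
         naturality := by
          intro U V f
          ext x
          exact (map_pow (X.presheaf.map f).hom _ _).symm }
  prop := by
    intro x
    refine ⟨fun a ha => ?_⟩
    obtain ⟨U, hxU, s, rfl⟩ := X.presheaf.exists_germ_eq a
    erw [PresheafedSpace.stalkMap_germ_apply] at ha
    have : IsUnit ((X.presheaf.germ U x hxU).hom (s ^ p ^ e)) := ha
    rw [map_pow] at this
    exact (isUnit_pow_iff (pow_ne_zero _ (Fact.out : p.Prime).ne_zero)).1 this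

/-- A scheme is normal if all its local rings are integrally closed domains. -/
class IsNormalScheme (X : Scheme.{u}) : Prop where
  isDomain_stalk : ∀ x : X, IsDomain (X.presheaf.stalk x)
  isIntegrallyClosed_stalk : ∀ x : X, IsIntegrallyClosed (X.presheaf.stalk x)

/-- Prime divisors are encoded by their generic points, the points of codimension one. -/
abbrev PrimeDivisor (X : Scheme.{u}) : Type u := {x : X // Order.coheight x = 1}

/-- Weil divisors (on a Noetherian scheme). -/
abbrev WeilDivisor (X : Scheme.{u}) : Type u := PrimeDivisor X →₀ ℤ

/-- Weil divisors with rational coefficients. -/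
abbrev QDivisor (X : Scheme.{u}) : Type u := PrimeDivisor X →₀ ℚ

/-- The round-up of a `ℚ`-divisor. -/
def QDivisor.ceil {X : Scheme.{u}} (D : QDivisor X) : WeilDivisor X :=
  D.mapRange Int.ceil Int.ceil_zero

theorem QDivisor.ceil_nonneg {X : Scheme.{u}} {D : QDivisor X} (h : 0 ≤ D) : 0 ≤ D.ceil := by
  intro x
  have := Int.ceil_mono (h x)
  simpa [QDivisor.ceil] using this

section divisorSheaf
variable (X : Scheme.{u}) [AlgebraicGeometry.IsIntegral X] [IsLocallyNoetherian X]

theorem isDiscreteValuationRing_stalk [IsNormalScheme X] (x : X) (hx : Order.coheight x = 1) :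
    IsDiscreteValuationRing (X.presheaf.stalk x) := by
  have h1 : Ring.KrullDimLE 1 (X.presheaf.stalk x) := krullDimLE_of_coheight_le hx.le
  have h2 : ringKrullDim (X.presheaf.stalk x) = 1 := by
    rw [ringKrullDim_stalk_eq_coheight, hx]; rfl
  have hf : ¬ IsField (X.presheaf.stalk x) := fun h => by
    rw [ringKrullDim_eq_zero_of_isField h] at h2
    exact zero_ne_one h2
  have h3 : IsIntegrallyClosed (X.presheaf.stalk x) := IsNormalScheme.isIntegrallyClosed_stalk x
  have h4 : Ring.DimensionLEOne (X.presheaf.stalk x) :=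
    ⟨fun {p} hp hp' => hp'.isMaximal_of_ne_bot hp⟩
  have h5 : IsDedekindRing (X.presheaf.stalk x) := { }
  have h6 : IsDedekindDomain (X.presheaf.stalk x) := { }
  exact ((IsDiscreteValuationRing.TFAE _ hf).out 0 2).2 h6

variable {X} in
/-- The sections over `U` of the sheaf `𝒪_X(D)`: rational functions `f` on `X` with
`ord_x f + D(x) ≥ 0` at all codimension one points `x ∈ U`. A rational function is encoded as the
constant function on `U` with that value, so that the zero group results for `U = ∅`. -/
structure IsDivisorSection (D : WeilDivisor X) (U : X.Opens) (s : U → X.functionField) : Prop where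
  const : ∀ x y : U, s x = s y
  ord_nonneg : ∀ (x : U) (hx : Order.coheight (x : X) = 1),
    s x ≠ 0 → 0 ≤ Scheme.ord (s x) x + D ⟨x, hx⟩

variable {X} in
/-- The value in the function field of a section of `𝒪_X`, at a point of its domain. -/
def toRat (U : X.Opens) (x : U) : Γ(X, U) →+* X.functionField :=
  haveI : Nonempty U := ⟨x⟩
  (X.germToFunctionField U).hom

theorem ord_one_eq_zero (x : X) : Scheme.ord (1 : X.functionField) x = 0 := by
  have := Scheme.ord_mul (x := x) (one_ne_zero (α := X.functionField)) one_ne_zero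
  rw [mul_one] at this
  omega

theorem ord_toRat_mul (U : X.Opens) (x : U) (r : Γ(X, U)) (f : X.functionField)
    (h : toRat U x r * f ≠ 0) : Scheme.ord f x ≤ Scheme.ord (toRat U x r * f) x := by
  have : Nonempty U := ⟨x⟩
  have hr : r ≠ 0 := by rintro rfl; simp at h
  exact Scheme.ord_le_smul x.2 hr f

theorem ord_toRat_nonneg (U : X.Opens) (x : U) (r : Γ(X, U)) (h : toRat U x r ≠ 0) :
    0 ≤ Scheme.ord (toRat U x r) x := by
  have := ord_toRat_mul X U x r 1 (by simpa using h)
  rwa [mul_one, ord_one_eq_zero] at this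

theorem toRat_res {U V : X.Opens} (i : V ⟶ U) (x : V) (r : Γ(X, U)) :
    toRat V x ((X.presheaf.map i.op).hom r) = toRat U ⟨x, i.le x.2⟩ r :=
  X.presheaf.germ_res_apply i _ _ r

section sections
variable {X} [IsNormalScheme X] (D : WeilDivisor X)

/-- The group of sections of `𝒪_X(D)` over `U`. -/
def divisorSections (U : X.Opens) : AddSubgroup (U → X.functionField) where
  carrier := {s | IsDivisorSection D U s}
  zero_mem' := ⟨fun _ _ => rfl, fun _ _ h => (h rfl).elim⟩
  add_mem' {s t} hs ht := by
    refine ⟨fun x y => congrArg₂ (· + ·) (hs.const x y) (ht.const x y), fun x hx h => ?_⟩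
    have := isDiscreteValuationRing_stalk X x hx
    by_cases h1 : s x = 0
    · have e : (s + t) x = t x := by simp [h1]
      rw [e] at h ⊢
      exact ht.ord_nonneg x hx h
    by_cases h2 : t x = 0
    · have e : (s + t) x = s x := by simp [h2]
      rw [e] at h ⊢
      exact hs.ord_nonneg x hx h
    have a := hs.ord_nonneg x hx h1
    have b := ht.ord_nonneg x hx h2
    have c := Scheme.ord_add (x := (x : X)) (f := s x) (g := t x) h
    change 0 ≤ Scheme.ord (s x + t x) x + _
    rcases min_le_iff.1 c with c | c <;> omega
  neg_mem' {s} hs := by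
    refine ⟨fun x y => congrArg (- ·) (hs.const x y), fun x hx h => ?_⟩
    have h1 : s x ≠ 0 := fun h0 => h (by simp [h0])
    have e : (-s) x = (-1) * s x := by simp
    have h2 : Scheme.ord (-1 : X.functionField) (x : X) = 0 := by
      have := Scheme.ord_mul (x := (x : X)) (f := (-1 : X.functionField)) (g := -1)
        (by simp) (by simp)
      rw [neg_one_mul, neg_neg, ord_one_eq_zero] at this
      omega
    rw [e, Scheme.ord_mul (by simp) h1, h2, zero_add]
    exact hs.ord_nonneg x hx h1

/-- `Γ(U, 𝒪_X)` acts on `Γ(U, 𝒪_X(D))` by multiplication in the function field. -/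
instance divisorSectionsModule (U : X.Opens) : Module Γ(X, U) (divisorSections D U) where
  smul r s := ⟨fun x => toRat U x r * s.1 x, by
    refine ⟨fun x y => congrArg (toRat U x r * ·) (s.2.const x y), fun x hx h => ?_⟩
    have h1 : s.1 x ≠ 0 := right_ne_zero_of_mul h
    exact (s.2.ord_nonneg x hx h1).trans
      (add_le_add_left (ord_toRat_mul X U x r (s.1 x) h) _)⟩
  one_smul s := Subtype.ext (funext fun x => by
    change toRat U x 1 * s.1 x = s.1 x; rw [map_one, one_mul])
  mul_smul a b s := Subtype.ext (funext fun x => by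
    change toRat U x (a * b) * s.1 x = toRat U x a * (toRat U x b * s.1 x)
    rw [map_mul, mul_assoc])
  smul_zero a := Subtype.ext (funext fun x => by
    change toRat U x a * (0 : X.functionField) = 0; rw [mul_zero])
  smul_add a s t := Subtype.ext (funext fun x => mul_add (toRat U x a) (s.1 x) (t.1 x))
  add_smul a b s := Subtype.ext (funext fun x => by
    change toRat U x (a + b) * s.1 x = toRat U x a * s.1 x + toRat U x b * s.1 x
    rw [map_add, add_mul])
  zero_smul s := Subtype.ext (funext fun x => by
    change toRat U x 0 * s.1 x = 0; rw [map_zero, zero_mul])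

/-- Restriction of sections of `𝒪_X(D)`. -/
def divisorRes {U V : X.Opens} (i : V ≤ U) : divisorSections D U →+ divisorSections D V where
  toFun s := ⟨fun x => s.1 ⟨x, i x.2⟩,
    fun _ _ => s.2.const _ _, fun x hx h => s.2.ord_nonneg ⟨x, i x.2⟩ hx h⟩
  map_zero' := rfl
  map_add' _ _ := rfl

/-- `𝒪_X(D)` as a presheaf of abelian groups. -/
def divisorPresheaf : TopCat.Presheaf Ab X where
  obj U := AddCommGrpCat.of (divisorSections D U.unop)
  map i := AddCommGrpCat.ofHom (divisorRes D i.unop.le)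

instance (U : X.Opensᵒᵖ) : Module (X.ringCatSheaf.obj.obj U) ((divisorPresheaf D).obj U) :=
  divisorSectionsModule D U.unop

theorem divisorPresheaf_isSheaf : (divisorPresheaf D).IsSheaf := by
  rw [TopCat.Presheaf.isSheaf_iff_isSheafUniqueGluing]
  intro ι U sf hsf
  have key : ∀ (i j : ι) (x : U i) (y : U j), (sf i).1 x = (sf j).1 y := by
    intro i j x y
    obtain ⟨z, hz, hz'⟩ := nonempty_preirreducible_inter (U i).2 (U j).2 ⟨x, x.2⟩ ⟨y, y.2⟩
    have h := congrFun (congrArg Subtype.val (hsf i j)) ⟨z, hz, hz'⟩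
    have h' : (sf i).1 ⟨z, hz⟩ = (sf j).1 ⟨z, hz'⟩ := h
    rw [(sf i).2.const x ⟨z, hz⟩, h', (sf j).2.const _ y]
  choose k hk using fun x : (iSup U : X.Opens) => Opens.mem_iSup.1 x.2
  refine ⟨⟨fun x => (sf (k x)).1 ⟨x, hk x⟩, fun x y => key _ _ _ _,
    fun x hx h => (sf (k x)).2.ord_nonneg ⟨x, hk x⟩ hx h⟩, fun i => ?_, fun t ht => ?_⟩
  · exact Subtype.ext (funext fun x => key _ _ _ _)
  · refine Subtype.ext (funext fun x => ?_)
    have h := congrFun (congrArg Subtype.val (ht (k x))) ⟨x, hk x⟩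
    exact h

/-- The sheaf of `𝒪_X`-modules `𝒪_X(D)`. -/
def divisorSheaf : X.Modules where
  val := PresheafOfModules.ofPresheaf (divisorPresheaf D) fun U V f r m =>
    Subtype.ext (funext fun x => by
      exact congrArg (· * m.1 ⟨x.1, f.unop.le x.2⟩) (toRat_res X f.unop x r).symm)
  isSheaf := divisorPresheaf_isSheaf D

end sections

end divisorSheaf

section frobenius
variable {X : Scheme.{u}} [AlgebraicGeometry.IsIntegral X] [IsLocallyNoetherian X] [IsNormalScheme X]

/-- For `E ≥ 0`, a regular function viewed as a section of `𝒪_X(E)`. -/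
def divisorOfSection (E : WeilDivisor X) (hE : 0 ≤ E) (U : X.Opens) :
    Γ(X, U) →ₗ[Γ(X, U)] divisorSections E U where
  toFun r := ⟨fun x => toRat U x r, fun _ _ => rfl, fun x hx h =>
    add_nonneg (ord_toRat_nonneg X U x r h) (hE ⟨x, hx⟩)⟩
  map_add' a b := Subtype.ext (funext fun x => map_add (toRat U x) a b)
  map_smul' a b := Subtype.ext (funext fun x => map_mul (toRat U x) a b)

/-- The natural inclusion `𝒪_X ↪ 𝒪_X(E)` for an effective divisor `E`. -/
def divisorInclusion (E : WeilDivisor X) (hE : 0 ≤ E) :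
    (SheafOfModules.unit X.ringCatSheaf : X.Modules) ⟶ divisorSheaf E where
  val := {
    app := fun U => ModuleCat.ofHom (divisorOfSection E hE U.unop)
    naturality := by
      intro U V f
      refine ModuleCat.hom_ext (LinearMap.ext fun r => ?_)
      exact Subtype.ext (funext fun x => toRat_res X f.unop x r) }

/-- The composition
`𝒪_X → F^e_* 𝒪_X ↪ F^e_* 𝒪_X(E)` of the `e`-times iterated Frobenius map with the natural
inclusion. -/
def frobeniusToDivisor (p : ℕ) [Fact p.Prime] (hp : (p : Γ(X, ⊤)) = 0) (e : ℕ)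
    (E : WeilDivisor X) (hE : 0 ≤ E) :
    (SheafOfModules.unit X.ringCatSheaf : X.Modules) ⟶
      (Scheme.Modules.pushforward (absFrobenius X p e hp)).obj (divisorSheaf E) :=
  (show (SheafOfModules.unit X.ringCatSheaf : X.Modules) ⟶
      (Scheme.Modules.pushforward (absFrobenius X p e hp)).obj
        (SheafOfModules.unit X.ringCatSheaf) from
    SheafOfModules.unitToPushforwardObjUnit (absFrobenius X p e hp).toRingCatSheafHom) ≫
  (Scheme.Modules.pushforward (absFrobenius X p e hp)).map (divisorInclusion E hE)

end frobenius

section symmetricGrading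
variable (R M : Type*) [CommRing R] [AddCommGroup M] [Module R M]

/-- The homogeneous pieces `S^n M` of the symmetric algebra of `M`. -/
def symPart (n : ℕ) : Submodule R (SymmetricAlgebra R M) :=
  LinearMap.range (SymmetricAlgebra.ι R M) ^ n

instance symPart_gradedMonoid : SetLike.GradedMonoid (symPart R M) :=
  Submodule.nat_power_gradedMonoid (LinearMap.range (SymmetricAlgebra.ι R M))

theorem ι_mem_symPart (m : M) : SymmetricAlgebra.ι R M m ∈ symPart R M 1 := by
  rw [symPart, pow_one]
  exact LinearMap.mem_range_self _ m

open DirectSum in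
/-- The linear map `M → ⨁ S^n M` onto the degree one part. -/
def symDirectSumι : M →ₗ[R] ⨁ i : ℕ, symPart R M i :=
  DirectSum.lof R ℕ (fun i => symPart R M i) 1 ∘ₗ
    (SymmetricAlgebra.ι R M).codRestrict _ fun m => ι_mem_symPart R M m

open DirectSum in
/-- The decomposition of the symmetric algebra into its homogeneous pieces. -/
def symDecompose : SymmetricAlgebra R M →ₐ[R] ⨁ i : ℕ, symPart R M i :=
  SymmetricAlgebra.lift (symDirectSumι R M)

open DirectSum in
theorem symDecompose_eq (i : ℕ) (x : symPart R M i) :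
    symDecompose R M x = DirectSum.of (fun i => symPart R M i) i x := by
  obtain ⟨x, hx⟩ := x
  dsimp only [Subtype.coe_mk, DirectSum.lof_eq_of]
  unfold symPart at hx
  induction hx using Submodule.pow_induction_on_left' with
  | algebraMap => simp_rw [AlgHom.commutes, DirectSum.algebraMap_apply]; rfl
  | add _ _ _ _ _ ihx ihy => simp_rw [map_add, ihx, ihy, ← map_add]; rfl
  | mem_mul _ hm _ _ _ ih =>
      obtain ⟨_, rfl⟩ := hm
      simp_rw [map_mul, ih, symDecompose, SymmetricAlgebra.lift_ι_apply, symDirectSumι]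
      erw [DirectSum.of_mul_of]
      exact DirectSum.of_eq_of_gradedMonoid_eq (Sigma.subtype_ext (add_comm _ _) rfl)

/-- The symmetric algebra `Sym M = ⨁ S^n M` as a graded algebra. -/
instance symGradedAlgebra : GradedAlgebra (symPart R M) :=
  GradedAlgebra.ofAlgHom _ (symDecompose R M)
    (by
      refine SymmetricAlgebra.algHom_ext (LinearMap.ext fun m => ?_)
      change DirectSum.coeAlgHom (symPart R M) (SymmetricAlgebra.lift (symDirectSumι R M)
        (SymmetricAlgebra.ι R M m)) = SymmetricAlgebra.ι R M m
      rw [SymmetricAlgebra.lift_ι_apply, symDirectSumι]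
      exact DirectSum.coeAlgHom_of _ _ _)
    (symDecompose_eq R M)

end symmetricGrading

section symMap
variable {A B : Type*} [CommRing A] [CommRing B] (σ : A →+* B) {M N : Type*} [AddCommGroup M]
  [Module A M] [AddCommGroup N] [Module B N] (l : M →ₛₗ[σ] N)

/-- The ring homomorphism `Sym_A M → Sym_B N` induced by a semilinear map `M → N`. -/
def symMapHom : SymmetricAlgebra A M →+* SymmetricAlgebra B N :=
  letI : Algebra A (SymmetricAlgebra B N) :=
    ((algebraMap B (SymmetricAlgebra B N)).comp σ).toAlgebra
  (SymmetricAlgebra.lift (R := A) (M := M)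
    { toFun := fun m => SymmetricAlgebra.ι B N (l m)
      map_add' := fun x y => by simp
      map_smul' := fun a x => by
        rw [map_smulₛₗ, map_smul, Algebra.smul_def, Algebra.smul_def]; rfl }).toRingHom

theorem symMapHom_ι (m : M) :
    symMapHom σ l (SymmetricAlgebra.ι A M m) = SymmetricAlgebra.ι B N (l m) := by
  let _ : Algebra A (SymmetricAlgebra B N) :=
    ((algebraMap B (SymmetricAlgebra B N)).comp σ).toAlgebra
  exact SymmetricAlgebra.lift_ι_apply _ m

theorem symMapHom_algebraMap (a : A) :
    symMapHom σ l (algebraMap A _ a) = algebraMap B _ (σ a) := by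
  let _ : Algebra A (SymmetricAlgebra B N) :=
    ((algebraMap B (SymmetricAlgebra B N)).comp σ).toAlgebra
  exact AlgHom.commutes _ a

theorem symHom_ext {T : Type*} [CommRing T] {f g : SymmetricAlgebra A M →+* T}
    (h : ∀ a, f (algebraMap A _ a) = g (algebraMap A _ a))
    (h' : ∀ m, f (SymmetricAlgebra.ι A M m) = g (SymmetricAlgebra.ι A M m)) : f = g := by
  refine RingHom.ext fun x => ?_
  induction x using SymmetricAlgebra.induction with
  | algebraMap r => exact h r
  | ι x => exact h' x
  | mul a b ha hb => rw [map_mul, map_mul, ha, hb]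
  | add a b ha hb => rw [map_add, map_add, ha, hb]

theorem symMapHom_mem {n : ℕ} {x : SymmetricAlgebra A M} (hx : x ∈ symPart A M n) :
    symMapHom σ l x ∈ symPart B N n := by
  unfold symPart at hx
  induction hx using Submodule.pow_induction_on_left' with
  | algebraMap r =>
    rw [symMapHom_algebraMap]
    exact SetLike.algebraMap_mem_graded (symPart B N) _
  | add _ _ _ _ _ ihx ihy => rw [map_add]; exact add_mem ihx ihy
  | mem_mul _ hm n _ _ ih =>
    obtain ⟨m, rfl⟩ := hm
    rw [map_mul, symMapHom_ι, Nat.succ_eq_add_one, add_comm]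
    exact SetLike.mul_mem_graded (ι_mem_symPart B N _) ih

theorem symMapHom_surj (r : A) (hs : ∀ b, ∃ (n : ℕ) (a : A), σ r ^ n * b = σ a)
    (hsN : ∀ y, ∃ (n : ℕ) (m : M), σ r ^ n • y = l m) (t : SymmetricAlgebra B N) :
    ∃ (n : ℕ) (s : SymmetricAlgebra A M),
      symMapHom σ l (algebraMap A _ r) ^ n * t = symMapHom σ l s := by
  induction t using SymmetricAlgebra.induction with
  | algebraMap b =>
    obtain ⟨n, a, h⟩ := hs b
    refine ⟨n, algebraMap A _ a, ?_⟩
    rw [symMapHom_algebraMap, symMapHom_algebraMap, ← map_pow, ← map_mul, h]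
  | ι y =>
    obtain ⟨n, m, h⟩ := hsN y
    refine ⟨n, SymmetricAlgebra.ι A M m, ?_⟩
    rw [symMapHom_algebraMap, symMapHom_ι, ← map_pow, ← Algebra.smul_def, ← map_smul, h]
  | mul a b ha hb =>
    obtain ⟨n, s, h⟩ := ha
    obtain ⟨n', s', h'⟩ := hb
    refine ⟨n + n', s * s', ?_⟩
    rw [map_mul, ← h, ← h']; ring
  | add a b ha hb =>
    obtain ⟨n, s, h⟩ := ha
    obtain ⟨n', s', h'⟩ := hb
    refine ⟨n + n', algebraMap A _ r ^ n' * s + algebraMap A _ r ^ n * s', ?_⟩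
    rw [map_add, map_mul, map_mul, ← h, ← h', map_pow, map_pow]; ring

theorem symMapHom_inj_aux [Algebra A B] [Module A N] [IsScalarTower A B N] (r : A)
    [IsLocalization.Away r B] (l : M →ₛₗ[algebraMap A B] N) (l' : M →ₗ[A] N)
    (hl : ∀ m, l m = l' m) [IsLocalizedModule (.powers r) l'] {T : Type*} [CommRing T]
    (c : SymmetricAlgebra A M →+* T) (hu : IsUnit (c (algebraMap A _ r)))
    (s : SymmetricAlgebra A M) (hsz : symMapHom (algebraMap A B) l s = 0) : c s = 0 := by
  let gB : B →+* T := IsLocalization.Away.lift (g := c.comp (algebraMap A _)) r hu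
  have hgB : ∀ a, gB (algebraMap A B a) = c (algebraMap A _ a) := fun a =>
    IsLocalization.Away.lift_eq (g := c.comp (algebraMap A _)) r hu a
  let _ : Algebra A T := (c.comp (algebraMap A _)).toAlgebra
  let _ : Algebra B T := gB.toAlgebra
  have : IsScalarTower A B T := IsScalarTower.of_algebraMap_eq fun a => (hgB a).symm
  let cM : M →ₗ[A] T :=
    { toFun := fun m => c (SymmetricAlgebra.ι A M m)
      map_add' := fun x y => by simp
      map_smul' := fun a x => by
        rw [map_smul, Algebra.smul_def, map_mul]
        exact (Algebra.smul_def a _).symm }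
  have hum : ∀ x : Submonoid.powers r, IsUnit (algebraMap A (Module.End A T) x) := by
    rintro ⟨_, n, rfl⟩
    have h1 : IsUnit (algebraMap A T (r ^ n)) := by
      rw [map_pow]; exact hu.pow n
    rw [Module.End.isUnit_iff]
    convert (IsUnit.isUnit_iff_mulLeft_bijective).1 h1 using 1
    funext t
    exact Algebra.smul_def (r ^ n) t
  let gN : N →ₗ[A] T := IsLocalizedModule.lift (.powers r) l' cM hum
  have hgN : ∀ m, gN (l' m) = c (SymmetricAlgebra.ι A M m) := fun m =>
    IsLocalizedModule.lift_apply (.powers r) l' cM hum m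
  let gN' : N →ₗ[B] T := LinearMap.extendScalarsOfIsLocalization (.powers r) B gN
  let ψ : SymmetricAlgebra B N →ₐ[B] T := SymmetricAlgebra.lift gN'
  have hψ : ψ.toRingHom.comp (symMapHom (algebraMap A B) l) = c := by
    refine symHom_ext (fun a => ?_) (fun m => ?_)
    · rw [RingHom.comp_apply, symMapHom_algebraMap]
      exact (ψ.commutes _).trans (hgB a)
    · rw [RingHom.comp_apply, symMapHom_ι, hl]
      exact (SymmetricAlgebra.lift_ι_apply gN' (l' m)).trans (hgN m)
  rw [← hψ, RingHom.comp_apply, hsz, map_zero]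

theorem symMapHom_inj [Algebra A B] [Module A N] [IsScalarTower A B N] (r : A)
    [IsLocalization.Away r B] (l : M →ₛₗ[algebraMap A B] N) (l' : M →ₗ[A] N)
    (hl : ∀ m, l m = l' m) [IsLocalizedModule (.powers r) l'] (s : SymmetricAlgebra A M)
    (hsz : symMapHom (algebraMap A B) l s = 0) :
    ∃ n : ℕ, algebraMap A (SymmetricAlgebra A M) r ^ n * s = 0 := by
  let ρ : SymmetricAlgebra A M := algebraMap A _ r
  have h0 := symMapHom_inj_aux r l l' hl (algebraMap _ (Localization.Away ρ))
    (IsLocalization.Away.algebraMap_isUnit ρ) s hsz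
  obtain ⟨⟨_, n, rfl⟩, hn⟩ := (IsLocalization.map_eq_zero_iff (.powers ρ) _ s).1 h0
  exact ⟨n, hn⟩

/-- `symMapHom` as a homomorphism of graded rings. -/
def symMap : GradedRingHom (symPart A M) (symPart B N) where
  toRingHom := symMapHom σ l
  map_mem := symMapHom_mem σ l

end symMap

section projLocalization

/-- The structure morphism `Proj 𝒜 ⟶ Spec R` of a graded `R`-algebra. -/
def projToSpec {R S : Type u} [CommRing R] [CommRing S] [Algebra R S] (𝒜 : ℕ → Submodule R S)
    [GradedAlgebra 𝒜] : Proj 𝒜 ⟶ Spec (.of R) :=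
  Proj.toSpecZero 𝒜 ≫ Spec.map (CommRingCat.ofHom (algebraMap R (𝒜 0)))

open HomogeneousLocalization in
theorem awayι_projToSpec {R S : Type u} [CommRing R] [CommRing S] [Algebra R S]
    (𝒜 : ℕ → Submodule R S) [GradedAlgebra 𝒜] {f : S} {m : ℕ} (hf : f ∈ 𝒜 m) (hm : 0 < m) :
    Proj.awayι 𝒜 f hf hm ≫ projToSpec 𝒜 =
      Spec.map (CommRingCat.ofHom ((fromZeroRingHom 𝒜 (.powers f)).comp
        (algebraMap R (𝒜 0)))) := by
  rw [projToSpec, Proj.awayι_toSpecZero_assoc, ← Spec.map_comp]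
  rfl

variable {A B S T : Type u} [CommRing A] [CommRing B] [CommRing S] [CommRing T] [Algebra A S]
  [Algebra B T] (𝒜 : ℕ → Submodule A S) (ℬ : ℕ → Submodule B T) [GradedAlgebra 𝒜]
  [GradedAlgebra ℬ]

/-- A graded ring homomorphism that is a localization away from the scalar `r`. -/
structure IsGradedAway (σ : A →+* B) (φ : 𝒜 →+*ᵍ ℬ) (r : A) : Prop where
  comm : ∀ a, φ (algebraMap A S a) = algebraMap B T (σ a)
  isUnit : IsUnit (σ r)
  surj : ∀ t, ∃ (n : ℕ) (s : S), φ (algebraMap A S r) ^ n * t = φ s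
  inj : ∀ s, φ s = 0 → ∃ n : ℕ, algebraMap A S r ^ n * s = 0

variable {𝒜 ℬ} {σ : A →+* B} {φ : 𝒜 →+*ᵍ ℬ} {r : A}

namespace IsGradedAway

theorem hom_surj (h : IsGradedAway 𝒜 ℬ σ φ r) {i : ℕ} {t : T} (ht : t ∈ ℬ i) :
    ∃ (n : ℕ) (s : S), s ∈ 𝒜 i ∧ φ (algebraMap A S r) ^ n * t = φ s := by
  obtain ⟨n, s, hs⟩ := h.surj t
  refine ⟨n, DirectSum.decompose 𝒜 s i, SetLike.coe_mem _, ?_⟩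
  have h1 : φ (algebraMap A S r) ^ n * t ∈ ℬ i := by
    rw [h.comm, ← map_pow, ← Algebra.smul_def]
    exact Submodule.smul_mem _ _ ht
  have h2 : (DirectSum.decompose ℬ (φ s) i : T) = φ (DirectSum.decompose 𝒜 s i) := by
    exact congrArg (fun z => (z i : T)) (DirectSum.decompose_map (𝒜 := 𝒜) (ℬ := ℬ) φ (x := s))
  rw [← h2, ← hs]
  exact (DirectSum.decompose_of_mem_same ℬ h1).symm

set_option linter.unusedSectionVars false in
theorem isUnit' (h : IsGradedAway 𝒜 ℬ σ φ r) : IsUnit (φ (algebraMap A S r)) := by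
  rw [h.comm]; exact h.isUnit.map _

open HomogeneousIdeal in
theorem irrelevant_le (h : IsGradedAway 𝒜 ℬ σ φ r) :
    HomogeneousIdeal.irrelevant ℬ ≤ (HomogeneousIdeal.irrelevant 𝒜).map φ := by
  rw [← toIdeal_le_toIdeal_iff]
  refine (toIdeal_irrelevant_le _).2 fun i hi t ht => ?_
  obtain ⟨n, s, hs, e⟩ := h.hom_surj ht
  have h1 : s ∈ (HomogeneousIdeal.irrelevant 𝒜).toIdeal :=
    HomogeneousIdeal.mem_irrelevant_of_mem 𝒜 hi hs
  have h2 : φ s ∈ ((HomogeneousIdeal.irrelevant 𝒜).map φ).toIdeal :=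
    Ideal.mem_map_of_mem _ h1
  rw [← e] at h2
  exact (Ideal.unit_mul_mem_iff_mem _ (h.isUnit'.pow n)).1 h2

/-- The morphism `Proj ℬ ⟶ Proj 𝒜`. -/
def projMap (h : IsGradedAway 𝒜 ℬ σ φ r) : Proj ℬ ⟶ Proj 𝒜 := Proj.map φ h.irrelevant_le

open HomogeneousLocalization in
theorem isLocalization (h : IsGradedAway 𝒜 ℬ σ φ r) {f : S} {d : ℕ} (hf : f ∈ 𝒜 d) :
    @IsLocalization.Away _ _ (fromZeroRingHom 𝒜 (.powers f) (algebraMap A (𝒜 0) r))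
      (Away ℬ (φ f)) _ (Away.map φ f).toAlgebra := by
  let _ := (Away.map φ f).toAlgebra
  let ρ : Away 𝒜 f := fromZeroRingHom 𝒜 (.powers f) (algebraMap A (𝒜 0) r)
  have hval : ∀ n : ℕ, (ρ ^ n).val = Localization.mk (algebraMap A S r ^ n) 1 := by
    intro n
    rw [val_pow]
    change Localization.mk (algebraMap A S r) 1 ^ n = _
    rw [Localization.mk_pow, one_pow]
  have hmapρ : Away.map φ f ρ = fromZeroRingHom ℬ (.powers (φ f)) (algebraMap B (ℬ 0) (σ r)) := by
    apply val_injective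
    change Localization.mk _ _ = Localization.mk _ _
    congr 1
    · exact h.comm r
    · exact Subtype.ext (map_one φ)
  have hval' : ∀ n : ℕ, (Away.map φ f (ρ ^ n)).val =
      Localization.mk (φ (algebraMap A S r) ^ n) 1 := by
    intro n
    rw [map_pow, hmapρ, val_pow]
    change Localization.mk (algebraMap B T (σ r)) 1 ^ n = _
    rw [Localization.mk_pow, one_pow, h.comm]
  refine (isLocalization_iff (.powers ρ) _).2 ⟨?_, ?_, ?_⟩
  · rintro ⟨_, n, rfl⟩
    change IsUnit (Away.map φ f (ρ ^ n))
    rw [map_pow, hmapρ]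
    exact ((h.isUnit.map (algebraMap B (ℬ 0))).map (fromZeroRingHom ℬ (.powers (φ f)))).pow n
  · intro x
    obtain ⟨n, t, ht, rfl⟩ := Away.mk_surjective ℬ (Graded.map_mem φ hf) x
    obtain ⟨m, s, hs, e⟩ := h.hom_surj ht
    refine ⟨⟨Away.mk 𝒜 hf n s hs, ⟨ρ ^ m, m, rfl⟩⟩, ?_⟩
    change _ * Away.map φ f (ρ ^ m) = Away.map φ f (Away.mk 𝒜 hf n s hs)
    apply val_injective
    rw [val_mul, hval', Away.map_mk, Away.val_mk, Away.val_mk, Localization.mk_mul, mul_one,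
      ← e, mul_comm]
  · intro x y hxy
    have hxy' : Away.map φ f (x - y) = 0 := by rw [map_sub]; exact sub_eq_zero.2 hxy
    obtain ⟨n, s, hs, e⟩ := Away.mk_surjective 𝒜 hf (x - y)
    rw [← e, Away.map_mk] at hxy'
    have h1 := congrArg val hxy'
    rw [Away.val_mk, val_zero, Localization.mk_eq_mk', IsLocalization.mk'_eq_zero_iff] at h1
    obtain ⟨⟨_, m, rfl⟩, hm⟩ := h1
    have hm' : φ (f ^ m * s) = 0 := by rw [map_mul, map_pow]; exact hm
    obtain ⟨k, hk⟩ := h.inj _ hm'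
    refine ⟨⟨ρ ^ k, k, rfl⟩, ?_⟩
    change ρ ^ k * x = ρ ^ k * y
    rw [← sub_eq_zero, ← mul_sub, ← e]
    apply val_injective
    rw [val_mul, hval, Away.val_mk, Localization.mk_mul, one_mul, val_zero,
      Localization.mk_eq_mk', IsLocalization.mk'_eq_zero_iff]
    exact ⟨⟨f ^ m, m, rfl⟩, by rw [← hk]; ring⟩

theorem isPullback_awayι (h : IsGradedAway 𝒜 ℬ σ φ r) {f : S} {d : ℕ} (hf : f ∈ 𝒜 d)
    (hd : 0 < d) : IsPullback (Spec.map (CommRingCat.ofHom (HomogeneousLocalization.Away.map φ f)))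
      (Proj.awayι ℬ (φ f) (Graded.map_mem φ hf) hd) (Proj.awayι 𝒜 f hf hd) h.projMap :=
  IsOpenImmersion.isPullback _ _ _ _ (Proj.awayι_comp_map φ h.irrelevant_le hd f hf) (by
    rw [Proj.opensRange_awayι, Proj.opensRange_awayι]
    exact Proj.map_preimage_basicOpen φ h.irrelevant_le f)

open HomogeneousLocalization in
theorem isOpenImmersion_away (h : IsGradedAway 𝒜 ℬ σ φ r) {f : S} {d : ℕ} (hf : f ∈ 𝒜 d) :
    IsOpenImmersion (Spec.map (CommRingCat.ofHom (Away.map φ f))) := by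
  let _ := (Away.map φ f).toAlgebra
  have := h.isLocalization hf
  exact IsOpenImmersion.of_isLocalization
    (fromZeroRingHom 𝒜 (.powers f) (algebraMap A (𝒜 0) r))

theorem isOpenImmersion_pullbackHom (h : IsGradedAway 𝒜 ℬ σ φ r) {f : S} {d : ℕ} (hf : f ∈ 𝒜 d)
    (hd : 0 < d) : IsOpenImmersion (pullback.snd h.projMap (Proj.awayι 𝒜 f hf hd)) := by
  have h1 := h.isPullback_awayι hf hd
  have h2 := h.isOpenImmersion_away hf
  refine (MorphismProperty.cancel_left_of_respectsIso (P := @IsOpenImmersion)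
    (h1.flip.isoPullback.hom) _).1 ?_
  have e : h1.flip.isoPullback.hom ≫ pullback.snd h.projMap (Proj.awayι 𝒜 f hf hd) =
      Spec.map (CommRingCat.ofHom (HomogeneousLocalization.Away.map φ f)) :=
    h1.flip.isoPullback_hom_snd
  rw [e]
  exact h2

instance isOpenImmersion (h : IsGradedAway 𝒜 ℬ σ φ r) : IsOpenImmersion h.projMap :=
  IsZariskiLocalAtTarget.of_openCover (P := @IsOpenImmersion)
    (Proj.affineOpenCover 𝒜).openCover fun i => h.isOpenImmersion_pullbackHom i.2.2 i.1.2

theorem awayι_projMap_projToSpec (h : IsGradedAway 𝒜 ℬ σ φ r) {f : S} {d : ℕ} (hf : f ∈ 𝒜 d)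
    (hd : 0 < d) : Proj.awayι ℬ (φ f) (Graded.map_mem φ hf) hd ≫ h.projMap ≫ projToSpec 𝒜 =
      Proj.awayι ℬ (φ f) (Graded.map_mem φ hf) hd ≫ projToSpec ℬ ≫
        Spec.map (CommRingCat.ofHom σ) := by
  rw [projMap, Proj.awayι_comp_map_assoc _ _ hd _ hf, awayι_projToSpec,
    ← Category.assoc, awayι_projToSpec, ← Spec.map_comp, ← Spec.map_comp]
  congr 1
  ext a
  change Localization.mk _ _ = Localization.mk _ _
  congr 1
  · exact h.comm a
  · exact Subtype.ext (map_one φ)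

theorem projMap_projToSpec (h : IsGradedAway 𝒜 ℬ σ φ r) :
    h.projMap ≫ projToSpec 𝒜 = projToSpec ℬ ≫ Spec.map (CommRingCat.ofHom σ) :=
  (Proj.mapAffineOpenCover φ h.irrelevant_le).openCover.hom_ext _ _ fun i =>
    h.awayι_projMap_projToSpec i.2.2 i.1.2

open HomogeneousLocalization in
theorem mem_range_of_mem_basicOpen (h : IsGradedAway 𝒜 ℬ σ φ r) {f : S} {d : ℕ} (hf : f ∈ 𝒜 d)
    (hd : 0 < d) (y : Spec (.of (Away 𝒜 f)))
    (hx : projToSpec 𝒜 (Proj.awayι 𝒜 f hf hd y) ∈ PrimeSpectrum.basicOpen r) :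
    ∃ z, h.projMap z = Proj.awayι 𝒜 f hf hd y := by
  let ρ := fromZeroRingHom 𝒜 (.powers f) (algebraMap A (𝒜 0) r)
  have hy : y ∈ PrimeSpectrum.basicOpen ρ := by
    have e : projToSpec 𝒜 (Proj.awayι 𝒜 f hf hd y) = _ :=
      congrArg (fun g => g.base y) (awayι_projToSpec 𝒜 hf hd)
    rw [e] at hx
    exact hx
  let _ := (Away.map φ f).toAlgebra
  have := h.isLocalization hf
  have hr := PrimeSpectrum.localization_away_comap_range (Away ℬ (φ f)) ρ
  obtain ⟨w, hw⟩ : y ∈ Set.range (PrimeSpectrum.comap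
      (algebraMap (Away 𝒜 f) (Away ℬ (φ f)))) := by
    rw [hr]; exact hy
  refine ⟨Proj.awayι ℬ (φ f) (Graded.map_mem φ hf) hd w, ?_⟩
  have e := congrArg (fun g => g.base w) (Proj.awayι_comp_map φ h.irrelevant_le hd _ hf)
  exact Eq.trans e (congrArg (fun z => Proj.awayι 𝒜 f hf hd z) hw)

theorem isPullback (h : IsGradedAway 𝒜 ℬ σ φ r) [IsOpenImmersion (Spec.map (CommRingCat.ofHom σ))]
    (hr : (Spec.map (CommRingCat.ofHom σ)).opensRange = PrimeSpectrum.basicOpen r) :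
    IsPullback (projToSpec ℬ) h.projMap (Spec.map (CommRingCat.ofHom σ)) (projToSpec 𝒜) := by
  refine IsOpenImmersion.isPullback _ _ _ _ h.projMap_projToSpec ?_
  rw [hr]
  ext x
  constructor
  · intro hx
    obtain ⟨i, y, rfl⟩ := (Proj.affineOpenCover 𝒜).openCover.exists_eq x
    exact h.mem_range_of_mem_basicOpen i.2.2 i.1.2 y hx
  · rintro ⟨z, rfl⟩
    change projToSpec 𝒜 (h.projMap z) ∈ PrimeSpectrum.basicOpen r
    have e : projToSpec 𝒜 (h.projMap z) = _ := congrArg (fun g => g.base z) h.projMap_projToSpec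
    rw [e]
    exact hr.le ⟨projToSpec ℬ z, rfl⟩

end IsGradedAway
end projLocalization

section quasiCoherent
variable {X : Scheme.{u}}

theorem fromSpec_image_le {U : X.Opens} (hU : IsAffineOpen U) (W : (Spec Γ(X, U)).Opens) :
    hU.fromSpec ''ᵁ W ≤ U := by
  conv_rhs => rw [← hU.opensRange_fromSpec]
  exact hU.fromSpec.image_le_opensRange W

theorem appIso_inv_fromSpec {U : X.Opens} (hU : IsAffineOpen U) (W : (Spec Γ(X, U)).Opens) :
    (Scheme.ΓSpecIso Γ(X, U)).inv ≫ (Spec Γ(X, U)).presheaf.map W.leTop.op ≫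
      (hU.fromSpec.appIso W).inv = X.presheaf.map (homOfLE (fromSpec_image_le hU W)).op := by
  rw [← Category.assoc, Iso.comp_inv_eq, Scheme.Hom.appIso_hom', Scheme.Hom.map_appLE,
    Scheme.Hom.appLE, hU.fromSpec_app_self, Category.assoc, ← Functor.map_comp]
  rfl

theorem smul_fromSpec {U : X.Opens} (hU : IsAffineOpen U) (V : X.Modules)
    (W : (Spec Γ(X, U)).Opens) (r : Γ(X, U)) (x : Γ(V.restrict hU.fromSpec, W)) :
    (V.restrictAppIso hU.fromSpec W).hom (r • x) =
      X.presheaf.map (homOfLE (fromSpec_image_le hU W)).op r •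
        (V.restrictAppIso hU.fromSpec W).hom x := by
  rw [Scheme.Modules.smul_Spec_def, ← appIso_inv_fromSpec hU W]
  rfl

theorem modules_res_res (V : X.Modules) {U₁ U₂ U₃ : X.Opens} (h : U₂ ≤ U₁) (h' : U₃ ≤ U₂)
    (x : Γ(V, U₁)) : V.presheaf.map (homOfLE h').op (V.presheaf.map (homOfLE h).op x) =
      V.presheaf.map (homOfLE (h'.trans h)).op x := by
  rw [← ConcreteCategory.comp_apply, ← Functor.map_comp]
  rfl

theorem modules_res_self (V : X.Modules) {U₁ : X.Opens} (h : U₁ ≤ U₁)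
    (x : Γ(V, U₁)) : V.presheaf.map (homOfLE h).op x = x := by
  change V.presheaf.map (𝟙 _) x = x
  rw [V.presheaf.map_id]
  rfl

theorem scheme_res_res {U₁ U₂ U₃ : X.Opens} (h : U₂ ≤ U₁) (h' : U₃ ≤ U₂)
    (x : Γ(X, U₁)) : X.presheaf.map (homOfLE h').op (X.presheaf.map (homOfLE h).op x) =
      X.presheaf.map (homOfLE (h'.trans h)).op x := by
  rw [← ConcreteCategory.comp_apply, ← Functor.map_comp]
  rfl

theorem exists_of_isQuasicoherent (V : X.Modules) [V.IsQuasicoherent] {U : X.Opens}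
    (hU : IsAffineOpen U) (f : Γ(X, U)) :
    (∀ y : Γ(V, X.basicOpen f), ∃ (n : ℕ) (m : Γ(V, U)),
      X.presheaf.map (homOfLE (X.basicOpen_le f)).op (f ^ n) • y =
        V.presheaf.map (homOfLE (X.basicOpen_le f)).op m) ∧
    (∀ m : Γ(V, U), V.presheaf.map (homOfLE (X.basicOpen_le f)).op m = 0 →
      ∃ n : ℕ, f ^ n • m = 0) := by
  have hM : (V.restrict hU.fromSpec).IsQuasicoherent :=
    Scheme.Modules.isQuasicoherent_restrictFunctor _ _
  have h1 : IsIso (V.restrict hU.fromSpec).fromTildeΓ := inferInstance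
  have h2 := (isIso_fromTildeΓ_iff_isLocalizing (V.restrict hU.fromSpec)).1 h1 f
  let D : (Spec Γ(X, U)).Opens := PrimeSpectrum.basicOpen f
  have eT : hU.fromSpec ''ᵁ ⊤ = U := by
    rw [Scheme.Hom.image_top_eq_opensRange, hU.opensRange_fromSpec]
  have eD : hU.fromSpec ''ᵁ D = X.basicOpen f := hU.fromSpec_image_basicOpen f
  have eR : D ≤ ⊤ := le_top
  refine ⟨fun y => ?_, fun m hm => ?_⟩
  · let y' : Γ(V.restrict hU.fromSpec, D) := V.presheaf.map (homOfLE eD.le).op y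
    obtain ⟨⟨m', ⟨_, n, rfl⟩⟩, hn⟩ := h2.surj y'
    let m'' : Γ(V, hU.fromSpec ''ᵁ ⊤) := m'
    refine ⟨n, V.presheaf.map (homOfLE eT.ge).op m'', ?_⟩
    have hn' : (V.restrictAppIso hU.fromSpec _).hom (f ^ n • y') =
      V.presheaf.map (homOfLE (Scheme.Hom.image_mono _ eR)).op m'' := hn
    rw [smul_fromSpec] at hn'
    have hn2 := congrArg (V.presheaf.map (homOfLE eD.ge).op) hn'
    rw [Scheme.Modules.map_smul, scheme_res_res] at hn2
    have e3 : V.presheaf.map (homOfLE eD.ge).op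
        ((V.restrictAppIso hU.fromSpec D).hom y') = y := by
      refine (modules_res_res V eD.le eD.ge y).trans (modules_res_self V _ y)
    rw [e3, modules_res_res] at hn2
    rw [modules_res_res]
    exact hn2
  · let m' : Γ(V.restrict hU.fromSpec, ⊤) := V.presheaf.map (homOfLE eT.le).op m
    have hm' : ((modulesSpecToSheaf.obj (V.restrict hU.fromSpec)).obj.map
        (PrimeSpectrum.basicOpen f).leTop.op).hom m' = 0 := by
      have : V.presheaf.map (homOfLE (Scheme.Hom.image_mono hU.fromSpec eR)).op
          (V.presheaf.map (homOfLE eT.le).op m) = 0 := by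
        rw [modules_res_res]
        have := congrArg (V.presheaf.map (homOfLE eD.le).op) hm
        rwa [modules_res_res, map_zero] at this
      exact this
    obtain ⟨⟨_, n, rfl⟩, hn⟩ := (h2.exists_of_eq (x₁ := m') (x₂ := 0) (by rw [hm', map_zero]))
    refine ⟨n, ?_⟩
    have hn' : (V.restrictAppIso hU.fromSpec ⊤).hom (f ^ n • m') =
        (V.restrictAppIso hU.fromSpec ⊤).hom (f ^ n • (0 : Γ(V.restrict hU.fromSpec, ⊤))) := hn
    rw [smul_zero, map_zero, smul_fromSpec] at hn'
    have hn2 := congrArg (V.presheaf.map (homOfLE eT.ge).op) hn'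
    rw [Scheme.Modules.map_smul, scheme_res_res, map_zero] at hn2
    have e3 : V.presheaf.map (homOfLE eT.ge).op
        ((V.restrictAppIso hU.fromSpec ⊤).hom m') = m := by
      refine (modules_res_res V eT.le eT.ge m).trans (modules_res_self V _ m)
    rw [e3] at hn2
    have e4 : X.presheaf.map (homOfLE (le_refl U)).op (f ^ n) = f ^ n := by
      change X.presheaf.map (𝟙 _) _ = _
      rw [X.presheaf.map_id]
      rfl
    rw [e4] at hn2
    exact hn2
end quasiCoherent

section projectiveBundle
variable {X : Scheme.{u}} (V : X.Modules)

/-- Restriction of sections as a semilinear map. -/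
def moduleRes {U W : X.Opens} (h : U ≤ W) :
    Γ(V, W) →ₛₗ[(X.presheaf.map (homOfLE h).op).hom] Γ(V, U) where
  toFun x := V.presheaf.map (homOfLE h).op x
  map_add' x y := map_add _ x y
  map_smul' r x := Scheme.Modules.map_smul V (homOfLE h) r x

/-- The grading of `Sym_{Γ(U, 𝒪_X)} Γ(U, V)`. -/
abbrev symSections (U : X.Opens) : ℕ → Submodule Γ(X, U) (SymmetricAlgebra Γ(X, U) Γ(V, U)) :=
  symPart Γ(X, U) Γ(V, U)

/-- The restriction map between the symmetric algebras of the modules of sections. -/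
def symRes {U W : X.Opens} (h : U ≤ W) : symSections V W →+*ᵍ symSections V U :=
  symMap _ (moduleRes V h)

theorem isGradedAway_symRes_basicOpen [V.IsQuasicoherent] {W : X.Opens} (hW : IsAffineOpen W)
    (f : Γ(X, W)) :
    IsGradedAway (symSections V W) (symSections V (X.basicOpen f))
      (X.presheaf.map (homOfLE (X.basicOpen_le f)).op).hom (symRes V (X.basicOpen_le f)) f := by
  let σ := (X.presheaf.map (homOfLE (X.basicOpen_le f)).op).hom
  let _ : Algebra Γ(X, W) Γ(X, X.basicOpen f) := σ.toAlgebra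
  let _ : Module Γ(X, W) Γ(V, X.basicOpen f) := Module.compHom _ σ
  have hloc : IsLocalization.Away f Γ(X, X.basicOpen f) := hW.isLocalization_basicOpen f
  have : IsScalarTower Γ(X, W) Γ(X, X.basicOpen f) Γ(V, X.basicOpen f) :=
    IsScalarTower.of_algebraMap_smul fun _ _ => rfl
  have hu : IsUnit (σ f) := IsLocalization.Away.algebraMap_isUnit f
  let l' : Γ(V, W) →ₗ[Γ(X, W)] Γ(V, X.basicOpen f) :=
    { toFun := moduleRes V (X.basicOpen_le f)
      map_add' := map_add _
      map_smul' := fun r x => (moduleRes V (X.basicOpen_le f)).map_smulₛₗ r x }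
  obtain ⟨hs, hi⟩ := exists_of_isQuasicoherent V hW f
  have hl' : IsLocalizedModule (.powers f) l' := by
    refine ⟨?_, fun y => ?_, fun {x y} hxy => ?_⟩
    · rintro ⟨_, n, rfl⟩
      rw [Module.End.isUnit_iff]
      have h1 := (hu.pow n).smul_bijective (β := Γ(V, X.basicOpen f))
      rw [← map_pow] at h1
      exact h1
    · obtain ⟨n, m, h⟩ := hs y
      exact ⟨⟨m, ⟨_, n, rfl⟩⟩, h⟩
    · obtain ⟨n, h⟩ := hi (x - y) (by rw [map_sub]; exact sub_eq_zero.2 hxy)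
      refine ⟨⟨_, n, rfl⟩, ?_⟩
      rw [smul_sub] at h
      exact sub_eq_zero.1 h
  refine ⟨fun a => symMapHom_algebraMap _ _ a, hu, ?_, ?_⟩
  · refine symMapHom_surj _ _ f (fun b => ?_) (fun y => ?_)
    · obtain ⟨⟨a, ⟨_, n, rfl⟩⟩, h⟩ := IsLocalization.surj (.powers f) b
      refine ⟨n, a, ?_⟩
      rw [← map_pow, mul_comm]
      exact h
    · obtain ⟨n, m, h⟩ := hs y
      refine ⟨n, m, ?_⟩
      rw [← map_pow]
      exact h
  · exact symMapHom_inj f (moduleRes V (X.basicOpen_le f)) l' (fun _ => rfl)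

open Scheme.AffineZariskiSite in
theorem exists_isGradedAway_symRes [V.IsQuasicoherent] {U W : X.AffineZariskiSite} (i : U ⟶ W) :
    ∃ r, IsGradedAway (symSections V W.1) (symSections V U.1)
        (X.presheaf.map (homOfLE (toOpens_mono i.le)).op).hom
        (symRes V (toOpens_mono i.le)) r ∧ U.1 = X.basicOpen r := by
  obtain ⟨f, hf⟩ := i.le
  obtain rfl : W.basicOpen f = U := Subtype.ext hf
  exact ⟨f, isGradedAway_symRes_basicOpen V W.2 f, rfl⟩

open Scheme.AffineZariskiSite in
theorem irrelevant_le_symRes [V.IsQuasicoherent] {U W : X.AffineZariskiSite} (i : U ⟶ W) :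
    HomogeneousIdeal.irrelevant (symSections V U.1) ≤
      (HomogeneousIdeal.irrelevant (symSections V W.1)).map (symRes V (toOpens_mono i.le)) := by
  obtain ⟨r, h, -⟩ := exists_isGradedAway_symRes V i
  exact h.irrelevant_le

theorem symRes_refl {U : X.Opens} (h : U ≤ U) : symRes V h = .id _ := by
  apply GradedRingHom.ext
  intro x
  refine DFunLike.congr_fun (f := symMapHom _ (moduleRes V h)) (g := RingHom.id _)
    (symHom_ext (fun a => ?_) (fun m => ?_)) x
  · rw [symMapHom_algebraMap]
    change algebraMap _ _ (X.presheaf.map (𝟙 _) a) = _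
    rw [X.presheaf.map_id]
    rfl
  · rw [symMapHom_ι]
    exact congrArg _ (modules_res_self V h m)

theorem symRes_trans {U₁ U₂ U₃ : X.Opens} (h : U₂ ≤ U₁) (h' : U₃ ≤ U₂) :
    symRes V (h'.trans h) = (symRes V h').comp (symRes V h) := by
  apply GradedRingHom.ext
  intro x
  refine DFunLike.congr_fun (f := symMapHom _ (moduleRes V (h'.trans h)))
    (g := (symMapHom _ (moduleRes V h')).comp (symMapHom _ (moduleRes V h)))
    (symHom_ext (fun a => ?_) (fun m => ?_)) x
  · rw [RingHom.comp_apply, symMapHom_algebraMap, symMapHom_algebraMap, symMapHom_algebraMap]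
    exact congrArg _ (scheme_res_res h h' a).symm
  · rw [RingHom.comp_apply, symMapHom_ι, symMapHom_ι, symMapHom_ι]
    exact congrArg _ (modules_res_res V h h' m).symm

theorem projMap_congr {A B : Type u} [CommRing A] [CommRing B] {σ τ : Type u} [SetLike σ A]
    [AddSubgroupClass σ A] [SetLike τ B] [AddSubgroupClass τ B] {𝒜 : ℕ → σ} {ℬ : ℕ → τ}
    [GradedRing 𝒜] [GradedRing ℬ] {f g : 𝒜 →+*ᵍ ℬ} (e : f = g)
    (hf : HomogeneousIdeal.irrelevant ℬ ≤ (HomogeneousIdeal.irrelevant 𝒜).map f)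
    (hg : HomogeneousIdeal.irrelevant ℬ ≤ (HomogeneousIdeal.irrelevant 𝒜).map g) :
    Proj.map f hf = Proj.map g hg := by
  subst e
  rfl

open Scheme.AffineZariskiSite in
/-- The functor `U ↦ Proj (Sym Γ(U, V))` on affine opens and basic open inclusions. -/
def projSymFunctor [V.IsQuasicoherent] : X.AffineZariskiSite ⥤ Scheme.{u} where
  obj U := Proj (symSections V U.1)
  map i := Proj.map (symRes V (toOpens_mono i.le)) (irrelevant_le_symRes V i)
  map_id U := (projMap_congr (symRes_refl V _) _ (by simp)).trans Proj.map_id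
  map_comp {U₁ U₂ U₃} i j :=
    (projMap_congr (symRes_trans V _ _) _ _).trans
      (Proj.map_comp _ _ (irrelevant_le_symRes V j) (irrelevant_le_symRes V i))

open Scheme.AffineZariskiSite in
theorem isoSpec_inv_naturality {U W : X.AffineZariskiSite} (i : U ⟶ W) :
    Spec.map (X.presheaf.map (homOfLE (toOpens_mono i.le)).op) ≫ W.2.isoSpec.inv =
      U.2.isoSpec.inv ≫ X.homOfLE (toOpens_mono i.le) :=
  (restrictIsoSpec X).inv.naturality i

open Scheme.AffineZariskiSite in
theorem projSym_isPullback [V.IsQuasicoherent] {U W : X.AffineZariskiSite} (i : U ⟶ W) :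
    IsPullback (projToSpec (symSections V U.1))
      (Proj.map (symRes V (toOpens_mono i.le)) (irrelevant_le_symRes V i))
      (Spec.map (X.presheaf.map (homOfLE (toOpens_mono i.le)).op))
      (projToSpec (symSections V W.1)) := by
  obtain ⟨r, h, hr⟩ := exists_isGradedAway_symRes V i
  let σ := (X.presheaf.map (homOfLE (toOpens_mono i.le)).op).hom
  let _ : Algebra Γ(X, W.1) Γ(X, U.1) := σ.toAlgebra
  have hloc : IsLocalization.Away r Γ(X, U.1) :=
    W.2.isLocalization_of_eq_basicOpen r (homOfLE (toOpens_mono i.le)) hr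
  have h1 : IsOpenImmersion (Spec.map (CommRingCat.ofHom σ)) :=
    IsOpenImmersion.of_isLocalization r
  exact h.isPullback (Opens.ext (PrimeSpectrum.localization_away_comap_range Γ(X, U.1) r))

open Scheme.AffineZariskiSite in
/-- The structure morphisms `Proj (Sym Γ(U, V)) ⟶ Spec Γ(U, 𝒪_X) ≅ U`. -/
def projSymNatTrans [V.IsQuasicoherent] :
    projSymFunctor V ⟶ (directedCover X).functorOfLocallyDirected where
  app U := projToSpec (symSections V U.1) ≫ U.2.isoSpec.inv
  naturality {U W} i := by
    have e := (projSym_isPullback V i).w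
    change Proj.map (symRes V (toOpens_mono i.le)) (irrelevant_le_symRes V i) ≫
      projToSpec (symSections V W.1) ≫ W.2.isoSpec.inv =
      (projToSpec (symSections V U.1) ≫ U.2.isoSpec.inv) ≫ X.homOfLE (toOpens_mono i.le)
    rw [Category.assoc, ← isoSpec_inv_naturality i, ← Category.assoc, ← Category.assoc, e]

open Scheme.AffineZariskiSite in
/-- The gluing data of the schemes `Proj (Sym Γ(U, V))`. -/
def projSymGluingData [V.IsQuasicoherent] : (directedCover X).RelativeGluingData where
  functor := projSymFunctor V
  natTrans := projSymNatTrans V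
  equifibered {U W} i := by
    have h := projSym_isPullback V i
    have h2 : IsPullback U.2.isoSpec.inv
      (Spec.map (X.presheaf.map (homOfLE (toOpens_mono i.le)).op))
      (X.homOfLE (toOpens_mono i.le)) W.2.isoSpec.inv :=
      IsPullback.of_horiz_isIso ⟨(isoSpec_inv_naturality i).symm⟩
    exact (h.paste_horiz h2).flip

/-- The projective bundle `Proj (Sym V)` of a quasi-coherent sheaf `V`, glued from the schemes
`Proj (Sym Γ(U, V))` for `U ⊆ X` affine open. -/
def projectiveBundle [V.IsQuasicoherent] : Scheme.{u} := (projSymGluingData V).glued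

/-- The projection of the projective bundle to its base. -/
def projectiveBundle.π [V.IsQuasicoherent] : projectiveBundle V ⟶ X :=
  (projSymGluingData V).toBase

end projectiveBundle

section lineBundles
variable {X : Scheme.{u}}

/-- A line bundle: an `𝒪_X`-module that is locally isomorphic to `𝒪_X`. -/
class IsLineBundle (L : X.Modules) : Prop where
  exists_iso_unit : ∀ x : X, ∃ U : X.Opens, x ∈ U ∧
    Nonempty (L.restrict U.ι ≅ SheafOfModules.unit U.toScheme.ringCatSheaf)

instance hasFiniteBiproducts_modules : HasFiniteBiproducts X.Modules :=
  Abelian.hasFiniteBiproducts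

/-- The presentation of a free module without relations. -/
def freePresentation (I : Type u) :
    (SheafOfModules.free (R := X.ringCatSheaf) I).Presentation where
  generators := SheafOfModules.free.generatingSections I
  relations := {
    I := ULift Empty
    s j := Empty.rec _ j.down
    epi := IsZero.epi (IsZero.of_iso (isZero_zero _) (Limits.kernel.ofMono _)) _ }

/-- Transport of a presentation along an isomorphism. -/
def presentationOfIso {A B : SheafOfModules.{u} X.ringCatSheaf} (e : A ≅ B)
    (P : SheafOfModules.Presentation.{u} A) : SheafOfModules.Presentation.{u} B :=
  P.ofIsIso e.hom

/-- The structure sheaf of `U`, seen as a sheaf on the slice site over `U`. -/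
def overUnitIso (U : X.Opens) : SheafOfModules.unit (X.ringCatSheaf.over U) ≅
    (Scheme.Modules.overEquiv U).inverse.obj (SheafOfModules.unit U.toScheme.ringCatSheaf) :=
  (Scheme.Modules.overEquiv U).unitIso.app _ ≪≫ (Scheme.Modules.overEquiv U).inverse.mapIso
    ((Scheme.Modules.overFunctorEquiv U).app (SheafOfModules.unit X.ringCatSheaf) ≪≫
      Scheme.Modules.restrictUnitIso U.ι)

theorem isQuasicoherent_over_of_restrict (V : X.Modules) (U : X.Opens)
    (P : SheafOfModules.Presentation.{u} (V.restrict U.ι)) :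
    SheafOfModules.IsQuasicoherent.{u, u} (SheafOfModules.over.{u} V U) := by
  let F : SheafOfModules.{u} U.toScheme.ringCatSheaf ⥤ SheafOfModules.{u} (X.ringCatSheaf.over U) :=
    (Scheme.Modules.overEquiv U).inverse
  have : PreservesColimitsOfSize.{u, u} F :=
    (Scheme.Modules.overEquiv U).symm.toAdjunction.leftAdjoint_preservesColimits
  let e : F.obj (V.restrict U.ι) ≅ SheafOfModules.over.{u} V U :=
    (Scheme.Modules.overEquiv U).inverse.mapIso
      ((Scheme.Modules.overFunctorEquiv U).app V).symm ≪≫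
      ((Scheme.Modules.overEquiv U).unitIso.app _).symm
  exact ((P.map F (overUnitIso U)).ofIsIso e.hom).isQuasicoherent

theorem isQuasicoherent_of_restrict (V : X.Modules)
    (h : ∀ x : X, ∃ U : X.Opens, x ∈ U ∧
      Nonempty (SheafOfModules.Presentation.{u} (V.restrict U.ι))) : V.IsQuasicoherent := by
  choose U hU hP using h
  have (x : X) : SheafOfModules.IsQuasicoherent.{u, u} (SheafOfModules.over.{u} V (U x)) :=
    isQuasicoherent_over_of_restrict V (U x) (hP x).some
  exact SheafOfModules.IsQuasicoherent.of_coversTop V U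
    ((Opens.coversTop_iff _ _).2 (eq_top_iff.2 fun x _ => Opens.mem_iSup.2 ⟨x, hU x⟩))

/-- If `L` is trivial on `U`, it is trivial on every open `W ⊆ U`. -/
def restrictUnitIsoOfLE {L : X.Modules} {U W : X.Opens} (h : W ≤ U)
    (e : L.restrict U.ι ≅ SheafOfModules.unit U.toScheme.ringCatSheaf) :
    L.restrict W.ι ≅ SheafOfModules.unit W.toScheme.ringCatSheaf :=
  (Scheme.Modules.restrictFunctorCongr (X.homOfLE_ι h).symm).app L ≪≫
    (Scheme.Modules.restrictFunctorComp (X.homOfLE h) U.ι).app L ≪≫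
    (Scheme.Modules.restrictFunctor (X.homOfLE h)).mapIso e ≪≫
    Scheme.Modules.restrictUnitIso (X.homOfLE h)

theorem exists_presentation_restrict_biproduct {r : ℕ} (L : Fin r → X.Modules) (W : X.Opens)
    (e : ∀ i, (L i).restrict W.ι ≅ SheafOfModules.unit W.toScheme.ringCatSheaf) :
    Nonempty (SheafOfModules.Presentation.{u} ((⨁ L).restrict W.ι)) := by
  let F := Scheme.Modules.restrictFunctor W.ι
  have : PreservesColimits F := (Scheme.Modules.restrictAdjunction W.ι).leftAdjoint_preservesColimits
  let R := W.toScheme.ringCatSheaf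
  have : F.PreservesZeroMorphisms := inferInstance
  have : PreservesBiproduct L F := preservesBiproduct_of_preservesCoproduct F
  let g : (SheafOfModules.free (R := R) (ULift.{u} (Fin r)) : W.toScheme.Modules) ≅
      (⨁ L).restrict W.ι :=
    Sigma.whiskerEquiv (C := W.toScheme.Modules) (f := fun _ : ULift.{u} (Fin r) =>
      SheafOfModules.unit R) (g := F.obj ∘ L) Equiv.ulift (fun i => e i.down) ≪≫
    (biproduct.isoCoproduct (F.obj ∘ L)).symm ≪≫ (F.mapBiproduct L).symm
  exact ⟨presentationOfIso g (freePresentation (X := W.toScheme) _)⟩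

instance isQuasicoherent_biproduct {r : ℕ} (L : Fin r → X.Modules) [h : ∀ i, IsLineBundle (L i)] :
    (⨁ L).IsQuasicoherent := by
  refine isQuasicoherent_of_restrict _ fun x => ?_
  choose U hU e using fun i => (h i).exists_iso_unit x
  refine ⟨Finset.univ.inf U, ?_, exists_presentation_restrict_biproduct L _ fun i =>
    restrictUnitIsoOfLE (Finset.inf_le (Finset.mem_univ i)) (e i).some⟩
  rw [← SetLike.mem_coe, Opens.coe_finset_inf]
  simpa using hU

end lineBundles

section flatPullback
variable {P X : Scheme.{u}} (π : P ⟶ X)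

/-- A point of codimension one on a flat `X`-scheme lying over a point `x` of codimension one
has no proper generization in the fibre over the closure of `x`. -/
theorem eq_of_specializes_of_flat [Flat π] {y c : P} (hy : Order.coheight y = 1)
    (hx : Order.coheight (π y) = 1) (h : c ⤳ y) (hc : π y ⤳ π c) : c = y := by
  have h1 : y ≤ c := h
  have h2 : π c ⤳ π y := h.map π.continuous
  by_contra hne
  have hlt : y < c := ⟨h1, fun h3 : c ≤ y => hne (Specializes.antisymm h h3 |>.eq)⟩
  have hc0 : Order.coheight c = 0 := by
    have h4 := Order.coheight_add_one_le hlt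
    rw [hy] at h4
    have h5 : Order.coheight c + 1 ≤ 0 + 1 := by rwa [zero_add]
    exact nonpos_iff_eq_zero.1 ((ENat.add_le_add_iff_right ENat.one_ne_top).1 h5)
  have hcx : π c = π y := (h2.antisymm hc).eq
  have hnm : ¬ IsMax (π y) := by
    rw [← Order.coheight_ne_zero, hx]; exact one_ne_zero
  obtain ⟨ξ, hξ⟩ := not_isMax_iff.1 hnm
  have hξ' : ξ ⤳ π c := by rw [hcx]; exact hξ.le
  obtain ⟨z, hz, rfl⟩ := Flat.generalizingMap π hξ'
  have hmax : IsMax c := Order.coheight_eq_zero.1 hc0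
  have h5 : z ≤ c := hmax hz
  have h6 : z = c := (Specializes.antisymm hz h5).eq
  have h7 : π z = π y := by rw [h6, hcx]
  rw [h7] at hξ
  exact lt_irrefl _ hξ

theorem finite_primeDivisor_over [Flat π] [AlgebraicGeometry.IsNoetherian P] (x : PrimeDivisor X) :
    {y : PrimeDivisor P | π y.1 = x.1}.Finite := by
  obtain ⟨S, hS, hcl, hirr, hZ⟩ := NoetherianSpace.exists_finite_set_isClosed_irreducible
    ((isClosed_closure (s := {x.1})).preimage π.continuous)
  have key : ∀ y ∈ {y : PrimeDivisor P | π y.1 = x.1},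
      ∃ C ∈ S, closure {y.1} = C := by
    intro y hy
    have hy' : π y.1 = x.1 := hy
    have hyZ : y.1 ∈ π ⁻¹' closure {x.1} := by
      change π y.1 ∈ closure {x.1}
      rw [hy']
      exact subset_closure rfl
    rw [hZ] at hyZ
    obtain ⟨C, hC, hyC⟩ := hyZ
    obtain ⟨c, hc⟩ := QuasiSober.sober (hirr C hC) (hcl C hC)
    have hcC : c ∈ C := hc.mem
    have hcZ : c ∈ π ⁻¹' closure {x.1} := by rw [hZ]; exact ⟨C, hC, hcC⟩
    have h1 : c = y.1 := by
      refine eq_of_specializes_of_flat π y.2 (by rw [hy']; exact x.2) (hc.specializes hyC) ?_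
      rw [hy']
      exact specializes_iff_mem_closure.2 hcZ
    exact ⟨C, hC, by rw [← h1]; exact hc⟩
  choose! C hC hCy using key
  refine Set.Finite.of_finite_image (f := C) (hS.subset ?_) ?_
  · rintro _ ⟨y, hy, rfl⟩
    exact hC y hy
  · intro y hy z hz e
    have h1 : closure {y.1} = closure {z.1} := by rw [hCy y hy, hCy z hz, e]
    refine Subtype.ext (Specializes.antisymm ?_ ?_).eq
    · exact specializes_iff_closure_subset.2 h1.ge
    · exact specializes_iff_closure_subset.2 h1.le

open scoped Classical in
/-- The pullback of a `ℚ`-divisor along a flat morphism `π`: the multiplicity in `π^* D` of a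
prime divisor with generic point `y` lying over the generic point `x` of a prime divisor is the
length of `𝒪_{P,y} / 𝔪_x 𝒪_{P,y}` times the multiplicity of `x` in `D`; other prime
divisors do not occur. -/
def flatPullback [Flat π] [AlgebraicGeometry.IsNoetherian P] (D : QDivisor X) : QDivisor P :=
  Finsupp.ofSupportFinite
    (fun y => if h : Order.coheight (π y.1) = 1 then
      ((Module.length (P.presheaf.stalk y.1) (P.presheaf.stalk y.1 ⧸
        (IsLocalRing.maximalIdeal (X.presheaf.stalk (π y.1))).map (π.stalkMap y.1).hom)).toNat : ℚ)
        * D ⟨π y.1, h⟩ else 0)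
    (by
      refine (D.support.finite_toSet.biUnion fun x _ => finite_primeDivisor_over π x).subset ?_
      intro y hy
      rw [Function.mem_support] at hy
      split_ifs at hy with h
      · refine Set.mem_biUnion (x := (⟨π y.1, h⟩ : PrimeDivisor X)) ?_
          (show π y.1 = π y.1 from rfl)
        exact Finsupp.mem_support_iff.2 (right_ne_zero_of_mul hy)
      · exact (hy rfl).elim)

end flatPullback

section varieties

/-- The grading of the polynomial ring by degree. -/
instance homogeneousSubmodule_gradedAlgebra (σ R : Type*) [CommRing R] :
    GradedAlgebra (MvPolynomial.homogeneousSubmodule σ R) := MvPolynomial.gradedAlgebra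

variable {k : Type u} [Field k] {X : Scheme.{u}} (s : X ⟶ Spec (.of k))

/-- `s : X ⟶ Spec k` exhibits `X` as a normal projective variety over `k`: `X` is integral, normal,
and a closed subscheme of some projective space `ℙ^n_k` over `k`. -/
class IsNormalProjectiveVariety : Prop where
  isIntegral : AlgebraicGeometry.IsIntegral X
  isNormal : IsNormalScheme X
  exists_isClosedImmersion : ∃ (n : ℕ)
    (i : X ⟶ Proj (MvPolynomial.homogeneousSubmodule (Fin (n + 1)) k)),
    IsClosedImmersion i ∧ i ≫ projToSpec (MvPolynomial.homogeneousSubmodule (Fin (n + 1)) k) = s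

theorem locallyOfFiniteType_projToSpec (n : ℕ) : LocallyOfFiniteType
    (projToSpec (MvPolynomial.homogeneousSubmodule (Fin (n + 1)) k)) ∧ QuasiCompact
    (projToSpec (MvPolynomial.homogeneousSubmodule (Fin (n + 1)) k)) := by
  let 𝒜 := MvPolynomial.homogeneousSubmodule (Fin (n + 1)) k
  have h0 : IsScalarTower k (𝒜 0) (MvPolynomial (Fin (n + 1)) k) :=
    IsScalarTower.of_algebraMap_eq' (R := k) (S := 𝒜 0)
      (A := MvPolynomial (Fin (n + 1)) k) rfl
  have h1 : Algebra.FiniteType (𝒜 0) (MvPolynomial (Fin (n + 1)) k) :=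
    Algebra.FiniteType.of_restrictScalars_finiteType k _ _
  have h2 : (algebraMap k (𝒜 0)).FiniteType := by
    refine RingHom.FiniteType.of_surjective _ fun x => ?_
    obtain ⟨x, hx⟩ := x
    refine ⟨x.coeff 0, Subtype.ext ?_⟩
    have := MvPolynomial.totalDegree_eq_zero_iff_eq_C.1
      (Nat.le_zero.1 (MvPolynomial.IsHomogeneous.totalDegree_le hx))
    exact this.symm
  have h3 : LocallyOfFiniteType (Spec.map (CommRingCat.ofHom (algebraMap k (𝒜 0)))) :=
    (HasRingHomProperty.Spec_iff (P := @LocallyOfFiniteType)).2 h2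
  constructor
  · exact inferInstanceAs (LocallyOfFiniteType (Proj.toSpecZero 𝒜 ≫ Spec.map _))
  · exact inferInstanceAs (QuasiCompact (Proj.toSpecZero 𝒜 ≫ Spec.map _))

namespace IsNormalProjectiveVariety

theorem isNoetherian [h : IsNormalProjectiveVariety s] : AlgebraicGeometry.IsNoetherian X := by
  obtain ⟨n, i, hi, rfl⟩ := h.exists_isClosedImmersion
  obtain ⟨h1, h2⟩ := locallyOfFiniteType_projToSpec (k := k) n
  have h3 : IsLocallyNoetherian X := LocallyOfFiniteType.isLocallyNoetherian
    (i ≫ projToSpec (MvPolynomial.homogeneousSubmodule (Fin (n + 1)) k))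
  have h4 : CompactSpace X := QuasiCompact.compactSpace_of_compactSpace
    (i ≫ projToSpec (MvPolynomial.homogeneousSubmodule (Fin (n + 1)) k))
  exact { }

end IsNormalProjectiveVariety

theorem natCast_eq_zero_of_charP {k : Type u} [Field k] {X : Scheme.{u}} (s : X ⟶ Spec (.of k))
    (p : ℕ) [CharP k p] : (p : Γ(X, ⊤)) = 0 := by
  have h := congrArg ((Scheme.ΓSpecIso (.of k)).inv ≫ s.appTop).hom (CharP.cast_eq_zero k p)
  rwa [map_natCast, map_zero] at h

end varieties

section globallyFRegular
variable (p : ℕ) [Fact p.Prime] {k : Type u} [Field k] [CharP k p] {X : Scheme.{u}}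

theorem ceil_mul_nonneg (e : ℕ) {Δ : QDivisor X} (h : 0 ≤ Δ) :
    0 ≤ (((p : ℚ) ^ e - 1) • Δ).ceil := by
  refine QDivisor.ceil_nonneg fun x => ?_
  have h1 : (1 : ℚ) ≤ (p : ℚ) ^ e :=
    one_le_pow₀ (by exact_mod_cast (Fact.out : p.Prime).one_lt.le)
  exact mul_nonneg (sub_nonneg.2 h1) (h x)

/-- `(X, Δ)` is globally sharply `F`-split: `Δ` is effective, and there is an `e > 0` such that
`𝒪_X → F^e_* 𝒪_X(⌈(p^e - 1) Δ⌉)` splits as a homomorphism of `𝒪_X`-modules. -/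
def IsGloballySharplyFSplit (s : X ⟶ Spec (.of k)) [h : IsNormalProjectiveVariety s]
    (Δ : QDivisor X) : Prop :=
  haveI := h.isIntegral
  haveI := h.isNormal
  haveI := h.isNoetherian
  ∃ hΔ : 0 ≤ Δ, ∃ e : ℕ, 0 < e ∧
    IsSplitMono (frobeniusToDivisor p (natCast_eq_zero_of_charP s p) e
      (((p : ℚ) ^ e - 1) • Δ).ceil (ceil_mul_nonneg p e hΔ))

/-- `(X, Δ)` is globally `F`-regular: `Δ` is effective, and for every effective divisor `D` there
is an `e > 0` such that `𝒪_X → F^e_* 𝒪_X(⌈(p^e - 1) Δ⌉ + D)` splits as a homomorphism of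
`𝒪_X`-modules. -/
def IsGloballyFRegular (s : X ⟶ Spec (.of k)) [h : IsNormalProjectiveVariety s]
    (Δ : QDivisor X) : Prop :=
  haveI := h.isIntegral
  haveI := h.isNormal
  haveI := h.isNoetherian
  ∃ hΔ : 0 ≤ Δ, ∀ (D : WeilDivisor X) (hD : 0 ≤ D), ∃ e : ℕ, 0 < e ∧
    IsSplitMono (frobeniusToDivisor p (natCast_eq_zero_of_charP s p) e
      ((((p : ℚ) ^ e - 1) • Δ).ceil + D) (add_nonneg (ceil_mul_nonneg p e hΔ) hD))

end globallyFRegular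

end

/-!
The proof takes place in function fields. Let `K` be the function field of `X` and `F` that of
`P = ℙ(V)`. A splitting of `𝒪_X → F^e_* 𝒪_X(E)` is the same as an additive map `φ` of `K` with
`φ (a ^ q * b) = a * φ b`, `q = p ^ e`, and `φ 1 = 1`, which sends the sections of `𝒪_X(E)` to
regular functions; since `X` is normal, this has to be tested at the points of codimension one only
(`isSplitMono_iff`, based on `mem_range_algebraMap_of_height_one`).

A local basis of `V` consisting of generators of the line bundles `L j` yields homogeneous coordinates
`x j` of `P`, and `F` is a purely transcendental extension of `K` in which the local rings of `P` are
localizations of polynomial rings over the local rings of `X` (`exists_coordinates`). Because `V` is a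
direct sum of line bundles, coordinates over different open sets of `X` differ by factors
`u j` in `K`, so monomials remain monomials. Therefore the extension `Ψ` of `φ` to `F` which maps
`z * x ^ (q b)` to `φ z * x ^ b` and kills the other monomials is compatible with all charts
(`IsInvLinear.exists_extension_monomial`, `trace_mem_of_localization`). A point of codimension one of
`P` either dominates `X` or is the generic point of the fibre over a point `x` of codimension one. In the
second case a uniformizer at `x` is also a uniformizer on `P` (`map_maximalIdeal_eq`), and `Ψ` inherits the
regularity of `φ`. This proves that global sharp `F`-splittings ascend.

For global `F`-regularity let `D` be an effective divisor on `P`. There is a form `G` in the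
coordinates, of some degree `m`, that vanishes along the components of `D` dominating `X` and has
coefficient `1` at some monomial `x ^ c` (`exists_form`). The remaining components of `D`, together with
the denominators of `G`, are bounded by the pullback of a divisor `D'` on `X`
(`exists_bound_vertical`). Let `φ` be a splitting for `D'`; composing it with itself ensures that
`m < q` (`IsSplitting.iterate`). Then `f ↦ Ψ (f * G / x ^ c)` maps `1` to `1`, because no monomial of `G`
other than `x ^ c` has exponents congruent to `c` modulo `q`, and it is a splitting for `D`
(`exists_isSplitting_bundle`).

The bundle is integral, normal and flat over `X`, since it is covered by spectra of polynomial rings.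
It is projective: closed immersions into projective space are described by finitely many rational
functions (`IsProjectiveSystem`), and such functions on `P` are products of the coordinates of `P` over
small affine open sets of `X` with high powers of the forms on `X` that define these open sets
(`exists_isProjectiveSystem_bundle`). Properness of `P` shows that the immersion they define is closed.
-/

/-! ### Additive maps that are linear over `q`-th powers -/

/-- An additive endomorphism `φ` of a ring is `q`-inverse linear if `φ (a ^ q * b) = a * φ b`. For
`q = p ^ e` in characteristic `p` these are the homomorphisms `F^e_* R → R` of `R`-modules. -/
def IsInvLinear (q : ℕ) {R : Type*} [CommRing R] (φ : R →+ R) : Prop :=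
  ∀ a b, φ (a ^ q * b) = a * φ b

section extension
variable {R F : Type*} [CommRing R] [Field F] [Algebra R F] [IsFractionRing R F]

/-- The value `ψ (h * w ^ (q - 1)) / w` depends only on the fraction `h / w`. -/
theorem IsInvLinear.div_eq_div {q : ℕ} (hq : 0 < q) {ψ : R →+ R} (hψ : IsInvLinear q ψ)
    {h w h' w' : R} (hw : w ≠ 0) (hw' : w' ≠ 0)
    (e : algebraMap R F h / algebraMap R F w = algebraMap R F h' / algebraMap R F w') :
    algebraMap R F (ψ (h * w ^ (q - 1))) / algebraMap R F w =
      algebraMap R F (ψ (h' * w' ^ (q - 1))) / algebraMap R F w' := by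
  have i : Function.Injective (algebraMap R F) := IsFractionRing.injective R F
  have hw0 : algebraMap R F w ≠ 0 := (map_ne_zero_iff _ i).2 hw
  have hw0' : algebraMap R F w' ≠ 0 := (map_ne_zero_iff _ i).2 hw'
  rw [div_eq_div_iff hw0 hw0', ← map_mul, ← map_mul] at e ⊢
  have e' := i e
  congr 1
  obtain ⟨n, rfl⟩ : ∃ n, q = n + 1 := ⟨q - 1, by omega⟩
  rw [mul_comm, ← hψ, mul_comm (ψ _), ← hψ]
  congr 1
  simp only [Nat.add_sub_cancel]
  calc w' ^ (n + 1) * (h * w ^ n) = (h * w') * (w' * w) ^ n := by ring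
    _ = (h' * w) * (w' * w) ^ n := by rw [e']
    _ = _ := by ring

/-- A `q`-inverse linear map extends to the field of fractions, by
`h / w ↦ ψ (h * w ^ (q - 1)) / w`. -/
theorem IsInvLinear.exists_extension [IsDomain R] {q : ℕ} (hq : 0 < q) {ψ : R →+ R}
    (hψ : IsInvLinear q ψ) :
    ∃ Ψ : F →+ F, IsInvLinear q Ψ ∧ ∀ r, Ψ (algebraMap R F r) = algebraMap R F (ψ r) := by
  have i : Function.Injective (algebraMap R F) := IsFractionRing.injective R F
  have key : ∀ f : F, ∃ g : F, ∀ h w : R, w ≠ 0 → f = algebraMap R F h / algebraMap R F w →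
      g = algebraMap R F (ψ (h * w ^ (q - 1))) / algebraMap R F w := by
    intro f
    obtain ⟨h, w, hw, rfl⟩ := IsFractionRing.div_surjective (A := R) f
    exact ⟨_, fun h' w' hw' e => hψ.div_eq_div hq (nonZeroDivisors.ne_zero hw) hw' e⟩
  choose Ψ hΨ using key
  refine ⟨⟨⟨Ψ, ?_⟩, ?_⟩, ?_, ?_⟩
  · rw [hΨ 0 0 1 one_ne_zero (by simp)]; simp
  · intro f f'
    obtain ⟨h, w, hw, e⟩ := IsFractionRing.div_surjective (A := R) f
    obtain ⟨h', w', hw', e'⟩ := IsFractionRing.div_surjective (A := R) f'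
    have n : w ≠ 0 := nonZeroDivisors.ne_zero hw
    have n' : w' ≠ 0 := nonZeroDivisors.ne_zero hw'
    have m : algebraMap R F w ≠ 0 := (map_ne_zero_iff _ i).2 n
    have m' : algebraMap R F w' ≠ 0 := (map_ne_zero_iff _ i).2 n'
    have nn : w * w' ≠ 0 := mul_ne_zero n n'
    have e1 : f = algebraMap R F (h * w') / algebraMap R F (w * w') := by
      rw [← e, map_mul, map_mul, mul_div_mul_right _ _ m']
    have e2 : f' = algebraMap R F (w * h') / algebraMap R F (w * w') := by
      rw [← e', map_mul, map_mul, mul_div_mul_left _ _ m]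
    have e3 : f + f' = algebraMap R F (h * w' + w * h') / algebraMap R F (w * w') := by
      rw [e1, e2, ← add_div, map_add]
    change Ψ (f + f') = Ψ f + Ψ f'
    rw [hΨ _ _ _ nn e1, hΨ _ _ _ nn e2, hΨ _ _ _ nn e3, add_mul, map_add, map_add, add_div]
  · intro a b
    obtain ⟨h, w, hw, e⟩ := IsFractionRing.div_surjective (A := R) a
    obtain ⟨h', w', hw', e'⟩ := IsFractionRing.div_surjective (A := R) b
    have n : w ≠ 0 := nonZeroDivisors.ne_zero hw
    have n' : w' ≠ 0 := nonZeroDivisors.ne_zero hw'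
    have m : algebraMap R F w ≠ 0 := (map_ne_zero_iff _ i).2 n
    have m' : algebraMap R F w' ≠ 0 := (map_ne_zero_iff _ i).2 n'
    obtain ⟨k, rfl⟩ : ∃ k, q = k + 1 := ⟨q - 1, by omega⟩
    have e1 : a ^ (k + 1) * b = algebraMap R F (h ^ (k + 1) * h' * w ^ 0 ) /
        algebraMap R F (w ^ (k + 1) * w') := by
      rw [← e, ← e', div_pow, pow_zero, mul_one, map_mul, map_mul, map_pow, map_pow,
        div_mul_div_comm]
    change Ψ (a ^ (k + 1) * b) = a * Ψ b
    rw [hΨ _ _ _ (mul_ne_zero (pow_ne_zero _ n) n') e1, hΨ _ _ _ n' e'.symm, ← e]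
    have e2 : h ^ (k + 1) * h' * w ^ 0 * (w ^ (k + 1) * w') ^ (k + 1 - 1) =
        (h * w ^ k) ^ (k + 1) * (h' * w' ^ k) := by
      simp only [Nat.add_sub_cancel]; ring
    have r := (algebraMap R F).map_mul
    rw [e2, hψ, r, r, r, map_pow, map_pow, Nat.add_sub_cancel]
    field_simp
    ring
  · intro r
    change Ψ _ = _
    rw [hΨ _ r 1 one_ne_zero (by simp)]
    simp

end extension

section polynomial
open MvPolynomial
variable {σ K : Type*} [Field K]

/-- The map `∑ z_a t^a ↦ ∑ φ(z_{q b}) t^b` on polynomials. -/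
noncomputable def polyTrace (q : ℕ) (hq : 0 < q) (φ : K →+ K) :
    MvPolynomial σ K →+ MvPolynomial σ K :=
  (AddMonoidAlgebra.coeffAddEquiv.symm.toAddMonoidHom.comp (Finsupp.mapRange.addMonoidHom φ)).comp
    ((Finsupp.comapDomain.addMonoidHom (f := fun b : σ →₀ ℕ => q • b)
      (smul_right_injective _ hq.ne')).comp AddMonoidAlgebra.coeffAddEquiv.toAddMonoidHom)

theorem coeff_polyTrace {q : ℕ} (hq : 0 < q) (φ : K →+ K) (h : MvPolynomial σ K) (b : σ →₀ ℕ) :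
    coeff b (polyTrace q hq φ h) = φ (coeff (q • b) h) := rfl

theorem polyTrace_monomial {q : ℕ} (hq : 0 < q) (φ : K →+ K) (z : K) (b : σ →₀ ℕ) :
    polyTrace q hq φ (monomial (q • b) z) = monomial b (φ z) := by
  classical
  ext d
  rw [coeff_polyTrace, coeff_monomial, coeff_monomial]
  by_cases e : b = d
  · subst e; simp
  · rw [if_neg e, if_neg (fun h => e (smul_right_injective _ hq.ne' h)), map_zero]

theorem polyTrace_monomial_eq_zero {q : ℕ} (hq : 0 < q) (φ : K →+ K) (z : K) (a : σ →₀ ℕ) (j : σ)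
    (h : ¬ q ∣ a j) : polyTrace q hq φ (monomial a z) = 0 := by
  classical
  ext d
  rw [coeff_polyTrace, coeff_monomial, if_neg, map_zero, coeff_zero]
  rintro rfl
  exact h ⟨d j, rfl⟩

theorem isInvLinear_polyTrace {p e : ℕ} [Fact p.Prime] [CharP K p] {φ : K →+ K}
    (hφ : IsInvLinear (p ^ e) φ) :
    IsInvLinear (p ^ e) (polyTrace (σ := σ) (p ^ e) (pow_pos (Fact.out : p.Prime).pos e) φ) := by
  classical
  intro a h
  induction a using MvPolynomial.induction_on' with
  | monomial d k =>
    induction h using MvPolynomial.induction_on' with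
    | monomial c z =>
      rw [monomial_pow, monomial_mul]
      by_cases hc : ∀ j, p ^ e ∣ c j
      · have hc' : ∃ b : σ →₀ ℕ, c = p ^ e • b := by
          refine ⟨c.mapRange (· / p ^ e) (by simp), Finsupp.ext fun j => ?_⟩
          simp [Nat.mul_div_cancel' (hc j)]
        obtain ⟨b, rfl⟩ := hc'
        rw [← smul_add, polyTrace_monomial, polyTrace_monomial, hφ, monomial_mul]
      · push Not at hc
        obtain ⟨j, hj⟩ := hc
        rw [polyTrace_monomial_eq_zero _ _ _ _ j hj, polyTrace_monomial_eq_zero _ _ _ _ j, mul_zero]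
        intro h
        refine hj ?_
        simpa [Nat.dvd_add_right] using h
    | add f g hf hg => rw [mul_add, map_add, hf, hg, map_add, mul_add]
  | add f g hf hg => rw [add_pow_char_pow, add_mul, map_add, hf, hg, add_mul]

end polynomial

/-! ### Laurent monomials and the extension of inverse linear maps -/

section monomials
open MvPolynomial
variable {ι K F : Type*} [Fintype ι] [Field K] [Field F] [Algebra K F]

/-- The Laurent monomial `∏ x_j ^ α_j`. -/
def zmonomial (x : ι → F) (α : ι → ℤ) : F := ∏ j, x j ^ α j

theorem prod_pow_eq_zmonomial (x : ι → F) (b : ι → ℕ) :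
    ∏ j, x j ^ b j = zmonomial x (fun j => (b j : ℤ)) := by simp [zmonomial]

theorem zmonomial_add {x : ι → F} (hx : ∀ j, x j ≠ 0) (α β : ι → ℤ) :
    zmonomial x (α + β) = zmonomial x α * zmonomial x β := by
  rw [zmonomial, zmonomial, zmonomial, ← Finset.prod_mul_distrib]
  exact Finset.prod_congr rfl fun j _ => zpow_add₀ (hx j) _ _

theorem zmonomial_smul (x : ι → F) (n : ℕ) (α : ι → ℤ) :
    zmonomial x ((n : ℤ) • α) = zmonomial x α ^ n := by
  rw [zmonomial, zmonomial, ← Finset.prod_pow]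
  refine Finset.prod_congr rfl fun j _ => ?_
  rw [Pi.smul_apply, smul_eq_mul, mul_comm, zpow_mul, zpow_natCast]

theorem zmonomial_neg (x : ι → F) (α : ι → ℤ) : zmonomial x (-α) = (zmonomial x α)⁻¹ := by
  rw [zmonomial, zmonomial, ← Finset.prod_inv_distrib]
  exact Finset.prod_congr rfl fun j _ => zpow_neg _ _

theorem zmonomial_ne_zero {x : ι → F} (hx : ∀ j, x j ≠ 0) (α : ι → ℤ) : zmonomial x α ≠ 0 :=
  Finset.prod_ne_zero_iff.2 fun j _ => zpow_ne_zero _ (hx j)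

theorem zmonomial_mul (x y : ι → F) (α : ι → ℤ) :
    zmonomial (x * y) α = zmonomial x α * zmonomial y α := by
  rw [zmonomial, zmonomial, zmonomial, ← Finset.prod_mul_distrib]
  exact Finset.prod_congr rfl fun j _ => mul_zpow _ _ _

theorem zmonomial_div_const {y : F} (hy : y ≠ 0) (x : ι → F) (α : ι → ℤ) :
    zmonomial (fun j => x j / y) α = zmonomial x α * y ^ (-∑ j, α j) := by
  classical
  have h : ∀ s : Finset ι, ∏ j ∈ s, y ^ α j = y ^ ∑ j ∈ s, α j := by
    intro s
    induction s using Finset.induction_on with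
    | empty => simp
    | insert a s ha ih => rw [Finset.prod_insert ha, Finset.sum_insert ha, ih, zpow_add₀ hy]
  rw [zmonomial, zmonomial, zpow_neg, ← h, ← Finset.prod_inv_distrib, ← Finset.prod_mul_distrib]
  exact Finset.prod_congr rfl fun j _ => by rw [div_zpow, div_eq_mul_inv]

theorem zmonomial_single [DecidableEq ι] (x : ι → F) (i : ι) (n : ℤ) :
    zmonomial x (Pi.single i n) = x i ^ n := by
  rw [zmonomial, Finset.prod_eq_single i]
  · simp
  · intro j _ hj; simp [hj]
  · simp

theorem map_zmonomial (u : ι → K) (α : ι → ℤ) :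
    algebraMap K F (zmonomial u α) = zmonomial (fun j => algebraMap K F (u j)) α := by
  simp [zmonomial, map_prod, map_zpow₀]

/-- Let `F` be generated as a field over `K` by the algebraically independent elements `x_j`,
`j ≠ i₀`, and let `x_{i₀} = 1`. A `p ^ e`-inverse linear map `φ` of `K` extends to `F` by
`z x ^ (p ^ e b) ↦ φ(z) x ^ b`, the other monomials being sent to zero. -/
theorem IsInvLinear.exists_extension_monomial {p e : ℕ} [Fact p.Prime] [CharP K p] {φ : K →+ K}
    (hφ : IsInvLinear (p ^ e) φ) {x : ι → F} {i₀ : ι} (h0 : x i₀ = 1) (hx : ∀ j, x j ≠ 0)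
    (hind : AlgebraicIndependent K fun j : {j // j ≠ i₀} => x j)
    (hgen : ∀ f : F, ∃ g h : MvPolynomial {j // j ≠ i₀} K,
      f = aeval (fun j : {j // j ≠ i₀} => x j) g / aeval (fun j : {j // j ≠ i₀} => x j) h) :
    ∃ Ψ : F →+ F, IsInvLinear (p ^ e) Ψ ∧ (∀ z, Ψ (algebraMap K F z) = algebraMap K F (φ z)) ∧
      ∀ z α j, j ≠ i₀ → ¬ ((p ^ e : ℕ) : ℤ) ∣ α j → Ψ (algebraMap K F z * zmonomial x α) = 0 := by
  classical
  have hq : 0 < p ^ e := pow_pos (Fact.out : p.Prime).pos e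
  let _ : Algebra (MvPolynomial {j // j ≠ i₀} K) F :=
    (aeval (fun j : {j // j ≠ i₀} => x j)).toRingHom.toAlgebra
  have hmap : ∀ g, algebraMap (MvPolynomial {j // j ≠ i₀} K) F g =
    aeval (fun j : {j // j ≠ i₀} => x j) g := fun _ => rfl
  have hinj : Function.Injective (algebraMap (MvPolynomial {j // j ≠ i₀} K) F) := hind
  have : FaithfulSMul (MvPolynomial {j // j ≠ i₀} K) F := (faithfulSMul_iff_algebraMap_injective _ _).2 hinj
  have : IsFractionRing (MvPolynomial {j // j ≠ i₀} K) F :=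
    IsFractionRing.of_field _ _ fun f => by
      obtain ⟨g, h, e⟩ := hgen f
      exact ⟨g, h, e⟩
  obtain ⟨Ψ, h1, h2⟩ := (isInvLinear_polyTrace (σ := {j // j ≠ i₀}) hφ).exists_extension (F := F) hq
  refine ⟨Ψ, h1, fun z => ?_, fun z α j hj hd => ?_⟩
  · have h3 := h2 (monomial (p ^ e • 0) z)
    rw [polyTrace_monomial, smul_zero] at h3
    simpa [hmap] using h3
  · -- make the exponents nonnegative by multiplying with a `p ^ e`-th power
    let β : ι → ℤ := fun j => |α j|
    have hnn : ∀ j, 0 ≤ (α + ((p ^ e : ℕ) : ℤ) • β) j := by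
      intro j
      have h4 : (1 : ℤ) ≤ ((p ^ e : ℕ) : ℤ) := by exact_mod_cast hq
      have h5 := neg_abs_le (α j)
      have h6 := abs_nonneg (α j)
      simp only [Pi.add_apply, Pi.smul_apply, smul_eq_mul, β]
      nlinarith
    have h3 : zmonomial x β * Ψ (algebraMap K F z * zmonomial x α) = 0 := by
      rw [← h1, ← zmonomial_smul, mul_left_comm, ← zmonomial_add hx]
      let a : {j // j ≠ i₀} →₀ ℕ :=
        Finsupp.equivFunOnFinite.symm fun j => ((α + ((p ^ e : ℕ) : ℤ) • β) j).toNat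
      have h4 : algebraMap K F z * zmonomial x (((p ^ e : ℕ) : ℤ) • β + α) =
          algebraMap (MvPolynomial {j // j ≠ i₀} K) F (monomial a z) := by
        rw [hmap, aeval_monomial, Finsupp.prod_fintype _ _ (by simp)]
        congr 1
        rw [zmonomial, Fintype.prod_eq_mul_prod_subtype_ne _ i₀, h0, one_zpow, one_mul]
        refine Finset.prod_congr rfl fun j _ => ?_
        rw [← zpow_natCast, add_comm]
        congr 1
        exact (Int.toNat_of_nonneg (hnn j)).symm
      rw [h4, h2, polyTrace_monomial_eq_zero _ _ _ _ ⟨j, hj⟩, map_zero]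
      intro h5
      apply hd
      have h6 : ((p ^ e : ℕ) : ℤ) ∣ (α + ((p ^ e : ℕ) : ℤ) • β) j := by
        rw [← Int.toNat_of_nonneg (hnn j)]
        exact_mod_cast h5
      simpa using h6
    exact (mul_eq_zero.1 h3).resolve_left (zmonomial_ne_zero hx _)

end monomials

/-! ### Coordinate rings of charts -/

section chart
variable {ι K F : Type*} [Field K] [Field F] [Algebra K F]

/-- The coordinates `u_j x_j / (u_i x_i)` on the chart where `u_i x_i` does not vanish. -/
def chartCoord (x : ι → F) (u : ι → K) (i j : ι) : F :=
  algebraMap K F (u j) * x j / (algebraMap K F (u i) * x i)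

theorem chartCoord_self {x : ι → F} {u : ι → K} (hx : ∀ j, x j ≠ 0) (hu : ∀ j, u j ≠ 0) (i : ι) :
    chartCoord x u i i = 1 :=
  div_self (mul_ne_zero (by simpa using hu i) (hx i))

theorem zmonomial_chartCoord [Fintype ι] {x : ι → F} {u : ι → K} (hx : ∀ j, x j ≠ 0) (hu : ∀ j, u j ≠ 0)
    (i : ι) (α : ι → ℤ) : zmonomial (chartCoord x u i) α =
      algebraMap K F (zmonomial u α * u i ^ (-∑ j, α j)) * (zmonomial x α * x i ^ (-∑ j, α j)) := by
  have h : chartCoord x u i =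
      fun j => ((fun j => algebraMap K F (u j)) * x) j / (algebraMap K F (u i) * x i) := rfl
  rw [h, zmonomial_div_const (mul_ne_zero (by simpa using hu i) (hx i)), zmonomial_mul,
    ← map_zmonomial, mul_zpow, map_mul, map_zpow₀]
  ring

/-- The subring of `F` generated by `O ⊆ K` and the coordinates of a chart. -/
def chartRing (x : ι → F) (u : ι → K) (i : ι) (O : Subring K) : Subring F :=
  Subring.closure (algebraMap K F '' O ∪ Set.range (chartCoord x u i))

theorem algebraMap_mem_chartRing (x : ι → F) (u : ι → K) (i : ι) {O : Subring K} {z : K}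
    (hz : z ∈ O) : algebraMap K F z ∈ chartRing x u i O :=
  Subring.subset_closure (Or.inl ⟨z, hz, rfl⟩)

theorem chartCoord_mem_chartRing (x : ι → F) (u : ι → K) (i : ι) (O : Subring K) (j : ι) :
    chartCoord x u i j ∈ chartRing x u i O :=
  Subring.subset_closure (Or.inr ⟨j, rfl⟩)

/-- The chart ring is additively generated by the products of elements of `O` and monomials in the
coordinates. -/
theorem chartRing_induction [Fintype ι] {x : ι → F} {u : ι → K} {i : ι} {O : Subring K} {P : F → Prop}
    (hm : ∀ z ∈ O, ∀ a : ι → ℕ, P (algebraMap K F z * ∏ j, chartCoord x u i j ^ a j))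
    (ha : ∀ f g, P f → P g → P (f + g)) {h : F} (hh : h ∈ chartRing x u i O) : P h := by
  classical
  let M : Submonoid F :=
    { carrier := {f | ∃ z ∈ O, ∃ a : ι → ℕ, f = algebraMap K F z * ∏ j, chartCoord x u i j ^ a j}
      one_mem' := ⟨1, O.one_mem, 0, by simp⟩
      mul_mem' := by
        rintro _ _ ⟨z, hz, a, rfl⟩ ⟨w, hw, b, rfl⟩
        refine ⟨z * w, O.mul_mem hz hw, a + b, ?_⟩
        simp only [Pi.add_apply, pow_add, Finset.prod_mul_distrib, map_mul]
        ring }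
  have h1 : algebraMap K F '' O ∪ Set.range (chartCoord x u i) ⊆ M := by
    rintro _ (⟨z, hz, rfl⟩ | ⟨j, rfl⟩)
    · exact ⟨z, hz, 0, by simp⟩
    · refine ⟨1, O.one_mem, Pi.single j 1, ?_⟩
      rw [Finset.prod_eq_single j (by intro k _ hk; simp [hk]) (by simp)]
      simp
  have h2 : h ∈ AddSubgroup.closure (M : Set F) := by
    have h3 := Subring.closure_mono h1 hh
    rw [Subring.mem_closure_iff, Submonoid.closure_eq] at h3
    exact h3
  clear hh
  have hneg : ∀ f ∈ (M : Set F), -f ∈ (M : Set F) := by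
    rintro _ ⟨z, hz, a, rfl⟩
    exact ⟨-z, O.neg_mem hz, a, by simp⟩
  induction h2 using AddSubgroup.closure_induction'' with
  | zero => simpa using hm 0 O.zero_mem 0
  | add f g _ _ hf hg => exact ha f g hf hg
  | mem f hf => obtain ⟨z, hz, a, rfl⟩ := hf; exact hm z hz a
  | neg_mem f hf => obtain ⟨z, hz, a, e⟩ := hneg f hf; rw [e]; exact hm z hz a

variable [Fintype ι] {q : ℕ} {φ : K →+ K} {Ψ : F →+ F} {x : ι → F} {u : ι → K} {i₀ : ι}

/-- `Ψ` maps `z s ^ a · x_i ^ m / x ^ c`, `m = ∑ c_j`, into the chart ring, because all exponents of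
a monomial of total degree zero that survives are nonnegative except possibly that of `s_i = 1`. -/
theorem trace_monomial_mem (hq : 0 < q) (hφ : IsInvLinear q φ) (hΨ : IsInvLinear q Ψ)
    (hφΨ : ∀ z, Ψ (algebraMap K F z) = algebraMap K F (φ z))
    (hΨ0 : ∀ z α j, j ≠ i₀ → ¬ (q : ℤ) ∣ α j → Ψ (algebraMap K F z * zmonomial x α) = 0)
    (hx : ∀ j, x j ≠ 0) (hu : ∀ j, u j ≠ 0) (i : ι) {c : ι → ℕ} (hc : ∀ j, c j < q)
    {O : Subring K} {z : K} (hz : φ (z * (∏ j, u j ^ c j) / u i ^ ∑ j, c j) ∈ O) (a : ι → ℕ) :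
    Ψ (algebraMap K F z * (∏ j, chartCoord x u i j ^ a j) *
      (x i ^ (∑ j, c j) / ∏ j, x j ^ c j)) ∈ chartRing x u i O := by
  classical
  let γ : ι → ℤ := fun j => c j
  let A : ι → ℤ := fun j => a j
  have hui : algebraMap K F (u i) ≠ 0 := by simpa using hu i
  set n : ℤ := ∑ j, A j with hn
  set m : ℤ := ∑ j, γ j with hm
  have hm' : ((∑ j, c j : ℕ) : ℤ) = m := by simp [hm, γ]
  let α : ι → ℤ := A - γ + Pi.single i (m - n)
  have hsum : ∑ j, α j = 0 := by
    simp [α, Finset.sum_add_distrib, hn, hm]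
  -- rewrite the argument as a scalar times a Laurent monomial in `x`
  have e1 : algebraMap K F z * (∏ j, chartCoord x u i j ^ a j) *
      (x i ^ (∑ j, c j) / ∏ j, x j ^ c j) =
      algebraMap K F (z * (zmonomial u A * u i ^ (-n))) * zmonomial x α := by
    rw [prod_pow_eq_zmonomial, prod_pow_eq_zmonomial, zmonomial_chartCoord hx hu, ← zpow_natCast (x i), hm',
      zmonomial_add hx, sub_eq_add_neg, zmonomial_add hx, zmonomial_single, zmonomial_neg,
      zpow_sub₀ (hx i), map_mul, ← hn, zpow_neg (x i), map_mul]
    simp only [map_mul, div_eq_mul_inv]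
    ring
  rw [e1]
  by_cases hd : ∀ j, (q : ℤ) ∣ α j
  · choose b hb using hd
    have hαb : α = (q : ℤ) • b := funext hb
    have hq' : (0 : ℤ) < q := by exact_mod_cast hq
    have hb0 : ∑ j, b j = 0 := by
      have h1 : (q : ℤ) * ∑ j, b j = 0 := by
        rw [Finset.mul_sum, ← hsum]
        exact Finset.sum_congr rfl fun j _ => (hb j).symm
      exact (mul_eq_zero.1 h1).resolve_left hq'.ne'
    -- `a j - c j = q * b j` and `c j < q` exclude negative `b j`
    have hbi : ∀ j, j ≠ i → 0 ≤ b j := by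
      intro j hj
      have h1 : (a j : ℤ) - c j = q * b j := by
        rw [← hb j]; simp [α, A, γ, hj]
      have h2 : (c j : ℤ) < q := by exact_mod_cast hc j
      by_contra h3
      nlinarith [Int.natCast_nonneg (a j)]
    have e2 : z * (zmonomial u A * u i ^ (-n)) =
        zmonomial u b ^ q * (z * (∏ j, u j ^ c j) / u i ^ ∑ j, c j) := by
      have h1 : A = γ + (Pi.single i (n - m) + (q : ℤ) • b) := by
        rw [← hαb]
        simp only [α]
        have : Pi.single i (n - m) + Pi.single i (m - n) = (0 : ι → ℤ) := by
          rw [← Pi.single_add]; simp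
        rw [add_left_comm, ← add_assoc γ, add_sub_cancel, add_left_comm, this, add_zero]
      rw [prod_pow_eq_zmonomial, h1, zmonomial_add hu, zmonomial_add hu, zmonomial_single, zmonomial_smul,
        ← zpow_natCast (u i), hm', zpow_sub₀ (hu i), zpow_neg]
      have := hu i
      have h2 : u i ^ n ≠ 0 := zpow_ne_zero _ this
      have h3 : u i ^ m ≠ 0 := zpow_ne_zero _ this
      change z * (zmonomial u γ * _ * _) = _ * (z * zmonomial u γ / _)
      field_simp
    have e3 : algebraMap K F (zmonomial u b) * zmonomial x b = zmonomial (chartCoord x u i) b := by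
      rw [zmonomial_chartCoord hx hu, hb0]; simp
    rw [hαb, zmonomial_smul, mul_comm, hΨ, hφΨ, e2, hφ, map_mul, ← mul_assoc,
      mul_comm (zmonomial x b), e3]
    refine mul_mem ?_ (algebraMap_mem_chartRing x u i hz)
    refine prod_mem fun j _ => ?_
    by_cases hj : j = i
    · subst hj; rw [chartCoord_self hx hu, one_zpow]; exact one_mem _
    · rw [← Int.toNat_of_nonneg (hbi j hj), zpow_natCast]
      exact pow_mem (chartCoord_mem_chartRing x u i O j) _
  · -- the exponents add up to zero, so that of `i₀` is not the only one not divisible by `q`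
    have hd' : ∃ j, j ≠ i₀ ∧ ¬ (q : ℤ) ∣ α j := by
      by_contra h1
      push Not at h1
      refine hd fun j => ?_
      by_cases hj : j = i₀
      · subst hj
        rw [← Finset.add_sum_erase _ _ (Finset.mem_univ j)] at hsum
        rw [eq_neg_of_add_eq_zero_left hsum, dvd_neg]
        exact Finset.dvd_sum fun k hk => h1 k (Finset.ne_of_mem_erase hk)
      · exact h1 j hj
    obtain ⟨j, hj, hjd⟩ := hd'
    rw [hΨ0 _ _ j hj hjd]
    exact zero_mem _

/-- The local criterion for regularity of `Ψ (f · x ^ (-c))`: `B` is a localization of a chart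
ring, and `f / x_i ^ m ∈ λ B`. -/
theorem trace_mem_of_localization (hq : 0 < q) (hφ : IsInvLinear q φ) (hΨ : IsInvLinear q Ψ)
    (hφΨ : ∀ z, Ψ (algebraMap K F z) = algebraMap K F (φ z))
    (hΨ0 : ∀ z α j, j ≠ i₀ → ¬ (q : ℤ) ∣ α j → Ψ (algebraMap K F z * zmonomial x α) = 0)
    (hx : ∀ j, x j ≠ 0) (hu : ∀ j, u j ≠ 0) (i : ι) {c : ι → ℕ} (hc : ∀ j, c j < q)
    {O : Subring K} {B : Subring F} (hB : chartRing x u i O ≤ B)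
    (hB' : ∀ b ∈ B, ∃ h ∈ chartRing x u i O, ∃ w ∈ chartRing x u i O,
      w ≠ 0 ∧ w⁻¹ ∈ B ∧ b = h / w)
    {l : K} (hl : ∀ z ∈ O, φ (l * z * (∏ j, u j ^ c j) / u i ^ ∑ j, c j) ∈ O)
    {f b : F} (hb : b ∈ B) (hf : f = algebraMap K F l * b * x i ^ ∑ j, c j) :
    Ψ (f / ∏ j, x j ^ c j) ∈ B := by
  obtain ⟨h, hh, w, hw, hw0, hwB, rfl⟩ := hB' b hb
  obtain ⟨k, rfl⟩ : ∃ k, q = k + 1 := ⟨q - 1, by omega⟩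
  -- the denominator `w` becomes a `q`-th power and leaves `Ψ`
  have e1 : f / ∏ j, x j ^ c j = w⁻¹ ^ (k + 1) * (algebraMap K F l * (h * w ^ k) *
      (x i ^ (∑ j, c j) / ∏ j, x j ^ c j)) := by
    rw [hf]
    have : w⁻¹ ^ (k + 1) = (w ^ k * w)⁻¹ := by rw [inv_pow, pow_succ]
    rw [this]
    field_simp
  rw [e1, hΨ]
  refine mul_mem hwB (hB ?_)
  have h1 : h * w ^ k ∈ chartRing x u i O := mul_mem hh (pow_mem hw k)
  refine chartRing_induction (P := fun g => Ψ (algebraMap K F l * g *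
      (x i ^ (∑ j, c j) / ∏ j, x j ^ c j)) ∈ chartRing x u i O) ?_ ?_ h1
  · intro z hz a
    have := trace_monomial_mem hq hφ hΨ hφΨ hΨ0 hx hu i hc (hl z hz) a
    rwa [map_mul (algebraMap K F), mul_assoc (algebraMap K F l)] at this
  · intro f g hf hg
    rw [mul_add, add_mul, map_add]
    exact add_mem hf hg

end chart

/-! ### Forms and elements of chart rings -/

section forms
open MvPolynomial
variable {ι K F : Type*} [Fintype ι] [Field K] [Field F] [Algebra K F]

theorem sum_eq_of_isHomogeneous {m : ℕ} {G : MvPolynomial ι K} (hG : G.IsHomogeneous m)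
    {a : ι →₀ ℕ} (ha : a ∈ G.support) : ∑ j, a j = m := by
  by_contra h
  refine mem_support_iff.1 ha (hG.coeff_eq_zero ?_)
  rwa [Finsupp.degree_eq_sum]

theorem aeval_eq_sum_zmonomial (x : ι → F) (G : MvPolynomial ι K) :
    aeval x G = ∑ a ∈ G.support, algebraMap K F (coeff a G) * zmonomial x (fun j => (a j : ℤ)) := by
  rw [aeval_def, eval₂_eq']
  exact Finset.sum_congr rfl fun a _ => by rw [prod_pow_eq_zmonomial]

/-- Homogenization: an element of the coordinate ring of the `i`-th chart over `K` becomes a form in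
the `x_j` after multiplication with a power of `x_i`. -/
theorem exists_isHomogeneous_of_mem_chartRing {x : ι → F} {u : ι → K} (hx : ∀ j, x j ≠ 0) (i : ι)
    {h : F} (hu : ∀ j, u j ≠ 0) (hh : h ∈ chartRing x u i ⊤) :
    ∃ (d : ℕ) (G : MvPolynomial ι K), G.IsHomogeneous d ∧ aeval x G = h * x i ^ d := by
  refine chartRing_induction (P := fun h => ∃ (d : ℕ) (G : MvPolynomial ι K),
    G.IsHomogeneous d ∧ aeval x G = h * x i ^ d) ?_ ?_ hh
  · intro z _ a
    refine ⟨∑ j, a j, monomial (Finsupp.equivFunOnFinite.symm a)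
      (z * ((∏ j, u j ^ a j) * (u i ^ ∑ j, a j)⁻¹)), ?_, ?_⟩
    · refine isHomogeneous_monomial _ ?_
      rw [Finsupp.degree_eq_sum]
      rfl
    · rw [aeval_monomial, Finsupp.prod_fintype _ _ (by simp)]
      have h1 : ∏ j, chartCoord x u i j ^ a j = algebraMap K F ((∏ j, u j ^ a j) *
          (u i ^ ∑ j, a j)⁻¹) * ((∏ j, x j ^ a j) * (x i ^ ∑ j, a j)⁻¹) := by
        rw [prod_pow_eq_zmonomial, zmonomial_chartCoord hx hu, prod_pow_eq_zmonomial,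
          prod_pow_eq_zmonomial, zpow_neg, zpow_neg, ← Nat.cast_sum, zpow_natCast, zpow_natCast]
      rw [h1, map_mul]
      simp only [Finsupp.coe_equivFunOnFinite_symm]
      have := pow_ne_zero (∑ j, a j) (hx i)
      field_simp
  · rintro f g ⟨d, G, hG, e⟩ ⟨d', G', hG', e'⟩
    refine ⟨d + d', G * X i ^ d' + G' * X i ^ d, ?_, ?_⟩
    · refine (hG.mul (by simpa using (isHomogeneous_X K i).pow d')).add ?_
      rw [add_comm d]
      exact hG'.mul (by simpa using (isHomogeneous_X K i).pow d)
    · rw [map_add, map_mul, map_mul, e, e', map_pow, map_pow, aeval_X]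
      ring

/-- Dehomogenization: a form is `x_i ^ m` times an element of the coordinate ring of the `i`-th
chart, and the denominators are controlled by those of its coefficients. -/
theorem exists_mem_chartRing_of_isHomogeneous {x : ι → F} {u : ι → K} (hx : ∀ j, x j ≠ 0)
    (hu : ∀ j, u j ≠ 0) (i : ι) {m : ℕ} {G : MvPolynomial ι K} (hG : G.IsHomogeneous m)
    {O : Subring K} {l : K} (hl : l ≠ 0)
    (hO : ∀ a ∈ G.support, coeff a G * (∏ j, u j ^ a j)⁻¹ * u i ^ m / l ∈ O) :
    ∃ b ∈ chartRing x u i O, aeval x G = algebraMap K F l * b * x i ^ m := by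
  refine ⟨∑ a ∈ G.support, algebraMap K F (coeff a G * (∏ j, u j ^ a j)⁻¹ * u i ^ m / l) *
    ∏ j, chartCoord x u i j ^ a j, sum_mem fun a ha => mul_mem
      (algebraMap_mem_chartRing x u i (hO a ha))
      (prod_mem fun j _ => pow_mem (chartCoord_mem_chartRing x u i O j) _), ?_⟩
  rw [aeval_eq_sum_zmonomial, Finset.mul_sum, Finset.sum_mul]
  refine Finset.sum_congr rfl fun a ha => ?_
  have hdeg : ∑ j, (a j : ℤ) = m := by
    rw [← sum_eq_of_isHomogeneous hG ha]; push_cast; rfl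
  have h1 := zmonomial_ne_zero hu (fun j => (a j : ℤ))
  have h2 : algebraMap K F (zmonomial u fun j => (a j : ℤ)) ≠ 0 := by simpa using h1
  have h3 : algebraMap K F l ≠ 0 := by simpa using hl
  have h4 : algebraMap K F (u i) ≠ 0 := by simpa using hu i
  rw [prod_pow_eq_zmonomial, prod_pow_eq_zmonomial, zmonomial_chartCoord hx hu, hdeg, zpow_neg,
    zpow_neg, zpow_natCast, zpow_natCast]
  simp only [map_mul, map_div₀, map_inv₀, map_pow]
  have := hx i
  field_simp

/-- The normalization of the trace: if `x ^ c` occurs in the form `G` with coefficient one, no other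
monomial of `G` has exponents congruent to `c`. -/
theorem trace_form_eq_one {q : ℕ} {φ : K →+ K} {Ψ : F →+ F} {x : ι → F} {i₀ : ι}
    (hφΨ : ∀ z, Ψ (algebraMap K F z) = algebraMap K F (φ z))
    (hΨ0 : ∀ z α j, j ≠ i₀ → ¬ (q : ℤ) ∣ α j → Ψ (algebraMap K F z * zmonomial x α) = 0)
    (hx : ∀ j, x j ≠ 0) (h1 : φ 1 = 1) {m : ℕ} (hm : m < q) {G : MvPolynomial ι K}
    (hG : G.IsHomogeneous m) {c : ι →₀ ℕ} (hc : coeff c G = 1) :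
    Ψ (aeval x G / ∏ j, x j ^ c j) = 1 := by
  classical
  have hdeg : ∀ a ∈ G.support, ∑ j, a j = m := fun a ha => sum_eq_of_isHomogeneous hG ha
  have hcs : c ∈ G.support := by rw [mem_support_iff, hc]; exact one_ne_zero
  rw [aeval_eq_sum_zmonomial, Finset.sum_div, map_sum, Finset.sum_eq_single c]
  · rw [hc, prod_pow_eq_zmonomial, mul_div_cancel_right₀ _ (zmonomial_ne_zero hx _), hφΨ, h1,
      map_one]
  · intro a ha hac
    rw [prod_pow_eq_zmonomial, div_eq_mul_inv, ← zmonomial_neg, mul_assoc, ← zmonomial_add hx]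
    have hle : ∀ b ∈ G.support, ∀ j, b j ≤ m := fun b hb j => by
      rw [← hdeg b hb]; exact Finset.single_le_sum (fun _ _ => Nat.zero_le _) (Finset.mem_univ j)
    by_contra hne
    have hall : ∀ j, j ≠ i₀ → a j = c j := by
      intro j hj
      by_contra hjne
      refine hne (hΨ0 _ _ j hj fun hd => hjne ?_)
      have h5 : ((a j : ℤ) - c j) = 0 := by
        refine Int.eq_zero_of_abs_lt_dvd hd ?_
        have h6 := hle a ha j
        have h7 := hle c hcs j
        change |(a j : ℤ) + -(c j : ℤ)| < q
        rw [abs_lt]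
        constructor <;> omega
      omega
    refine hac (Finsupp.ext fun j => ?_)
    by_cases hj : j = i₀
    · subst hj
      have h8 := (hdeg a ha).trans (hdeg c hcs).symm
      rw [← Finset.add_sum_erase _ _ (Finset.mem_univ j),
        ← Finset.add_sum_erase _ c (Finset.mem_univ j),
        Finset.sum_congr rfl fun k hk => hall k (Finset.ne_of_mem_erase hk)] at h8
      exact Nat.add_right_cancel h8
    · exact hall j hj
  · intro h; exact (h hcs).elim

end forms

/-! ### Normal domains -/

section hartogs
variable {A K : Type*} [CommRing A] [IsDomain A] [IsNoetherianRing A] [IsIntegrallyClosed A]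
  [Field K] [Algebra A K] [IsFractionRing A K]

/-- A Noetherian integrally closed domain is the intersection of its localizations at the primes of
height one. -/
theorem mem_range_algebraMap_of_height_one {f : K}
    (hf : ∀ P : Ideal A, P.IsPrime → P.height = 1 →
      ∃ b ∉ P, ∃ a, algebraMap A K b * f = algebraMap A K a) :
    f ∈ (algebraMap A K).range := by
  by_contra hfA
  let N : Submodule A K := LinearMap.range (Algebra.linearMap A K)
  have hN : ∀ y : K, y ∈ N ↔ y ∈ (algebraMap A K).range := fun y => Iff.rfl
  have hf0 : (N.mkQ f) ≠ 0 := by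
    rw [Submodule.mkQ_apply, ne_eq, Submodule.Quotient.mk_eq_zero]
    exact hfA
  obtain ⟨P, hP, hle⟩ := exists_le_isAssociatedPrime_of_isNoetherianRing A (N.mkQ f) hf0
  obtain ⟨hPp, g', hg'⟩ := isAssociatedPrime_iff.1 hP
  obtain ⟨g, rfl⟩ := N.mkQ_surjective g'
  have hPg : ∀ a, a ∈ P ↔ ∃ r, algebraMap A K r = algebraMap A K a * g := by
    intro a
    have := hN (a • g)
    rw [hg', Submodule.mem_colon_singleton, Submodule.mem_bot, ← map_smul, Submodule.mkQ_apply,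
      Submodule.Quotient.mk_eq_zero, this, Algebra.smul_def]
    rfl
  have hgA : g ∉ (algebraMap A K).range := by
    rintro ⟨r, hr⟩
    refine hPp.ne_top ((Ideal.eq_top_iff_one _).2 ((hPg 1).2 ⟨r, ?_⟩))
    rw [hr, map_one, one_mul]
  have hPbot : P ≠ ⊥ := by
    obtain ⟨a, b, hb, e⟩ := IsFractionRing.div_surjective (A := A) g
    intro h
    have hb0 : algebraMap A K b ≠ 0 :=
      (map_ne_zero_iff _ (IsFractionRing.injective A K)).2 (nonZeroDivisors.ne_zero hb)
    have : b ∈ P := (hPg b).2 ⟨a, by rw [← e]; field_simp⟩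
    rw [h] at this
    exact nonZeroDivisors.ne_zero hb this
  by_cases hPP : ∀ a ∈ P, ∀ r, algebraMap A K r = algebraMap A K a * g → r ∈ P
  · refine hgA ?_
    have hint : IsIntegral A g := by
      let Q : Submodule A K := Submodule.map (Algebra.linearMap A K) P
      refine isIntegral_of_smul_mem_submodule (M := K) (N := Q) ?_ ?_ g ?_
      · intro h
        obtain ⟨a, ha, ha0⟩ := Submodule.exists_mem_ne_zero_of_ne_bot hPbot
        have h1 : algebraMap A K a ∈ Q := ⟨a, ha, rfl⟩
        rw [h] at h1
        exact ha0 (IsFractionRing.injective A K (h1.trans (map_zero _).symm))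
      · exact (IsNoetherian.noetherian P).map _
      · rintro _ ⟨a, ha, rfl⟩
        obtain ⟨r, hr⟩ := (hPg a).1 ha
        refine ⟨r, hPP a ha r hr, ?_⟩
        rw [smul_eq_mul, mul_comm]
        exact hr
    obtain ⟨r, hr⟩ := IsIntegrallyClosed.isIntegral_iff.1 hint
    exact ⟨r, hr⟩
  · push Not at hPP
    obtain ⟨t, ht, s, hs, hsP⟩ := hPP
    have hmin : P ∈ (Ideal.span {t}).minimalPrimes := by
      refine ⟨⟨hPp, (Ideal.span_singleton_le_iff_mem _).2 ht⟩, ?_⟩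
      rintro Q ⟨hQ, hQt⟩ hQP a ha
      obtain ⟨r, hr⟩ := (hPg a).1 ha
      have h1 : s * a = t * r := by
        apply IsFractionRing.injective A K
        rw [map_mul, map_mul, hs, hr]; ring
      have h2 : s * a ∈ Q := by
        rw [h1]; exact Q.mul_mem_right _ ((Ideal.span_singleton_le_iff_mem _).1 hQt)
      exact (hQ.mem_or_mem h2).resolve_left fun h => hsP (hQP h)
    have hle1 := Ideal.height_le_one_of_isPrincipal_of_mem_minimalPrimes _ P hmin
    have hne0 : P.height ≠ 0 := by
      rw [ne_eq, Ideal.height_eq_zero_iff, IsDomain.minimalPrimes_eq_singleton_bot]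
      exact hPbot
    have h1 : P.height = 1 := le_antisymm hle1 (Order.one_le_iff_ne_zero.2 hne0)
    obtain ⟨b, hb, a, e⟩ := hf P hPp h1
    refine hb (hle ?_)
    rw [Submodule.mem_colon_singleton, Submodule.mem_bot, ← map_smul, Submodule.mkQ_apply,
      Submodule.Quotient.mk_eq_zero, hN, Algebra.smul_def, e]
    exact ⟨a, rfl⟩

end hartogs

section normal
open MvPolynomial

/-- A polynomial ring over an integrally closed domain is integrally closed. -/
theorem isIntegrallyClosed_mvPolynomial (σ A : Type*) [CommRing A] [IsDomain A]
    [IsIntegrallyClosed A] : IsIntegrallyClosed (MvPolynomial σ A) := by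
  let K := FractionRing A
  let L := FractionRing (MvPolynomial σ K)
  let _ : Algebra (MvPolynomial σ A) (MvPolynomial σ K) := MvPolynomial.algebraMvPolynomial
  have hinj : Function.Injective (algebraMap (MvPolynomial σ A) (MvPolynomial σ K)) :=
    map_injective _ (IsFractionRing.injective A K)
  have hinj2 : Function.Injective (algebraMap (MvPolynomial σ K) L) := IsFractionRing.injective _ _
  have hf : FaithfulSMul (MvPolynomial σ A) L :=
    (faithfulSMul_iff_algebraMap_injective _ _).2 (hinj2.comp hinj)
  have hloc : IsLocalization ((nonZeroDivisors A).map (C (σ := σ))) (MvPolynomial σ K) :=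
    MvPolynomial.isLocalization (nonZeroDivisors A) K
  have : IsFractionRing (MvPolynomial σ A) L := IsFractionRing.of_field _ _ fun f => by
    obtain ⟨g, h, hh, rfl⟩ := IsFractionRing.div_surjective (A := MvPolynomial σ K) f
    obtain ⟨c, hc⟩ := IsLocalization.exist_integer_multiples_of_finite
      ((nonZeroDivisors A).map (C (σ := σ))) (fun i : Bool => bif i then g else h)
    obtain ⟨g', h1⟩ := hc true
    obtain ⟨h', h2⟩ := hc false
    refine ⟨g', h', ?_⟩
    obtain ⟨_, a, ha, rfl⟩ := c
    have hc0 : algebraMap (MvPolynomial σ A) (MvPolynomial σ K) (C a) ≠ 0 := by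
      rw [ne_eq, map_eq_zero_iff _ hinj, C_eq_zero]
      exact nonZeroDivisors.ne_zero ha
    rw [IsScalarTower.algebraMap_apply (MvPolynomial σ A) (MvPolynomial σ K) L,
      IsScalarTower.algebraMap_apply (MvPolynomial σ A) (MvPolynomial σ K) L h', h1, h2]
    simp only [cond_true, cond_false, Algebra.smul_def, map_mul]
    rw [mul_div_mul_left _ _ ((map_ne_zero_iff _ hinj2).2 hc0)]
  refine (isIntegrallyClosed_iff L).2 fun {x} hx => ?_
  have hx' : IsIntegral (MvPolynomial σ K) x := hx.tower_top
  obtain ⟨y, rfl⟩ := IsIntegrallyClosed.isIntegral_iff.1 hx'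
  have hy : IsIntegral (MvPolynomial σ A) y := (isIntegral_algebraMap_iff hinj2).1 hx
  rw [isIntegral_iff_isIntegral_coeff] at hy
  have hy' : y ∈ (map (algebraMap A K) : MvPolynomial σ A →+* _).range := by
    refine mem_range_map_iff_coeffs_subset.2 fun z hz => ?_
    obtain ⟨n, -, rfl⟩ := mem_coeffs_iff.1 hz
    obtain ⟨a, ha⟩ := IsIntegrallyClosed.isIntegral_iff.1 (hy n)
    exact ⟨a, ha⟩
  obtain ⟨w, rfl⟩ := hy'
  exact ⟨w, rfl⟩

end normal

/-! ### Charts of the projective bundle of a free module -/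

section away
open MvPolynomial HomogeneousLocalization
variable {A M ι : Type*} [CommRing A] [AddCommGroup M] [Module A M] (b : Module.Basis ι A M) (i : ι)

/-- Dehomogenization of a symmetric algebra with respect to the basis element `b i`. -/
noncomputable def symDehom : SymmetricAlgebra A M →ₐ[A] MvPolynomial {j // j ≠ i} A :=
  open scoped Classical in
  SymmetricAlgebra.lift (b.constr A fun j => if h : j = i then 1 else X ⟨j, h⟩)

theorem symDehom_self : symDehom b i (SymmetricAlgebra.ι A M (b i)) = 1 := by
  rw [symDehom, SymmetricAlgebra.lift_ι_apply, b.constr_basis, dif_pos rfl]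

theorem symDehom_of_ne (j : {j // j ≠ i}) : symDehom b i (SymmetricAlgebra.ι A M (b j)) = X j := by
  rw [symDehom, SymmetricAlgebra.lift_ι_apply, b.constr_basis, dif_neg j.2]

/-- Dehomogenization as a map on the degree zero part of the localization. -/
noncomputable def awayToPoly :
    Away (symPart A M) (SymmetricAlgebra.ι A M (b i)) →+* MvPolynomial {j // j ≠ i} A :=
  (IsLocalization.Away.lift (S := Localization.Away (SymmetricAlgebra.ι A M (b i)))
    (g := (symDehom b i).toRingHom) (SymmetricAlgebra.ι A M (b i))
      (by change IsUnit (symDehom b i _); rw [symDehom_self]; exact isUnit_one)).comp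
    (algebraMap (Away (symPart A M) (SymmetricAlgebra.ι A M (b i))) _)

theorem awayToPoly_mk (n : ℕ) (s : SymmetricAlgebra A M) (hs : s ∈ symPart A M (n • 1)) :
    awayToPoly b i (Away.mk _ (ι_mem_symPart A M (b i)) n s hs) = symDehom b i s := by
  have h1 : algebraMap (Away (symPart A M) (SymmetricAlgebra.ι A M (b i)))
      (Localization.Away (SymmetricAlgebra.ι A M (b i)))
      (Away.mk _ (ι_mem_symPart A M (b i)) n s hs) = IsLocalization.mk' _ s
        (⟨SymmetricAlgebra.ι A M (b i) ^ n, n, rfl⟩ :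
          Submonoid.powers (SymmetricAlgebra.ι A M (b i))) := by
    rw [← Localization.mk_eq_mk']
    exact Away.val_mk _ n (ι_mem_symPart A M (b i)) s hs
  rw [awayToPoly, RingHom.comp_apply, h1]
  refine (IsLocalization.lift_mk'_spec _ _ _ _).2 ?_
  change symDehom b i s = symDehom b i (_ ^ n) * _
  rw [map_pow, symDehom_self, one_pow, one_mul]

/-- The degree zero fraction `m / b i`. -/
noncomputable def awayFrac (m : M) : Away (symPart A M) (SymmetricAlgebra.ι A M (b i)) :=
  Away.mk _ (ι_mem_symPart A M (b i)) 1 (SymmetricAlgebra.ι A M m)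
    (by rw [one_smul]; exact ι_mem_symPart A M m)

/-- Elements of the base ring as functions on the `i`-th chart. -/
noncomputable def awayScalar : A →+* Away (symPart A M) (SymmetricAlgebra.ι A M (b i)) :=
  (fromZeroRingHom _ _).comp (algebraMap A (symPart A M 0))

/-- The inverse of `awayToPoly`, sending `X j` to `b j / b i`. -/
noncomputable def polyToAway :
    MvPolynomial {j // j ≠ i} A →+* Away (symPart A M) (SymmetricAlgebra.ι A M (b i)) :=
  eval₂Hom (awayScalar b i) fun j => awayFrac b i (b j)

theorem val_awayScalar (a : A) : (awayScalar b i a).val =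
    algebraMap _ (Localization.Away (SymmetricAlgebra.ι A M (b i))) (algebraMap A (SymmetricAlgebra A M) a) :=
  Localization.mk_one_eq_algebraMap _

theorem val_awayFrac (m : M) : (awayFrac b i m).val *
    algebraMap _ (Localization.Away (SymmetricAlgebra.ι A M (b i)))
      (SymmetricAlgebra.ι A M (b i)) =
    algebraMap _ (Localization.Away (SymmetricAlgebra.ι A M (b i))) (SymmetricAlgebra.ι A M m) := by
  rw [awayFrac, Away.val_mk, Localization.mk_eq_mk']
  simp only [pow_one]
  exact IsLocalization.mk'_spec (Localization.Away (SymmetricAlgebra.ι A M (b i)))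
    (SymmetricAlgebra.ι A M m) (⟨_, 1, pow_one _⟩ : Submonoid.powers (SymmetricAlgebra.ι A M (b i)))

theorem val_polyToAway_ι (m : M) :
    (polyToAway b i (symDehom b i (SymmetricAlgebra.ι A M m))).val *
      algebraMap _ (Localization.Away (SymmetricAlgebra.ι A M (b i)))
        (SymmetricAlgebra.ι A M (b i)) =
      algebraMap _ (Localization.Away (SymmetricAlgebra.ι A M (b i)))
        (SymmetricAlgebra.ι A M m) := by
  have hm : m ∈ Submodule.span A (Set.range b) := by rw [b.span_eq]; trivial
  induction hm using Submodule.span_induction with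
  | mem m hm =>
    obtain ⟨j, rfl⟩ := hm
    by_cases hj : j = i
    · subst hj; rw [symDehom_self, map_one, val_one, one_mul]
    · rw [symDehom_of_ne b i ⟨j, hj⟩, polyToAway, coe_eval₂Hom, eval₂_X, val_awayFrac]
  | zero => simp [val_zero]
  | add m n _ _ hm hn => simp only [map_add, val_add, add_mul, hm, hn]
  | smul a m _ hm =>
    have h1 : polyToAway b i (symDehom b i (algebraMap A _ a)) = awayScalar b i a := by
      rw [AlgHom.commutes, algebraMap_eq, polyToAway, coe_eval₂Hom, eval₂_C]
    rw [map_smul, Algebra.smul_def, map_mul, map_mul, val_mul, mul_assoc, hm, map_mul, h1,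
      val_awayScalar]

theorem val_polyToAway {n : ℕ} {s : SymmetricAlgebra A M} (hs : s ∈ symPart A M n) :
    (polyToAway b i (symDehom b i s)).val *
      algebraMap _ (Localization.Away (SymmetricAlgebra.ι A M (b i)))
        (SymmetricAlgebra.ι A M (b i)) ^ n =
      algebraMap _ (Localization.Away (SymmetricAlgebra.ι A M (b i))) s := by
  unfold symPart at hs
  induction hs using Submodule.pow_induction_on_left' with
  | algebraMap r =>
    rw [AlgHom.commutes, algebraMap_eq, polyToAway, coe_eval₂Hom, eval₂_C, val_awayScalar, pow_zero,
      mul_one]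
  | add _ _ _ _ _ ihx ihy => rw [map_add, map_add, val_add, add_mul, ihx, ihy, map_add]
  | mem_mul _ hm _ _ _ ih =>
    obtain ⟨m, rfl⟩ := hm
    rw [map_mul, map_mul, val_mul, map_mul, ← ih, Nat.succ_eq_add_one, pow_succ,
      ← val_polyToAway_ι b i m]
    ring

/-- The `i`-th standard chart of the projective bundle of a free module is an affine space. -/
noncomputable def awayEquiv :
    MvPolynomial {j // j ≠ i} A ≃+* Away (symPart A M) (SymmetricAlgebra.ι A M (b i)) :=
  RingEquiv.ofRingHom (polyToAway b i) (awayToPoly b i)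
    (by
      refine RingHom.ext fun y => ?_
      obtain ⟨n, s, hs, rfl⟩ := Away.mk_surjective _ (ι_mem_symPart A M (b i)) y
      rw [RingHom.comp_apply, awayToPoly_mk]
      apply val_injective
      have h1 := val_polyToAway b i (n := n) (by simpa using hs)
      rw [RingHom.id_apply, Away.val_mk, Localization.mk_eq_mk', IsLocalization.eq_mk'_iff_mul_eq]
      rw [← h1, map_pow])
    (by
      refine MvPolynomial.ringHom_ext (fun a => ?_) fun j => ?_
      · rw [RingHom.comp_apply, polyToAway, coe_eval₂Hom, eval₂_C]
        have h1 : awayScalar b i a = Away.mk _ (ι_mem_symPart A M (b i)) 0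
            (algebraMap A _ a) (by rw [zero_smul]; exact SetLike.algebraMap_mem_graded _ a) := by
          apply val_injective
          rw [val_awayScalar, Away.val_mk, Localization.mk_eq_mk',
            IsLocalization.eq_mk'_iff_mul_eq]
          simp
        rw [h1, awayToPoly_mk, AlgHom.commutes]
        rfl
      · rw [RingHom.comp_apply, polyToAway, coe_eval₂Hom, eval₂_X, awayFrac, awayToPoly_mk,
          symDehom_of_ne]
        rfl)

theorem awayEquiv_C (a : A) : awayEquiv b i (C a) = awayScalar b i a := by
  change polyToAway b i _ = _
  rw [polyToAway, coe_eval₂Hom, eval₂_C]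

theorem awayEquiv_X (j : {j // j ≠ i}) : awayEquiv b i (X j) = awayFrac b i (b j) := by
  change polyToAway b i _ = _
  rw [polyToAway, coe_eval₂Hom, eval₂_X]

end away

/-! ### Local rings inside the function field -/

section stalkRing
variable {X : Scheme.{u}} [AlgebraicGeometry.IsIntegral X]

/-- The local ring at `x` of an integral scheme, as a subring of the function field. -/
noncomputable def stalkRing (x : X) : Subring X.functionField :=
  (algebraMap (X.presheaf.stalk x) X.functionField).range

theorem toRat_injective (U : X.Opens) (x : U) : Function.Injective (toRat U x) :=
  haveI : Nonempty U := ⟨x⟩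
  Scheme.germToFunctionField_injective X U

theorem algebraMap_germ (U : X.Opens) (x y : U) (r : Γ(X, U)) :
    algebraMap (X.presheaf.stalk (y : X)) X.functionField (X.presheaf.germ U y y.2 r) =
      toRat U x r :=
  haveI : Nonempty U := ⟨x⟩
  Scheme.algebraMap_germ_eq_germToFunctionField X y.2 r

theorem toRat_map {U V : X.Opens} (i : V ⟶ U) (x : V) (r : Γ(X, U)) :
    toRat V x (X.presheaf.map i.op r) = toRat U ⟨x, i.le x.2⟩ r :=
  X.presheaf.germ_res_apply i _ _ r

theorem toRat_mem_stalkRing (U : X.Opens) (x y : U) (r : Γ(X, U)) :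
    toRat U x r ∈ stalkRing (y : X) :=
  ⟨_, algebraMap_germ U x y r⟩

theorem exists_toRat_of_mem_stalkRing {x : X} {f : X.functionField} (hf : f ∈ stalkRing x) :
    ∃ (U : X.Opens) (hx : x ∈ U) (r : Γ(X, U)), toRat U ⟨x, hx⟩ r = f := by
  obtain ⟨a, rfl⟩ := hf
  obtain ⟨U, hU, r, rfl⟩ := X.presheaf.exists_germ_eq a
  exact ⟨U, hU, r, (algebraMap_germ U ⟨x, hU⟩ ⟨x, hU⟩ r).symm⟩

theorem stalkRing_le_of_specializes {x y : X} (h : x ⤳ y) : stalkRing y ≤ stalkRing x := by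
  intro f hf
  obtain ⟨U, hy, r, rfl⟩ := exists_toRat_of_mem_stalkRing hf
  exact toRat_mem_stalkRing U ⟨y, hy⟩ ⟨x, h.mem_open U.2 hy⟩ r

/-- A rational function that is regular at each point of `U` is a section over `U`. -/
theorem exists_toRat_of_forall_mem (U : X.Opens) (x : U) {f : X.functionField}
    (hf : ∀ y ∈ U, f ∈ stalkRing y) : ∃ r : Γ(X, U), toRat U x r = f := by
  choose W hW r hr using fun y : U => exists_toRat_of_mem_stalkRing (hf y y.2)
  let W' : U → X.Opens := fun y => W y ⊓ U
  have hW' : ∀ y : U, (y : X) ∈ W' y := fun y => ⟨hW y, y.2⟩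
  let r' : ∀ y : U, Γ(X, W' y) := fun y => X.presheaf.map (homOfLE inf_le_left).op (r y)
  have hr' : ∀ (y : U) (z : W' y), toRat (W' y) z (r' y) = f := fun y z =>
    (toRat_map (homOfLE inf_le_left) z (r y)).trans (hr y)
  obtain ⟨s, hs, -⟩ := X.sheaf.existsUnique_gluing' W' U (fun y => homOfLE inf_le_right)
    (fun y hy => Opens.mem_iSup.2 ⟨⟨y, hy⟩, hW' ⟨y, hy⟩⟩) r' (by
      intro y z
      obtain ⟨w, hw⟩ : (((W' y ⊓ W' z : X.Opens) : Set X)).Nonempty :=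
        nonempty_preirreducible_inter (W' y).2 (W' z).2 ⟨y, hW' y⟩ ⟨z, hW' z⟩
      apply toRat_injective (W' y ⊓ W' z) ⟨w, hw⟩
      refine (toRat_map _ ⟨w, hw⟩ (r' y)).trans (Eq.trans ?_
        (toRat_map _ ⟨w, hw⟩ (r' z)).symm)
      rw [hr', hr'])
  refine ⟨s, ?_⟩
  have h1 := congrArg (toRat (W' x) ⟨x, hW' x⟩) (hs x)
  rw [hr'] at h1
  rw [← h1]
  exact (toRat_map (homOfLE inf_le_right) ⟨x, hW' x⟩ s).symm

theorem exists_eq_div_of_mem_stalkRing {U : X.Opens} (hU : IsAffineOpen U) (x : U)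
    {f : X.functionField} (hf : f ∈ stalkRing (x : X)) :
    ∃ a b : Γ(X, U), X.presheaf.germ U x x.2 b ∉ IsLocalRing.maximalIdeal _ ∧
      toRat U x b ≠ 0 ∧ (toRat U x b)⁻¹ ∈ stalkRing (x : X) ∧
      f = toRat U x a / toRat U x b := by
  obtain ⟨z, rfl⟩ := hf
  have h1 := hU.isLocalization_stalk x
  obtain ⟨⟨a, b⟩, h⟩ := IsLocalization.surj (hU.primeIdealOf x).asIdeal.primeCompl z
  have hu : IsUnit (X.presheaf.germ U x x.2 b.1) :=
    IsLocalization.map_units (X.presheaf.stalk (x : X)) b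
  have e1 := algebraMap_germ U x x b.1
  have hb : toRat U x b.1 ≠ 0 := by rw [← e1]; exact (hu.map _).ne_zero
  refine ⟨a, b.1, ?_, hb, ?_, ?_⟩
  · rw [IsLocalRing.mem_maximalIdeal, mem_nonunits_iff, not_not]; exact hu
  · obtain ⟨v, hv⟩ := hu.exists_right_inv
    refine ⟨v, ?_⟩
    refine eq_inv_of_mul_eq_one_left ?_
    rw [← e1, ← map_mul, mul_comm, hv, map_one]
  · rw [eq_div_iff hb, ← e1, ← algebraMap_germ U x x a, ← map_mul]
    exact congrArg _ h

end stalkRing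

/-! ### Orders of vanishing in codimension one -/

section ord
variable {X : Scheme.{u}} [AlgebraicGeometry.IsIntegral X] [IsLocallyNoetherian X]

theorem ord_inv (f : X.functionField) (x : X) : Scheme.ord f⁻¹ x = - Scheme.ord f x := by
  by_cases h : f = 0
  · simp [h]
  have := Scheme.ord_mul (x := x) h (inv_ne_zero h)
  rw [mul_inv_cancel₀ h, ord_one_eq_zero] at this
  omega

theorem ord_pow (f : X.functionField) (x : X) (n : ℕ) :
    Scheme.ord (f ^ n) x = n * Scheme.ord f x := by
  by_cases h : f = 0
  · subst h
    cases n <;> simp [ord_one_eq_zero]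
  induction n with
  | zero => simp [ord_one_eq_zero]
  | succ n ih =>
    rw [pow_succ, Scheme.ord_mul (pow_ne_zero n h) h, ih]; push_cast; ring

theorem ord_zpow (f : X.functionField) (x : X) (n : ℤ) :
    Scheme.ord (f ^ n) x = n * Scheme.ord f x := by
  obtain ⟨n, rfl | rfl⟩ := n.eq_nat_or_neg
  · rw [zpow_natCast, ord_pow]
  · rw [zpow_neg, ord_inv, zpow_natCast, ord_pow]; ring

theorem ord_div {f g : X.functionField} (hf : f ≠ 0) (hg : g ≠ 0) (x : X) :
    Scheme.ord (f / g) x = Scheme.ord f x - Scheme.ord g x := by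
  rw [div_eq_mul_inv, Scheme.ord_mul hf (inv_ne_zero hg), ord_inv, sub_eq_add_neg]

variable [IsNormalScheme X]

theorem ord_nonneg_iff {x : X} (hx : Order.coheight x = 1) {f : X.functionField} (hf : f ≠ 0) :
    0 ≤ Scheme.ord f x ↔ f ∈ stalkRing x := by
  have h1 := isDiscreteValuationRing_stalk X x hx
  rw [Scheme.le_ord_iff hx hf]
  change (1 : WithZero (Multiplicative ℤ)) ≤ Ring.ordFrac (X.presheaf.stalk x) f ↔ _
  have hv : ((IsDiscreteValuationRing.maximalIdeal (X.presheaf.stalk x)).valuation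
      X.functionField) f ≠ 0 := by
    rw [ne_eq, Valuation.zero_iff]; exact hf
  rw [Ring.ordFrac_eq_valuation_inv, one_le_inv₀ (zero_lt_iff.2 hv)]
  constructor
  · intro h
    obtain ⟨a, ha⟩ := IsDiscreteValuationRing.exists_lift_of_le_one h
    exact ⟨a, ha⟩
  · rintro ⟨a, rfl⟩
    exact IsDedekindDomain.HeightOneSpectrum.valuation_le_one _ a

theorem ord_irreducible {x : X} (hx : Order.coheight x = 1) {t : X.presheaf.stalk x}
    (ht : Irreducible t) : Scheme.ord (algebraMap _ X.functionField t) x = 1 := by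
  have h1 := isDiscreteValuationRing_stalk X x hx
  have h0 : algebraMap (X.presheaf.stalk x) X.functionField t ≠ 0 :=
    (map_ne_zero_iff _ (IsFractionRing.injective _ _)).2 ht.ne_zero
  rw [Scheme.ord_eq_iff hx h0]
  exact Ring.ordFrac_irreducible ht

theorem exists_uniformizer {x : X} (hx : Order.coheight x = 1) :
    ∃ t : X.presheaf.stalk x, Irreducible t ∧
      IsLocalRing.maximalIdeal (X.presheaf.stalk x) = Ideal.span {t} := by
  have h1 := isDiscreteValuationRing_stalk X x hx
  obtain ⟨t, ht⟩ := IsDiscreteValuationRing.exists_irreducible (X.presheaf.stalk x)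
  exact ⟨t, ht, ht.maximalIdeal_eq⟩

theorem exists_ord_eq_one {x : X} (hx : Order.coheight x = 1) :
    ∃ t : X.functionField, t ≠ 0 ∧ Scheme.ord t x = 1 := by
  obtain ⟨t, ht, -⟩ := exists_uniformizer hx
  exact ⟨_, (map_ne_zero_iff _ (IsFractionRing.injective _ _)).2 ht.ne_zero, ord_irreducible hx ht⟩

theorem mul_zpow_mem_stalkRing_iff {x : X} (hx : Order.coheight x = 1) {t : X.functionField}
    (h0 : t ≠ 0) (ht : Scheme.ord t x = 1) {f : X.functionField} {n : ℤ} :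
    f * t ^ n ∈ stalkRing x ↔ (f ≠ 0 → 0 ≤ Scheme.ord f x + n) := by
  by_cases hf : f = 0
  · simp [hf, zero_mem]
  have h1 : t ^ n ≠ 0 := zpow_ne_zero n h0
  rw [← ord_nonneg_iff hx (mul_ne_zero hf h1), Scheme.ord_mul hf h1, ord_zpow, ht, mul_one]
  simp [hf]

theorem isIntegrallyClosed_section {W : X.Opens} (hW : IsAffineOpen W) [Nonempty W] :
    IsIntegrallyClosed Γ(X, W) := by
  have hmem : ∀ y : PrimeSpectrum Γ(X, W), hW.fromSpec y ∈ W := fun y => by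
    have h := hW.range_fromSpec
    exact h.subset ⟨y, rfl⟩
  have hloc : ∀ y : PrimeSpectrum Γ(X, W), @IsLocalization.AtPrime
      (R := Γ(X, W)) (S := X.presheaf.stalk <| hW.fromSpec y) _ _
      ((X.presheaf.germ W _ (hmem y)).hom.toAlgebra) y.asIdeal _ := fun y =>
    hW.isLocalization_stalk' y (hmem y)
  refine IsIntegrallyClosed.of_localization_maximal fun P _ hP => ?_
  let y : PrimeSpectrum Γ(X, W) := ⟨P, hP.isPrime⟩
  let _ := (X.presheaf.germ W _ (hmem y)).hom.toAlgebra
  have h1 : IsLocalization.AtPrime (X.presheaf.stalk (hW.fromSpec y)) P := hloc y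
  have h2 := IsNormalScheme.isIntegrallyClosed_stalk (hW.fromSpec y)
  exact h2.of_equiv (IsLocalization.algEquiv P.primeCompl (X.presheaf.stalk (hW.fromSpec y))
    (Localization.AtPrime P)).toRingEquiv

/-- On a normal locally Noetherian scheme, a rational function that is regular in codimension one
is regular. -/
theorem mem_stalkRing_of_codim_one {U : X.Opens} {f : X.functionField}
    (hf : ∀ y ∈ U, Order.coheight y = 1 → f ∈ stalkRing y) {z : X} (hz : z ∈ U) :
    f ∈ stalkRing z := by
  obtain ⟨_, ⟨W, hW, rfl⟩, hzW, hWU⟩ := X.isBasis_affineOpens.exists_subset_of_mem_open hz U.2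
  have hne : Nonempty W := ⟨⟨z, hzW⟩⟩
  have hN : IsNoetherianRing Γ(X, W) := IsLocallyNoetherian.component_noetherian ⟨W, hW⟩
  have hfrac := functionField_isFractionRing_of_isAffineOpen X W hW
  have hmem : ∀ y : PrimeSpectrum Γ(X, W), hW.fromSpec y ∈ W := fun y => by
    have h := hW.range_fromSpec
    exact h.subset ⟨y, rfl⟩
  have hloc : ∀ y : PrimeSpectrum Γ(X, W), @IsLocalization.AtPrime
      (R := Γ(X, W)) (S := X.presheaf.stalk <| hW.fromSpec y) _ _
      ((X.presheaf.germ W _ (hmem y)).hom.toAlgebra) y.asIdeal _ := fun y =>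
    hW.isLocalization_stalk' y (hmem y)
  have hIC := isIntegrallyClosed_section hW
  obtain ⟨r, rfl⟩ := mem_range_algebraMap_of_height_one (A := Γ(X, W)) (f := f) fun P hP hP1 => by
    let y : PrimeSpectrum Γ(X, W) := ⟨P, hP⟩
    have := hW.isOpenImmersion_fromSpec
    have hy : Order.coheight (hW.fromSpec y) = 1 :=
      (coheight_eq_of_isOpenImmersion hW.fromSpec).trans
        ((idealHeight_eq_coheight Γ(X, W) y).symm.trans hP1)
    obtain ⟨g, hg⟩ := hf _ (hWU (hmem y)) hy
    let _ := (X.presheaf.germ W _ (hmem y)).hom.toAlgebra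
    have h1 : IsLocalization.AtPrime (X.presheaf.stalk (hW.fromSpec y)) P := hloc y
    obtain ⟨⟨a, b⟩, h⟩ := IsLocalization.surj P.primeCompl g
    refine ⟨b, b.2, a, ?_⟩
    have e1 : ∀ c, algebraMap Γ(X, W) X.functionField c =
        algebraMap _ X.functionField (X.presheaf.germ W _ (hmem y) c) := fun c =>
      (algebraMap_germ W ⟨z, hzW⟩ ⟨_, hmem y⟩ c).symm
    rw [e1, e1, ← hg, ← map_mul, mul_comm]
    exact congrArg _ h
  exact toRat_mem_stalkRing W ⟨z, hzW⟩ ⟨z, hzW⟩ r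

end ord

section finite

theorem finite_codim_one_not_mem {X : Scheme.{u}} [AlgebraicGeometry.IsIntegral X]
    [AlgebraicGeometry.IsNoetherian X] (U : X.Opens) (hU : (U : Set X).Nonempty) :
    {x : X | Order.coheight x = 1 ∧ x ∉ U}.Finite := by
  obtain ⟨S, hS, hcl, hirr, hZ⟩ := NoetherianSpace.exists_finite_set_isClosed_irreducible
    (isClosed_compl_iff.2 U.2)
  have key : ∀ y ∈ {x : X | Order.coheight x = 1 ∧ x ∉ U}, ∃ C ∈ S, closure {y} = C := by
    rintro y ⟨hy, hyU⟩
    have hyZ : y ∈ U.carrierᶜ := hyU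
    rw [hZ] at hyZ
    obtain ⟨C, hC, hyC⟩ := hyZ
    obtain ⟨c, hc⟩ := QuasiSober.sober (hirr C hC) (hcl C hC)
    have hcU : c ∉ U := by
      have : c ∈ U.carrierᶜ := by rw [hZ]; exact ⟨C, hC, hc.mem⟩
      exact this
    have h1 : y ≤ c := hc.specializes hyC
    have h2 : c = y := by
      by_contra hne
      have hlt : y < c := ⟨h1, fun h3 : c ≤ y => hne (Specializes.antisymm h1 h3).eq⟩
      have hlt2 : c < genericPoint X :=
        ⟨genericPoint_specializes c, fun h3 : genericPoint X ≤ c => hcU (by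
          have e : c = genericPoint X := (Specializes.antisymm h3 (genericPoint_specializes c)).eq
          rw [e]
          exact ((genericPoint_spec X).mem_open_set_iff U.isOpen).mpr (by simpa using hU))⟩
      have h4 := Order.coheight_add_one_le hlt
      have h5 := Order.coheight_add_one_le hlt2
      rw [hy] at h4
      have h6 : (1 : ℕ∞) ≤ Order.coheight c := le_trans (by simp) h5
      have h7 : (1 : ℕ∞) + 1 ≤ 1 := (add_le_add_left h6 1).trans h4
      exact absurd h7 (by decide)
    exact ⟨C, hC, by rw [← h2]; exact hc⟩
  choose! C hC hCy using key
  refine Set.Finite.of_finite_image (f := C) (hS.subset ?_) ?_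
  · rintro _ ⟨y, hy, rfl⟩
    exact hC y hy
  · intro y hy z hz e
    have h1 : closure {y} = closure {z} := by rw [hCy y hy, hCy z hz, e]
    refine (Specializes.antisymm ?_ ?_).eq
    · exact specializes_iff_closure_subset.2 h1.ge
    · exact specializes_iff_closure_subset.2 h1.le

end finite

/-! ### Splittings of Frobenius in terms of the function field -/

theorem section_ext {X : Scheme.{u}} [AlgebraicGeometry.IsIntegral X] (U : X.Opens)
    {r r' : Γ(X, U)} (h : ∀ x : U, toRat U x r = toRat U x r') :
    r = r' := by
  by_cases hU : Nonempty U
  · obtain ⟨x⟩ := hU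
    exact toRat_injective U x (h x)
  · have e : U = ⊥ := by
      ext x
      exact ⟨fun hx => (hU ⟨x, hx⟩).elim, fun hx => hx.elim⟩
    subst e
    exact Subsingleton.elim _ _

section splitting
variable {X : Scheme.{u}} [AlgebraicGeometry.IsIntegral X] [IsLocallyNoetherian X]

/-- A `q`-inverse linear map `φ` on the function field that sends `1` to `1` and the sections of
`𝒪_X(E)` to regular functions. -/
structure IsSplitting (q : ℕ) (E : WeilDivisor X) (φ : X.functionField →+ X.functionField) :
    Prop where
  isInvLinear : IsInvLinear q φ
  map_one : φ 1 = 1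
  map_mem : ∀ (x : X) (hx : Order.coheight x = 1) (f : X.functionField),
    (f ≠ 0 → 0 ≤ Scheme.ord f x + E ⟨x, hx⟩) → φ f ∈ stalkRing x

/-- Composites of splittings: `F^e_* 𝒪_X(E + p^e E')` is `F^e_*` of the reflexive tensor product of
`𝒪_X(E)` and the pullback of `𝒪_X(E')`. -/
theorem IsSplitting.comp [IsNormalScheme X] {q q' : ℕ} {E E' E'' : WeilDivisor X}
    {φ φ' : X.functionField →+ X.functionField} (h : IsSplitting q E φ)
    (h' : IsSplitting q' E' φ') (hE : ∀ x, E'' x ≤ E x + q * E' x) :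
    IsSplitting (q * q') E'' (φ'.comp φ) := by
  refine ⟨fun a b => ?_, ?_, fun x hx f hf => ?_⟩
  · rw [AddMonoidHom.comp_apply, mul_comm q q', pow_mul, h.isInvLinear, h'.isInvLinear]; rfl
  · rw [AddMonoidHom.comp_apply, h.map_one, h'.map_one]
  · obtain ⟨t, h0, ht⟩ := exists_ord_eq_one hx
    refine h'.map_mem x hx _ ((mul_zpow_mem_stalkRing_iff hx h0 ht).1 ?_)
    rw [mul_comm, ← h.isInvLinear]
    refine h.map_mem x hx _ fun hn => ?_
    have hf0 : f ≠ 0 := right_ne_zero_of_mul hn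
    have h1 := hf hf0
    have h2 := hE ⟨x, hx⟩
    rw [Scheme.ord_mul (left_ne_zero_of_mul hn) hf0, ord_pow, ord_zpow, ht, mul_one]
    linarith

theorem ceil_sub_one_mul_le (q n : ℕ) (d : ℚ) :
    ⌈((q : ℚ) ^ (n + 1) - 1) * d⌉ ≤ ⌈((q : ℚ) - 1) * d⌉ + q * ⌈((q : ℚ) ^ n - 1) * d⌉ := by
  rw [Int.ceil_le]
  push_cast
  have h1 := Int.le_ceil (((q : ℚ) - 1) * d)
  have h2 := mul_le_mul_of_nonneg_left (Int.le_ceil (((q : ℚ) ^ n - 1) * d))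
    (Nat.cast_nonneg (α := ℚ) q)
  calc ((q : ℚ) ^ (n + 1) - 1) * d = ((q : ℚ) - 1) * d + q * (((q : ℚ) ^ n - 1) * d) := by ring
    _ ≤ _ := add_le_add h1 h2

/-- Iterating a splitting for `⌈(q - 1) Δ⌉ + D` gives splittings for `⌈(q ^ n - 1) Δ⌉ + D`. -/
theorem IsSplitting.iterate [IsNormalScheme X] {q : ℕ} {Δ : QDivisor X}
    {D : WeilDivisor X} (hD : 0 ≤ D) {φ : X.functionField →+ X.functionField}
    (h : IsSplitting q ((((q : ℚ) - 1) • Δ).ceil + D) φ) (n : ℕ) :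
    ∃ φ', IsSplitting (q ^ (n + 1)) ((((q : ℚ) ^ (n + 1) - 1) • Δ).ceil + D) φ' := by
  induction n with
  | zero => exact ⟨φ, by simpa using h⟩
  | succ n ih =>
    obtain ⟨φ', h'⟩ := ih
    refine ⟨φ'.comp φ, ?_⟩
    rw [pow_succ']
    refine h.comp h' fun x => ?_
    have h1 := ceil_sub_one_mul_le q (n + 1) (Δ x)
    have h2 : (0 : ℤ) ≤ q * D x := mul_nonneg (by positivity) (hD x)
    change ⌈((q : ℚ) ^ (n + 1 + 1) - 1) * Δ x⌉ + D x ≤ ⌈((q : ℚ) - 1) * Δ x⌉ + D x +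
      q * (⌈((q : ℚ) ^ (n + 1) - 1) * Δ x⌉ + D x)
    linarith

end splitting

section criterion
variable {X : Scheme.{u}} [AlgebraicGeometry.IsIntegral X] [IsLocallyNoetherian X] [IsNormalScheme X]
  {p : ℕ} [Fact p.Prime] {hp : (p : Γ(X, ⊤)) = 0} {e : ℕ} {E : WeilDivisor X}

/-- A splitting maps sections of `𝒪_X(E)` to functions that are regular in codimension one, hence
regular. -/
theorem IsSplitting.exists_section {q : ℕ} {φ : X.functionField →+ X.functionField}
    (h : IsSplitting q E φ) (U : X.Opens) (s : divisorSections E U) :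
    ∃ r : Γ(X, U), ∀ x, toRat U x r = φ (s.1 x) := by
  by_cases hU : Nonempty U
  · obtain ⟨x⟩ := hU
    obtain ⟨r, hr⟩ := exists_toRat_of_forall_mem U x (f := φ (s.1 x)) fun z hz =>
      mem_stalkRing_of_codim_one (fun y hy hy1 => h.map_mem y hy1 _ fun h0 => by
        rw [s.2.const x ⟨y, hy⟩] at h0 ⊢
        exact s.2.ord_nonneg ⟨y, hy⟩ hy1 h0) hz
    exact ⟨r, fun y => by rw [s.2.const y x, ← hr]; rfl⟩
  · exact ⟨0, fun x => (hU ⟨x⟩).elim⟩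

/-- The map `F^e_* 𝒪_X(E) → 𝒪_X` on sections over `U` defined by a splitting. -/
noncomputable def IsSplitting.toFun {q : ℕ} {φ : X.functionField →+ X.functionField}
    (h : IsSplitting q E φ) (U : X.Opens) (s : divisorSections E U) : Γ(X, U) :=
  (h.exists_section U s).choose

theorem IsSplitting.toRat_toFun {q : ℕ} {φ : X.functionField →+ X.functionField}
    (h : IsSplitting q E φ) (U : X.Opens) (s : divisorSections E U) (x : U) :
    toRat U x (h.toFun U s) = φ (s.1 x) :=
  (h.exists_section U s).choose_spec x

theorem IsSplitting.toFun_add {q : ℕ} {φ : X.functionField →+ X.functionField}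
    (h : IsSplitting q E φ) (U : X.Opens) (s t : divisorSections E U) :
    h.toFun U (s + t) = h.toFun U s + h.toFun U t := section_ext U fun x => by
  rw [map_add, h.toRat_toFun, h.toRat_toFun, h.toRat_toFun, ← map_add]
  rfl

theorem IsSplitting.toFun_smul {q : ℕ} {φ : X.functionField →+ X.functionField}
    (h : IsSplitting q E φ) (U : X.Opens) (r : Γ(X, U)) (s : divisorSections E U) :
    h.toFun U (r ^ q • s) = r * h.toFun U s := section_ext U fun x => by
  rw [map_mul, h.toRat_toFun, h.toRat_toFun, ← h.isInvLinear]
  refine congrArg φ ?_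
  change toRat U x (r ^ q) * _ = _
  rw [map_pow]

theorem IsSplitting.toFun_res {q : ℕ} {φ : X.functionField →+ X.functionField}
    (h : IsSplitting q E φ) {U V : X.Opens} (i : V ⟶ U) (s : divisorSections E U) :
    h.toFun V (divisorRes E i.le s) = X.presheaf.map i.op (h.toFun U s) :=
  section_ext V fun x => by
    rw [h.toRat_toFun, toRat_map, h.toRat_toFun]
    rfl

/-- The retraction `F^e_* 𝒪_X(E) → 𝒪_X` defined by a splitting. -/
noncomputable def IsSplitting.retraction {φ : X.functionField →+ X.functionField}
    (h : IsSplitting (p ^ e) E φ) :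
    (Scheme.Modules.pushforward (absFrobenius X p e hp)).obj (divisorSheaf E) ⟶
      (SheafOfModules.unit X.ringCatSheaf : X.Modules) where
  val := {
    app := fun U => ModuleCat.ofHom (X := ((Scheme.Modules.pushforward
        (absFrobenius X p e hp)).obj (divisorSheaf E)).val.obj U)
        (Y := (SheafOfModules.unit X.ringCatSheaf).val.obj U)
      { toFun := fun s => h.toFun U.unop s
        map_add' := fun s t => h.toFun_add U.unop s t
        map_smul' := fun r s => h.toFun_smul U.unop r s }
    naturality := by
      intro U V i
      exact ModuleCat.hom_ext (LinearMap.ext fun s => h.toFun_res i.unop s) }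

theorem IsSplitting.isSplitMono {φ : X.functionField →+ X.functionField}
    (h : IsSplitting (p ^ e) E φ) (hE : 0 ≤ E) : IsSplitMono (frobeniusToDivisor p hp e E hE) := by
  refine IsSplitMono.mk' ⟨h.retraction, Scheme.Modules.hom_ext _ _ fun U => ?_⟩
  ext r
  refine section_ext U fun x => ?_
  change toRat U x (h.toFun U (divisorOfSection E hE U ((show Γ(X, U) from r) ^ p ^ e))) =
    toRat U x (show Γ(X, U) from r)
  rw [h.toRat_toFun]
  change φ (toRat U x ((show Γ(X, U) from r) ^ p ^ e)) = _
  rw [map_pow, ← mul_one (_ ^ _), h.isInvLinear, h.map_one, mul_one]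

end criterion

section isDivisorSection
variable {X : Scheme.{u}} [AlgebraicGeometry.IsIntegral X] [AlgebraicGeometry.IsNoetherian X]
  {E : WeilDivisor X}

/-- A rational function lies in `𝒪_X(E)` on an open neighbourhood of every point of codimension
one at which it satisfies the condition on its order. -/
theorem exists_isDivisorSection (hE : 0 ≤ E) (x : X) (hx : Order.coheight x = 1)
    (f : X.functionField) (hf : f ≠ 0 → 0 ≤ Scheme.ord f x + E ⟨x, hx⟩) :
    ∃ U : X.Opens, x ∈ U ∧ IsDivisorSection E U fun _ => f := by
  by_cases h0 : f = 0
  · exact ⟨⊤, trivial, fun _ _ => rfl, fun _ _ h => (h h0).elim⟩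
  obtain ⟨W, -, g, hW, hg, hu⟩ := exists_isUnit_germ_eq X f h0
  let S := {y : X | Order.coheight y = 1 ∧ y ∉ W} \ {x}
  have hS : S.Finite := (finite_codim_one_not_mem W (Set.nonempty_coe_sort.1 hW)).subset
    Set.sdiff_subset
  have hcl : IsClosed (⋃ y ∈ S, closure {y}) := hS.isClosed_biUnion fun _ _ => isClosed_closure
  refine ⟨⟨(⋃ y ∈ S, closure {y})ᶜ, hcl.isOpen_compl⟩, ?_, fun _ _ => rfl, fun z hz _ => ?_⟩
  · intro hxS
    simp only [Set.mem_iUnion] at hxS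
    obtain ⟨y, ⟨⟨hy, -⟩, hyx⟩, hxy⟩ := hxS
    have h1 : x ≤ y := specializes_iff_mem_closure.2 hxy
    have h2 : ¬ x < y := fun hlt => by
      have h3 := Order.coheight_add_one_le hlt
      rw [hx, hy] at h3
      exact absurd h3 (by decide)
    have h3 : y ≤ x := by
      by_contra h; exact h2 ⟨h1, h⟩
    exact hyx (Specializes.antisymm h3 h1).eq.symm
  · by_cases hzx : z.1 = x
    · have h1 : ∀ z : X, z = x → ∀ hz : Order.coheight z = 1, 0 ≤ Scheme.ord f z + E ⟨z, hz⟩ := by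
        rintro _ rfl _
        exact hf h0
      exact h1 z hzx hz
    · have hzW : (z : X) ∈ W := by
        by_contra hzW
        refine z.2 (Set.mem_biUnion (x := (z : X)) ⟨⟨hz, hzW⟩, hzx⟩ (subset_closure rfl))
      have h1 : Scheme.ord f (z : X) = 0 := by rw [← hg]; exact Scheme.ord_of_isUnit hu hzW
      rw [h1, zero_add]
      exact hE _

theorem exists_isDivisorSection_nonempty (hE : 0 ≤ E) (f : X.functionField) :
    ∃ U : X.Opens, Nonempty U ∧ IsDivisorSection E U fun _ => f := by
  by_cases h0 : f = 0
  · exact ⟨⊤, ⟨⟨genericPoint X, trivial⟩⟩, fun _ _ => rfl, fun _ _ h => (h h0).elim⟩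
  obtain ⟨W, -, g, hW, hg, hu⟩ := exists_isUnit_germ_eq X f h0
  refine ⟨W, hW, fun _ _ => rfl, fun z hz _ => ?_⟩
  have h1 : Scheme.ord f (z : X) = 0 := by rw [← hg]; exact Scheme.ord_of_isUnit hu z.2
  rw [h1, zero_add]
  exact hE _

end isDivisorSection

section criterion'
variable {X : Scheme.{u}} [AlgebraicGeometry.IsIntegral X] [AlgebraicGeometry.IsNoetherian X]
  [IsNormalScheme X] {p : ℕ} [Fact p.Prime] {hp : (p : Γ(X, ⊤)) = 0} {e : ℕ} {E : WeilDivisor X}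

/-- A retraction defines a map on the function field, since every rational function is a section of
`𝒪_X(E)` on some nonempty open set and the value of the retraction does not depend on that set. -/
theorem exists_isSplitting_of_isSplitMono (hE : 0 ≤ E)
    (h : IsSplitMono (frobeniusToDivisor p hp e E hE)) : ∃ φ, IsSplitting (p ^ e) E φ := by
  obtain ⟨⟨ρ, hρ⟩⟩ := h.exists_splitMono
  -- the retraction on sections
  let a : ∀ U : X.Opens, divisorSections E U → Γ(X, U) := fun U =>
    (ρ.val.app (op U)).hom
  have a_add : ∀ U (s t : divisorSections E U), a U (s + t) = a U s + a U t := fun U s t =>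
    map_add (ρ.val.app (op U)).hom s t
  have a_smul : ∀ U (r : Γ(X, U)) (s : divisorSections E U), a U (r ^ p ^ e • s) = r * a U s :=
    fun U r s => (ρ.val.app (op U)).hom.map_smul r s
  have a_res : ∀ {U V : X.Opens} (i : V ≤ U) (s : divisorSections E U),
      a V (divisorRes E i s) = X.presheaf.map (homOfLE i).op (a U s) := fun {U V} i s =>
    congrArg (fun g => g.hom s) (ρ.val.naturality (homOfLE i).op)
  have a_one : ∀ U, a U (divisorOfSection E hE U 1) = 1 := fun U => by
    have h1 := congrArg (fun g => (g.val.app (op U)).hom (1 : Γ(X, U))) hρ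
    have h2 : a U (divisorOfSection E hE U ((1 : Γ(X, U)) ^ p ^ e)) = 1 := h1
    rwa [one_pow] at h2
  have a_congr : ∀ {U V : X.Opens} (x : U) (y : V) (s : divisorSections E U)
      (t : divisorSections E V), s.1 x = t.1 y → toRat U x (a U s) = toRat V y (a V t) := by
    intro U V x y s t hst
    obtain ⟨z, hz, hz'⟩ := nonempty_preirreducible_inter U.2 V.2 ⟨x, x.2⟩ ⟨y, y.2⟩
    let w : (U ⊓ V : X.Opens) := ⟨z, hz, hz'⟩
    have h1 : divisorRes E (inf_le_left : U ⊓ V ≤ U) s =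
        divisorRes E (inf_le_right : U ⊓ V ≤ V) t := Subtype.ext (funext fun v => by
      change s.1 ⟨v, v.2.1⟩ = t.1 ⟨v, v.2.2⟩
      rw [s.2.const _ x, hst, t.2.const y])
    have h2 := congrArg (fun s => toRat (U ⊓ V) w (a _ s)) h1
    rw [a_res, a_res, toRat_map, toRat_map] at h2
    exact h2
  choose W hW hs using exists_isDivisorSection_nonempty (X := X) hE
  have x₀ : ∀ f, W f := fun f => (hW f).some
  let φ : X.functionField → X.functionField := fun f => toRat (W f) (x₀ f) (a (W f) ⟨_, hs f⟩)
  have φ_eq : ∀ {U : X.Opens} (x : U) (s : divisorSections E U), φ (s.1 x) = toRat U x (a U s) :=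
    fun {U} x s => a_congr _ _ _ _ rfl
  have φ_add : ∀ f g, φ (f + g) = φ f + φ g := by
    intro f g
    obtain ⟨z, hz, hz'⟩ := nonempty_preirreducible_inter (W f).2 (W g).2 ⟨x₀ f, (x₀ f).2⟩
      ⟨x₀ g, (x₀ g).2⟩
    let w : (W f ⊓ W g : X.Opens) := ⟨z, hz, hz'⟩
    let s := divisorRes E (inf_le_left : W f ⊓ W g ≤ W f) ⟨_, hs f⟩
    let t := divisorRes E (inf_le_right : W f ⊓ W g ≤ W g) ⟨_, hs g⟩
    have h1 : φ f = _ := φ_eq w s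
    have h2 : φ g = _ := φ_eq w t
    have h3 : φ (f + g) = _ := φ_eq w (s + t)
    rw [h1, h2, h3, a_add, map_add]
  refine ⟨⟨⟨φ, ?_⟩, φ_add⟩, ?_, ?_, ?_⟩
  · have h1 := φ_add 0 0
    rw [add_zero] at h1
    exact left_eq_add.1 h1
  · intro f g
    change φ (f ^ p ^ e * g) = f * φ g
    obtain ⟨U, hU, r, rfl⟩ := X.presheaf.exists_germ_eq f
    obtain ⟨z, hz, hz'⟩ := nonempty_preirreducible_inter U.2 (W g).2 ⟨_, hU⟩ ⟨x₀ g, (x₀ g).2⟩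
    let w : (U ⊓ W g : X.Opens) := ⟨z, hz, hz'⟩
    let s := divisorRes E (inf_le_right : U ⊓ W g ≤ W g) ⟨_, hs g⟩
    let r' : Γ(X, U ⊓ W g) := X.presheaf.map (homOfLE inf_le_left).op r
    have hr' : toRat _ w r' = X.presheaf.germ U _ hU r := toRat_map _ w r
    have h1 : φ g = _ := φ_eq w s
    have h2 : φ (toRat _ w (r' ^ p ^ e) * g) = _ := φ_eq w (r' ^ p ^ e • s)
    rw [map_pow, hr'] at h2
    rw [h2, h1, a_smul, map_mul, hr']
  · have h1 : φ (toRat (⊤ : X.Opens) ⟨genericPoint X, trivial⟩ 1) = _ :=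
      φ_eq (U := ⊤) ⟨genericPoint X, trivial⟩ (divisorOfSection E hE ⊤ 1)
    rw [a_one, map_one] at h1
    exact h1
  · intro x hx f hf
    obtain ⟨U, hxU, hs⟩ := exists_isDivisorSection hE x hx f hf
    have h1 : φ f = _ := φ_eq ⟨x, hxU⟩ ⟨_, hs⟩
    change φ f ∈ _
    rw [h1]
    exact toRat_mem_stalkRing U ⟨x, hxU⟩ ⟨x, hxU⟩ _

/-- `𝒪_X → F^e_* 𝒪_X(E)` splits if and only if there is a `p ^ e`-inverse linear map on the function
field that sends `1` to `1` and is regular on `𝒪_X(E)` in codimension one. -/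
theorem isSplitMono_iff (hE : 0 ≤ E) :
    IsSplitMono (frobeniusToDivisor p hp e E hE) ↔ ∃ φ, IsSplitting (p ^ e) E φ :=
  ⟨exists_isSplitting_of_isSplitMono hE, fun ⟨_, h⟩ => h.isSplitMono hE⟩

end criterion'

/-! ### Local generators of line bundles and adapted bases of their direct sum -/

section generators
variable {X : Scheme.{u}}

theorem moduleRes_moduleRes (M : X.Modules) {U₁ U₂ U₃ : X.Opens} (h : U₂ ≤ U₁) (h' : U₃ ≤ U₂)
    (x : Γ(M, U₁)) : moduleRes M h' (moduleRes M h x) = moduleRes M (h'.trans h) x :=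
  modules_res_res M h h' x

theorem moduleRes_self (M : X.Modules) {U : X.Opens} (h : U ≤ U) (x : Γ(M, U)) :
    moduleRes M h x = x :=
  modules_res_self M h x

theorem app_moduleRes {M N : X.Modules} (φ : M ⟶ N) {U W : X.Opens} (h : U ≤ W) (x : Γ(M, W)) :
    φ.app U (moduleRes M h x) = moduleRes N h (φ.app W x) :=
  congrArg (fun g => g.hom x) (φ.mapPresheaf.naturality (homOfLE h).op)

/-- A section `g` over `U` that freely generates the module `L` on `U`. -/
def IsGenerator (L : X.Modules) {U : X.Opens} (g : Γ(L, U)) : Prop :=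
  ∀ (W : X.Opens) (h : W ≤ U), Function.Bijective fun a : Γ(X, W) => a • moduleRes L h g

theorem IsGenerator.res {L : X.Modules} {U W : X.Opens} {g : Γ(L, U)} (hg : IsGenerator L g)
    (h : W ≤ U) : IsGenerator L (moduleRes L h g) := by
  intro W' h'
  rw [moduleRes_moduleRes]
  exact hg W' _

theorem IsGenerator.exists_unit {L : X.Modules} {U : X.Opens} {g g' : Γ(L, U)}
    (hg : IsGenerator L g) (hg' : IsGenerator L g') : ∃ v : Γ(X, U)ˣ, g' = (v : Γ(X, U)) • g := by
  obtain ⟨a, ha⟩ := (hg U le_rfl).2 g'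
  obtain ⟨b, hb⟩ := (hg' U le_rfl).2 g
  simp only [moduleRes_self] at ha hb
  have h1 : b * a = 1 := (hg U le_rfl).1 (by
    simp only [moduleRes_self]; rw [mul_smul, ha, hb, one_smul])
  exact ⟨⟨a, b, by rw [mul_comm, h1], h1⟩, ha.symm⟩

theorem exists_isGenerator (L : X.Modules) [h : IsLineBundle L] (x : X) :
    ∃ U : X.Opens, x ∈ U ∧ ∃ g : Γ(L, U), IsGenerator L g := by
  obtain ⟨U, hx, ⟨e⟩⟩ := h.exists_iso_unit x
  -- `Γ(L, U.ι ''ᵁ W) = Γ(U, W)` by the trivialization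
  let a : ∀ W : U.toScheme.Opens, Γ(X, U.ι ''ᵁ W) → Γ(L, U.ι ''ᵁ W) := fun W =>
    (e.inv.val.app (op W)).hom.toFun
  let b : ∀ W : U.toScheme.Opens, Γ(L, U.ι ''ᵁ W) → Γ(X, U.ι ''ᵁ W) := fun W =>
    (e.hom.val.app (op W)).hom.toFun
  have hab : ∀ W s, a W (b W s) = s := fun W s =>
    congrArg (fun g => (g.val.app (op W)).hom s) e.hom_inv_id
  have hba : ∀ W s, b W (a W s) = s := fun W s =>
    congrArg (fun g => (g.val.app (op W)).hom s) e.inv_hom_id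
  have hsm : ∀ (W : U.toScheme.Opens) (r : Γ(X, U.ι ''ᵁ W)) (y : Γ(L, U.ι ''ᵁ W)),
      (U.ι.appIso W).inv (show Γ(U.toScheme, W) from r) • y = r • y := fun W r y => by
    rw [Scheme.Opens.ι_appIso]
    rfl
  have ha : ∀ W r, a W r = r • a W 1 := fun W r => by
    rw [← hsm]
    refine Eq.trans ?_ ((e.inv.val.app (op W)).hom.map_smul r (show Γ(X, U.ι ''ᵁ W) from 1))
    exact congrArg (a W) (mul_one r).symm
  have hres : ∀ W, a W 1 = moduleRes L (Scheme.Hom.image_mono U.ι (le_top : W ≤ ⊤)) (a ⊤ 1) := by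
    intro W
    have h1 := congrArg (fun g => g.hom (1 : Γ(X, U.ι ''ᵁ ⊤)))
      (e.inv.val.naturality (homOfLE (le_top : W ≤ ⊤)).op)
    have h2 : a W (X.presheaf.map (homOfLE (Scheme.Hom.image_mono U.ι (le_top : W ≤ ⊤))).op 1) =
      moduleRes L (Scheme.Hom.image_mono U.ι (le_top : W ≤ ⊤)) (a ⊤ 1) := h1
    rwa [map_one] at h2
  refine ⟨U.ι ''ᵁ ⊤, by simpa using hx, a ⊤ 1, fun W hW => ?_⟩
  obtain ⟨W, rfl⟩ : ∃ W' : U.toScheme.Opens, U.ι ''ᵁ W' = W :=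
    ⟨U.ι ⁻¹ᵁ W, by
      rw [Scheme.Hom.image_preimage_eq_opensRange_inf]
      simpa using hW⟩
  rw [← hres W]
  have h1 : (fun r : Γ(X, U.ι ''ᵁ W) => r • a W 1) = a W := funext fun r => (ha W r).symm
  rw [h1]
  exact ⟨Function.LeftInverse.injective (hba W), Function.RightInverse.surjective (hab W)⟩

end generators

section adapted
variable {X : Scheme.{u}} {r : ℕ} (L : Fin r → X.Modules)

/-- A family of sections `e j` of `⨁ L` over `U`, where `e j` is a generator of the summand `L j`. -/
def IsAdapted {U : X.Opens} (e : Fin r → Γ(⨁ L, U)) : Prop :=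
  ∃ g : ∀ j, Γ(L j, U), (∀ j, IsGenerator (L j) (g j)) ∧ ∀ j, e j = (biproduct.ι L j).app U (g j)

variable {L}

theorem IsAdapted.res {U W : X.Opens} {e : Fin r → Γ(⨁ L, U)} (he : IsAdapted L e) (h : W ≤ U) :
    IsAdapted L fun j => moduleRes (⨁ L) h (e j) := by
  obtain ⟨g, hg, e1⟩ := he
  refine ⟨fun j => moduleRes (L j) h (g j), fun j => (hg j).res h, fun j => ?_⟩
  dsimp only
  rw [e1, app_moduleRes]

theorem IsAdapted.exists_unit {U : X.Opens} {e e' : Fin r → Γ(⨁ L, U)} (he : IsAdapted L e)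
    (he' : IsAdapted L e') : ∃ v : Fin r → Γ(X, U)ˣ, ∀ j, e' j = (v j : Γ(X, U)) • e j := by
  obtain ⟨g, hg, e1⟩ := he
  obtain ⟨g', hg', e1'⟩ := he'
  choose v hv using fun j => (hg j).exists_unit (hg' j)
  refine ⟨v, fun j => ?_⟩
  rw [e1, e1', hv, Scheme.Modules.Hom.app_smul]

theorem sum_app {M N : X.Modules} {ι : Type*} (s : Finset ι) (φ : ι → (M ⟶ N)) (U : X.Opens)
    (x : Γ(M, U)) : (∑ i ∈ s, φ i).app U x = ∑ i ∈ s, (φ i).app U x := by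
  classical
  induction s using Finset.induction_on with
  | empty => rw [Finset.sum_empty, Finset.sum_empty]; rfl
  | insert a s ha ih =>
    rw [Finset.sum_insert ha, Finset.sum_insert ha, ← ih]; rfl

theorem biproduct_ι_app_π_app (j l : Fin r) (U : X.Opens) (x : Γ(L j, U)) :
    (biproduct.π L l).app U ((biproduct.ι L j).app U x) =
      if h : j = l then h ▸ x else 0 := by
  have h1 : (biproduct.π L l).app U ((biproduct.ι L j).app U x) =
    (biproduct.ι L j ≫ biproduct.π L l).app U x := rfl
  rw [h1]
  split_ifs with h
  · subst h; rw [biproduct.ι_π_self]; rfl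
  · rw [biproduct.ι_π_ne L h]; rfl

theorem IsAdapted.linearIndependent {U : X.Opens} {e : Fin r → Γ(⨁ L, U)} (he : IsAdapted L e) :
    LinearIndependent Γ(X, U) e := by
  obtain ⟨g, hg, e1⟩ := he
  refine Fintype.linearIndependent_iff.2 fun a ha l => ?_
  have h1 := congrArg ((biproduct.π L l).app U) ha
  rw [map_sum, map_zero, Finset.sum_eq_single l] at h1
  · rw [Scheme.Modules.Hom.app_smul, e1, biproduct_ι_app_π_app, dif_pos rfl] at h1
    refine (hg l U le_rfl).1 ?_
    simp only [moduleRes_self]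
    rw [zero_smul]
    exact h1
  · intro j _ hj
    rw [Scheme.Modules.Hom.app_smul, e1, biproduct_ι_app_π_app, dif_neg hj, smul_zero]
  · intro h; exact (h (Finset.mem_univ l)).elim

theorem IsAdapted.span_eq_top {U : X.Opens} {e : Fin r → Γ(⨁ L, U)} (he : IsAdapted L e) :
    Submodule.span Γ(X, U) (Set.range e) = ⊤ := by
  obtain ⟨g, hg, e1⟩ := he
  refine eq_top_iff.2 fun m _ => ?_
  have h1 : m = ∑ j, (biproduct.ι L j).app U ((biproduct.π L j).app U m) := by
    have h2 := sum_app Finset.univ (fun j => biproduct.π L j ≫ biproduct.ι L j) U m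
    rw [biproduct.total] at h2
    exact h2
  rw [h1]
  refine Submodule.sum_mem _ fun j _ => ?_
  obtain ⟨a, ha⟩ := (hg j U le_rfl).2 ((biproduct.π L j).app U m)
  simp only [moduleRes_self] at ha
  rw [← ha, Scheme.Modules.Hom.app_smul, ← e1]
  exact Submodule.smul_mem _ _ (Submodule.subset_span ⟨j, rfl⟩)

/-- An adapted family is a basis of the module of sections. -/
noncomputable def IsAdapted.basis {U : X.Opens} {e : Fin r → Γ(⨁ L, U)} (he : IsAdapted L e) :
    Module.Basis (Fin r) Γ(X, U) Γ(⨁ L, U) :=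
  Module.Basis.mk he.linearIndependent he.span_eq_top.ge

theorem IsAdapted.basis_apply {U : X.Opens} {e : Fin r → Γ(⨁ L, U)} (he : IsAdapted L e)
    (j : Fin r) : he.basis j = e j :=
  Module.Basis.mk_apply _ _ j

theorem exists_isAdapted [∀ i, IsLineBundle (L i)] (x : X) :
    ∃ U : X.Opens, IsAffineOpen U ∧ x ∈ U ∧ ∃ e : Fin r → Γ(⨁ L, U), IsAdapted L e := by
  choose U hU g hg using fun j => exists_isGenerator (L j) x
  have hx : x ∈ Finset.univ.inf U := by
    rw [← SetLike.mem_coe, Opens.coe_finset_inf]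
    simpa using hU
  obtain ⟨_, ⟨W, hW, rfl⟩, hxW, hWU⟩ :=
    X.isBasis_affineOpens.exists_subset_of_mem_open hx (Finset.univ.inf U).2
  have h : ∀ j, W ≤ U j := fun j => le_trans hWU (Finset.inf_le (Finset.mem_univ j))
  exact ⟨W, hW, hxW, fun j => (biproduct.ι L j).app W (moduleRes (L j) (h j) (g j)), _,
    fun j => (hg j).res (h j), fun j => rfl⟩

end adapted

/-! ### Affine charts of the projective bundle -/

section specSection
variable {P : Scheme.{u}} {R : CommRingCat.{u}} (c : Spec R ⟶ P) [IsOpenImmersion c]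

/-- The functions on the image of an open immersion `Spec R ⟶ P`. -/
noncomputable def specSection : R ≃+* Γ(P, c ''ᵁ ⊤) :=
  ((Scheme.ΓSpecIso R).symm ≪≫ (c.appIso ⊤).symm).commRingCatIsoToRingEquiv

theorem appLE_specSection (a : R) :
    c.appLE (c ''ᵁ ⊤) ⊤ (c.preimage_image_eq ⊤).ge (specSection c a) =
      (Scheme.ΓSpecIso R).inv a := by
  have h1 : (c.appIso ⊤).hom (specSection c a) = (Scheme.ΓSpecIso R).inv a := by
    change (c.appIso ⊤).hom ((c.appIso ⊤).inv _) = _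
    rw [← ConcreteCategory.comp_apply, Iso.inv_hom_id]
    rfl
  rwa [Scheme.Hom.appIso_hom'] at h1

theorem appLE_injective {s t : Γ(P, c ''ᵁ ⊤)}
    (h : c.appLE (c ''ᵁ ⊤) ⊤ (c.preimage_image_eq ⊤).ge s =
      c.appLE (c ''ᵁ ⊤) ⊤ (c.preimage_image_eq ⊤).ge t) : s = t := by
  rw [← Scheme.Hom.appIso_hom'] at h
  exact (c.appIso ⊤).commRingCatIsoToRingEquiv.injective h

theorem map_specSection {R' : CommRingCat.{u}} {c' : Spec R' ⟶ P} [IsOpenImmersion c'] {ψ : R ⟶ R'}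
    (h : c' = Spec.map ψ ≫ c) (le : c' ''ᵁ ⊤ ≤ c ''ᵁ ⊤) (a : R) :
    P.presheaf.map (homOfLE le).op (specSection c a) = specSection c' (ψ a) := by
  apply appLE_injective c'
  rw [appLE_specSection, ← ConcreteCategory.comp_apply, Scheme.Hom.map_appLE]
  have h1 : c'.appLE (c ''ᵁ ⊤) ⊤ ((c'.preimage_image_eq ⊤).ge.trans (c'.preimage_mono le)) =
      c.appLE (c ''ᵁ ⊤) ⊤ (c.preimage_image_eq ⊤).ge ≫ (Spec.map ψ).appLE ⊤ ⊤
        (show (⊤ : (Spec R').Opens) ≤ Spec.map ψ ⁻¹ᵁ ⊤ from le_rfl) := by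
    rw [Scheme.Hom.appLE_comp_appLE]
    subst h
    rfl
  refine (congrArg (fun g => g.hom (specSection c a)) h1).trans ?_
  change (Spec.map ψ).appLE ⊤ ⊤ (show (⊤ : (Spec R').Opens) ≤ Spec.map ψ ⁻¹ᵁ ⊤ from le_rfl)
    (c.appLE (c ''ᵁ ⊤) ⊤ (c.preimage_image_eq ⊤).ge (specSection c a)) = _
  rw [appLE_specSection]
  have h2 := congrArg (fun g => g.hom a) (Scheme.ΓSpecIso_inv_naturality ψ)
  refine Eq.trans ?_ h2.symm
  change _ = (Spec.map ψ).appTop _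
  rw [Scheme.Hom.appTop, ← Scheme.Hom.appLE_eq_app]
  rfl

variable {c} in
theorem image_le_image {R' : CommRingCat.{u}} {c' : Spec R' ⟶ P} [IsOpenImmersion c'] {ψ : R ⟶ R'}
    (h : c' = Spec.map ψ ≫ c) : c' ''ᵁ ⊤ ≤ c ''ᵁ ⊤ := by
  rintro _ ⟨y, -, rfl⟩
  subst h
  exact ⟨Spec.map ψ y, trivial, rfl⟩

theorem appLE_eq_specSection {X : Scheme.{u}} {π : P ⟶ X} {U : X.Opens} (hU : IsAffineOpen U)
    {φ : Γ(X, U) ⟶ R} (h : c ≫ π = Spec.map φ ≫ hU.fromSpec) (le : c ''ᵁ ⊤ ≤ π ⁻¹ᵁ U)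
    (a : Γ(X, U)) : π.appLE U (c ''ᵁ ⊤) le a = specSection c (φ a) := by
  apply appLE_injective c
  rw [appLE_specSection, ← ConcreteCategory.comp_apply, Scheme.Hom.appLE_comp_appLE]
  have le2 : (⊤ : (Spec Γ(X, U)).Opens) ≤ hU.fromSpec ⁻¹ᵁ U := by
    rw [hU.fromSpec_preimage_self]
  have le3 : (⊤ : (Spec R).Opens) ≤ (c ≫ π) ⁻¹ᵁ U :=
    (c.preimage_image_eq ⊤).ge.trans (c.preimage_mono le)
  have h1 : (c ≫ π).appLE U ⊤ le3 = hU.fromSpec.appLE U ⊤ le2 ≫ (Spec.map φ).appLE ⊤ ⊤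
      (show (⊤ : (Spec R).Opens) ≤ Spec.map φ ⁻¹ᵁ ⊤ from le_rfl) := by
    rw [Scheme.Hom.appLE_comp_appLE]
    congr 1
  refine (congrArg (fun g => g.hom a) h1).trans ?_
  have h3 : hU.fromSpec.appLE U ⊤ le2 = (Scheme.ΓSpecIso Γ(X, U)).inv := by
    rw [Scheme.Hom.appLE, hU.fromSpec_app_self, Category.assoc, ← Functor.map_comp]
    exact (congrArg _ ((Spec Γ(X, U)).presheaf.map_id _)).trans (Category.comp_id _)
  rw [h3]
  have h2 := congrArg (fun g => g.hom a) (Scheme.ΓSpecIso_inv_naturality φ)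
  refine Eq.trans ?_ h2.symm
  change _ = (Spec.map φ).appTop _
  rw [Scheme.Hom.appTop, ← Scheme.Hom.appLE_eq_app]
  rfl

end specSection

section degOneFrac
open HomogeneousLocalization
variable {R S : Type*} [CommRing R] [CommRing S] [Algebra R S] (𝒜 : ℕ → Submodule R S)
  [GradedAlgebra 𝒜]

/-- The fraction `g / f` of two elements of degree one. -/
def degOneFrac {f g : S} (hf : f ∈ 𝒜 1) (hg : g ∈ 𝒜 1) : Away 𝒜 f :=
  Away.mk 𝒜 hf 1 g (by rwa [one_smul])

/-- An element of the base ring as an element of a homogeneous localization. -/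
def scalarAway (f : S) : R →+* Away 𝒜 f :=
  (fromZeroRingHom 𝒜 (.powers f)).comp (algebraMap R (𝒜 0))

variable {𝒜}

theorem map_degOneFrac {R' S' : Type*} [CommRing R'] [CommRing S'] [Algebra R' S']
    {ℬ : ℕ → Submodule R' S'} [GradedAlgebra ℬ] (φ : 𝒜 →+*ᵍ ℬ) {f g : S} (hf : f ∈ 𝒜 1)
    (hg : g ∈ 𝒜 1) : Away.map φ f (degOneFrac 𝒜 hf hg) =
      degOneFrac ℬ (Graded.map_mem φ hf) (Graded.map_mem φ hg) := by
  rw [degOneFrac, Away.map_mk]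
  rfl

theorem degOneFrac_self {f : S} (hf : f ∈ 𝒜 1) : degOneFrac 𝒜 hf hf = 1 := by
  apply val_injective
  rw [degOneFrac, Away.val_mk, val_one, Localization.mk_eq_mk', IsLocalization.mk'_eq_iff_eq_mul]
  simp

theorem degOneFrac_smul {f g : S} (hf : f ∈ 𝒜 1) (hg : g ∈ 𝒜 1) (a : R) :
    degOneFrac 𝒜 hf (Submodule.smul_mem _ a hg) = scalarAway 𝒜 f a * degOneFrac 𝒜 hf hg := by
  apply val_injective
  rw [val_mul]
  change _ = Localization.mk (algebraMap R S a) 1 * _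
  rw [degOneFrac, degOneFrac, Away.val_mk, Away.val_mk, Localization.mk_mul, one_mul,
    Algebra.smul_def]

theorem awayMap_degOneFrac_mul {f g l : S} (hf : f ∈ 𝒜 1) (hg : g ∈ 𝒜 1) (hl : l ∈ 𝒜 1) :
    awayMap 𝒜 hg (rfl : f * g = f * g) (degOneFrac 𝒜 hf hg) *
      awayMap 𝒜 hf (mul_comm f g) (degOneFrac 𝒜 hg hl) =
    awayMap 𝒜 hg (rfl : f * g = f * g) (degOneFrac 𝒜 hf hl) := by
  apply val_injective
  rw [val_mul, degOneFrac, degOneFrac, degOneFrac, awayMap_mk, awayMap_mk, awayMap_mk,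
    Away.val_mk, Away.val_mk, Away.val_mk, Localization.mk_mul, Localization.mk_eq_mk_iff,
    Localization.r_iff_exists]
  refine ⟨1, ?_⟩
  simp only [Submonoid.coe_mul, OneMemClass.coe_one]
  ring

end degOneFrac

section bundleChart
open HomogeneousLocalization Scheme.AffineZariskiSite
variable {X : Scheme.{u}} (V : X.Modules) [V.IsQuasicoherent]

/-- The open immersion `Proj (Sym Γ(U, V)) ⟶ ℙ(V)`. -/
noncomputable def bundleι (U : X.AffineZariskiSite) :
    Proj (symSections V U.1) ⟶ projectiveBundle V :=
  (projSymGluingData V).cover.f U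

instance (U : X.AffineZariskiSite) : IsOpenImmersion (bundleι V U) :=
  (projSymGluingData V).cover.map_prop U

theorem bundleι_π (U : X.AffineZariskiSite) : bundleι V U ≫ projectiveBundle.π V =
    projToSpec (symSections V U.1) ≫ U.2.fromSpec :=
  ((projSymGluingData V).ι_toBase U).trans (Category.assoc _ _ _)

theorem opensRange_bundleι (U : X.AffineZariskiSite) :
    (bundleι V U).opensRange = projectiveBundle.π V ⁻¹ᵁ U.1 := by
  have h := (projSymGluingData V).toBase_preimage_eq_opensRange_ι U
  refine h.symm.trans ?_
  congr 1
  exact U.1.opensRange_ι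

theorem map_bundleι {W U : X.AffineZariskiSite} (i : W ⟶ U) :
    Proj.map (symRes V (toOpens_mono i.le)) (irrelevant_le_symRes V i) ≫ bundleι V U =
      bundleι V W :=
  (projSymGluingData V).cover.trans_map i

/-- The affine chart `D₊(f)` of the projective bundle over the affine open set `U`. -/
noncomputable def bundleChart (U : X.AffineZariskiSite) {d : ℕ}
    {f : SymmetricAlgebra Γ(X, U.1) Γ(V, U.1)} (hf : f ∈ symSections V U.1 d) (hd : 0 < d) :
    Spec (.of (Away (symSections V U.1) f)) ⟶ projectiveBundle V :=
  Proj.awayι (symSections V U.1) f hf hd ≫ bundleι V U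

variable {U : X.AffineZariskiSite} {d d' : ℕ} {f g : SymmetricAlgebra Γ(X, U.1) Γ(V, U.1)}
  (hf : f ∈ symSections V U.1 d) (hd : 0 < d) (hg : g ∈ symSections V U.1 d') (hd' : 0 < d')

instance : IsOpenImmersion (bundleChart V U hf hd) :=
  inferInstanceAs (IsOpenImmersion (_ ≫ _))

theorem bundleChart_π : bundleChart V U hf hd ≫ projectiveBundle.π V =
    Spec.map (CommRingCat.ofHom (scalarAway (symSections V U.1) f)) ≫ U.2.fromSpec := by
  rw [bundleChart, Category.assoc, bundleι_π, ← Category.assoc, awayι_projToSpec]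
  rfl

theorem bundleChart_res {W : X.AffineZariskiSite} (i : W ⟶ U) :
    bundleChart V W (Graded.map_mem (symRes V (toOpens_mono i.le)) hf) hd =
      Spec.map (CommRingCat.ofHom (Away.map (symRes V (toOpens_mono i.le)) f)) ≫
        bundleChart V U hf hd := by
  have h := Proj.awayι_comp_map (symRes V (toOpens_mono i.le)) (irrelevant_le_symRes V i) hd f hf
  refine (congrArg (_ ≫ ·) (map_bundleι V i).symm).trans ?_
  refine (Category.assoc _ _ _).symm.trans ((congrArg (· ≫ bundleι V U) h).trans ?_)
  exact Category.assoc _ _ _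

theorem SpecMap_awayMap_awayι_of_eq {A B : Type u} [CommRing A] [CommRing B] [Algebra A B]
    {𝒜 : ℕ → Submodule A B} [GradedAlgebra 𝒜] {f g h : B} {m m' n : ℕ} (hf : f ∈ 𝒜 m)
    (hm : 0 < m) (hg : g ∈ 𝒜 m') (hh : h ∈ 𝒜 n) (hn : 0 < n) (e : h = f * g) (en : n = m + m') :
    Proj.awayι 𝒜 h hh hn =
      Spec.map (CommRingCat.ofHom (awayMap 𝒜 hg e)) ≫ Proj.awayι 𝒜 f hf hm := by
  subst en
  exact (Proj.SpecMap_awayMap_awayι 𝒜 hf hm hg e).symm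

theorem bundleChart_mul {h : SymmetricAlgebra Γ(X, U.1) Γ(V, U.1)} {n : ℕ}
    (hh : h ∈ symSections V U.1 n) (hn : 0 < n) (e : h = f * g) (en : n = d + d') :
    bundleChart V U hh hn =
      Spec.map (CommRingCat.ofHom (awayMap (symSections V U.1) hg e)) ≫
        bundleChart V U hf hd :=
  (congrArg (· ≫ bundleι V U) (SpecMap_awayMap_awayι_of_eq hf hd hg hh hn e en)).trans
    (Category.assoc _ _ _)

theorem bundleChart_image : bundleChart V U hf hd ''ᵁ ⊤ =
    bundleι V U ''ᵁ Proj.basicOpen (symSections V U.1) f :=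
  (Scheme.Hom.comp_image (Proj.awayι (symSections V U.1) f hf hd) (bundleι V U) ⊤).trans
    (congrArg (bundleι V U ''ᵁ ·) ((Scheme.Hom.image_top_eq_opensRange _).trans
      (Proj.opensRange_awayι (symSections V U.1) f hf hd)))

theorem image_inf {P Q : Scheme.{u}} (j : Q ⟶ P) [IsOpenImmersion j] (A B : Q.Opens) :
    j ''ᵁ (A ⊓ B) = j ''ᵁ A ⊓ j ''ᵁ B := by
  ext x
  constructor
  · rintro ⟨y, ⟨h1, h2⟩, rfl⟩
    exact ⟨⟨y, h1, rfl⟩, ⟨y, h2, rfl⟩⟩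
  · rintro ⟨⟨y, h1, rfl⟩, ⟨z, h2, e⟩⟩
    obtain rfl := j.injective e
    exact ⟨_, ⟨h1, h2⟩, rfl⟩

theorem bundleChart_mul_image {h : SymmetricAlgebra Γ(X, U.1) Γ(V, U.1)} {n : ℕ}
    (hh : h ∈ symSections V U.1 n) (hn : 0 < n) (e : h = f * g) :
    bundleChart V U hh hn ''ᵁ ⊤ = bundleChart V U hf hd ''ᵁ ⊤ ⊓ bundleChart V U hg hd' ''ᵁ ⊤ := by
  subst e
  refine (bundleChart_image V hh hn).trans (Eq.trans ?_ (congrArg₂ (· ⊓ ·)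
    (bundleChart_image V hf hd) (bundleChart_image V hg hd')).symm)
  exact (congrArg (bundleι V U ''ᵁ ·) (Proj.basicOpen_mul (symSections V U.1) f g)).trans
    (image_inf _ _ _)

theorem bundleChart_image_le : bundleChart V U hf hd ''ᵁ ⊤ ≤ projectiveBundle.π V ⁻¹ᵁ U.1 := by
  refine (bundleChart_image V hf hd).le.trans ?_
  rw [← opensRange_bundleι]
  exact (bundleι V U).image_le_opensRange _

theorem isAffineOpen_bundleChart : IsAffineOpen (bundleChart V U hf hd ''ᵁ ⊤) := by
  rw [Scheme.Hom.image_top_eq_opensRange]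
  exact isAffineOpen_opensRange _

theorem exists_mem_bundleChart {ι : Type*} (b : Module.Basis ι Γ(X, U.1) Γ(V, U.1))
    {z : projectiveBundle V} (hz : z ∈ projectiveBundle.π V ⁻¹ᵁ U.1) :
    ∃ i, z ∈ bundleChart V U (ι_mem_symPart _ _ (b i)) one_pos ''ᵁ ⊤ := by
  rw [← opensRange_bundleι] at hz
  obtain ⟨y, rfl⟩ := hz
  have h1 := Proj.iSup_basicOpen_eq_top (symSections V U.1)
    (fun i => SymmetricAlgebra.ι Γ(X, U.1) Γ(V, U.1) (b i)) (by
      refine (HomogeneousIdeal.toIdeal_irrelevant_le _).2 fun n hn s hs => ?_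
      obtain ⟨n, rfl⟩ : ∃ m, n = m + 1 := ⟨n - 1, by omega⟩
      rw [symSections, symPart, pow_succ] at hs
      have hι : ∀ m, SymmetricAlgebra.ι Γ(X, U.1) Γ(V, U.1) m ∈ Ideal.span (Set.range fun i =>
          SymmetricAlgebra.ι Γ(X, U.1) Γ(V, U.1) (b i)) := fun m => by
        have hm : m ∈ Submodule.span Γ(X, U.1) (Set.range b) := by rw [b.span_eq]; trivial
        induction hm using Submodule.span_induction with
        | mem m hm => obtain ⟨j, rfl⟩ := hm; exact Ideal.subset_span ⟨j, rfl⟩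
        | zero => rw [map_zero]; exact zero_mem _
        | add m n _ _ hm hn => rw [map_add]; exact add_mem hm hn
        | smul a m _ hm => rw [map_smul, Algebra.smul_def]; exact Ideal.mul_mem_left _ _ hm
      refine Submodule.mul_induction_on hs (fun a _ c hc => ?_) fun a c ha hc => add_mem ha hc
      obtain ⟨m, rfl⟩ := hc
      exact Ideal.mul_mem_left _ _ (hι m))
  have h2 : y ∈ ⨆ i, Proj.basicOpen (symSections V U.1)
      (SymmetricAlgebra.ι Γ(X, U.1) Γ(V, U.1) (b i)) := by rw [h1]; trivial
  obtain ⟨i, hi⟩ := Opens.mem_iSup.1 h2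
  exact ⟨i, (bundleChart_image V (ι_mem_symPart _ _ (b i)) one_pos).ge ⟨y, hi, rfl⟩⟩

/-- The quotient `g / f` of two forms of degree one as a function on the chart `D₊(f)`. -/
noncomputable def bundleFrac {f g : SymmetricAlgebra Γ(X, U.1) Γ(V, U.1)}
    (hf : f ∈ symSections V U.1 1) (hg : g ∈ symSections V U.1 1) :
    Γ(projectiveBundle V, bundleChart V U hf one_pos ''ᵁ ⊤) :=
  specSection (bundleChart V U hf one_pos) (degOneFrac _ hf hg)

theorem bundleChart_image_res_le {W : X.AffineZariskiSite} (i : W ⟶ U) :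
    bundleChart V W (Graded.map_mem (symRes V (toOpens_mono i.le)) hf) hd ''ᵁ ⊤ ≤
      bundleChart V U hf hd ''ᵁ ⊤ := by
  exact image_le_image (bundleChart_res V hf hd i)

theorem map_bundleFrac {f g : SymmetricAlgebra Γ(X, U.1) Γ(V, U.1)}
    (hf : f ∈ symSections V U.1 1) (hg : g ∈ symSections V U.1 1) {W : X.AffineZariskiSite}
    (i : W ⟶ U) :
    (projectiveBundle V).presheaf.map (homOfLE (bundleChart_image_res_le V hf one_pos i)).op
      (bundleFrac V hf hg) =
    bundleFrac V (Graded.map_mem (symRes V (toOpens_mono i.le)) hf)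
      (Graded.map_mem (symRes V (toOpens_mono i.le)) hg) :=
  (map_specSection _ (bundleChart_res V hf one_pos i) _ _).trans
    (congrArg (specSection _) (map_degOneFrac (symRes V (toOpens_mono i.le)) hf hg))

theorem bundleFrac_mul {f g l : SymmetricAlgebra Γ(X, U.1) Γ(V, U.1)}
    (hf : f ∈ symSections V U.1 1) (hg : g ∈ symSections V U.1 1) (hl : l ∈ symSections V U.1 1)
    {z : projectiveBundle V} (h1 : z ∈ bundleChart V U hf one_pos ''ᵁ ⊤)
    (h2 : z ∈ bundleChart V U hg one_pos ''ᵁ ⊤) :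
    (projectiveBundle V).presheaf.germ _ z h1 (bundleFrac V hf hg) *
      (projectiveBundle V).presheaf.germ _ z h2 (bundleFrac V hg hl) =
    (projectiveBundle V).presheaf.germ _ z h1 (bundleFrac V hf hl) := by
  have h2' : 0 < 1 + 1 := by norm_num
  have h3 : z ∈ bundleChart V U (SetLike.mul_mem_graded hf hg) h2' ''ᵁ ⊤ :=
    (bundleChart_mul_image V hf one_pos hg one_pos (SetLike.mul_mem_graded hf hg) h2' rfl).ge
      ⟨h1, h2⟩
  have c1 := bundleChart_mul V hf one_pos hg (SetLike.mul_mem_graded hf hg) h2' rfl rfl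
  have c2 := bundleChart_mul V hg one_pos hf (SetLike.mul_mem_graded hf hg) h2' (mul_comm f g) rfl
  have e1 := map_specSection _ c1 (image_le_image c1)
  have e2 := map_specSection _ c2 (image_le_image c2)
  have g1 := fun a => (congrArg ((projectiveBundle V).presheaf.germ _ z h3) (e1 a).symm).trans
    ((projectiveBundle V).presheaf.germ_res_apply (homOfLE _) z h3 _)
  have g2 := fun a => (congrArg ((projectiveBundle V).presheaf.germ _ z h3) (e2 a).symm).trans
    ((projectiveBundle V).presheaf.germ_res_apply (homOfLE _) z h3 _)
  refine (congrArg₂ (· * ·) (g1 _).symm (g2 _).symm).trans (Eq.trans ?_ (g1 _))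
  refine (map_mul ((projectiveBundle V).presheaf.germ _ z h3).hom _ _).symm.trans (congrArg _ ?_)
  refine (map_mul (specSection _) _ _).symm.trans (congrArg _ ?_)
  exact awayMap_degOneFrac_mul hf hg hl

end bundleChart

open Scheme.AffineZariskiSite in
theorem symRes_ι {X : Scheme.{u}} (V : X.Modules) {U W : X.AffineZariskiSite} (i : W ⟶ U)
    (m : Γ(V, U.1)) : symRes V (toOpens_mono i.le) (SymmetricAlgebra.ι _ _ m) =
      SymmetricAlgebra.ι _ _ (moduleRes V (toOpens_mono i.le) m) :=
  symMapHom_ι _ _ m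

section charts
open Scheme.AffineZariskiSite
variable {X : Scheme.{u}} (V : X.Modules) [V.IsQuasicoherent] (U : X.AffineZariskiSite)

/-- The open set of the projective bundle over the affine open `U` where the section `m` of `V`
does not vanish. -/
noncomputable def chartOpen (m : Γ(V, U.1)) : (projectiveBundle V).Opens :=
  bundleChart V U (ι_mem_symPart _ _ m) one_pos ''ᵁ ⊤

/-- The quotient `m' / m` of two sections of `V`, as a function where `m` does not vanish. -/
noncomputable def chartFrac (m m' : Γ(V, U.1)) : Γ(projectiveBundle V, chartOpen V U m) :=
  bundleFrac V (ι_mem_symPart _ _ m) (ι_mem_symPart _ _ m')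

variable {U}

theorem chartOpen_le (m : Γ(V, U.1)) : chartOpen V U m ≤ projectiveBundle.π V ⁻¹ᵁ U.1 :=
  bundleChart_image_le V (ι_mem_symPart _ _ m) one_pos

theorem isAffineOpen_chartOpen (m : Γ(V, U.1)) : IsAffineOpen (chartOpen V U m) :=
  isAffineOpen_bundleChart V (ι_mem_symPart _ _ m) one_pos

theorem chartFrac_self (m : Γ(V, U.1)) : chartFrac V U m m = 1 :=
  (congrArg (specSection _) (degOneFrac_self (ι_mem_symPart _ _ m))).trans
    (map_one (specSection _))

theorem chartFrac_mul {m m' m'' : Γ(V, U.1)} {z : projectiveBundle V} (h : z ∈ chartOpen V U m)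
    (h' : z ∈ chartOpen V U m') :
    (projectiveBundle V).presheaf.germ _ z h (chartFrac V U m m') *
      (projectiveBundle V).presheaf.germ _ z h' (chartFrac V U m' m'') =
    (projectiveBundle V).presheaf.germ _ z h (chartFrac V U m m'') :=
  bundleFrac_mul V (ι_mem_symPart _ _ m) (ι_mem_symPart _ _ m') (ι_mem_symPart _ _ m'') h h'

theorem appLE_chartOpen (m : Γ(V, U.1)) (a : Γ(X, U.1)) :
    (projectiveBundle.π V).appLE U.1 (chartOpen V U m) (chartOpen_le V m) a =
      specSection (bundleChart V U (ι_mem_symPart _ _ m) one_pos)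
        (scalarAway (symSections V U.1) _ a) :=
  appLE_eq_specSection _ U.2 (bundleChart_π V (ι_mem_symPart _ _ m) one_pos) _ a

theorem bundleFrac_congr {f g g' : SymmetricAlgebra Γ(X, U.1) Γ(V, U.1)}
    (hf : f ∈ symSections V U.1 1) (hg : g ∈ symSections V U.1 1) (hg' : g' ∈ symSections V U.1 1)
    (e : g = g') : bundleFrac V hf hg = bundleFrac V hf hg' := by
  subst e
  rfl

theorem chartFrac_smul (m m' : Γ(V, U.1)) (a : Γ(X, U.1)) :
    chartFrac V U m (a • m') =
      (projectiveBundle.π V).appLE U.1 (chartOpen V U m) (chartOpen_le V m) a *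
        chartFrac V U m m' := by
  rw [appLE_chartOpen]
  refine (bundleFrac_congr V _ _ (Submodule.smul_mem _ a (ι_mem_symPart _ _ m'))
    (map_smul _ _ _)).trans ?_
  exact (congrArg (specSection _) (degOneFrac_smul _ (ι_mem_symPart _ _ m') a)).trans
    (map_mul (specSection _) _ _)

theorem chartOpen_eq_image (m : Γ(V, U.1)) : chartOpen V U m =
    bundleι V U ''ᵁ Proj.basicOpen (symSections V U.1) (SymmetricAlgebra.ι _ _ m) :=
  bundleChart_image V (ι_mem_symPart _ _ m) one_pos

theorem chartOpen_smul_le (m : Γ(V, U.1)) (a : Γ(X, U.1)) :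
    chartOpen V U (a • m) ≤ chartOpen V U m := by
  rw [chartOpen_eq_image, chartOpen_eq_image]
  refine Scheme.Hom.image_mono _ (Proj.basicOpen_mono _ _ _ ?_)
  rw [map_smul, Algebra.smul_def]
  exact Dvd.intro_left _ rfl

theorem chartOpen_unit_smul (m : Γ(V, U.1)) (a : Γ(X, U.1)ˣ) :
    chartOpen V U ((a : Γ(X, U.1)) • m) = chartOpen V U m := by
  refine le_antisymm (chartOpen_smul_le V m _) ?_
  have h := chartOpen_smul_le V ((a : Γ(X, U.1)) • m) (↑a⁻¹ : Γ(X, U.1))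
  rwa [smul_smul, Units.inv_mul, one_smul] at h

theorem chartOpen_res {W : X.AffineZariskiSite} (i : W ⟶ U) (m : Γ(V, U.1)) :
    chartOpen V W (moduleRes V (toOpens_mono i.le) m) =
      chartOpen V U m ⊓ projectiveBundle.π V ⁻¹ᵁ W.1 := by
  have h1 := Proj.map_preimage_basicOpen (symRes V (toOpens_mono i.le))
    (irrelevant_le_symRes V i) (SymmetricAlgebra.ι _ _ m)
  have h1' : Proj.map (symRes V (toOpens_mono i.le)) (irrelevant_le_symRes V i) ⁻¹ᵁ
      Proj.basicOpen (symSections V U.1) (SymmetricAlgebra.ι _ _ m) =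
      Proj.basicOpen (symSections V W.1)
        (SymmetricAlgebra.ι _ _ (moduleRes V (toOpens_mono i.le) m)) :=
    h1.trans (congrArg (Proj.basicOpen (symSections V W.1)) (symRes_ι V i m))
  have hpt : ∀ y, bundleι V W y = bundleι V U
      (Proj.map (symRes V (toOpens_mono i.le)) (irrelevant_le_symRes V i) y) := fun y =>
    (congrArg (fun g => g.base y) (map_bundleι V i)).symm
  refine le_antisymm (le_inf ?_ (chartOpen_le V _)) ?_
  · rw [chartOpen_eq_image, chartOpen_eq_image, ← h1']
    rintro _ ⟨y, hy, rfl⟩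
    exact ⟨_, hy, (hpt y).symm⟩
  · rintro z ⟨hz, hz'⟩
    have hz2 : z ∈ (bundleι V W).opensRange := by rw [opensRange_bundleι]; exact hz'
    obtain ⟨y, rfl⟩ := hz2
    rw [chartOpen_eq_image, ← h1']
    refine ⟨y, ?_, rfl⟩
    have hz3 : bundleι V W y ∈ chartOpen V U m := hz
    rw [chartOpen_eq_image] at hz3
    obtain ⟨w, hw, e⟩ := hz3
    have e' : w = _ := (bundleι V U).injective (e.trans (hpt y))
    have hw' : Proj.map (symRes V (toOpens_mono i.le)) (irrelevant_le_symRes V i) y ∈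
        (Proj.basicOpen (symSections V U.1) (SymmetricAlgebra.ι _ _ m) : Set _) := by
      rwa [← e']
    exact hw'

theorem germ_bundleFrac_congr {f f' g g' : SymmetricAlgebra Γ(X, U.1) Γ(V, U.1)}
    (hf : f ∈ symSections V U.1 1) (hf' : f' ∈ symSections V U.1 1) (hg : g ∈ symSections V U.1 1)
    (hg' : g' ∈ symSections V U.1 1) (e : f = f') (e' : g = g') {z : projectiveBundle V}
    (hz : z ∈ bundleChart V U hf one_pos ''ᵁ ⊤) (hz' : z ∈ bundleChart V U hf' one_pos ''ᵁ ⊤) :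
    (projectiveBundle V).presheaf.germ _ z hz (bundleFrac V hf hg) =
      (projectiveBundle V).presheaf.germ _ z hz' (bundleFrac V hf' hg') := by
  subst e e'
  rfl

theorem germ_chartFrac_res {W : X.AffineZariskiSite} (i : W ⟶ U) (m m' : Γ(V, U.1))
    {z : projectiveBundle V} (h : z ∈ chartOpen V U m)
    (h' : z ∈ chartOpen V W (moduleRes V (toOpens_mono i.le) m)) :
    (projectiveBundle V).presheaf.germ _ z h' (chartFrac V W (moduleRes V (toOpens_mono i.le) m)
      (moduleRes V (toOpens_mono i.le) m')) =
    (projectiveBundle V).presheaf.germ _ z h (chartFrac V U m m') := by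
  have hf := ι_mem_symPart Γ(X, U.1) Γ(V, U.1) m
  have hg := ι_mem_symPart Γ(X, U.1) Γ(V, U.1) m'
  have hf2 : symRes V (toOpens_mono i.le) (SymmetricAlgebra.ι _ _ m) ∈ symSections V W.1 1 :=
    Graded.map_mem (symRes V (toOpens_mono i.le)) hf
  have hg2 : symRes V (toOpens_mono i.le) (SymmetricAlgebra.ι _ _ m') ∈ symSections V W.1 1 :=
    Graded.map_mem (symRes V (toOpens_mono i.le)) hg
  have hz : z ∈ bundleChart V W hf2 one_pos ''ᵁ ⊤ := by
    have h2 : z ∈ bundleι V W ''ᵁ Proj.basicOpen (symSections V W.1)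
        (SymmetricAlgebra.ι _ _ (moduleRes V (toOpens_mono i.le) m)) :=
      (chartOpen_eq_image V _).le h'
    refine (bundleChart_image V hf2 one_pos).ge ?_
    exact ((congrArg (fun s => bundleι V W ''ᵁ Proj.basicOpen (symSections V W.1) s)
      (symRes_ι V i m)).ge h2)
  refine (germ_bundleFrac_congr V _ hf2 _ hg2 (symRes_ι V i m).symm (symRes_ι V i m').symm
    h' hz).trans ?_
  refine (congrArg _ (map_bundleFrac V hf hg i).symm).trans ?_
  exact (projectiveBundle V).presheaf.germ_res_apply
    (homOfLE (bundleChart_image_res_le V hf one_pos i)) z hz _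

theorem exists_mem_chartOpen {ι : Type*} (b : Module.Basis ι Γ(X, U.1) Γ(V, U.1))
    {z : projectiveBundle V} (hz : z ∈ projectiveBundle.π V ⁻¹ᵁ U.1) :
    ∃ i, z ∈ chartOpen V U (b i) :=
  exists_mem_bundleChart V b hz

/-- The functions on a standard chart form a polynomial ring. -/
noncomputable def chartEquiv {ι : Type*}
    (b : Module.Basis ι Γ(X, U.1) Γ(V, U.1)) (i : ι) :
    MvPolynomial {j // j ≠ i} Γ(X, U.1) ≃+* Γ(projectiveBundle V, chartOpen V U (b i)) :=
  (awayEquiv b i).trans (specSection (bundleChart V U (ι_mem_symPart _ _ (b i)) one_pos))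

theorem chartEquiv_C {ι : Type*} (b : Module.Basis ι Γ(X, U.1) Γ(V, U.1)) (i : ι) (a : Γ(X, U.1)) :
    chartEquiv V b i (MvPolynomial.C a) = (projectiveBundle.π V).appLE U.1 _ (chartOpen_le V _) a :=
  (congrArg (specSection _) (awayEquiv_C b i a)).trans (appLE_chartOpen V (b i) a).symm

theorem chartEquiv_X {ι : Type*} (b : Module.Basis ι Γ(X, U.1) Γ(V, U.1)) (i : ι)
    (j : {j // j ≠ i}) :
    chartEquiv V b i (MvPolynomial.X j) = chartFrac V U (b i) (b j) :=
  congrArg (specSection _) (awayEquiv_X b i j)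

theorem chartOpen_inf_nonempty {ι : Type*} (b : Module.Basis ι Γ(X, U.1) Γ(V, U.1))
    [IsDomain Γ(X, U.1)] (i j : ι) :
    ((chartOpen V U (b i) ⊓ chartOpen V U (b j) : (projectiveBundle V).Opens) :
      Set (projectiveBundle V)).Nonempty := by
  let s := SymmetricAlgebra.ι Γ(X, U.1) Γ(V, U.1)
  have hd : IsDomain (SymmetricAlgebra Γ(X, U.1) Γ(V, U.1)) :=
    (SymmetricAlgebra.equivMvPolynomial b).toMulEquiv.isDomain _
  have h0 : ∀ i, s (b i) ≠ 0 := fun i h => by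
    have h1 := congrArg (SymmetricAlgebra.equivMvPolynomial b) h
    rw [SymmetricAlgebra.equivMvPolynomial_ι_apply, map_zero] at h1
    exact MvPolynomial.X_ne_zero i h1
  have hm : s (b i) * s (b j) ∈ symSections V U.1 (1 + 1) :=
    SetLike.mul_mem_graded (ι_mem_symPart _ _ _) (ι_mem_symPart _ _ _)
  have h2 : 0 < 1 + 1 := by norm_num
  have e := bundleChart_mul_image V (ι_mem_symPart _ _ (b i)) one_pos
    (ι_mem_symPart _ _ (b j)) one_pos hm h2 rfl
  have hn : Nontrivial (HomogeneousLocalization.Away (symSections V U.1) (s (b i) * s (b j))) := by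
    have : IsDomain (Localization.Away (s (b i) * s (b j))) :=
      IsLocalization.isDomain_localization
        (powers_le_nonZeroDivisors_of_noZeroDivisors (mul_ne_zero (h0 i) (h0 j)))
    refine ⟨0, 1, fun h => ?_⟩
    have h1 := congrArg HomogeneousLocalization.val h
    rw [HomogeneousLocalization.val_zero, HomogeneousLocalization.val_one] at h1
    exact zero_ne_one h1
  obtain ⟨y⟩ : Nonempty (PrimeSpectrum (HomogeneousLocalization.Away (symSections V U.1)
    (s (b i) * s (b j)))) := inferInstance
  exact ⟨_, e.le ⟨y, trivial, rfl⟩⟩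

end charts

/-! ### Flatness, integrality and normality of the projective bundle -/

open Scheme.AffineZariskiSite in
theorem exists_res_basis {X : Scheme.{u}} {r : ℕ} (L : Fin r → X.Modules) {U W : X.AffineZariskiSite} (i : W ⟶ U)
    {b : Module.Basis (Fin r) Γ(X, U.1) Γ(⨁ L, U.1)} (hb : IsAdapted L b) :
    ∃ b' : Module.Basis (Fin r) Γ(X, W.1) Γ(⨁ L, W.1), IsAdapted L b' ∧
      ∀ j, b' j = moduleRes (⨁ L) (toOpens_mono i.le) (b j) :=
  ⟨(hb.res (toOpens_mono i.le)).basis, by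
    have : ((hb.res (toOpens_mono i.le)).basis : Fin r → _) = _ :=
      funext (hb.res (toOpens_mono i.le)).basis_apply
    rw [this]; exact hb.res _, (hb.res (toOpens_mono i.le)).basis_apply⟩

section bundleGeometry
open Scheme.AffineZariskiSite
variable {X : Scheme.{u}} {r : ℕ} (L : Fin r → X.Modules) [∀ i, IsLineBundle (L i)]

theorem exists_isAdapted_basis (x : X) : ∃ U : X.AffineZariskiSite, x ∈ U.1 ∧
    ∃ b : Module.Basis (Fin r) Γ(X, U.1) Γ(⨁ L, U.1), IsAdapted L b := by
  obtain ⟨U, hU, hx, e, he⟩ := exists_isAdapted (L := L) x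
  refine ⟨⟨U, hU⟩, hx, he.basis, ?_⟩
  have : (he.basis : Fin r → Γ(⨁ L, U)) = e := funext he.basis_apply
  rwa [this]

theorem exists_chart (z : projectiveBundle (⨁ L)) : ∃ U : X.AffineZariskiSite,
    ∃ b : Module.Basis (Fin r) Γ(X, U.1) Γ(⨁ L, U.1), IsAdapted L b ∧
      ∃ i, z ∈ chartOpen (⨁ L) U (b i) := by
  obtain ⟨U, hU, b, hb⟩ := exists_isAdapted_basis L (projectiveBundle.π (⨁ L) z)
  exact ⟨U, b, hb, exists_mem_chartOpen _ b hU⟩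

instance flat_bundle_π : Flat (projectiveBundle.π (⨁ L)) := by
  refine (HasRingHomProperty.iff_exists_appLE (P := @Flat)
    (RingHom.Flat.stableUnderComposition.stableUnderCompositionWithLocalizationAway
      RingHom.Flat.holdsForLocalizationAway).1).2
    fun z => ?_
  obtain ⟨U, b, -, i, hz⟩ := exists_chart L z
  refine ⟨⟨U.1, U.2⟩, ⟨_, isAffineOpen_chartOpen _ (b i)⟩, hz, chartOpen_le _ _, ?_⟩
  have e : ((projectiveBundle.π (⨁ L)).appLE U.1 _ (chartOpen_le _ (b i))).hom =
      ((chartEquiv (⨁ L) b i).toRingHom).comp MvPolynomial.C :=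
    RingHom.ext fun a => (chartEquiv_C (⨁ L) b i a).symm
  have h : RingHom.Flat (MvPolynomial.C : Γ(X, U.1) →+* MvPolynomial {j // j ≠ i} Γ(X, U.1)) :=
    RingHom.flat_algebraMap_iff.2 inferInstance
  have h2 := h.comp (RingHom.Flat.of_bijective
    (f := (chartEquiv (⨁ L) b i).toRingHom) (chartEquiv (⨁ L) b i).bijective)
  exact e ▸ h2

/-- Two nonempty affine open sets of an irreducible scheme contain a nonempty open set that is basic in
both of them. -/
theorem exists_common_basic [IrreducibleSpace X] (U U' : X.AffineZariskiSite) (hU : (U.1 : Set X).Nonempty)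
    (hU' : (U'.1 : Set X).Nonempty) :
    ∃ W : X.AffineZariskiSite, (W.1 : Set X).Nonempty ∧ Nonempty (W ⟶ U) ∧ Nonempty (W ⟶ U') := by
  obtain ⟨x, hx, hx'⟩ := nonempty_preirreducible_inter U.1.2 U'.1.2 hU hU'
  obtain ⟨f, g, e, hf⟩ := exists_basicOpen_le_affine_inter U.2 U'.2 x ⟨hx, hx'⟩
  refine ⟨U.basicOpen f, ⟨x, hf⟩, ⟨homOfLE ⟨f, rfl⟩⟩, ⟨homOfLE ⟨g, e.symm⟩⟩⟩

/-- Charts over different affine open sets meet, because on a common basic open set the adapted bases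
differ by units. -/
theorem chartOpen_inf_chartOpen_nonempty [AlgebraicGeometry.IsIntegral X] {U U' : X.AffineZariskiSite}
    {b : Module.Basis (Fin r) Γ(X, U.1) Γ(⨁ L, U.1)} (hb : IsAdapted L b)
    {b' : Module.Basis (Fin r) Γ(X, U'.1) Γ(⨁ L, U'.1)} (hb' : IsAdapted L b') (i i' : Fin r)
    (h : (U.1 : Set X).Nonempty) (h' : (U'.1 : Set X).Nonempty) :
    ((chartOpen (⨁ L) U (b i) ⊓ chartOpen (⨁ L) U' (b' i') : (projectiveBundle (⨁ L)).Opens) :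
      Set (projectiveBundle (⨁ L))).Nonempty := by
  obtain ⟨W, hW, ⟨j⟩, ⟨j'⟩⟩ := exists_common_basic U U' h h'
  obtain ⟨c, hc, e⟩ := exists_res_basis L j hb
  obtain ⟨c', hc', e'⟩ := exists_res_basis L j' hb'
  obtain ⟨v, hv⟩ := hc.exists_unit hc'
  have : Nonempty W.1 := hW.to_subtype
  have : IsDomain Γ(X, W.1) := inferInstance
  obtain ⟨z, hz, hz'⟩ := chartOpen_inf_nonempty (⨁ L) c i i'
  refine ⟨z, ?_, ?_⟩
  · have h1 : z ∈ chartOpen (⨁ L) W (c i) := hz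
    rw [e, chartOpen_res _ j] at h1
    exact h1.1
  · have h1 : z ∈ chartOpen (⨁ L) W (c i') := hz'
    rw [← chartOpen_unit_smul _ _ (v i'), ← hv, e', chartOpen_res _ j'] at h1
    exact h1.1

theorem isDomain_chart [AlgebraicGeometry.IsIntegral X] {U : X.AffineZariskiSite}
    (hU : (U.1 : Set X).Nonempty) (b : Module.Basis (Fin r) Γ(X, U.1) Γ(⨁ L, U.1)) (i : Fin r) :
    IsDomain Γ(projectiveBundle (⨁ L), chartOpen (⨁ L) U (b i)) := by
  have : Nonempty U.1 := hU.to_subtype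
  exact (chartEquiv (⨁ L) b i).symm.toMulEquiv.isDomain _

theorem isIrreducible_chartOpen [AlgebraicGeometry.IsIntegral X] {U : X.AffineZariskiSite}
    (hU : (U.1 : Set X).Nonempty) (b : Module.Basis (Fin r) Γ(X, U.1) Γ(⨁ L, U.1)) (i : Fin r) :
    IsPreirreducible (chartOpen (⨁ L) U (b i) : Set (projectiveBundle (⨁ L))) := by
  have hd := isDomain_chart L hU b i
  have hA := isAffineOpen_chartOpen (⨁ L) (b i)
  rw [← hA.range_fromSpec, ← Set.image_univ]
  exact (PreirreducibleSpace.isPreirreducible_univ).image _ hA.fromSpec.continuous.continuousOn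

theorem nonempty_of_mem_chartOpen {U : X.AffineZariskiSite} {m : Γ(⨁ L, U.1)}
    {z : projectiveBundle (⨁ L)} (hz : z ∈ chartOpen (⨁ L) U m) : (U.1 : Set X).Nonempty :=
  ⟨_, chartOpen_le (⨁ L) m hz⟩

theorem isIntegral_bundle [AlgebraicGeometry.IsIntegral X] (hr : 0 < r) :
    AlgebraicGeometry.IsIntegral (projectiveBundle (⨁ L)) := by
  have hred : IsReduced (projectiveBundle (⨁ L)) := by
    have : ∀ z, _root_.IsReduced ((projectiveBundle (⨁ L)).presheaf.stalk z) := fun z => by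
      obtain ⟨U, b, -, i, hz⟩ := exists_chart L z
      have hd := isDomain_chart L (nonempty_of_mem_chartOpen L hz) b i
      have hA := isAffineOpen_chartOpen (⨁ L) (b i)
      let _ := ((projectiveBundle (⨁ L)).presheaf.germ _ z hz).hom.toAlgebra
      have : IsLocalization.AtPrime ((projectiveBundle (⨁ L)).presheaf.stalk z)
        (hA.primeIdealOf ⟨z, hz⟩).asIdeal := hA.isLocalization_stalk ⟨z, hz⟩
      have := IsLocalization.isDomain_of_atPrime ((projectiveBundle (⨁ L)).presheaf.stalk z)
        (hA.primeIdealOf ⟨z, hz⟩).asIdeal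
      infer_instance
    exact isReduced_of_isReduced_stalk _
  have hirr : PreirreducibleSpace (projectiveBundle (⨁ L)) := by
    refine ⟨fun A B hA hB ⟨y, _, hy⟩ ⟨z, _, hz⟩ => ?_⟩
    obtain ⟨U, b, hb, i, hy'⟩ := exists_chart L y
    obtain ⟨U', b', hb', i', hz'⟩ := exists_chart L z
    have hU := nonempty_of_mem_chartOpen L hy'
    have hU' := nonempty_of_mem_chartOpen L hz'
    obtain ⟨w, hw, hw'⟩ := chartOpen_inf_chartOpen_nonempty L hb hb' i i' hU hU'
    obtain ⟨t, ht, ht1, ht2⟩ := isIrreducible_chartOpen L hU b i A _ hA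
      (chartOpen (⨁ L) U' (b' i')).2 ⟨y, hy', hy⟩ ⟨w, hw, hw'⟩
    obtain ⟨t', ht', ht1', ht2'⟩ := isIrreducible_chartOpen L hU' b' i' _ B
      (hA.inter (chartOpen (⨁ L) U (b i)).2) hB ⟨t, ht2, ht1, ht⟩ ⟨z, hz', hz⟩
    exact ⟨t', trivial, ht1'.1, ht2'⟩
  have hne : Nonempty (projectiveBundle (⨁ L)) := by
    obtain ⟨U, hU, b, hb⟩ := exists_isAdapted_basis L (genericPoint X)
    obtain ⟨w, -, -⟩ := chartOpen_inf_chartOpen_nonempty L hb hb ⟨0, hr⟩ ⟨0, hr⟩ ⟨_, hU⟩ ⟨_, hU⟩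
    exact ⟨w⟩
  have : IrreducibleSpace (projectiveBundle (⨁ L)) := ⟨hne⟩
  exact isIntegral_of_irreducibleSpace_of_isReduced _

theorem isNormalScheme_bundle [AlgebraicGeometry.IsIntegral X] [IsLocallyNoetherian X]
    [IsNormalScheme X] : IsNormalScheme (projectiveBundle (⨁ L)) := by
  have h : ∀ z, IsDomain ((projectiveBundle (⨁ L)).presheaf.stalk z) ∧
      IsIntegrallyClosed ((projectiveBundle (⨁ L)).presheaf.stalk z) := fun z => by
    obtain ⟨U, b, -, i, hz⟩ := exists_chart L z
    have hU := nonempty_of_mem_chartOpen L hz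
    have hd := isDomain_chart L hU b i
    have hA := isAffineOpen_chartOpen (⨁ L) (b i)
    let _ := ((projectiveBundle (⨁ L)).presheaf.germ _ z hz).hom.toAlgebra
    have hloc : IsLocalization.AtPrime ((projectiveBundle (⨁ L)).presheaf.stalk z)
      (hA.primeIdealOf ⟨z, hz⟩).asIdeal := hA.isLocalization_stalk ⟨z, hz⟩
    have : Nonempty U.1 := hU.to_subtype
    have := isIntegrallyClosed_section U.2
    have := isIntegrallyClosed_mvPolynomial {j // j ≠ i} Γ(X, U.1)
    have : IsIntegrallyClosed Γ(projectiveBundle (⨁ L), chartOpen (⨁ L) U (b i)) :=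
      IsIntegrallyClosed.of_equiv (chartEquiv (⨁ L) b i)
    exact ⟨IsLocalization.isDomain_of_atPrime _ (hA.primeIdealOf ⟨z, hz⟩).asIdeal,
      isIntegrallyClosed_of_isLocalization _ (hA.primeIdealOf ⟨z, hz⟩).asIdeal.primeCompl
        (Ideal.primeCompl_le_nonZeroDivisors _)⟩
  exact ⟨fun z => (h z).1, fun z => (h z).2⟩

end bundleGeometry

/-! ### The extension of function fields -/

section functionFieldMap
variable {P X : Scheme.{u}} [AlgebraicGeometry.IsIntegral P] [AlgebraicGeometry.IsIntegral X]
  (π : P ⟶ X) [Flat π]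

theorem map_genericPoint_of_flat : π (genericPoint P) = genericPoint X := by
  obtain ⟨z, hz, e⟩ := Flat.generalizingMap π (genericPoint_specializes (π (genericPoint P)))
  rw [← e, (hz.antisymm (genericPoint_specializes z)).eq]

/-- The extension of function fields induced by a flat morphism of integral schemes. -/
noncomputable def functionFieldMap : X.functionField →+* P.functionField :=
  (X.presheaf.stalkSpecializes (specializes_of_eq (map_genericPoint_of_flat π)) ≫
    π.stalkMap (genericPoint P)).hom

theorem functionFieldMap_toRat {U : X.Opens} {V : P.Opens} (le : V ≤ π ⁻¹ᵁ U) (x : U) (y : V)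
    (a : Γ(X, U)) : functionFieldMap π (toRat U x a) = toRat V y (π.appLE U V le a) := by
  have hy : genericPoint P ∈ V := (genericPoint_specializes (y : P)).mem_open V.2 y.2
  have hx : genericPoint X ∈ U := (genericPoint_specializes (x : X)).mem_open U.2 x.2
  have hx' : π (genericPoint P) ∈ U := le hy
  change (π.stalkMap (genericPoint P)) (X.presheaf.stalkSpecializes _
    (X.presheaf.germ U (genericPoint X) hx a)) = P.presheaf.germ V (genericPoint P) hy _
  have h1 : X.presheaf.stalkSpecializes (specializes_of_eq (map_genericPoint_of_flat π))
      (X.presheaf.germ U (genericPoint X) hx a) =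
      X.presheaf.germ U (π (genericPoint P)) hx' a :=
    congrArg (fun g => g.hom a) (X.presheaf.germ_stalkSpecializes hx
      (specializes_of_eq (map_genericPoint_of_flat π)))
  rw [h1, Scheme.Hom.germ_stalkMap_apply, Scheme.Hom.appLE]
  exact (P.presheaf.germ_res_apply (homOfLE le) _ hy _).symm

end functionFieldMap

section
variable {P X : Scheme.{u}} [AlgebraicGeometry.IsIntegral P] [AlgebraicGeometry.IsIntegral X]
  (π : P ⟶ X) [Algebra X.functionField P.functionField]

/-- The function field of `P` is regarded as an extension of that of `X` via `π`. -/
class IsFunctionFieldExtension : Prop where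
  algebraMap_toRat : ∀ {U : X.Opens} {V : P.Opens} (le : V ≤ π ⁻¹ᵁ U) (x : U) (y : V)
    (a : Γ(X, U)), algebraMap X.functionField P.functionField (toRat U x a) =
      toRat V y (π.appLE U V le a)

variable [IsFunctionFieldExtension π]

theorem algebraMap_mem_stalkRing (y : P) {f : X.functionField} (hf : f ∈ stalkRing (π y)) :
    algebraMap X.functionField P.functionField f ∈ stalkRing y := by
  obtain ⟨U, hx, a, rfl⟩ := exists_toRat_of_mem_stalkRing hf
  have h := IsFunctionFieldExtension.algebraMap_toRat (π := π) (le_refl (π ⁻¹ᵁ U)) ⟨π y, hx⟩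
    (⟨y, hx⟩ : (π ⁻¹ᵁ U : P.Opens)) a
  have h2 := toRat_mem_stalkRing (π ⁻¹ᵁ U) ⟨y, hx⟩ ⟨y, hx⟩ (π.appLE U (π ⁻¹ᵁ U) le_rfl a)
  exact Set.mem_of_eq_of_mem h h2

/-- The coordinates `u j * x j` define an affine chart of `P` at the point `y`, the `i`-th one being
the denominator: the local ring at `y` is a localization of the polynomial ring they generate over
the local ring at `π y`. -/
structure IsChartAt {ι : Type*} (x : ι → P.functionField) (y : P) (u : ι → X.functionField) (i : ι) :
    Prop where
  ne_zero : ∀ j, u j ≠ 0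
  le : chartRing x u i (stalkRing (π y)) ≤ stalkRing y
  exists_frac : ∀ b ∈ stalkRing y, ∃ h ∈ chartRing x u i (stalkRing (π y)),
    ∃ w ∈ chartRing x u i (stalkRing (π y)), w ≠ 0 ∧ w⁻¹ ∈ stalkRing y ∧ b = h / w

end

section coordinates
open Scheme.AffineZariskiSite
variable {X : Scheme.{u}} {V : X.Modules} [V.IsQuasicoherent]
  [AlgebraicGeometry.IsIntegral (projectiveBundle V)] {U : X.AffineZariskiSite}

/-- The quotient `m' / m` of two sections of `V` as a rational function on the projective bundle. The
point `y` only witnesses that `m` does not vanish identically. -/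
noncomputable def ratFrac (m m' : Γ(V, U.1)) (y : chartOpen V U m) :
    (projectiveBundle V).functionField :=
  toRat (chartOpen V U m) y (chartFrac V U m m')

theorem ratFrac_self (m : Γ(V, U.1)) (y : chartOpen V U m) : ratFrac m m y = 1 := by
  rw [ratFrac, chartFrac_self, map_one]

theorem genericPoint_mem {P : Scheme.{u}} [AlgebraicGeometry.IsIntegral P] {A : P.Opens} (y : A) :
    genericPoint P ∈ A :=
  (genericPoint_specializes (y : P)).mem_open A.2 y.2

theorem ratFrac_mul (m m' m'' : Γ(V, U.1)) (y : chartOpen V U m) (y' : chartOpen V U m') :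
    ratFrac m m' y * ratFrac m' m'' y' = ratFrac m m'' y :=
  chartFrac_mul V (genericPoint_mem y) (genericPoint_mem y')

theorem ratFrac_ne_zero (m m' : Γ(V, U.1)) (y : chartOpen V U m) (y' : chartOpen V U m') :
    ratFrac m m' y ≠ 0 := by
  intro h
  have h1 := ratFrac_mul m m' m y y'
  rw [h, zero_mul, ratFrac_self] at h1
  exact zero_ne_one h1

theorem ratFrac_res {W : X.AffineZariskiSite} (i : W ⟶ U) (m m' : Γ(V, U.1))
    (y : chartOpen V U m) (y' : chartOpen V W (moduleRes V (toOpens_mono i.le) m)) :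
    ratFrac (moduleRes V (toOpens_mono i.le) m) (moduleRes V (toOpens_mono i.le) m') y' =
      ratFrac m m' y :=
  germ_chartFrac_res V i m m' (genericPoint_mem y) (genericPoint_mem y')

variable [AlgebraicGeometry.IsIntegral X] [Algebra X.functionField (projectiveBundle V).functionField]
  [IsFunctionFieldExtension (projectiveBundle.π V)]

theorem ratFrac_smul (m m' : Γ(V, U.1)) (y : chartOpen V U m) (x : U.1) (a : Γ(X, U.1)) :
    ratFrac m (a • m') y =
      algebraMap X.functionField _ (toRat U.1 x a) * ratFrac m m' y := by
  rw [ratFrac, chartFrac_smul, map_mul, IsFunctionFieldExtension.algebraMap_toRat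
    (π := projectiveBundle.π V) (chartOpen_le V m) x y]
  rfl

theorem ratFrac_unit_smul (m m' : Γ(V, U.1)) (x : U.1) (a a' : Γ(X, U.1)ˣ) (y : chartOpen V U m)
    (y' : chartOpen V U ((a : Γ(X, U.1)) • m)) :
    ratFrac ((a : Γ(X, U.1)) • m) ((a' : Γ(X, U.1)) • m') y' =
      algebraMap X.functionField _ (toRat U.1 x a') /
        algebraMap X.functionField _ (toRat U.1 x a) * ratFrac m m' y := by
  have h0 : algebraMap X.functionField (projectiveBundle V).functionField (toRat U.1 x a) ≠ 0 :=
    ((a.isUnit.map (toRat U.1 x)).map (algebraMap _ _)).ne_zero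
  have h1 := ratFrac_self ((a : Γ(X, U.1)) • m) y'
  rw [ratFrac_smul _ _ _ x] at h1
  rw [ratFrac_smul _ _ _ x, ← ratFrac_mul _ _ m' y' y, div_mul_eq_mul_div, eq_div_iff h0, mul_assoc,
    mul_right_comm, mul_comm _ (algebraMap _ _ (toRat U.1 x a)), h1, one_mul]

theorem toRat_chartEquiv {ι : Type*} (b : Module.Basis ι Γ(X, U.1) Γ(V, U.1)) (i : ι)
    (y : chartOpen V U (b i)) (x : U.1) (f : MvPolynomial {j // j ≠ i} Γ(X, U.1)) :
    toRat _ y (chartEquiv V b i f) =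
      MvPolynomial.eval₂ ((algebraMap X.functionField _).comp (toRat U.1 x))
        (fun j : {j // j ≠ i} => ratFrac (b i) (b j) y) f := by
  have h : (toRat _ y).comp (chartEquiv V b i).toRingHom = MvPolynomial.eval₂Hom
      ((algebraMap X.functionField _).comp (toRat U.1 x))
        (fun j : {j // j ≠ i} => ratFrac (b i) (b j) y) := by
    refine MvPolynomial.ringHom_ext (fun a => ?_) fun j => ?_
    · rw [MvPolynomial.eval₂Hom_C, RingHom.comp_apply, RingHom.comp_apply,
        IsFunctionFieldExtension.algebraMap_toRat
          (π := projectiveBundle.π V) (chartOpen_le V (b i)) x y, ← chartEquiv_C V b i]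
      rfl
    · rw [MvPolynomial.eval₂Hom_X', RingHom.comp_apply, ratFrac, ← chartEquiv_X V b i j]
      rfl
  exact DFunLike.congr_fun h f

end coordinates

/-! ### Homogeneous coordinates on the projective bundle -/

section algebraicIndependence
open MvPolynomial

theorem algebraicIndependent_of_isFractionRing {σ A K F : Type*} [CommRing A] [IsDomain A] [Field K]
    [Algebra A K] [IsFractionRing A K] [CommRing F] [Algebra K F] {x : σ → F}
    (h : Function.Injective (eval₂Hom ((algebraMap K F).comp (algebraMap A K)) x)) :
    AlgebraicIndependent K x := by
  rw [algebraicIndependent_iff]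
  intro f hf
  let _ : Algebra (MvPolynomial σ A) (MvPolynomial σ K) := MvPolynomial.algebraMvPolynomial
  obtain ⟨⟨g, ⟨_, ⟨a, ha, rfl⟩⟩⟩, hg⟩ := IsLocalization.surj
    ((nonZeroDivisors A).map (C (σ := σ))) f
  have hg' : f * map (algebraMap A K) (C a) = map (algebraMap A K) g := hg
  rw [map_C] at hg'
  have h1 : eval₂Hom ((algebraMap K F).comp (algebraMap A K)) x g = 0 := by
    rw [coe_eval₂Hom, ← eval₂_map, ← hg', ← aeval_def, map_mul, hf, zero_mul]
  have h2 : g = 0 := h (by rw [h1, map_zero])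
  rw [h2, map_zero] at hg'
  refine (mul_eq_zero.1 hg').resolve_right fun h3 => ?_
  rw [C_eq_zero] at h3
  exact nonZeroDivisors.ne_zero ha ((FaithfulSMul.algebraMap_eq_zero_iff A K).1 h3)

end algebraicIndependence

theorem ratFrac_congr {X : Scheme.{u}} {V : X.Modules} [V.IsQuasicoherent]
    [AlgebraicGeometry.IsIntegral (projectiveBundle V)] {U : X.AffineZariskiSite}
    {m m₁ m' m₁' : Γ(V, U.1)} (e : m = m₁) (e' : m' = m₁') {z : projectiveBundle V}
    (h : z ∈ chartOpen V U m) (h' : z ∈ chartOpen V U m₁) :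
    ratFrac m m' ⟨z, h⟩ = ratFrac m₁ m₁' ⟨z, h'⟩ := by
  subst e e'
  rfl

section bundleCoordinates
open Scheme.AffineZariskiSite
variable {X : Scheme.{u}} [AlgebraicGeometry.IsIntegral X] {r : ℕ} (L : Fin r → X.Modules)
  [∀ i, IsLineBundle (L i)] [AlgebraicGeometry.IsIntegral (projectiveBundle (⨁ L))]

theorem genericPoint_mem_chartOpen {U : X.AffineZariskiSite} (hU : (U.1 : Set X).Nonempty)
    {b : Module.Basis (Fin r) Γ(X, U.1) Γ(⨁ L, U.1)} (hb : IsAdapted L b) (j : Fin r) :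
    genericPoint (projectiveBundle (⨁ L)) ∈ chartOpen (⨁ L) U (b j) := by
  obtain ⟨w, hw, -⟩ := chartOpen_inf_chartOpen_nonempty L hb hb j j hU hU
  exact genericPoint_mem ⟨w, hw⟩

variable [Algebra X.functionField (projectiveBundle (⨁ L)).functionField]
  [IsFunctionFieldExtension (projectiveBundle.π (⨁ L))]

/-- The local ring at `y` is a localization of the polynomial ring of functions on a chart. -/
theorem isChartAt_of_ratFrac_eq {U : X.AffineZariskiSite}
    {b : Module.Basis (Fin r) Γ(X, U.1) Γ(⨁ L, U.1)} {i : Fin r} {y : projectiveBundle (⨁ L)}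
    (hy : y ∈ chartOpen (⨁ L) U (b i)) {x : Fin r → (projectiveBundle (⨁ L)).functionField}
    {u : Fin r → X.functionField} (hu : ∀ j, u j ≠ 0)
    (h : ∀ j, ratFrac (b i) (b j) ⟨y, hy⟩ = chartCoord x u i j) :
    IsChartAt (projectiveBundle.π (⨁ L)) x y u i := by
  have hx := chartOpen_le (⨁ L) _ hy
  have hmem : ∀ f, toRat _ ⟨y, hy⟩ f ∈
      chartRing x u i (stalkRing (projectiveBundle.π (⨁ L) y)) := fun f => by
    obtain ⟨f, rfl⟩ := (chartEquiv (⨁ L) b i).surjective f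
    rw [toRat_chartEquiv b i ⟨y, hy⟩ ⟨_, hx⟩]
    refine MvPolynomial.eval₂_mem (fun a _ => ?_) fun j => ?_
    · exact algebraMap_mem_chartRing x u i (toRat_mem_stalkRing U.1 ⟨_, hx⟩ ⟨_, hx⟩ _)
    · rw [h]
      exact chartCoord_mem_chartRing x u i _ _
  refine ⟨hu, Subring.closure_le.2 ?_, fun f hf => ?_⟩
  · rintro _ (⟨z, hz, rfl⟩ | ⟨j, rfl⟩)
    · exact algebraMap_mem_stalkRing (projectiveBundle.π (⨁ L)) y hz
    · rw [← h]
      exact toRat_mem_stalkRing _ ⟨y, hy⟩ ⟨y, hy⟩ _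
  · obtain ⟨f, g, -, h1, h2, h3⟩ :=
      exists_eq_div_of_mem_stalkRing (isAffineOpen_chartOpen (⨁ L) (b i)) ⟨y, hy⟩ hf
    exact ⟨_, hmem f, _, hmem g, h1, h2, h3⟩

/-- The functions `x j = b j / b i₀` for a local basis `b` of `V` are homogeneous coordinates on the
projective bundle. -/
theorem exists_coordinates (hr : 0 < r) :
    ∃ (x : Fin r → (projectiveBundle (⨁ L)).functionField) (i₀ : Fin r), x i₀ = 1 ∧
      (∀ j, x j ≠ 0) ∧
      AlgebraicIndependent X.functionField (fun j : {j // j ≠ i₀} => x j) ∧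
      (∀ f, ∃ g h : MvPolynomial {j // j ≠ i₀} X.functionField,
        f = MvPolynomial.aeval (fun j : {j // j ≠ i₀} => x j) g /
          MvPolynomial.aeval (fun j : {j // j ≠ i₀} => x j) h) ∧
      (∀ y, ∃ u i, IsChartAt (projectiveBundle.π (⨁ L)) x y u i) ∧
      ∃ U₀ : X.Opens, (U₀ : Set X).Nonempty ∧ ∀ y, projectiveBundle.π (⨁ L) y ∈ U₀ →
        ∃ i, IsChartAt (projectiveBundle.π (⨁ L)) x y 1 i := by
  obtain ⟨U, hU, b, hb⟩ := exists_isAdapted_basis L (genericPoint X)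
  have hU' : (U.1 : Set X).Nonempty := ⟨_, hU⟩
  have hη := genericPoint_mem_chartOpen L hU' hb
  let i₀ : Fin r := ⟨0, hr⟩
  let x : Fin r → (projectiveBundle (⨁ L)).functionField := fun j =>
    ratFrac (b i₀) (b j) ⟨_, hη i₀⟩
  have hx : ∀ j, x j ≠ 0 := fun j => ratFrac_ne_zero _ _ _ ⟨_, hη j⟩
  have hquot : ∀ i j (y : chartOpen (⨁ L) U (b i)), ratFrac (b i) (b j) y = x j / x i :=
    fun i j y => by
      rw [eq_div_iff (hx i), mul_comm]
      exact ratFrac_mul _ _ _ _ y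
  have : Nonempty U.1 := ⟨⟨_, hU⟩⟩
  let _ : Algebra Γ(X, U.1) X.functionField := (toRat U.1 ⟨_, hU⟩).toAlgebra
  have hfrac : IsFractionRing Γ(X, U.1) X.functionField :=
    functionField_isFractionRing_of_isAffineOpen X U.1 U.2
  refine ⟨x, i₀, ratFrac_self _ _, hx, ?_, fun f => ?_, fun y => ?_, U.1, hU', fun y hy => ?_⟩
  · apply algebraicIndependent_of_isFractionRing (A := Γ(X, U.1))
    have h : ⇑(MvPolynomial.eval₂Hom ((algebraMap X.functionField
        (projectiveBundle (⨁ L)).functionField).comp (algebraMap Γ(X, U.1) X.functionField))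
        fun j : {j // j ≠ i₀} => x j) =
        (toRat _ ⟨_, hη i₀⟩) ∘ chartEquiv (⨁ L) b i₀ :=
      funext fun f => (toRat_chartEquiv b i₀ ⟨_, hη i₀⟩ ⟨_, hU⟩ f).symm
    rw [h]
    exact (toRat_injective _ _).comp (chartEquiv (⨁ L) b i₀).injective
  · have hA := isAffineOpen_chartOpen (⨁ L) (b i₀)
    have : Nonempty (chartOpen (⨁ L) U (b i₀)) := ⟨⟨_, hη i₀⟩⟩
    have := functionField_isFractionRing_of_isAffineOpen _ _ hA
    obtain ⟨f, g, -, rfl⟩ := IsFractionRing.div_surjective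
      (A := Γ(projectiveBundle (⨁ L), chartOpen (⨁ L) U (b i₀))) f
    obtain ⟨f, rfl⟩ := (chartEquiv (⨁ L) b i₀).surjective f
    obtain ⟨g, rfl⟩ := (chartEquiv (⨁ L) b i₀).surjective g
    have h : ∀ f, algebraMap _ (projectiveBundle (⨁ L)).functionField (chartEquiv (⨁ L) b i₀ f) =
        MvPolynomial.aeval (fun j : {j // j ≠ i₀} => x j)
          (MvPolynomial.map (toRat U.1 ⟨_, hU⟩) f) := fun f => by
      rw [MvPolynomial.aeval_def, MvPolynomial.eval₂_map]
      exact toRat_chartEquiv b i₀ ⟨_, hη i₀⟩ ⟨_, hU⟩ f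
    exact ⟨_, _, congrArg₂ (· / ·) (h f) (h g)⟩
  · obtain ⟨U', b', hb', i, hy⟩ := exists_chart L y
    obtain ⟨W, hW, ⟨j⟩, ⟨j'⟩⟩ := exists_common_basic U U' hU' (nonempty_of_mem_chartOpen L hy)
    obtain ⟨c, hc, e⟩ := exists_res_basis L j hb
    obtain ⟨c', hc', e'⟩ := exists_res_basis L j' hb'
    obtain ⟨v, hv⟩ := hc.exists_unit hc'
    have hWη : genericPoint X ∈ W.1 := genericPoint_mem ⟨_, hW.some_mem⟩
    have hη1 := genericPoint_mem_chartOpen L hW hc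
    have hη2 := genericPoint_mem_chartOpen L hW hc'
    have hne : ∀ j, toRat W.1 ⟨_, hWη⟩ (v j : Γ(X, W.1)) ≠ 0 := fun j =>
      ((v j).isUnit.map _).ne_zero
    refine ⟨fun j => toRat W.1 ⟨_, hWη⟩ (v j : Γ(X, W.1)), i,
      isChartAt_of_ratFrac_eq L hy hne fun l => ?_⟩
    have e1 : ∀ l, moduleRes (⨁ L) (toOpens_mono j'.le) (b' l) =
        (v l : Γ(X, W.1)) • moduleRes (⨁ L) (toOpens_mono j.le) (b l) := fun l => by
      rw [← e', hv, e]
    have h1 : genericPoint _ ∈ chartOpen (⨁ L) W (moduleRes (⨁ L) (toOpens_mono j.le) (b i)) := by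
      rw [← e]; exact hη1 i
    have h2 : genericPoint _ ∈ chartOpen (⨁ L) W (moduleRes (⨁ L) (toOpens_mono j'.le) (b' i)) := by
      rw [← e']; exact hη2 i
    have h3 : genericPoint _ ∈ chartOpen (⨁ L) W
        ((v i : Γ(X, W.1)) • moduleRes (⨁ L) (toOpens_mono j.le) (b i)) := by
      rw [← e1]; exact h2
    rw [← ratFrac_res j' (b' i) (b' l) ⟨y, hy⟩ ⟨_, h2⟩,
      ratFrac_congr (e1 i) (e1 l) h2 h3,
      ratFrac_unit_smul _ _ ⟨_, hWη⟩ (v i) (v l) ⟨_, h1⟩,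
      ratFrac_res j (b i) (b l) ⟨_, hη i⟩, hquot, chartCoord]
    exact div_mul_div_comm _ _ _ _
  · obtain ⟨i, hi⟩ := exists_mem_chartOpen (⨁ L) b hy
    refine ⟨i, isChartAt_of_ratFrac_eq L hi (fun _ => one_ne_zero) fun j => ?_⟩
    rw [hquot, chartCoord, Pi.one_apply, Pi.one_apply, map_one, one_mul, one_mul]

end bundleCoordinates

/-! ### Points of codimension one of the projective bundle -/

theorem isPrime_map_C_mvPolynomial {σ A : Type*} [CommRing A] (I : Ideal A) [I.IsPrime] :
    (I.map (MvPolynomial.C (σ := σ))).IsPrime := by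
  rw [← Ideal.Quotient.isDomain_iff_prime]
  exact (MvPolynomial.quotientEquivQuotientMvPolynomial I).symm.toMulEquiv.isDomain _

section codimOne

/-- A consequence of going down. -/
theorem coheight_map_le_one_of_flat {P X : Scheme.{u}} (π : P ⟶ X) [Flat π] {y : P}
    (hy : Order.coheight y = 1) : Order.coheight (π y) ≤ 1 := by
  by_contra! h
  have h2 : ((2 : ℕ) : ℕ∞) ≤ Order.coheight (π y) := by
    have := Order.add_one_le_of_lt h
    exact le_trans (by norm_num) this
  obtain ⟨p, hp, hl⟩ := Order.exists_series_of_le_coheight (π y) h2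
  have h01 : π y < p ⟨1, by omega⟩ := by
    rw [← hp]
    exact p.strictMono (show (⟨0, by omega⟩ : Fin (p.length + 1)) < ⟨1, by omega⟩ from
      Nat.zero_lt_one)
  have h12 : p ⟨1, by omega⟩ < p ⟨2, by omega⟩ := p.strictMono Nat.one_lt_two
  obtain ⟨z, hz, e⟩ := Flat.generalizingMap π (show p ⟨1, by omega⟩ ⤳ π y from h01.le)
  obtain ⟨w, hw, e'⟩ := Flat.generalizingMap π (show p ⟨2, by omega⟩ ⤳ π z by
    rw [e]; exact h12.le)
  have hyz : y < z := lt_of_le_not_ge (show y ≤ z from hz) fun h => h01.not_ge <| by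
    have h' : π y ⤳ π z := Specializes.map (show y ⤳ z from h) π.continuous
    exact e ▸ h'
  have hzw : z < w := lt_of_le_not_ge (show z ≤ w from hw) fun h => h12.not_ge <| by
    have h' : π z ⤳ π w := Specializes.map (show z ⤳ w from h) π.continuous
    exact e ▸ e' ▸ h'
  have h3 := Order.coheight_add_one_le hyz
  have h4 := Order.coheight_add_one_le hzw
  rw [hy] at h3
  have h5 : Order.coheight w + 1 + 1 ≤ 0 + 1 := (add_le_add_left h4 1).trans (by simpa using h3)
  have h6 := (ENat.add_le_add_iff_right ENat.one_ne_top).1 h5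
  simp at h6

theorem germ_stalkMap_appLE {P X : Scheme.{u}} (π : P ⟶ X) {U : X.Opens} {V : P.Opens}
    (le : V ≤ π ⁻¹ᵁ U) {y : P} (hy : y ∈ V) (a : Γ(X, U)) :
    π.stalkMap y (X.presheaf.germ U (π y) (le hy) a) = P.presheaf.germ V y hy (π.appLE U V le a) := by
  have h1 : π.stalkMap y (X.presheaf.germ U (π y) (le hy) a) =
      P.presheaf.germ (π ⁻¹ᵁ U) y (le hy) (π.app U a) :=
    Scheme.Hom.germ_stalkMap_apply π U y (le hy) a
  rw [h1, Scheme.Hom.appLE]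
  exact (P.presheaf.germ_res_apply (homOfLE le) _ hy _).symm

section bundle
variable {X : Scheme.{u}} [AlgebraicGeometry.IsIntegral X] {r : ℕ} (L : Fin r → X.Modules)
  [∀ i, IsLineBundle (L i)]

/-- The prime ideal of `π y` generates a nonzero prime ideal of the polynomial ring of functions on a
chart, which is contained in the prime ideal of `y`. As the latter has height one, they are equal. -/
theorem map_maximalIdeal_eq {y : projectiveBundle (⨁ L)} (hy : Order.coheight y = 1)
    (hx : Order.coheight (projectiveBundle.π (⨁ L) y) = 1) :
    (IsLocalRing.maximalIdeal (X.presheaf.stalk (projectiveBundle.π (⨁ L) y))).map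
      ((projectiveBundle.π (⨁ L)).stalkMap y).hom = IsLocalRing.maximalIdeal _ := by
  obtain ⟨U, b, -, i, hyU⟩ := exists_chart L y
  have hxU := chartOpen_le (⨁ L) _ hyU
  have hU : (U.1 : Set X).Nonempty := ⟨_, hxU⟩
  have hd := isDomain_chart L hU b i
  have hA := isAffineOpen_chartOpen (⨁ L) (b i)
  let φ := ((projectiveBundle.π (⨁ L)).appLE U.1 _ (chartOpen_le (⨁ L) (b i))).hom
  let ψ := (X.presheaf.germ U.1 _ hxU).hom
  let ρ := ((projectiveBundle (⨁ L)).presheaf.germ _ y hyU).hom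
  have hcomm : ∀ a, ((projectiveBundle.π (⨁ L)).stalkMap y).hom (ψ a) = ρ (φ a) := fun a => by
    exact germ_stalkMap_appLE _ (chartOpen_le (⨁ L) (b i)) hyU a
  let _ := ψ.toAlgebra
  let _ := ρ.toAlgebra
  let 𝔭 := (U.2.primeIdealOf ⟨_, hxU⟩).asIdeal
  let 𝔓 := (hA.primeIdealOf ⟨y, hyU⟩).asIdeal
  have hloc : IsLocalization.AtPrime (X.presheaf.stalk (projectiveBundle.π (⨁ L) y)) 𝔭 :=
    U.2.isLocalization_stalk ⟨_, hxU⟩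
  have hloc' : IsLocalization.AtPrime ((projectiveBundle (⨁ L)).presheaf.stalk y) 𝔓 :=
    hA.isLocalization_stalk ⟨y, hyU⟩
  have h1 : 𝔭.map ψ = IsLocalRing.maximalIdeal _ := IsLocalization.AtPrime.map_eq_maximalIdeal 𝔭 _
  have h2 : 𝔓.map ρ = IsLocalRing.maximalIdeal _ := IsLocalization.AtPrime.map_eq_maximalIdeal 𝔓 _
  have hφ : φ = (chartEquiv (⨁ L) b i).toRingHom.comp MvPolynomial.C :=
    RingHom.ext fun a => (chartEquiv_C (⨁ L) b i a).symm
  have hQ : (𝔭.map φ).IsPrime := by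
    have : (𝔭.map (MvPolynomial.C (σ := {j // j ≠ i}))).IsPrime :=
      isPrime_map_C_mvPolynomial 𝔭
    rw [hφ, ← Ideal.map_map]
    exact Ideal.map_isPrime_of_equiv (chartEquiv (⨁ L) b i)
  have hQ0 : 𝔭.map φ ≠ ⊥ := by
    intro h
    have hinj : Function.Injective φ := by
      rw [hφ]
      exact (chartEquiv (⨁ L) b i).injective.comp (MvPolynomial.C_injective _ _)
    have h3 : 𝔭 = ⊥ := (Ideal.map_eq_bot_iff_of_injective hinj).1 h
    rw [h3, Ideal.map_bot] at h1
    have h4 : IsField (X.presheaf.stalk (projectiveBundle.π (⨁ L) y)) :=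
      IsLocalRing.isField_iff_maximalIdeal_eq.2 h1.symm
    have h5 := ringKrullDim_stalk_eq_coheight (projectiveBundle.π (⨁ L) y)
    rw [ringKrullDim_eq_zero_of_isField h4, hx] at h5
    exact zero_ne_one h5
  have hle : 𝔭.map φ ≤ 𝔓 := by
    refine Ideal.map_le_iff_le_comap.2 fun a ha => ?_
    have h3 : ψ a ∈ IsLocalRing.maximalIdeal _ := h1 ▸ Ideal.mem_map_of_mem ψ ha
    have h4 : ρ (φ a) ∈ IsLocalRing.maximalIdeal _ := by
      rw [← hcomm]
      exact map_nonunit _ _ h3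
    have h5 := IsLocalization.AtPrime.under_maximalIdeal ((projectiveBundle (⨁ L)).presheaf.stalk y) 𝔓
    rw [Ideal.mem_comap, ← h5]
    exact h4
  have hht : 𝔓.height = 1 := by
    have h3 := IsLocalization.AtPrime.ringKrullDim_eq_height 𝔓
      ((projectiveBundle (⨁ L)).presheaf.stalk y)
    rw [ringKrullDim_stalk_eq_coheight, hy] at h3
    exact_mod_cast h3.symm
  have heq : 𝔭.map φ = 𝔓 := by
    refine eq_of_le_of_not_lt hle fun hlt => ?_
    have hfin : 𝔓.FiniteHeight := 𝔓.finiteHeight_iff.2 (Or.inr (by simp [hht]))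
    have h3 := Ideal.height_strict_mono_of_isPrime_of_isPrime hlt
    rw [hht, Order.lt_one_iff, Ideal.height_eq_zero_iff,
      IsDomain.minimalPrimes_eq_singleton_bot] at h3
    exact hQ0 h3
  rw [← h1, ← h2, ← heq, Ideal.map_map, Ideal.map_map]
  congr 1
  exact RingHom.ext hcomm

/-- The multiplicities in the pullback of a prime divisor are equal to one. -/
theorem length_fiber_eq_one {y : projectiveBundle (⨁ L)} (hy : Order.coheight y = 1)
    (hx : Order.coheight (projectiveBundle.π (⨁ L) y) = 1) :
    Module.length ((projectiveBundle (⨁ L)).presheaf.stalk y)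
      ((projectiveBundle (⨁ L)).presheaf.stalk y ⧸
        (IsLocalRing.maximalIdeal (X.presheaf.stalk (projectiveBundle.π (⨁ L) y))).map
          ((projectiveBundle.π (⨁ L)).stalkMap y).hom) = 1 := by
  rw [map_maximalIdeal_eq L hy hx, Module.length_eq_one_iff, isSimpleModule_iff_isCoatom]
  exact (IsLocalRing.maximalIdeal.isMaximal _).out

variable [AlgebraicGeometry.IsIntegral (projectiveBundle (⨁ L))]
  [Algebra X.functionField (projectiveBundle (⨁ L)).functionField]
  [IsFunctionFieldExtension (projectiveBundle.π (⨁ L))]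

theorem algebraMap_algebraMap_stalk {P X : Scheme.{u}} [AlgebraicGeometry.IsIntegral P]
    [AlgebraicGeometry.IsIntegral X] (π : P ⟶ X) [Algebra X.functionField P.functionField]
    [IsFunctionFieldExtension π] (y : P) (t : X.presheaf.stalk (π y)) :
    algebraMap X.functionField P.functionField (algebraMap _ X.functionField t) =
      algebraMap _ P.functionField (π.stalkMap y t) := by
  obtain ⟨U, hU, a, rfl⟩ := X.presheaf.exists_germ_eq t
  have h1 := algebraMap_germ U ⟨π y, hU⟩ ⟨π y, hU⟩ a
  have h2 := algebraMap_germ (π ⁻¹ᵁ U) ⟨y, hU⟩ ⟨y, hU⟩ (π.appLE U (π ⁻¹ᵁ U) le_rfl a)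
  have h3 := germ_stalkMap_appLE π (le_refl (π ⁻¹ᵁ U)) (y := y) hU a
  have h4 := IsFunctionFieldExtension.algebraMap_toRat (π := π) (le_refl (π ⁻¹ᵁ U)) ⟨π y, hU⟩
    (⟨y, hU⟩ : (π ⁻¹ᵁ U : P.Opens)) a
  exact (congrArg _ h1).trans (h4.trans (h2.symm.trans (congrArg _ h3.symm)))

/-- A uniformizer of the base remains a uniformizer on the projective bundle. -/
theorem exists_uniformizer_bundle [IsLocallyNoetherian X] [IsNormalScheme X]
    [IsLocallyNoetherian (projectiveBundle (⨁ L))] [IsNormalScheme (projectiveBundle (⨁ L))]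
    {y : projectiveBundle (⨁ L)} (hy : Order.coheight y = 1)
    (hx : Order.coheight (projectiveBundle.π (⨁ L) y) = 1) :
    ∃ t : X.functionField, t ≠ 0 ∧ Scheme.ord t (projectiveBundle.π (⨁ L) y) = 1 ∧
      Scheme.ord (algebraMap X.functionField (projectiveBundle (⨁ L)).functionField t) y = 1 := by
  obtain ⟨t, ht, h1⟩ := exists_uniformizer hx
  have hDVR := isDiscreteValuationRing_stalk _ y hy
  have h2 := map_maximalIdeal_eq L hy hx
  rw [h1, Ideal.map_span, Set.image_singleton] at h2
  have h3 : Irreducible ((projectiveBundle.π (⨁ L)).stalkMap y t) :=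
    (IsDiscreteValuationRing.irreducible_iff_uniformizer _).2 h2.symm
  refine ⟨algebraMap _ _ t, ?_, ord_irreducible hx ht, ?_⟩
  · exact (map_ne_zero_iff _ (IsFractionRing.injective _ _)).2 ht.ne_zero
  · rw [algebraMap_algebraMap_stalk (projectiveBundle.π (⨁ L)) y]
    exact ord_irreducible hy h3

end bundle
end codimOne

/-! ### Extension of splittings to the projective bundle -/

open scoped Classical in
/-- A divisor on `P` over a prime divisor of `X` has the same coefficient in the pullback, if the fibres
in codimension one are reduced. -/
theorem flatPullback_apply {P X : Scheme.{u}} (π : P ⟶ X) [Flat π] [AlgebraicGeometry.IsNoetherian P]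
    (hlen : ∀ y : P, Order.coheight y = 1 → Order.coheight (π y) = 1 →
      Module.length (P.presheaf.stalk y) (P.presheaf.stalk y ⧸
        (IsLocalRing.maximalIdeal (X.presheaf.stalk (π y))).map (π.stalkMap y).hom) = 1)
    (Δ : QDivisor X) (y : PrimeDivisor P) :
    flatPullback π Δ y = if h : Order.coheight (π y.1) = 1 then Δ ⟨π y.1, h⟩ else 0 := by
  change (if h : Order.coheight (π y.1) = 1 then _ else _) = _
  split_ifs with h
  · rw [hlen y.1 y.2 h]
    simp
  · rfl

theorem stalkRing_eq_top_of_coheight_eq_zero {X : Scheme.{u}} [AlgebraicGeometry.IsIntegral X]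
    {x : X} (hx : Order.coheight x = 0) :
    stalkRing x = ⊤ := by
  have h1 : x ⤳ genericPoint X := Order.coheight_eq_zero.1 hx (genericPoint_specializes x)
  refine top_le_iff.1 (le_trans (fun f _ => ?_) (stalkRing_le_of_specializes h1))
  obtain ⟨U, hU, r, rfl⟩ := X.presheaf.exists_germ_eq f
  exact toRat_mem_stalkRing U ⟨_, hU⟩ ⟨_, hU⟩ r

section transfer
variable {P X : Scheme.{u}} [AlgebraicGeometry.IsIntegral P] [AlgebraicGeometry.IsIntegral X]
  (π : P ⟶ X) [Algebra X.functionField P.functionField]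

/-- Homogeneous coordinates `x j` for the projective bundle `π`, normalized by `x i₀ = 1`, which come
from a trivialization of the bundle over `U₀`. -/
structure IsProjectiveCoordinates {ι : Type*} (x : ι → P.functionField) (i₀ : ι) (U₀ : X.Opens) :
    Prop where
  eq_one : x i₀ = 1
  ne_zero : ∀ j, x j ≠ 0
  algebraicIndependent : AlgebraicIndependent X.functionField (fun j : {j // j ≠ i₀} => x j)
  exists_eq_div : ∀ f, ∃ g h : MvPolynomial {j // j ≠ i₀} X.functionField,
    f = MvPolynomial.aeval (fun j : {j // j ≠ i₀} => x j) g /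
      MvPolynomial.aeval (fun j : {j // j ≠ i₀} => x j) h
  exists_chart : ∀ y, ∃ u i, IsChartAt π x y u i
  nonempty : (U₀ : Set X).Nonempty
  exists_chart_one : ∀ y, π y ∈ U₀ → ∃ i, IsChartAt π x y 1 i

variable [IsLocallyNoetherian X] [IsLocallyNoetherian P] [IsNormalScheme X] [IsNormalScheme P]
  [Flat π]

open MvPolynomial in
/-- A splitting `φ` on the base, together with a form `G` of degree less than `q` with a coefficient
`1` at the monomial `x ^ c`, induces the splitting `f ↦ Ψ (f * G / x ^ c)` on the projective bundle, where
`Ψ` extends `φ` and kills all monomials that are not `q`-th powers. -/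
theorem exists_isSplitting_bundle {ι : Type*} [Fintype ι] {x : ι → P.functionField} {i₀ : ι} {U₀ : X.Opens}
    (hx : IsProjectiveCoordinates π x i₀ U₀)
    (ht : ∀ y : P, Order.coheight y = 1 → Order.coheight (π y) = 1 →
      ∃ t : X.functionField, t ≠ 0 ∧ Scheme.ord t (π y) = 1 ∧
        Scheme.ord (algebraMap X.functionField P.functionField t) y = 1)
    {p e : ℕ} [Fact p.Prime] [CharP X.functionField p]
    {E : WeilDivisor X} {E' : WeilDivisor P} {φ : X.functionField →+ X.functionField}
    (hφ : IsSplitting (p ^ e) E φ) {m : ℕ} (hm : m < p ^ e) {G : MvPolynomial ι X.functionField}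
    (hG : G.IsHomogeneous m) {c : ι →₀ ℕ} (hc : coeff c G = 1)
    (hhor : ∀ (y : P) (hy : Order.coheight y = 1), Order.coheight (π y) = 0 →
      ∃ u i, IsChartAt π x y u i ∧ E' ⟨y, hy⟩ ≤ Scheme.ord (aeval x G / x i ^ m) y)
    (hver : ∀ (y : P) (hy : Order.coheight y = 1) (hy' : Order.coheight (π y) = 1),
      ∃ u i, IsChartAt π x y u i ∧ ∃ l ≠ 0, ∃ b ∈ chartRing x u i (stalkRing (π y)),
        aeval x G = algebraMap _ _ l * b * x i ^ m ∧
        E' ⟨y, hy⟩ ≤ E ⟨π y, hy'⟩ + Scheme.ord (l * (∏ j, u j ^ c j) / u i ^ m) (π y)) :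
    ∃ Ψ, IsSplitting (p ^ e) E' Ψ := by
  obtain ⟨Ψ, hΨ, hΨφ, hΨ0⟩ := hφ.isInvLinear.exists_extension_monomial hx.eq_one hx.ne_zero
    hx.algebraicIndependent hx.exists_eq_div
  have hG0 : aeval x G ≠ 0 := by
    intro h
    have h1 := trace_form_eq_one hΨφ hΨ0 hx.ne_zero hφ.map_one hm hG hc
    rw [h, zero_div, map_zero] at h1
    exact zero_ne_one h1
  have hsum : ∑ j, c j = m := sum_eq_of_isHomogeneous hG (by
    rw [mem_support_iff, hc]; exact one_ne_zero)
  have hcq : ∀ j, c j < p ^ e := fun j =>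
    (Finset.single_le_sum (fun _ _ => Nat.zero_le _) (Finset.mem_univ j)).trans_lt (hsum.trans_lt hm)
  have hq : 0 < p ^ e := (Nat.zero_le m).trans_lt hm
  refine ⟨Ψ.comp (AddMonoidHom.mulRight (aeval x G / ∏ j, x j ^ c j)), ?_, ?_, ?_⟩
  · intro a f
    change Ψ (a ^ (p ^ e) * f * _) = a * Ψ (f * _)
    rw [mul_assoc, hΨ]
  · change Ψ (1 * _) = 1
    rw [one_mul]
    exact trace_form_eq_one hΨφ hΨ0 hx.ne_zero hφ.map_one hm hG hc
  · intro y hy f hf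
    change Ψ (f * _) ∈ _
    rw [← mul_div_assoc]
    have hle := coheight_map_le_one_of_flat π hy
    by_cases hy' : Order.coheight (π y) = 1
    · -- `y` is the generic point of a fibre, and a uniformizer `t` of `π y` measures the pole of `f`
      obtain ⟨u, i, hch, l, hl, b, hb, hGb, hE⟩ := hver y hy hy'
      obtain ⟨t, ht0, ht1, ht2⟩ := ht y hy hy'
      have ht0' : algebraMap X.functionField P.functionField t ≠ 0 := by simpa using ht0
      set n := E' ⟨y, hy⟩
      have hf' : f * algebraMap X.functionField P.functionField t ^ n ∈ stalkRing y :=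
        (mul_zpow_mem_stalkRing_iff hy ht0' ht2).2 hf
      refine trace_mem_of_localization hq hφ.isInvLinear hΨ hΨφ hΨ0 hx.ne_zero hch.ne_zero i hcq
        hch.le hch.exists_frac (l := t ^ (-n) * l) (fun z hz => ?_) (mul_mem hf' (hch.le hb)) ?_
      · refine hφ.map_mem _ hy' _ fun h0 => ?_
        have hz0 : z ≠ 0 := by rintro rfl; simp at h0
        have hz1 := (ord_nonneg_iff hy' hz0).2 hz
        have hw0 : l * (∏ j, u j ^ c j) / u i ^ m ≠ 0 := by
          refine div_ne_zero (mul_ne_zero hl (Finset.prod_ne_zero_iff.2 fun j _ => ?_)) ?_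
          · exact pow_ne_zero _ (hch.ne_zero j)
          · exact pow_ne_zero _ (hch.ne_zero i)
        have e1 : t ^ (-n) * l * z * (∏ j, u j ^ c j) / u i ^ ∑ j, c j =
            t ^ (-n) * (z * (l * (∏ j, u j ^ c j) / u i ^ m)) := by
          rw [hsum]; ring
        rw [e1, Scheme.ord_mul (zpow_ne_zero _ ht0) (mul_ne_zero hz0 hw0),
          Scheme.ord_mul hz0 hw0, ord_zpow, ht1]
        omega
      · rw [hGb, hsum, map_mul, map_zpow₀, zpow_neg]
        field_simp
    · -- `y` dominates the base, and only the zeros of the form `G` matter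
      have hy0 : Order.coheight (π y) = 0 := by
        rcases hle.lt_or_eq with h | h
        · exact Order.lt_one_iff.1 h
        · exact absurd h hy'
      obtain ⟨u, i, hch, hE⟩ := hhor y hy hy0
      refine trace_mem_of_localization hq hφ.isInvLinear hΨ hΨφ hΨ0 hx.ne_zero hch.ne_zero i hcq
        hch.le hch.exists_frac (l := 1) (b := f * (aeval x G / x i ^ m)) (fun z _ => ?_) ?_ ?_
      · rw [stalkRing_eq_top_of_coheight_eq_zero hy0]; trivial
      · by_cases hf0 : f = 0
        · rw [hf0, zero_mul]; exact zero_mem _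
        · have hw0 : aeval x G / x i ^ m ≠ 0 := div_ne_zero hG0 (pow_ne_zero _ (hx.ne_zero i))
          refine (ord_nonneg_iff hy (mul_ne_zero hf0 hw0)).1 ?_
          rw [Scheme.ord_mul hf0 hw0]
          have := hf hf0
          omega
      · rw [map_one, one_mul, hsum, mul_assoc, div_mul_cancel₀ _ (pow_ne_zero _ (hx.ne_zero i))]

end transfer

/-! ### Forms vanishing along a divisor -/

theorem exists_nonneg_finsupp {α β : Type*} (T : Finset α) (f : α → β) (B : α → ℤ) :
    ∃ D : β →₀ ℤ, 0 ≤ D ∧ ∀ a ∈ T, B a ≤ D (f a) := by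
  classical
  induction T using Finset.induction_on with
  | empty => exact ⟨0, le_rfl, by simp⟩
  | insert a T ha ih =>
    obtain ⟨D, hD, h⟩ := ih
    refine ⟨D + Finsupp.single (f a) (max 0 (B a)), add_nonneg hD ?_, fun b hb => ?_⟩
    · exact Finsupp.single_nonneg.2 (le_max_left _ _)
    · have h1 : 0 ≤ Finsupp.single (f a) (max 0 (B a)) (f b) :=
        Finsupp.single_nonneg.2 (le_max_left _ _) (f b)
      rcases Finset.mem_insert.1 hb with rfl | hb
      · rw [Finsupp.add_apply, Finsupp.single_eq_same]
        have := hD (f b)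
        have := le_max_right 0 (B b)
        change 0 ≤ D (f b) at *
        omega
      · have := h b hb
        rw [Finsupp.add_apply]
        omega

theorem exists_open_regular {X : Scheme.{u}} [AlgebraicGeometry.IsIntegral X] {α : Type*}
    (s : Finset α) (g : α → X.functionField) :
    ∃ U : X.Opens, genericPoint X ∈ U ∧ ∀ x ∈ U, ∀ a ∈ s, g a ∈ stalkRing x := by
  classical
  induction s using Finset.induction_on with
  | empty => exact ⟨⊤, trivial, by simp⟩
  | insert a s ha ih =>
    obtain ⟨U, hU, h⟩ := ih
    obtain ⟨W, hW, r, hr⟩ := X.presheaf.exists_germ_eq (g a)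
    refine ⟨U ⊓ W, ⟨hU, hW⟩, fun x hx b hb => ?_⟩
    rcases Finset.mem_insert.1 hb with rfl | hb
    · rw [← hr]
      exact toRat_mem_stalkRing W ⟨_, hW⟩ ⟨_, hx.2⟩ r
    · exact h x hx.1 b hb

section forms
variable {P X : Scheme.{u}} [AlgebraicGeometry.IsIntegral P] [AlgebraicGeometry.IsIntegral X]
  {π : P ⟶ X} [Algebra X.functionField P.functionField]
  [IsLocallyNoetherian P] [IsNormalScheme P] {ι : Type*} [Fintype ι]
  {x : ι → P.functionField} {i₀ : ι} {U₀ : X.Opens}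
open MvPolynomial

theorem ord_form_nonneg (hx : IsProjectiveCoordinates π x i₀ U₀) {y : P}
    (hy : Order.coheight y = 1) (hy' : Order.coheight (π y) = 0) {u : ι → X.functionField} {i : ι}
    (hch : IsChartAt π x y u i) {m : ℕ} {G : MvPolynomial ι X.functionField}
    (hG : G.IsHomogeneous m) (hG0 : aeval x G ≠ 0) : 0 ≤ Scheme.ord (aeval x G / x i ^ m) y := by
  have hxi : x i ^ m ≠ 0 := pow_ne_zero _ (hx.ne_zero i)
  obtain ⟨b, hb, h⟩ := exists_mem_chartRing_of_isHomogeneous hx.ne_zero hch.ne_zero i hG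
    (O := stalkRing (π y)) (l := 1) one_ne_zero
    (fun _ _ => by rw [stalkRing_eq_top_of_coheight_eq_zero hy']; trivial)
  rw [map_one, one_mul] at h
  refine (ord_nonneg_iff hy (div_ne_zero hG0 hxi)).2 ?_
  rw [h, mul_div_cancel_right₀ _ hxi]
  exact hch.le hb

/-- Homogenization of a uniformizer at a point `y` of codimension one that dominates the base. -/
theorem exists_form_ord_pos (hx : IsProjectiveCoordinates π x i₀ U₀) {y : P}
    (hy : Order.coheight y = 1) (hy' : Order.coheight (π y) = 0) {u : ι → X.functionField} {i : ι}
    (hch : IsChartAt π x y u i) : ∃ (m : ℕ) (G : MvPolynomial ι X.functionField),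
      G.IsHomogeneous m ∧ aeval x G ≠ 0 ∧ Scheme.ord (aeval x G / x i ^ m) y = 1 := by
  obtain ⟨t, ht0, ht⟩ := exists_ord_eq_one hy
  have ht1 : t ∈ stalkRing y := (ord_nonneg_iff hy ht0).1 (by omega)
  obtain ⟨h, hh, w, hw, hw0, hw1, rfl⟩ := hch.exists_frac t ht1
  have hh0 : h ≠ 0 := by rintro rfl; simp at ht0
  rw [stalkRing_eq_top_of_coheight_eq_zero hy'] at hh
  obtain ⟨m, G, hG, e⟩ := exists_isHomogeneous_of_mem_chartRing hx.ne_zero i hch.ne_zero hh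
  have hxi : x i ^ m ≠ 0 := pow_ne_zero _ (hx.ne_zero i)
  refine ⟨m, G, hG, by rw [e]; exact mul_ne_zero hh0 hxi, ?_⟩
  rw [e, mul_div_cancel_right₀ _ hxi]
  have h1 := (ord_nonneg_iff hy hw0).2 (hch.le hw)
  have h2 := (ord_nonneg_iff hy (inv_ne_zero hw0)).2 hw1
  rw [ord_inv] at h2
  rw [ord_div hh0 hw0] at ht
  omega

theorem exists_form_ord_ge (hx : IsProjectiveCoordinates π x i₀ U₀)
    {u : P → ι → X.functionField} {i : P → ι} (hch : ∀ y, IsChartAt π x y (u y) (i y))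
    (T : Finset P) (hT : ∀ y ∈ T, Order.coheight y = 1 ∧ Order.coheight (π y) = 0) (n : P → ℕ) :
    ∃ (m : ℕ) (G : MvPolynomial ι X.functionField), G.IsHomogeneous m ∧ aeval x G ≠ 0 ∧
      ∀ y ∈ T, (n y : ℤ) ≤ Scheme.ord (aeval x G / x (i y) ^ m) y := by
  classical
  induction T using Finset.induction_on with
  | empty => exact ⟨0, 1, isHomogeneous_one _ _, by simp, by simp⟩
  | insert z T hz ih =>
    obtain ⟨m, G, hG, hG0, h⟩ := ih fun y hy => hT y (Finset.mem_insert_of_mem hy)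
    obtain ⟨hz1, hz2⟩ := hT z (Finset.mem_insert_self z T)
    obtain ⟨d, H, hH, hH0, h'⟩ := exists_form_ord_pos hx hz1 hz2 (hch z)
    have e : ∀ y, aeval x (H ^ n z * G) / x (i y) ^ (d * n z + m) =
        (aeval x H / x (i y) ^ d) ^ n z * (aeval x G / x (i y) ^ m) := fun y => by
      rw [map_mul, map_pow, pow_add, pow_mul, div_pow, div_mul_div_comm]
    refine ⟨d * n z + m, H ^ n z * G, (hH.pow (n z)).mul hG, ?_, fun y hy => ?_⟩
    · rw [map_mul, map_pow]
      exact mul_ne_zero (pow_ne_zero _ hH0) hG0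
    · have hxi : ∀ m, x (i y) ^ m ≠ 0 := fun m => pow_ne_zero _ (hx.ne_zero _)
      obtain ⟨hy1, hy2⟩ := hT y hy
      have hH1 := ord_form_nonneg hx hy1 hy2 (hch y) hH hH0
      have hG1 := ord_form_nonneg hx hy1 hy2 (hch y) hG hG0
      rw [e, Scheme.ord_mul (pow_ne_zero _ (div_ne_zero hH0 (hxi d))) (div_ne_zero hG0 (hxi m)),
        ord_pow]
      rcases Finset.mem_insert.1 hy with rfl | hy
      · rw [h']
        omega
      · have := h y hy
        have := mul_nonneg (Int.natCast_nonneg (n z)) hH1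
        omega

/-- There is a form that vanishes along the components of `D` which dominate the base, to the order
prescribed by `D`. It is scaled in such a way that one of its coefficients is `1`. -/
theorem exists_form [IsFunctionFieldExtension π] (hx : IsProjectiveCoordinates π x i₀ U₀)
    {u : P → ι → X.functionField} {i : P → ι} (hch : ∀ y, IsChartAt π x y (u y) (i y))
    (D : WeilDivisor P) :
    ∃ (m : ℕ) (G : MvPolynomial ι X.functionField) (c : ι →₀ ℕ), G.IsHomogeneous m ∧
      coeff c G = 1 ∧ ∀ (y : P) (hy : Order.coheight y = 1), Order.coheight (π y) = 0 →
        D ⟨y, hy⟩ ≤ Scheme.ord (aeval x G / x (i y) ^ m) y := by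
  classical
  obtain ⟨m, G, hG, hG0, h⟩ := exists_form_ord_ge hx hch
    ((D.support.image Subtype.val).filter fun y => Order.coheight (π y) = 0) (by
      intro y hy
      obtain ⟨h1, h2⟩ := Finset.mem_filter.1 hy
      obtain ⟨z, -, rfl⟩ := Finset.mem_image.1 h1
      exact ⟨z.2, h2⟩)
    (fun y => if hy : Order.coheight y = 1 then (D ⟨y, hy⟩).toNat else 0)
  have hGne : G ≠ 0 := by rintro rfl; simp at hG0
  obtain ⟨c, hc⟩ := Finset.nonempty_iff_ne_empty.2 (mt support_eq_empty.1 hGne)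
  have hc0 : coeff c G ≠ 0 := mem_support_iff.1 hc
  have e : aeval x (C (coeff c G)⁻¹ * G) =
      algebraMap X.functionField P.functionField (coeff c G)⁻¹ * aeval x G := by
    rw [map_mul, aeval_C]
  have ha0 : algebraMap X.functionField P.functionField (coeff c G)⁻¹ ≠ 0 := by simpa using hc0
  refine ⟨m, C (coeff c G)⁻¹ * G, c, ?_, ?_, fun y hy hy' => ?_⟩
  · simpa using (isHomogeneous_C ι (coeff c G)⁻¹).mul hG
  · rw [coeff_C_mul, inv_mul_cancel₀ hc0]
  · have hxi : x (i y) ^ m ≠ 0 := pow_ne_zero _ (hx.ne_zero _)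
    have h1 : 0 ≤ Scheme.ord (algebraMap X.functionField P.functionField (coeff c G)⁻¹) y :=
      (ord_nonneg_iff hy ha0).2 (algebraMap_mem_stalkRing π y (by
        rw [stalkRing_eq_top_of_coheight_eq_zero hy']; trivial))
    rw [e, mul_div_assoc, Scheme.ord_mul ha0 (div_ne_zero hG0 hxi)]
    by_cases hyD : D ⟨y, hy⟩ = 0
    · have := ord_form_nonneg hx hy hy' (hch y) hG hG0
      omega
    · have h2 := h y (Finset.mem_filter.2 ⟨Finset.mem_image.2 ⟨⟨y, hy⟩,
        Finsupp.mem_support_iff.2 hyD, rfl⟩, hy'⟩)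
      rw [dif_pos hy] at h2
      have := Int.self_le_toNat (D ⟨y, hy⟩)
      omega

end forms

/-! ### Splittings for pullbacks of divisors -/

theorem exists_common_denominator {X : Scheme.{u}} [AlgebraicGeometry.IsIntegral X] (y : X)
    {α : Type*} (s : Finset α) (g : α → X.functionField) :
    ∃ l : X.functionField, l ≠ 0 ∧ ∀ a ∈ s, g a / l ∈ stalkRing y := by
  obtain ⟨c, hc⟩ := IsLocalization.exist_integer_multiples (nonZeroDivisors (X.presheaf.stalk y)) s g
  have hc0 : algebraMap (X.presheaf.stalk y) X.functionField c ≠ 0 :=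
    (map_ne_zero_iff _ (IsFractionRing.injective _ _)).2 (nonZeroDivisors.ne_zero c.2)
  refine ⟨_, inv_ne_zero hc0, fun a ha => ?_⟩
  obtain ⟨b, hb⟩ := hc a ha
  refine ⟨b, hb.trans ?_⟩
  rw [div_inv_eq_mul, mul_comm]
  exact Algebra.smul_def _ _

theorem IsProjectiveCoordinates.exists_chart_family {P X : Scheme.{u}} [AlgebraicGeometry.IsIntegral P]
    [AlgebraicGeometry.IsIntegral X] {π : P ⟶ X} [Algebra X.functionField P.functionField]
    {ι : Type*} {x : ι → P.functionField} {i₀ : ι} {U₀ : X.Opens}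
    (hx : IsProjectiveCoordinates π x i₀ U₀) :
    ∃ (u : P → ι → X.functionField) (i : P → ι), (∀ y, IsChartAt π x y (u y) (i y)) ∧
      ∀ y, π y ∈ U₀ → u y = 1 := by
  have h : ∀ y, ∃ u i, IsChartAt π x y u i ∧ (π y ∈ U₀ → u = 1) := fun y => by
    by_cases hy : π y ∈ U₀
    · obtain ⟨i, hi⟩ := hx.exists_chart_one y hy
      exact ⟨1, i, hi, fun _ => rfl⟩
    · obtain ⟨u, i, hi⟩ := hx.exists_chart y
      exact ⟨u, i, hi, fun h => absurd h hy⟩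
  choose u i h1 h2 using h
  exact ⟨u, i, h1, h2⟩

section divisors
variable {P X : Scheme.{u}} [AlgebraicGeometry.IsIntegral P] [AlgebraicGeometry.IsIntegral X]
  {π : P ⟶ X} [Algebra X.functionField P.functionField] [IsFunctionFieldExtension π]
  [Flat π] [AlgebraicGeometry.IsNoetherian P] [IsNormalScheme P] [IsLocallyNoetherian X]
  [IsNormalScheme X]
  {ι : Type*} [Fintype ι]
  {x : ι → P.functionField} {i₀ : ι} {U₀ : X.Opens}
open MvPolynomial

/-- The vertical part of an effective divisor on the projective bundle, and the poles along vertical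
divisors of the coefficients of a form, are bounded by the pullback of a divisor on the base. -/
theorem exists_bound_vertical (hx : IsProjectiveCoordinates π x i₀ U₀)
    {u : P → ι → X.functionField} {i : P → ι} (hch : ∀ y, IsChartAt π x y (u y) (i y))
    (hu : ∀ y, π y ∈ U₀ → u y = 1) (D : WeilDivisor P) {m : ℕ}
    {G : MvPolynomial ι X.functionField} (hG : G.IsHomogeneous m) (c : ι →₀ ℕ) :
    ∃ D' : WeilDivisor X, 0 ≤ D' ∧
      ∀ (y : P) (hy : Order.coheight y = 1) (hy' : Order.coheight (π y) = 1), ∃ l ≠ 0,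
        ∃ b ∈ chartRing x (u y) (i y) (stalkRing (π y)),
        aeval x G = algebraMap _ _ l * b * x (i y) ^ m ∧
        D ⟨y, hy⟩ ≤ D' ⟨π y, hy'⟩ +
          Scheme.ord (l * (∏ j, u y j ^ c j) / u y (i y) ^ m) (π y) := by
  classical
  obtain ⟨U₁, hη, hU₁⟩ := exists_open_regular G.support fun a => coeff a G
  have hη0 : genericPoint X ∈ U₀ := genericPoint_mem ⟨_, hx.nonempty.some_mem⟩
  -- `l` may be taken to be `1` over a dense open set, so `D'` has to correct finitely many orders only
  have key : ∀ y : P, ∃ l : X.functionField, l ≠ 0 ∧ (π y ∈ U₀ ⊓ U₁ → l = 1) ∧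
      (Order.coheight (π y) = 1 → ∀ a ∈ G.support,
        coeff a G * (∏ j, u y j ^ a j)⁻¹ * u y (i y) ^ m / l ∈ stalkRing (π y)) := fun y => by
    by_cases h : π y ∈ U₀ ⊓ U₁
    · refine ⟨1, one_ne_zero, fun _ => rfl, fun _ a ha => ?_⟩
      simpa [hu y h.1] using hU₁ _ h.2 a ha
    · by_cases h1 : Order.coheight (π y) = 1
      · obtain ⟨l, hl, h2⟩ := exists_common_denominator (π y) G.support fun a =>
          coeff a G * (∏ j, u y j ^ a j)⁻¹ * u y (i y) ^ m
        exact ⟨l, hl, fun h' => absurd h' h, fun _ => h2⟩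
      · exact ⟨1, one_ne_zero, fun _ => rfl, fun h' => absurd h' h1⟩
  choose l hl0 hl1 hl2 using key
  have hfin := finite_codim_one_not_mem (π ⁻¹ᵁ (U₀ ⊓ U₁)) (by
    have h : π (genericPoint P) ∈ U₀ ⊓ U₁ := by
      rw [map_genericPoint_of_flat]
      exact ⟨hη0, hη⟩
    exact ⟨genericPoint P, h⟩)
  let T' : Finset P := hfin.toFinset ∪ D.support.image Subtype.val
  let T : Finset {y : P // Order.coheight (π y) = 1} := T'.subtype _
  let B : P → ℤ := fun y => (if hy : Order.coheight y = 1 then D ⟨y, hy⟩ else 0) -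
    Scheme.ord (l y * (∏ j, u y j ^ c j) / u y (i y) ^ m) (π y)
  obtain ⟨D', hD', h⟩ := exists_nonneg_finsupp T
    (fun y => (⟨π y.1, y.2⟩ : PrimeDivisor X)) (fun y => B y.1)
  refine ⟨D', hD', fun y hy hy' => ?_⟩
  obtain ⟨b, hb, e⟩ := exists_mem_chartRing_of_isHomogeneous hx.ne_zero (hch y).ne_zero (i y) hG
    (hl0 y) (hl2 y hy')
  refine ⟨l y, hl0 y, b, hb, e, ?_⟩
  have h1 : B y ≤ D' ⟨π y, hy'⟩ := by
    by_cases hyT : y ∈ T'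
    · exact h ⟨y, hy'⟩ (Finset.mem_subtype.2 hyT)
    · have h2 : π y ∈ U₀ ⊓ U₁ := by
        by_contra h3
        exact hyT (Finset.mem_union_left _ (hfin.mem_toFinset.2 ⟨hy, h3⟩))
      have h3 : D ⟨y, hy⟩ = 0 := by
        by_contra h3
        exact hyT (Finset.mem_union_right _ (Finset.mem_image.2 ⟨⟨y, hy⟩,
          Finsupp.mem_support_iff.2 h3, rfl⟩))
      have h4 : B y = 0 := by
        simp only [B]
        rw [dif_pos hy, h3, hl1 y h2, hu y h2.1]
        simp [ord_one_eq_zero]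
      rw [h4]
      exact hD' _
  simp only [B] at h1
  rw [dif_pos hy] at h1
  omega

variable {p : ℕ} [Fact p.Prime] [CharP X.functionField p]

/-- The case of the constant form `1`: global sharp `F`-splittings ascend. -/
theorem IsSplitting.flatPullback (hx : IsProjectiveCoordinates π x i₀ U₀)
    (ht : ∀ y : P, Order.coheight y = 1 → Order.coheight (π y) = 1 →
      ∃ t : X.functionField, t ≠ 0 ∧ Scheme.ord t (π y) = 1 ∧
        Scheme.ord (algebraMap X.functionField P.functionField t) y = 1)
    (hlen : ∀ y : P, Order.coheight y = 1 → Order.coheight (π y) = 1 →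
      Module.length (P.presheaf.stalk y) (P.presheaf.stalk y ⧸
        (IsLocalRing.maximalIdeal (X.presheaf.stalk (π y))).map (π.stalkMap y).hom) = 1)
    {Δ : QDivisor X} {e : ℕ} {φ : X.functionField →+ X.functionField}
    (hφ : IsSplitting (p ^ e) (((p : ℚ) ^ e - 1) • Δ).ceil φ) :
    ∃ Ψ, IsSplitting (p ^ e) (((p : ℚ) ^ e - 1) • (_root_.flatPullback π Δ)).ceil Ψ := by
  obtain ⟨u, i, hch, -⟩ := hx.exists_chart_family
  refine exists_isSplitting_bundle π hx ht hφ (m := 0) (G := 1) (c := 0) ?_ (isHomogeneous_one _ _)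
    (by simp) (fun y hy hy' => ⟨u y, i y, hch y, ?_⟩) fun y hy hy' => ⟨u y, i y, hch y,
      1, one_ne_zero, 1, one_mem _, by simp, ?_⟩
  · exact pow_pos (Fact.out : p.Prime).pos e
  · have h1 := flatPullback_apply π hlen Δ ⟨y, hy⟩
    rw [dif_neg (by rw [hy']; exact zero_ne_one)] at h1
    simp [QDivisor.ceil, h1, ord_one_eq_zero]
  · have h1 := flatPullback_apply π hlen Δ ⟨y, hy⟩
    rw [dif_pos hy'] at h1
    simp [QDivisor.ceil, h1, ord_one_eq_zero]

/-- Global `F`-regularity ascends. The form `G` and the divisor `D'` on the base depend only on `D`. A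
splitting for `D'` is iterated until `p ^ e` exceeds the degree of `G`. -/
theorem exists_isSplitting_flatPullback_add (hx : IsProjectiveCoordinates π x i₀ U₀)
    (ht : ∀ y : P, Order.coheight y = 1 → Order.coheight (π y) = 1 →
      ∃ t : X.functionField, t ≠ 0 ∧ Scheme.ord t (π y) = 1 ∧
        Scheme.ord (algebraMap X.functionField P.functionField t) y = 1)
    (hlen : ∀ y : P, Order.coheight y = 1 → Order.coheight (π y) = 1 →
      Module.length (P.presheaf.stalk y) (P.presheaf.stalk y ⧸
        (IsLocalRing.maximalIdeal (X.presheaf.stalk (π y))).map (π.stalkMap y).hom) = 1)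
    {Δ : QDivisor X}
    (h : ∀ D : WeilDivisor X, 0 ≤ D → ∃ e, 0 < e ∧
      ∃ φ, IsSplitting (p ^ e) ((((p : ℚ) ^ e - 1) • Δ).ceil + D) φ) (D : WeilDivisor P) :
    ∃ e, 0 < e ∧
      ∃ Ψ, IsSplitting (p ^ e) ((((p : ℚ) ^ e - 1) • (_root_.flatPullback π Δ)).ceil + D) Ψ := by
  obtain ⟨u, i, hch, hu⟩ := hx.exists_chart_family
  obtain ⟨m, G, c, hG, hc, hhor⟩ := exists_form hx hch D
  obtain ⟨D', hD', hver⟩ := exists_bound_vertical hx hch hu D hG c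
  obtain ⟨e₀, he₀, φ₀, hφ₀⟩ := h D' hD'
  have hφ₁ : IsSplitting (p ^ e₀) (((((p ^ e₀ : ℕ) : ℚ) - 1) • Δ).ceil + D') φ₀ := by
    rwa [Nat.cast_pow]
  obtain ⟨φ, hφ⟩ := hφ₁.iterate hD' m
  have hφ' : IsSplitting (p ^ (e₀ * (m + 1)))
      ((((p : ℚ) ^ (e₀ * (m + 1)) - 1) • Δ).ceil + D') φ := by
    rwa [Nat.cast_pow, ← pow_mul, ← pow_mul] at hφ
  refine ⟨e₀ * (m + 1), Nat.mul_pos he₀ m.succ_pos, exists_isSplitting_bundle π hx ht hφ' ?_ hG hc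
    (fun y hy hy' => ⟨u y, i y, hch y, ?_⟩) fun y hy hy' => ?_⟩
  · calc m < p ^ m := Nat.lt_pow_self (Fact.out : p.Prime).one_lt
      _ ≤ p ^ (e₀ * (m + 1)) := Nat.pow_le_pow_right (Fact.out : p.Prime).pos (by nlinarith)
  · have h1 := flatPullback_apply π hlen Δ ⟨y, hy⟩
    rw [dif_neg (by rw [hy']; exact zero_ne_one)] at h1
    have h2 := hhor y hy hy'
    simpa [QDivisor.ceil, h1] using h2
  · have h1 := flatPullback_apply π hlen Δ ⟨y, hy⟩
    rw [dif_pos hy'] at h1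
    obtain ⟨l, hl, b, hb, e1, e2⟩ := hver y hy hy'
    refine ⟨u y, i y, hch y, l, hl, b, hb, e1, ?_⟩
    have e3 : (((p : ℚ) ^ (e₀ * (m + 1)) - 1) • (_root_.flatPullback π Δ)).ceil ⟨y, hy⟩ =
        (((p : ℚ) ^ (e₀ * (m + 1)) - 1) • Δ).ceil ⟨π y, hy'⟩ := by
      simp [QDivisor.ceil, h1]
    rw [Finsupp.add_apply, Finsupp.add_apply, e3]
    omega

end divisors

/-! ### Morphisms to projective space given by rational functions -/

section awayEval
open HomogeneousLocalization MvPolynomial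
variable {σ k F F' : Type*} [CommRing k] [CommRing F] [CommRing F'] (κ : k →+* F) (f : σ → F)

/-- Evaluation at the point with homogeneous coordinates `f` of the functions of degree zero on the
open subset `D₊(β)` of projective space. -/
noncomputable def awayEval {β : MvPolynomial σ k} (h : IsUnit (eval₂Hom κ f β)) :
    Away (homogeneousSubmodule σ k) β →+* F :=
  (IsLocalization.Away.lift (S := Localization.Away β) β h).comp
    (algebraMap (Away (homogeneousSubmodule σ k) β) (Localization.Away β))

variable {κ f}

theorem awayEval_mk_mul {β : MvPolynomial σ k} (h : IsUnit (eval₂Hom κ f β)) {d : ℕ}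
    (hβ : β ∈ homogeneousSubmodule σ k d) (m : ℕ) (g : MvPolynomial σ k)
    (hg : g ∈ homogeneousSubmodule σ k (m • d)) :
    awayEval κ f h (Away.mk _ hβ m g hg) * eval₂Hom κ f β ^ m = eval₂Hom κ f g := by
  have h1 : ∀ p, IsLocalization.Away.lift (S := Localization.Away β) β h
      (algebraMap _ (Localization.Away β) p) = eval₂Hom κ f p :=
    IsLocalization.Away.lift_eq β h
  have h2 : (Away.mk (homogeneousSubmodule σ k) hβ m g hg).val *
      algebraMap _ (Localization.Away β) (β ^ m) = algebraMap _ (Localization.Away β) g := by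
    rw [Away.val_mk, Localization.mk_eq_mk']
    exact IsLocalization.mk'_spec (Localization.Away β) g
      (⟨β ^ m, m, rfl⟩ : Submonoid.powers β)
  have h3 := congrArg (IsLocalization.Away.lift (S := Localization.Away β) β h) h2
  rw [map_mul, h1, h1, map_pow] at h3
  exact h3

theorem awayEval_scalar {β : MvPolynomial σ k} (h : IsUnit (eval₂Hom κ f β)) (a : k) :
    awayEval κ f h (scalarAway (homogeneousSubmodule σ k) β a) = κ a := by
  have h1 : (scalarAway (homogeneousSubmodule σ k) β a).val =
      algebraMap _ (Localization.Away β) (C a) :=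
    Localization.mk_one_eq_algebraMap (C a)
  have h2 := congrArg (IsLocalization.Away.lift (S := Localization.Away β) β h) h1
  rw [IsLocalization.Away.lift_eq, eval₂Hom_C] at h2
  exact h2

theorem awayEval_awayMap {β γ δ : MvPolynomial σ k} {d : ℕ} (hγ : γ ∈ homogeneousSubmodule σ k d)
    (e : δ = β * γ) (h : IsUnit (eval₂Hom κ f β)) (h' : IsUnit (eval₂Hom κ f δ)) :
    (awayEval κ f h').comp (awayMap _ hγ e) = awayEval κ f h := by
  have h1 : (IsLocalization.Away.lift (S := Localization.Away δ) δ h').comp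
      (Localization.awayLift (algebraMap _ (Localization.Away δ)) β (isUnit_of_dvd_unit
        (map_dvd _ ⟨_, e⟩) (IsLocalization.Away.algebraMap_isUnit δ))) =
      IsLocalization.Away.lift (S := Localization.Away β) β h := by
    refine IsLocalization.ringHom_ext (Submonoid.powers β) (RingHom.ext fun p => ?_)
    rw [RingHom.comp_apply, RingHom.comp_apply, RingHom.comp_apply, Localization.awayLift,
      IsLocalization.Away.lift_eq, IsLocalization.Away.lift_eq, IsLocalization.Away.lift_eq]
  refine RingHom.ext fun z => ?_
  refine (congrArg (IsLocalization.Away.lift (S := Localization.Away δ) δ h')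
    (val_awayMap (𝒜 := homogeneousSubmodule σ k) hγ e z)).trans ?_
  exact DFunLike.congr_fun h1 z.val

theorem comp_awayEval (ψ : F →+* F') {β : MvPolynomial σ k} (h : IsUnit (eval₂Hom κ f β))
    (h' : IsUnit (eval₂Hom (ψ.comp κ) (ψ ∘ f) β)) :
    ψ.comp (awayEval κ f h) = awayEval (ψ.comp κ) (ψ ∘ f) h' := by
  have h1 : ψ.comp (IsLocalization.Away.lift (S := Localization.Away β) β h) =
      IsLocalization.Away.lift (S := Localization.Away β) β h' := by
    refine IsLocalization.ringHom_ext (Submonoid.powers β) (RingHom.ext fun p => ?_)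
    rw [RingHom.comp_apply, RingHom.comp_apply, RingHom.comp_apply,
      IsLocalization.Away.lift_eq, IsLocalization.Away.lift_eq]
    exact MvPolynomial.hom_eval₂ p κ ψ f
  exact RingHom.ext fun z => DFunLike.congr_fun h1 z.val

theorem eval₂Hom_smul_of_isHomogeneous {g : MvPolynomial σ k} {d : ℕ}
    (hg : g ∈ homogeneousSubmodule σ k d) (c : F) :
    eval₂Hom κ (fun j => c * f j) g = c ^ d * eval₂Hom κ f g := by
  rw [coe_eval₂Hom, coe_eval₂Hom, eval₂_eq, eval₂_eq, Finset.mul_sum]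
  refine Finset.sum_congr rfl fun m hm => ?_
  have h1 : ∑ j ∈ m.support, m j = d := by
    have := hg (mem_support_iff.1 hm)
    rw [Finsupp.weight_apply, Finsupp.sum] at this
    simpa only [Pi.one_apply, smul_eq_mul, mul_one] using this
  simp only [mul_pow, Finset.prod_mul_distrib, Finset.prod_pow_eq_pow_sum, h1]
  ring

theorem awayEval_smul {β : MvPolynomial σ k} {d : ℕ} (hβ : β ∈ homogeneousSubmodule σ k d)
    (c : F) (h : IsUnit (eval₂Hom κ f β)) (h' : IsUnit (eval₂Hom κ (fun j => c * f j) β)) :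
    awayEval κ (fun j => c * f j) h' = awayEval κ f h := by
  refine RingHom.ext fun z => ?_
  obtain ⟨m, g, hg, rfl⟩ := Away.mk_surjective _ hβ z
  have h1 := awayEval_mk_mul h hβ m g hg
  have h2 := awayEval_mk_mul h' hβ m g hg
  refine (h'.pow m).mul_right_cancel (h2.trans ?_)
  rw [eval₂Hom_smul_of_isHomogeneous hg, eval₂Hom_smul_of_isHomogeneous hβ, ← h1, mul_pow, ← pow_mul,
    smul_eq_mul, mul_comm m d]
  ring

end awayEval

section glue
variable {Y Z : Scheme.{u}} [AlgebraicGeometry.IsIntegral Y]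

/-- Morphisms to a separated scheme on the members of an open covering of an integral scheme glue if
they agree at the generic point. -/
theorem exists_hom_of_fromFunctionField_eq [Z.IsSeparated] {A : Type*} (V : A → Y.Opens)
    (hη : ∀ a, genericPoint Y ∈ V a) (hV : ∀ y, ∃ a, y ∈ V a) (h : ∀ a, (V a).toScheme ⟶ Z)
    (pt : Spec Y.functionField ⟶ Z)
    (hpt : ∀ a, (V a).fromSpecStalkOfMem (genericPoint Y) (hη a) ≫ h a = pt) :
    ∃ i : Y ⟶ Z, ∀ a, (V a).ι ≫ i = h a := by
  let g : ∀ a, Y.PartialMap Z := fun a => ⟨V a, (V a).2.dense ⟨_, hη a⟩, h a⟩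
  obtain ⟨a₀, -⟩ := hV (genericPoint Y)
  have hg : ∀ a, (g a).toRationalMap = (g a₀).toRationalMap := fun a =>
    Scheme.RationalMap.eq_of_fromFunctionField_eq _ _ ((hpt a).trans (hpt a₀).symm)
  let f : Y.RationalMap Z := (g a₀).toRationalMap
  have hdom : ⊤ ≤ f.domain := fun y _ => by
    obtain ⟨a, ha⟩ := hV y
    have h1 := (g a).le_domain_toRationalMap ha
    rwa [hg a] at h1
  let φ : f.domain.toScheme ⟶ Z := f.toPartialMap.hom
  refine ⟨Y.topIso.inv ≫ Y.homOfLE hdom ≫ φ, fun a => ?_⟩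
  have key : ∀ (f' : Y.RationalMap Z) (hf : (g a).toRationalMap = f') (le : V a ≤ f'.domain),
      Y.homOfLE le ≫ f'.toPartialMap.hom = h a := by
    rintro _ rfl le
    exact (g a).toPartialMap_toRationalMap_restrict
  have h2 : Y.homOfLE (le_top.trans hdom) ≫ φ = h a := key f (hg a) (le_top.trans hdom)
  rw [← h2, ← Category.assoc, ← Category.assoc]
  congr 1
  rw [← cancel_mono (Scheme.Opens.ι _)]
  simp

end glue

/-! ### Closed immersions into projective space -/

section projectiveSystem
variable {k : Type u} [Field k] {Y : Scheme.{u}} (t : Y ⟶ Spec (.of k))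

/-- The constants of a scheme over a field `k`, as sections over `U`. -/
noncomputable def constSection (U : Y.Opens) : k →+* Γ(Y, U) :=
  ((Scheme.ΓSpecIso (.of k)).inv ≫ t.appLE ⊤ U (show U ≤ t ⁻¹ᵁ ⊤ from le_top)).hom

theorem map_constSection {U V : Y.Opens} (i : V ⟶ U) (a : k) :
    Y.presheaf.map i.op (constSection t U a) = constSection t V a := by
  change ((Scheme.ΓSpecIso (.of k)).inv ≫ t.appLE ⊤ U (show U ≤ t ⁻¹ᵁ ⊤ from le_top) ≫
    Y.presheaf.map i.op).hom a = _
  rw [Scheme.Hom.appLE_map]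
  rfl

theorem ι_comp_eq (U : Y.Opens) :
    U.ι ≫ t = U.toSpecΓ ≫ Spec.map (CommRingCat.ofHom (constSection t U)) := by
  have h : Spec.map (CommRingCat.ofHom (constSection t U)) =
      Spec.map (t.appLE ⊤ U (show U ≤ t ⁻¹ᵁ ⊤ from le_top)) ≫
        Spec.map (Scheme.ΓSpecIso (.of k)).inv :=
    Spec.map_comp _ _
  rw [h, ← Category.assoc, Scheme.Opens.toSpecΓ_SpecMap_appLE, Category.assoc,
    Scheme.Opens.toSpecΓ_top, Category.assoc, toSpecΓ_SpecMap_ΓSpecIso_inv,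
    Category.comp_id, Scheme.Hom.resLE_comp_ι]

variable [AlgebraicGeometry.IsIntegral Y]

/-- The constants of an integral scheme over a field `k`, as rational functions. -/
noncomputable def constRat : k →+* Y.functionField :=
  (toRat ⊤ ⟨genericPoint Y, trivial⟩).comp (constSection t ⊤)

theorem toRat_constSection (U : Y.Opens) (y : U) (a : k) :
    toRat U y (constSection t U a) = constRat t a := by
  rw [← map_constSection t (homOfLE (le_top : U ≤ ⊤)), toRat_map]
  rfl

theorem constRat_mem_stalkRing (a : k) (y : Y) : constRat t a ∈ stalkRing y :=
  toRat_mem_stalkRing ⊤ _ ⟨y, trivial⟩ _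

/-- Rational functions `f b` are the homogeneous coordinates of a locally closed embedding into
projective space. The coordinates `f a` with `a ∈ A` have no common zero, and `V a` is the set where `f a`
does not vanish. -/
structure IsProjectiveSystem {ι : Type*} (f : ι → Y.functionField) (A : Set ι) (V : ι → Y.Opens) :
    Prop where
  ne_zero : ∀ a ∈ A, f a ≠ 0
  isAffineOpen : ∀ a ∈ A, IsAffineOpen (V a)
  genericPoint_mem : ∀ a ∈ A, genericPoint Y ∈ V a
  exists_mem : ∀ y, ∃ a ∈ A, y ∈ V a
  mem_stalkRing : ∀ a ∈ A, ∀ b, ∀ y ∈ V a, f b / f a ∈ stalkRing y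
  mem_of_inv_mem : ∀ a ∈ A, ∀ b ∈ A, ∀ y ∈ V a, (f b / f a)⁻¹ ∈ stalkRing y → y ∈ V b
  mem_closure : ∀ a ∈ A, ∀ (y : V a) (g : Γ(Y, V a)), toRat (V a) y g ∈
    Subring.closure (Set.range (constRat t) ∪ Set.range fun b => f b / f a)

variable {t}

theorem IsProjectiveSystem.reindex {ι ι' : Type*} {f : ι → Y.functionField} {A : Set ι}
    {V : ι → Y.Opens} (h : IsProjectiveSystem t f A V) (e : ι' ≃ ι) :
    IsProjectiveSystem t (f ∘ e) (e ⁻¹' A) (V ∘ e) where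
  ne_zero a ha := h.ne_zero _ ha
  isAffineOpen a ha := h.isAffineOpen _ ha
  genericPoint_mem a ha := h.genericPoint_mem _ ha
  exists_mem y := by
    obtain ⟨a, ha, hy⟩ := h.exists_mem y
    exact ⟨e.symm a, by simpa using ha, by simpa using hy⟩
  mem_stalkRing a ha b := h.mem_stalkRing _ ha _
  mem_of_inv_mem a ha b hb := h.mem_of_inv_mem _ ha _ hb
  mem_closure a ha y g := by
    have h1 : (Set.range fun b => (f ∘ e) b / (f ∘ e) a) = Set.range fun b => f b / f (e a) :=
      e.surjective.range_comp fun b => f b / f (e a)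
    rw [h1]
    exact h.mem_closure _ ha y g

open MvPolynomial HomogeneousLocalization

theorem mem_basicOpen_of_inv {U : Y.Opens} (y : U) {g : Γ(Y, U)}
    (h : (y : Y) ∈ Y.basicOpen g) : (toRat U y g)⁻¹ ∈ stalkRing (y : Y) := by
  have h1 : IsUnit (Y.presheaf.germ U y y.2 g) := (Y.mem_basicOpen g y y.2).1 h
  obtain ⟨v, hv⟩ := h1
  refine ⟨↑v⁻¹, ?_⟩
  rw [← algebraMap_germ U y y, ← hv]
  exact (map_units_inv (algebraMap (Y.presheaf.stalk (y : Y)) Y.functionField) v)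

/-- A projective system defines a closed immersion of a proper scheme into projective space. The
morphisms `V a → D₊(X a)` are closed immersions since the quotients `f b / f a` and the constants generate
the functions on `V a`, and they glue as they agree at the generic point. The open sets `D₊(X a)` with
`a ∈ A` cover the image, which is closed. -/
theorem IsProjectiveSystem.exists_isClosedImmersion [IsProper t] {n : ℕ}
    {f : Fin (n + 1) → Y.functionField} {A : Set (Fin (n + 1))} {V : Fin (n + 1) → Y.Opens}
    (hf : IsProjectiveSystem t f A V) :
    ∃ i : Y ⟶ Proj (homogeneousSubmodule (Fin (n + 1)) k),
      IsClosedImmersion i ∧ i ≫ projToSpec (homogeneousSubmodule (Fin (n + 1)) k) = t := by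
  let 𝒜 := homogeneousSubmodule (Fin (n + 1)) k
  have hX : ∀ b : Fin (n + 1), (X b : MvPolynomial (Fin (n + 1)) k) ∈ 𝒜 1 := isHomogeneous_X k
  have hη : ∀ a : A, genericPoint Y ∈ V a := fun a => hf.genericPoint_mem a a.2
  let η : ∀ a : A, V a := fun a => ⟨_, hη a⟩
  choose ρ hρ using fun (a : A) b =>
    exists_toRat_of_forall_mem (V a) (η a) (hf.mem_stalkRing a a.2 b)
  have hρ' : ∀ (a : A) b (y : V a), toRat (V a) y (ρ a b) = f b / f a := fun a b y => hρ a b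
  have hone : ∀ a : A, ρ a a = 1 := fun a => toRat_injective (V a) (η a) (by
    rw [hρ', map_one, div_self (hf.ne_zero a a.2)])
  have hu : ∀ a : A, IsUnit (eval₂Hom (constSection t (V a)) (ρ a) (X (a : Fin (n + 1)))) :=
    fun a => by rw [eval₂Hom_X', hone]; exact isUnit_one
  let φ : ∀ a : A, Away 𝒜 (X (a : Fin (n + 1)) : MvPolynomial (Fin (n + 1)) k) →+* Γ(Y, V a) :=
    fun a => awayEval (constSection t (V a)) (ρ a) (hu a)
  have hφX : ∀ (a : A) b, φ a (degOneFrac 𝒜 (hX a) (hX b)) = ρ a b := fun a b => by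
    have h1 := awayEval_mk_mul (hu a) (hX a) 1 (X b) (by rw [one_smul]; exact hX b)
    rw [eval₂Hom_X', eval₂Hom_X', hone, one_pow, mul_one] at h1
    exact h1
  have hsurj : ∀ a, Function.Surjective (φ a) := fun a g => by
    have h1 : Subring.closure (Set.range (constRat t) ∪ Set.range fun b => f b / f a) ≤
        ((toRat (V a) (η a)).comp (φ a)).range := by
      rw [Subring.closure_le]
      rintro _ (⟨c, rfl⟩ | ⟨b, rfl⟩)
      · refine ⟨scalarAway 𝒜 _ c, ?_⟩
        rw [RingHom.comp_apply, awayEval_scalar, toRat_constSection]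
      · refine ⟨degOneFrac 𝒜 (hX a) (hX b), ?_⟩
        rw [RingHom.comp_apply, hφX, hρ']
    obtain ⟨z, hz⟩ := h1 (hf.mem_closure a a.2 (η a) g)
    exact ⟨z, toRat_injective _ (η a) hz⟩
  let c : ∀ a : A, (V a).toScheme ⟶ Spec (.of (Away 𝒜 (X (a : Fin (n + 1))))) := fun a =>
    (V a).toSpecΓ ≫ Spec.map (CommRingCat.ofHom (φ a))
  have hc : ∀ a, IsClosedImmersion (c a) := fun a => by
    have h1 : IsIso (V a).toSpecΓ := by
      rw [← (hf.isAffineOpen a a.2).isoSpec_hom]; infer_instance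
    have h2 := IsClosedImmersion.spec_of_surjective (CommRingCat.ofHom (φ a)) (hsurj a)
    infer_instance
  let h : ∀ a : A, (V a).toScheme ⟶ Proj 𝒜 := fun a => c a ≫ Proj.awayι 𝒜 _ (hX a) one_pos
  -- the point of projective space with coordinates `f`
  have hv : ∀ a : A, IsUnit (eval₂Hom (constRat t) f (X (a : Fin (n + 1)))) := fun a => by
    rw [eval₂Hom_X']; exact (hf.ne_zero a a.2).isUnit
  let pt : ∀ a : A, Spec Y.functionField ⟶ Proj 𝒜 := fun a =>
    Spec.map (CommRingCat.ofHom (awayEval (constRat t) f (hv a))) ≫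
      Proj.awayι 𝒜 _ (hX a) one_pos
  have hpt : ∀ a b, pt a = pt b := fun a b => by
    have h2 : 0 < 1 + 1 := by norm_num
    have hu2 : IsUnit (eval₂Hom (constRat t) f
        (X (a : Fin (n + 1)) * X (b : Fin (n + 1)))) := by
      rw [map_mul]; exact (hv a).mul (hv b)
    have key : ∀ (a b : A) (δ : MvPolynomial (Fin (n + 1)) k)
        (e : X (a : Fin (n + 1)) * X (b : Fin (n + 1)) = δ)
        (hh : δ ∈ 𝒜 (1 + 1)) (hu2 : IsUnit (eval₂Hom (constRat t) f δ)),
        pt a = Spec.map (CommRingCat.ofHom (awayEval (constRat t) f hu2)) ≫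
          Proj.awayι 𝒜 _ hh h2 := fun a b δ e hh hu2 => by
      rw [SpecMap_awayMap_awayι_of_eq (hX a) one_pos (hX b) hh h2 e.symm rfl, ← Category.assoc,
        ← Spec.map_comp, ← CommRingCat.ofHom_comp, awayEval_awayMap (hX b) e.symm (hv a) hu2]
      rfl
    have hh := SetLike.mul_mem_graded (hX a) (hX b)
    exact (key a b _ rfl hh hu2).trans (key b a _ (mul_comm _ _) hh hu2).symm
  have hgen : ∀ a : A, (V a).fromSpecStalkOfMem (genericPoint Y) (hη a) ≫ h a = pt a := fun a => by
    change _ ≫ ((V a).toSpecΓ ≫ _) ≫ _ = _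
    rw [Category.assoc, Scheme.Opens.fromSpecStalkOfMem_toSpecΓ_assoc, ← Category.assoc,
      ← Spec.map_comp]
    have e1 : (toRat (V a) (η a)).comp (constSection t (V a)) = constRat t :=
      RingHom.ext fun c => toRat_constSection t _ _ c
    have e2 : toRat (V a) (η a) ∘ ρ a = fun b => (f a)⁻¹ * f b := funext fun b => by
      rw [Function.comp_apply, hρ', div_eq_inv_mul]
    have hu' : IsUnit (eval₂Hom ((toRat (V a) (η a)).comp (constSection t (V a)))
        (toRat (V a) (η a) ∘ ρ a) (X (a : Fin (n + 1)))) := by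
      rw [eval₂Hom_X', Function.comp_apply, hone, map_one]; exact isUnit_one
    have e3 : (toRat (V a) (η a)).comp (φ a) = awayEval (constRat t) f (hv a) := by
      refine (comp_awayEval _ (hu a) hu').trans ?_
      clear_value η
      revert hu'
      rw [e1, e2]
      exact fun hu' => awayEval_smul (hX a) _ (hv a) hu'
    exact congrArg (fun g => Spec.map (CommRingCat.ofHom g) ≫ _) e3
  obtain ⟨a₀, ha₀, -⟩ := hf.exists_mem (genericPoint Y)
  obtain ⟨i, hi⟩ := exists_hom_of_fromFunctionField_eq (fun a : A => V a) hη
    (fun y => by obtain ⟨a, ha, hy⟩ := hf.exists_mem y; exact ⟨⟨a, ha⟩, hy⟩) h (pt ⟨a₀, ha₀⟩)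
    fun a => (hgen a).trans (hpt _ _)
  have hiS : i ≫ projToSpec 𝒜 = t := by
    have hd : IsDominant (V a₀).ι := ⟨by
      rw [DenseRange, Scheme.Opens.range_ι]
      exact (V a₀).2.dense ⟨_, hη ⟨a₀, ha₀⟩⟩⟩
    refine ext_of_isDominant (V a₀).ι ?_
    have h1 : (V a₀).ι ≫ i = c ⟨a₀, ha₀⟩ ≫ Proj.awayι 𝒜 _ (hX a₀) one_pos := hi ⟨a₀, ha₀⟩
    have h2 : c ⟨a₀, ha₀⟩ = (V a₀).toSpecΓ ≫ Spec.map (CommRingCat.ofHom (φ ⟨a₀, ha₀⟩)) := rfl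
    rw [← Category.assoc, h1, Category.assoc, awayι_projToSpec, ι_comp_eq, h2, Category.assoc,
      ← Spec.map_comp, ← CommRingCat.ofHom_comp]
    congr 3
    exact RingHom.ext fun x => awayEval_scalar (hu ⟨a₀, ha₀⟩) x
  -- this needs `mem_of_inv_mem`: outside `V a` the coordinate `f a` vanishes
  have hpre : ∀ a : A, i ⁻¹ᵁ Proj.basicOpen 𝒜 (X (a : Fin (n + 1))) = V a := fun a => by
    ext y
    constructor
    · intro hy
      obtain ⟨b, hb, hyb⟩ := hf.exists_mem y
      have h1 : i y = Proj.awayι 𝒜 _ (hX b) one_pos (c ⟨b, hb⟩ ⟨y, hyb⟩) :=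
        congrArg (fun g => g.base ⟨y, hyb⟩) (hi ⟨b, hb⟩)
      have h2 : i y ∈ Proj.basicOpen 𝒜 (X (a : Fin (n + 1))) := hy
      rw [h1] at h2
      have h3 : c ⟨b, hb⟩ ⟨y, hyb⟩ ∈ Proj.awayι 𝒜 _ (hX b) one_pos ⁻¹ᵁ
        Proj.basicOpen 𝒜 (X (a : Fin (n + 1))) := h2
      rw [Proj.awayι_preimage_basicOpen 𝒜 (hX b) one_pos (hX a) one_pos] at h3
      have h4 : (⟨y, hyb⟩ : V b) ∈ (V b).toSpecΓ ⁻¹ᵁ PrimeSpectrum.basicOpen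
        (φ ⟨b, hb⟩ (Away.isLocalizationElem (hX b) (hX a))) := h3
      rw [Scheme.Opens.toSpecΓ_preimage_basicOpen] at h4
      have h5 : φ ⟨b, hb⟩ (Away.isLocalizationElem (hX b) (hX a)) = ρ ⟨b, hb⟩ a := by
        rw [← hφX]
        congr 1
        exact val_injective _ (by rw [Away.val_mk, degOneFrac, Away.val_mk]; simp)
      rw [h5] at h4
      have h6 := mem_basicOpen_of_inv ⟨y, hyb⟩ h4
      rw [hρ' ⟨b, hb⟩ a ⟨y, hyb⟩] at h6
      exact hf.mem_of_inv_mem b hb a a.2 y hyb h6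
    · intro hy
      have h1 : i y = Proj.awayι 𝒜 _ (hX a) one_pos (c a ⟨y, hy⟩) :=
        congrArg (fun g => g.base ⟨y, hy⟩) (hi a)
      change i y ∈ Proj.basicOpen 𝒜 (X (a : Fin (n + 1)))
      rw [h1, ← Proj.opensRange_awayι 𝒜 _ (hX a) one_pos]
      exact ⟨_, rfl⟩
  have hprop : IsProper i := by
    have : IsProper (i ≫ projToSpec 𝒜) := by rw [hiS]; infer_instance
    have : IsSeparated (projToSpec 𝒜) :=
      inferInstanceAs (IsSeparated (Proj.toSpecZero 𝒜 ≫ Spec.map _))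
    exact IsProper.of_comp i (projToSpec 𝒜)
  have hclosed : IsClosed (Set.range i) := i.isClosedMap.isClosed_range
  refine ⟨i, ?_, hiS⟩
  -- over the complement of the image of `i` there is nothing to prove
  let W : Option A → (Proj 𝒜).Opens := fun o => o.elim ⟨(Set.range i)ᶜ, hclosed.isOpen_compl⟩
    fun a => Proj.basicOpen 𝒜 (X (a : Fin (n + 1)))
  refine IsZariskiLocalAtTarget.of_iSup_eq_top W ?_ fun o => ?_
  · refine top_le_iff.1 fun z _ => Opens.mem_iSup.2 ?_
    by_cases hz : z ∈ Set.range i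
    · obtain ⟨y, rfl⟩ := hz
      obtain ⟨a, ha, hy⟩ := hf.exists_mem y
      refine ⟨some ⟨a, ha⟩, ?_⟩
      rw [← hpre ⟨a, ha⟩] at hy
      exact hy
    · exact ⟨none, hz⟩
  · cases o with
    | none =>
      have : IsEmpty (i ⁻¹ᵁ W none).toScheme := ⟨fun y => y.2 ⟨_, rfl⟩⟩
      infer_instance
    | some a =>
      have e : i ∣_ Proj.basicOpen 𝒜 (X (a : Fin (n + 1))) =
          (Y.isoOfEq (hpre a)).hom ≫ c a ≫ (Proj.basicOpenIsoSpec 𝒜 _ (hX a) one_pos).inv := by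
        rw [← cancel_mono (Scheme.Opens.ι _), morphismRestrict_ι, Category.assoc, Category.assoc,
          Proj.basicOpenIsoSpec_inv_ι 𝒜 _ (hX a) one_pos]
        have h2 : c a ≫ Proj.awayι 𝒜 _ (hX a) one_pos = (V a).ι ≫ i := (hi a).symm
        rw [h2, ← Category.assoc, Scheme.isoOfEq_hom_ι]
      have h2 : IsClosedImmersion (i ∣_ Proj.basicOpen 𝒜 (X (a : Fin (n + 1)))) := by
        have := hc a
        rw [e]
        infer_instance
      exact h2

end projectiveSystem

/-! ### Properness of the projective bundle -/

theorem isProper_projToSpec {R S : Type u} [CommRing R] [CommRing S] [Algebra R S]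
    (𝒜 : ℕ → Submodule R S) [GradedAlgebra 𝒜] [Algebra.FiniteType R S]
    (h : Function.Surjective (algebraMap R (𝒜 0))) : IsProper (projToSpec 𝒜) := by
  have h0 : IsScalarTower R (𝒜 0) S :=
    IsScalarTower.of_algebraMap_eq' (R := R) (S := 𝒜 0) (A := S) rfl
  have h1 : Algebra.FiniteType (𝒜 0) S := Algebra.FiniteType.of_restrictScalars_finiteType R _ _
  have h2 : IsClosedImmersion (Spec.map (CommRingCat.ofHom (algebraMap R (𝒜 0)))) :=
    IsClosedImmersion.spec_of_surjective _ h
  exact inferInstanceAs (IsProper (Proj.toSpecZero 𝒜 ≫ Spec.map _))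

theorem isProper_projToSpec_mvPolynomial {k : Type u} [Field k] (n : ℕ) :
    IsProper (projToSpec (MvPolynomial.homogeneousSubmodule (Fin (n + 1)) k)) := by
  refine isProper_projToSpec _ fun ⟨x, hx⟩ => ⟨x.coeff 0, Subtype.ext ?_⟩
  exact (MvPolynomial.totalDegree_eq_zero_iff_eq_C.1
    (Nat.le_zero.1 (MvPolynomial.IsHomogeneous.totalDegree_le hx))).symm

instance isProper_bundle_π {X : Scheme.{u}} {r : ℕ} (L : Fin r → X.Modules)
    [∀ i, IsLineBundle (L i)] : IsProper (projectiveBundle.π (⨁ L)) := by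
  choose U hU b hb using exists_isAdapted_basis L
  refine IsZariskiLocalAtTarget.of_iSup_eq_top (fun x => (U x).1) ?_ fun x => ?_
  · exact top_le_iff.1 fun x _ => Opens.mem_iSup.2 ⟨x, hU x⟩
  · have h1 : Algebra.FiniteType Γ(X, (U x).1) (SymmetricAlgebra Γ(X, (U x).1) Γ(⨁ L, (U x).1)) :=
      Algebra.FiniteType.equiv inferInstance (SymmetricAlgebra.equivMvPolynomial (b x)).symm
    have h2 : IsProper (projToSpec (symSections (⨁ L) (U x).1)) := by
      refine isProper_projToSpec _ fun ⟨a, ha⟩ => ?_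
      have ha' : a ∈ (1 : Submodule Γ(X, (U x).1) _) := ha
      obtain ⟨c, hc⟩ := Submodule.mem_one.1 ha'
      exact ⟨c, Subtype.ext hc⟩
    let e := IsOpenImmersion.isoOfRangeEq (projectiveBundle.π (⨁ L) ⁻¹ᵁ (U x).1).ι
      (bundleι (⨁ L) (U x)) (by
        rw [Scheme.Opens.range_ι, ← opensRange_bundleι]
        rfl)
    have h3 : projectiveBundle.π (⨁ L) ∣_ (U x).1 =
        e.hom ≫ projToSpec (symSections (⨁ L) (U x).1) ≫ (U x).2.isoSpec.inv := by
      rw [← cancel_mono (Scheme.Opens.ι _), morphismRestrict_ι, Category.assoc, Category.assoc]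
      have h4 := IsOpenImmersion.isoOfRangeEq_hom_fac (projectiveBundle.π (⨁ L) ⁻¹ᵁ (U x).1).ι
        (bundleι (⨁ L) (U x)) (by
        rw [Scheme.Opens.range_ι, ← opensRange_bundleι]
        rfl)
      rw [← h4, Category.assoc, bundleι_π]
      rfl
    rw [h3]
    infer_instance

/-! ### Projective coordinates of a closed subscheme of projective space -/

theorem basicOpen_specSection {P : Scheme.{u}} {R : CommRingCat.{u}} (c : Spec R ⟶ P)
    [IsOpenImmersion c] (a : R) :
    P.basicOpen (specSection c a) = c ''ᵁ PrimeSpectrum.basicOpen a := by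
  rw [← basicOpen_eq_of_affine, Scheme.image_basicOpen]
  rfl

open HomogeneousLocalization in
theorem isLocalizationElem_eq_degOneFrac {R S : Type*} [CommRing R] [CommRing S] [Algebra R S]
    (𝒜 : ℕ → Submodule R S) [GradedAlgebra 𝒜] {f g : S} (hf : f ∈ 𝒜 1) (hg : g ∈ 𝒜 1) :
    Away.isLocalizationElem hf hg = degOneFrac 𝒜 hf hg :=
  val_injective _ (by rw [Away.val_mk, degOneFrac, Away.val_mk, pow_one])

theorem awayι_image_basicOpen_le {R S : Type u} [CommRing R] [CommRing S] [Algebra R S]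
    (𝒜 : ℕ → Submodule R S) [GradedAlgebra 𝒜] {f g : S} (hf : f ∈ 𝒜 1) (hg : g ∈ 𝒜 1) :
    Proj.awayι 𝒜 f hf one_pos ''ᵁ PrimeSpectrum.basicOpen (degOneFrac 𝒜 hf hg) ≤
      Proj.basicOpen 𝒜 g := by
  rw [← isLocalizationElem_eq_degOneFrac 𝒜, ← Proj.awayι_preimage_basicOpen 𝒜 hf one_pos hg one_pos]
  exact Scheme.Hom.image_preimage_le _ _

theorem basicOpen_chartFrac_le {X : Scheme.{u}} (V : X.Modules) [V.IsQuasicoherent]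
    {U : X.AffineZariskiSite} (m m' : Γ(V, U.1)) :
    (projectiveBundle V).basicOpen (chartFrac V U m m') ≤ chartOpen V U m' := by
  have h1 := basicOpen_specSection (bundleChart V U (ι_mem_symPart _ _ m) one_pos)
    (degOneFrac _ (ι_mem_symPart _ _ m) (ι_mem_symPart _ _ m'))
  refine h1.le.trans ?_
  rw [chartOpen_eq_image]
  refine (Scheme.Hom.comp_image _ _ _).le.trans ?_
  exact Scheme.Hom.image_mono _ (awayι_image_basicOpen_le _ (ι_mem_symPart _ _ m)
    (ι_mem_symPart _ _ m'))

section
open HomogeneousLocalization MvPolynomial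
variable {k : Type u} [Field k]

theorem specSection_scalarAway {R S : Type u} [Field R] [CommRing S] [Algebra R S]
    (𝒜 : ℕ → Submodule R S) [GradedAlgebra 𝒜] {f : S} {d : ℕ} (hf : f ∈ 𝒜 d) (hd : 0 < d) (a : R) :
    specSection (Proj.awayι 𝒜 f hf hd) (scalarAway 𝒜 f a) = constSection (projToSpec 𝒜) _ a := by
  let c := Proj.awayι 𝒜 f hf hd
  apply appLE_injective c
  rw [appLE_specSection]
  have h1 : (Scheme.ΓSpecIso (.of R)).inv ≫
      (projToSpec 𝒜).appLE ⊤ (c ''ᵁ ⊤) (show c ''ᵁ ⊤ ≤ projToSpec 𝒜 ⁻¹ᵁ ⊤ from le_top) ≫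
      c.appLE (c ''ᵁ ⊤) ⊤ (c.preimage_image_eq ⊤).ge =
      CommRingCat.ofHom (scalarAway 𝒜 f) ≫ (Scheme.ΓSpecIso _).inv := by
    rw [Scheme.Hom.appLE_comp_appLE, Scheme.ΓSpecIso_inv_naturality]
    congr 1
    rw [Scheme.Hom.appTop, ← Scheme.Hom.appLE_eq_app]
    have h2 : c ≫ projToSpec 𝒜 = Spec.map (CommRingCat.ofHom (scalarAway 𝒜 f)) :=
      awayι_projToSpec 𝒜 hf hd
    congr 1
  exact (congrArg (fun g => g.hom a) h1).symm

theorem germ_specSection_mul {R S : Type u} [CommRing R] [CommRing S] [Algebra R S]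
    (𝒜 : ℕ → Submodule R S) [GradedAlgebra 𝒜] {f g l : S} (hf : f ∈ 𝒜 1) (hg : g ∈ 𝒜 1)
    (hl : l ∈ 𝒜 1) {z : Proj 𝒜} (h1 : z ∈ Proj.awayι 𝒜 f hf one_pos ''ᵁ ⊤)
    (h2 : z ∈ Proj.awayι 𝒜 g hg one_pos ''ᵁ ⊤) :
    (Proj 𝒜).presheaf.germ _ z h1 (specSection (Proj.awayι 𝒜 f hf one_pos) (degOneFrac 𝒜 hf hg)) *
      (Proj 𝒜).presheaf.germ _ z h2 (specSection (Proj.awayι 𝒜 g hg one_pos) (degOneFrac 𝒜 hg hl)) =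
    (Proj 𝒜).presheaf.germ _ z h1 (specSection (Proj.awayι 𝒜 f hf one_pos) (degOneFrac 𝒜 hf hl)) := by
  have h2' : 0 < 1 + 1 := by norm_num
  have hfg := SetLike.mul_mem_graded hf hg
  have h3 : z ∈ Proj.awayι 𝒜 (f * g) hfg h2' ''ᵁ ⊤ := by
    rw [Scheme.Hom.image_top_eq_opensRange, Proj.opensRange_awayι] at h1 h2 ⊢
    rw [Proj.basicOpen_mul]
    exact ⟨h1, h2⟩
  have c1 := SpecMap_awayMap_awayι_of_eq hf one_pos hg hfg h2' rfl rfl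
  have c2 := SpecMap_awayMap_awayι_of_eq hg one_pos hf hfg h2' (mul_comm f g) rfl
  have g1 := fun a => (congrArg ((Proj 𝒜).presheaf.germ _ z h3)
    (map_specSection _ c1 (image_le_image c1) a).symm).trans
      ((Proj 𝒜).presheaf.germ_res_apply (homOfLE _) z h3 _)
  have g2 := fun a => (congrArg ((Proj 𝒜).presheaf.germ _ z h3)
    (map_specSection _ c2 (image_le_image c2) a).symm).trans
      ((Proj 𝒜).presheaf.germ_res_apply (homOfLE _) z h3 _)
  refine (congrArg₂ (· * ·) (g1 _).symm (g2 _).symm).trans (Eq.trans ?_ (g1 _))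
  refine (map_mul ((Proj 𝒜).presheaf.germ _ z h3).hom _ _).symm.trans (congrArg _ ?_)
  refine (map_mul (specSection _) _ _).symm.trans (congrArg _ ?_)
  exact awayMap_degOneFrac_mul hf hg hl

theorem irrelevant_le_span_X {n : ℕ} :
    (HomogeneousIdeal.irrelevant (homogeneousSubmodule (Fin (n + 1)) k)).toIdeal ≤
      Ideal.span (Set.range fun b => (MvPolynomial.X b : MvPolynomial (Fin (n + 1)) k)) := by
  refine (HomogeneousIdeal.toIdeal_irrelevant_le _).2 fun m hm p hp => ?_
  rw [← Set.image_univ]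
  refine mem_ideal_span_X_image.2 fun e he => ?_
  by_contra! h
  have h1 : e = 0 := Finsupp.ext fun j => h j trivial
  have h2 := (show p.IsHomogeneous m from hp) (mem_support_iff.1 he)
  rw [h1, map_zero] at h2
  omega

theorem X_mem_homogeneousSubmodule {σ : Type*} (b : σ) :
    (MvPolynomial.X b : MvPolynomial σ k) ∈ homogeneousSubmodule σ k 1 :=
  isHomogeneous_X k b

theorem exists_eq_eval₂_degOneFrac {σ : Type*} (a : σ)
    (z : Away (homogeneousSubmodule σ k) (MvPolynomial.X a : MvPolynomial σ k)) :
    ∃ p : MvPolynomial σ k, z = eval₂Hom (scalarAway (homogeneousSubmodule σ k) _)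
      (fun b => degOneFrac (homogeneousSubmodule σ k) (X_mem_homogeneousSubmodule a)
        (X_mem_homogeneousSubmodule b)) p := by
  obtain ⟨m, p, hp, rfl⟩ := Away.mk_surjective _ (X_mem_homogeneousSubmodule a) z
  let S := Localization.Away (MvPolynomial.X a : MvPolynomial σ k)
  let ℓ : MvPolynomial σ k →+* S := algebraMap _ S
  let v := algebraMap (Away (homogeneousSubmodule σ k) (MvPolynomial.X a : MvPolynomial σ k)) S
  have hv : ∀ b, ℓ (MvPolynomial.X b) = ℓ (MvPolynomial.X a) *
      v (degOneFrac (homogeneousSubmodule σ k) (X_mem_homogeneousSubmodule a) (X_mem_homogeneousSubmodule b)) :=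
    fun b => by
      have h1 := IsLocalization.mk'_spec' S (MvPolynomial.X b)
        (⟨MvPolynomial.X a ^ 1, 1, rfl⟩ : Submonoid.powers (MvPolynomial.X a : MvPolynomial σ k))
      have h2 : v (degOneFrac (homogeneousSubmodule σ k) (X_mem_homogeneousSubmodule a)
          (X_mem_homogeneousSubmodule b)) = IsLocalization.mk' S (MvPolynomial.X b)
          (⟨MvPolynomial.X a ^ 1, 1, rfl⟩ : Submonoid.powers (MvPolynomial.X a : MvPolynomial σ k)) := by
        refine (Away.val_mk _ _ (X_mem_homogeneousSubmodule a) _ _).trans ?_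
        rw [Localization.mk_eq_mk']
      rw [h2]
      refine h1.symm.trans (congrArg (· * _) ?_)
      exact congrArg _ (pow_one _)
  have hs : ∀ c : k, v (scalarAway (homogeneousSubmodule σ k) _ c) = ℓ (C c) := fun c =>
    Localization.mk_one_eq_algebraMap (C c)
  refine ⟨p, val_injective _ ?_⟩
  have h1 : ℓ p = ℓ (MvPolynomial.X a) ^ m * v (eval₂Hom (scalarAway (homogeneousSubmodule σ k) _)
      (fun b => degOneFrac (homogeneousSubmodule σ k) (X_mem_homogeneousSubmodule a)
        (X_mem_homogeneousSubmodule b)) p) := by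
    rw [smul_eq_mul, mul_one] at hp
    rw [coe_eval₂Hom, hom_eval₂, ← coe_eval₂Hom, ← eval₂Hom_smul_of_isHomogeneous hp]
    refine DFunLike.congr_fun (MvPolynomial.ringHom_ext (f := ℓ) (fun c => ?_) fun b => ?_) p
    · rw [eval₂Hom_C]
      exact (hs c).symm
    · rw [eval₂Hom_X']
      exact hv b
  have h2 := IsLocalization.mk'_spec' S p
    (⟨MvPolynomial.X a ^ m, m, rfl⟩ : Submonoid.powers (MvPolynomial.X a : MvPolynomial σ k))
  have h3 : IsUnit (ℓ (MvPolynomial.X a) ^ m) :=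
    (IsLocalization.Away.algebraMap_isUnit (S := S) (MvPolynomial.X a)).pow m
  rw [Away.val_mk, Localization.mk_eq_mk']
  refine h3.mul_left_cancel (Eq.trans ?_ (h2.trans h1))
  rw [map_pow]

theorem mem_basicOpen_of_inv_mem {Y : Scheme.{u}} [AlgebraicGeometry.IsIntegral Y] {U : Y.Opens}
    (y : U) {g : Γ(Y, U)} (h0 : toRat U y g ≠ 0) (h : (toRat U y g)⁻¹ ∈ stalkRing (y : Y)) :
    (y : Y) ∈ Y.basicOpen g := by
  obtain ⟨w, hw⟩ := h
  rw [Y.mem_basicOpen g y y.2]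
  refine IsUnit.of_mul_eq_one w (IsFractionRing.injective (Y.presheaf.stalk (y : Y)) Y.functionField ?_)
  rw [map_mul, hw, algebraMap_germ U y y, mul_inv_cancel₀ h0, map_one]

theorem app_constSection {X Z : Scheme.{u}} {t : X ⟶ Spec (.of k)} {s : Z ⟶ Spec (.of k)} (i : X ⟶ Z)
    (h : i ≫ s = t) (D : Z.Opens) (a : k) :
    constSection t (i ⁻¹ᵁ D) a = i.app D (constSection s D a) := by
  subst h
  change _ = (s.appLE ⊤ D _ ≫ i.app D).hom _
  rw [← Scheme.Hom.appLE_eq_app, Scheme.Hom.appLE_comp_appLE]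
  rfl

/-- The coordinate functions of a closed subvariety of projective space, divided by one of them that does
not vanish identically. The set `A` consists of the indices of those that do not. -/
theorem exists_isProjectiveSystem {X : Scheme.{u}} [AlgebraicGeometry.IsIntegral X]
    (t : X ⟶ Spec (.of k)) {n : ℕ} (i : X ⟶ Proj (homogeneousSubmodule (Fin (n + 1)) k))
    [IsClosedImmersion i] (hi : i ≫ projToSpec (homogeneousSubmodule (Fin (n + 1)) k) = t) :
    ∃ (f : Fin (n + 1) → X.functionField) (A : Set (Fin (n + 1))) (V : Fin (n + 1) → X.Opens),
      IsProjectiveSystem t f A V := by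
  let 𝒜 := homogeneousSubmodule (Fin (n + 1)) k
  have hX : ∀ b : Fin (n + 1), (MvPolynomial.X b : MvPolynomial (Fin (n + 1)) k) ∈ 𝒜 1 :=
    isHomogeneous_X k
  let c := fun b => Proj.awayι 𝒜 _ (hX b) one_pos
  let D : Fin (n + 1) → (Proj 𝒜).Opens := fun b => c b ''ᵁ ⊤
  have hD : ∀ b, D b = Proj.basicOpen 𝒜 (MvPolynomial.X b) := fun b =>
    (Scheme.Hom.image_top_eq_opensRange _).trans (Proj.opensRange_awayι 𝒜 _ (hX b) one_pos)
  have hDaff : ∀ b, IsAffineOpen (D b) := fun b => by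
    rw [hD]; exact Proj.isAffineOpen_basicOpen 𝒜 _ (hX b) one_pos
  have hcov : ∀ z : Proj 𝒜, ∃ b, z ∈ D b := fun z => by
    have h1 := Proj.iSup_basicOpen_eq_top 𝒜
      (fun b => (MvPolynomial.X b : MvPolynomial (Fin (n + 1)) k)) irrelevant_le_span_X
    obtain ⟨b, hb⟩ := Opens.mem_iSup.1 (h1.ge (show z ∈ ⊤ from trivial))
    exact ⟨b, by rw [hD]; exact hb⟩
  let V : Fin (n + 1) → X.Opens := fun b => i ⁻¹ᵁ D b
  let A : Set (Fin (n + 1)) := {b | genericPoint X ∈ V b}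
  let ψ : ∀ b, Away 𝒜 (MvPolynomial.X b : MvPolynomial (Fin (n + 1)) k) →+* Γ(X, V b) := fun b =>
    (i.app (D b)).hom.comp (specSection (c b)).toRingHom
  have hψ : ∀ b, Function.Surjective (ψ b) := fun b =>
    (i.app_surjective (D b) (hDaff b)).comp (specSection (c b)).surjective
  let g : ∀ a : A, Fin (n + 1) → X.functionField := fun a b =>
    toRat (V a) ⟨_, a.2⟩ (ψ a (degOneFrac 𝒜 (hX a) (hX b)))
  have hmul : ∀ (a b : A) l, g a b * g b l = g a l := fun a b l => by
    have ha : i (genericPoint X) ∈ D a := a.2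
    have hb : i (genericPoint X) ∈ D b := b.2
    have h1 := congrArg (i.stalkMap (genericPoint X))
      (germ_specSection_mul 𝒜 (hX a) (hX b) (hX l) ha hb)
    have h2 : ∀ (a : A) (ha : i (genericPoint X) ∈ D a) m, i.stalkMap (genericPoint X)
        ((Proj 𝒜).presheaf.germ (D a) _ ha (specSection (c a) m)) = toRat (V a) ⟨_, a.2⟩ (ψ a m) :=
      fun a ha m => Scheme.Hom.germ_stalkMap_apply i (D a) (genericPoint X) ha _
    rw [map_mul] at h1
    exact (congrArg₂ (· * ·) (h2 a ha _) (h2 b hb _)).symm.trans (h1.trans (h2 a ha _))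
  have hself : ∀ a : A, g a a = 1 := fun a => by
    change toRat _ _ (ψ a _) = 1
    rw [degOneFrac_self, map_one, map_one]
  have hne : ∀ a b : A, g a b ≠ 0 := fun a b h => by
    have h1 := hmul a b a
    rw [h, zero_mul, hself] at h1
    exact zero_ne_one h1
  obtain ⟨a₀, ha₀⟩ := hcov (i (genericPoint X))
  let a₀ : A := ⟨a₀, ha₀⟩
  have hdiv : ∀ (a : A) b, g a₀ b / g a₀ a = g a b := fun a b => by
    rw [div_eq_iff (hne a₀ a), mul_comm, hmul]
  have hmemA : ∀ {x : X} {b}, x ∈ V b → b ∈ A := fun {x b} hx => genericPoint_mem ⟨x, hx⟩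
  refine ⟨g a₀, A, V, ?_, fun a _ => (hDaff a).preimage i, fun a ha => ha, fun x => ?_, ?_, ?_, ?_⟩
  · exact fun a ha => hne a₀ ⟨a, ha⟩
  · obtain ⟨b, hb⟩ := hcov (i x)
    exact ⟨b, hmemA (x := x) hb, hb⟩
  · intro a ha b x hx
    rw [hdiv ⟨a, ha⟩]
    exact toRat_mem_stalkRing (V a) _ ⟨x, hx⟩ _
  · intro a ha b hb x hx h
    rw [hdiv ⟨a, ha⟩] at h
    have h1 : x ∈ X.basicOpen (ψ a (degOneFrac 𝒜 (hX a) (hX b))) :=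
      mem_basicOpen_of_inv_mem ⟨x, hx⟩ (hne ⟨a, ha⟩ ⟨b, hb⟩) h
    have h2 : x ∈ i ⁻¹ᵁ ((Proj 𝒜).basicOpen (specSection (c a) (degOneFrac 𝒜 (hX a) (hX b)))) := by
      rw [Scheme.preimage_basicOpen]
      exact h1
    rw [basicOpen_specSection] at h2
    change i x ∈ D b
    rw [hD]
    exact awayι_image_basicOpen_le 𝒜 (hX a) (hX b) h2
  · intro a ha x s
    obtain ⟨z, rfl⟩ := hψ a s
    obtain ⟨p, h0⟩ := exists_eq_eval₂_degOneFrac a z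
    have h1 : (toRat (V a) x).comp (ψ a) (eval₂Hom (scalarAway 𝒜 _)
        (fun b => degOneFrac 𝒜 (hX a) (hX b)) p) ∈ Subring.closure
          (Set.range (constRat t) ∪ Set.range fun b => g a₀ b / g a₀ a) := by
      rw [coe_eval₂Hom, hom_eval₂]
      refine eval₂_mem (fun e _ => ?_) fun b => ?_
      · refine Subring.subset_closure (Or.inl ⟨coeff e p, ?_⟩)
        rw [RingHom.comp_apply, RingHom.comp_apply, ← toRat_constSection t (V a) x]
        congr 1
        have h2 : ψ a (scalarAway 𝒜 _ (coeff e p)) =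
          i.app (D a) (constSection (projToSpec 𝒜) (D a) (coeff e p)) :=
          congrArg (i.app (D a)) (specSection_scalarAway 𝒜 (hX a) one_pos _)
        rw [h2]
        exact app_constSection i hi (D a) _
      · refine Subring.subset_closure (Or.inr ⟨b, ?_⟩)
        exact hdiv ⟨a, ha⟩ b
    rwa [← h0] at h1

end

/-! ### Affine coverings of projective varieties by forms -/

section subring
variable {F : Type*} [Field F] (O : Subring F)

theorem Subring.inv_mem_of_mul_inv_mem {a b : F} (ha : a ∈ O) (h0 : a ≠ 0) (h : (a * b)⁻¹ ∈ O) :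
    b⁻¹ ∈ O := by
  have : b⁻¹ = a * (a * b)⁻¹ := by rw [mul_inv, mul_inv_cancel_left₀ h0]
  rw [this]
  exact mul_mem ha h

theorem Subring.inv_mem_of_pow_inv_mem {a : F} (ha : a ∈ O) {m : ℕ} (hm : 0 < m)
    (h : (a ^ m)⁻¹ ∈ O) : a⁻¹ ∈ O := by
  by_cases h0 : a = 0
  · rw [h0, inv_zero]
    exact zero_mem _
  obtain ⟨m, rfl⟩ : ∃ l, m = l + 1 := ⟨m - 1, by omega⟩
  rw [pow_succ] at h
  exact O.inv_mem_of_mul_inv_mem (pow_mem ha m) (pow_ne_zero m h0) h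

end subring

section refinement
variable {k : Type u} [Field k] {X : Scheme.{u}} {t : X ⟶ Spec (.of k)}
  [AlgebraicGeometry.IsIntegral X] {ι : Type*} {f : ι → X.functionField} {A : Set ι}
  {V : ι → X.Opens}

/-- A regular function on the affine piece `V a` of a projective variety becomes a form when it is
multiplied with a high power of the coordinate `f a`: its quotient by the same power of another
coordinate `f l` is regular on `V l`. -/
theorem IsProjectiveSystem.exists_forall_mul_pow_div_mem (h : IsProjectiveSystem t f A V) {a : ι}
    (ha : a ∈ A) {g : X.functionField}
    (hg : g ∈ Subring.closure (Set.range (constRat t) ∪ Set.range fun b => f b / f a)) :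
    ∃ d, ∀ e, d ≤ e → ∀ l ∈ A, ∀ y ∈ V l, g * (f a / f l) ^ e ∈ stalkRing y := by
  induction hg using Subring.closure_induction with
  | mem g hg =>
    obtain ⟨c, rfl⟩ | ⟨b, rfl⟩ := hg
    · exact ⟨0, fun e _ l hl y hy => mul_mem (constRat_mem_stalkRing t c y)
        (pow_mem (h.mem_stalkRing l hl a y hy) e)⟩
    · refine ⟨1, fun e he l hl y hy => ?_⟩
      obtain ⟨e, rfl⟩ : ∃ m, e = m + 1 := ⟨e - 1, by omega⟩
      have : f b / f a * (f a / f l) ^ (e + 1) = f b / f l * (f a / f l) ^ e := by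
        rw [pow_succ', ← mul_assoc, div_mul_div_cancel₀ (h.ne_zero a ha)]
      dsimp only
      rw [this]
      exact mul_mem (h.mem_stalkRing l hl b y hy) (pow_mem (h.mem_stalkRing l hl a y hy) e)
  | zero => exact ⟨0, fun e _ l hl y hy => by rw [zero_mul]; exact zero_mem _⟩
  | one => exact ⟨0, fun e _ l hl y hy => by
      rw [one_mul]; exact pow_mem (h.mem_stalkRing l hl a y hy) e⟩
  | add g g' _ _ h1 h2 =>
    obtain ⟨d, hd⟩ := h1
    obtain ⟨d', hd'⟩ := h2
    refine ⟨max d d', fun e he l hl y hy => ?_⟩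
    rw [add_mul]
    exact add_mem (hd e (le_of_max_le_left he) l hl y hy) (hd' e (le_of_max_le_right he) l hl y hy)
  | neg g _ h1 =>
    obtain ⟨d, hd⟩ := h1
    exact ⟨d, fun e he l hl y hy => by rw [neg_mul]; exact neg_mem (hd e he l hl y hy)⟩
  | mul g g' _ _ h1 h2 =>
    obtain ⟨d, hd⟩ := h1
    obtain ⟨d', hd'⟩ := h2
    refine ⟨d + d', fun e he l hl y hy => ?_⟩
    obtain ⟨e, rfl⟩ : ∃ m, e = d + m := ⟨e - d, by omega⟩
    rw [pow_add, mul_mul_mul_comm]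
    exact mul_mem (hd d le_rfl l hl y hy) (hd' e (by omega) l hl y hy)

/-- The open sets `W` where a form `b` of positive degree does not vanish form a basis of the topology
of a projective variety. -/
theorem IsProjectiveSystem.exists_form (h : IsProjectiveSystem t f A V) {x : X} {U : X.Opens}
    (hx : x ∈ U) : ∃ (D : ℕ) (b : X.functionField) (W : X.Opens), 0 < D ∧ b ≠ 0 ∧ IsAffineOpen W ∧
      x ∈ W ∧ W ≤ U ∧ ∀ l ∈ A, ∀ y ∈ V l, b / f l ^ D ∈ stalkRing y ∧
        ((b / f l ^ D)⁻¹ ∈ stalkRing y ↔ y ∈ W) := by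
  obtain ⟨a, ha, hxa⟩ := h.exists_mem x
  obtain ⟨g, hgU, hxg⟩ := (h.isAffineOpen a ha).exists_basicOpen_le ⟨x, hx⟩ hxa
  have hga : X.basicOpen g ≤ V a := X.basicOpen_le g
  have hg0 : toRat (V a) ⟨x, hxa⟩ g ≠ 0 := fun h0 => by
    have h1 : g = 0 := toRat_injective (V a) ⟨x, hxa⟩ (by rw [h0, map_zero])
    rw [h1, Scheme.basicOpen_zero] at hxg
    exact hxg
  set G := toRat (V a) ⟨x, hxa⟩ g with hG
  have hmem : ∀ y ∈ V a, G ∈ stalkRing y := fun y hy => toRat_mem_stalkRing (V a) _ ⟨y, hy⟩ g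
  have hinv : ∀ y ∈ V a, (G⁻¹ ∈ stalkRing y ↔ y ∈ X.basicOpen g) := fun y hy =>
    ⟨fun h1 => mem_basicOpen_of_inv_mem ⟨y, hy⟩ hg0 h1, fun h1 => mem_basicOpen_of_inv ⟨y, hy⟩ h1⟩
  obtain ⟨d, hd⟩ := h.exists_forall_mul_pow_div_mem ha (h.mem_closure a ha ⟨x, hxa⟩ g)
  have ha0 := h.ne_zero a ha
  refine ⟨d + 1, G * f a ^ (d + 1), X.basicOpen g, d.succ_pos, mul_ne_zero hg0 (pow_ne_zero _ ha0),
    (h.isAffineOpen a ha).basicOpen g, hxg, hgU, fun l hl y hy => ?_⟩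
  have hl0 := h.ne_zero l hl
  rw [mul_div_assoc, ← div_pow]
  have hfrac := h.mem_stalkRing l hl a y hy
  refine ⟨hd _ d.le_succ l hl y hy, fun h1 => ?_, fun hyg => ?_⟩
  · have h2 : (f a / f l)⁻¹ ∈ stalkRing y := by
      rw [pow_succ, ← mul_assoc] at h1
      exact (stalkRing y).inv_mem_of_mul_inv_mem (hd d le_rfl l hl y hy)
        (mul_ne_zero hg0 (pow_ne_zero _ (div_ne_zero ha0 hl0))) h1
    have hya := h.mem_of_inv_mem l hl a ha y hy h2
    refine (hinv y hya).1 ?_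
    rw [mul_comm] at h1
    exact (stalkRing y).inv_mem_of_mul_inv_mem (pow_mem hfrac _)
      (pow_ne_zero _ (div_ne_zero ha0 hl0)) h1
  · have hya := hga hyg
    rw [mul_inv, ← inv_pow, inv_div]
    exact mul_mem ((hinv y hya).2 hyg) (pow_mem (h.mem_stalkRing a ha l y hya) _)

/-- A projective variety is covered by finitely many affine open sets `W s`, contained in given
neighbourhoods of points, which are the sets where forms `b s` of the same degree do not vanish. -/
theorem IsProjectiveSystem.exists_refinement [CompactSpace X] (h : IsProjectiveSystem t f A V)
    (U : X → X.Opens) (hU : ∀ x, x ∈ U x) :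
    ∃ (S : Type u) (_ : Fintype S) (b : S → X.functionField) (W : S → X.Opens),
      (∀ s, b s ≠ 0) ∧ (∀ s, IsAffineOpen (W s)) ∧ (∀ s, (W s : Set X).Nonempty) ∧
      (∀ s, ∃ x, W s ≤ U x) ∧ (∀ y, ∃ s, y ∈ W s) ∧
      ∀ s s', ∀ y ∈ W s', b s / b s' ∈ stalkRing y ∧ ((b s / b s')⁻¹ ∈ stalkRing y → y ∈ W s) := by
  classical
  choose D b W hD hb hWaff hxW hWU hform using fun x => h.exists_form (hU x)
  obtain ⟨T, -, hT⟩ := (isCompact_univ (X := X)).elim_nhds_subcover (fun x => (W x : Set X))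
    fun x _ => (W x).2.mem_nhds (hxW x)
  let E : X → ℕ := fun x => ∏ y ∈ T.erase x, D y
  have hE : ∀ x, 0 < E x := fun x => Finset.prod_pos fun y _ => hD y
  have hDE : ∀ x ∈ T, D x * E x = ∏ y ∈ T, D y := fun x hx => Finset.mul_prod_erase T D hx
  have key : ∀ x ∈ T, ∀ l ∈ A, ∀ y ∈ V l, b x ^ E x / f l ^ (∏ y ∈ T, D y) ∈ stalkRing y ∧
      ((b x ^ E x / f l ^ (∏ y ∈ T, D y))⁻¹ ∈ stalkRing y ↔ y ∈ W x) := fun x hx l hl y hy => by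
    obtain ⟨h1, h2⟩ := hform x l hl y hy
    rw [← hDE x hx, pow_mul, ← div_pow]
    refine ⟨pow_mem h1 _, fun h3 => h2.1 ((stalkRing y).inv_mem_of_pow_inv_mem h1 (hE x) h3),
      fun h3 => ?_⟩
    rw [← inv_pow]
    exact pow_mem (h2.2 h3) _
  refine ⟨T, inferInstance, fun s => b s ^ E s, fun s => W s, fun s => pow_ne_zero _ (hb s),
    fun s => hWaff s, fun s => ⟨_, hxW s⟩, fun s => ⟨s, hWU s⟩, fun y => ?_, fun s s' y hy => ?_⟩
  · have h1 := hT (Set.mem_univ y)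
    simp only [Set.mem_iUnion] at h1
    obtain ⟨x, hx, hy⟩ := h1
    exact ⟨⟨x, hx⟩, hy⟩
  · obtain ⟨l, hl, hyl⟩ := h.exists_mem y
    obtain ⟨h1, h2⟩ := key s s.2 l hl y hyl
    obtain ⟨h1', h2'⟩ := key s' s'.2 l hl y hyl
    have hl0 := pow_ne_zero (∏ y ∈ T, D y) (h.ne_zero l hl)
    have e : b s ^ E s / b s' ^ E s' = (b s ^ E s / f l ^ (∏ y ∈ T, D y)) *
        (b s' ^ E s' / f l ^ (∏ y ∈ T, D y))⁻¹ := by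
      rw [← div_eq_mul_inv, div_div_div_cancel_right₀ hl0]
    have h3 := h2'.2 hy
    refine ⟨by rw [e]; exact mul_mem h1 h3, fun h4 => h2.1 ?_⟩
    rw [e, mul_comm] at h4
    refine (stalkRing y).inv_mem_of_mul_inv_mem h3 (inv_ne_zero (div_ne_zero ?_ hl0)) h4
    exact pow_ne_zero _ (hb s')

/-- A rational function that is regular on the subset of an affine open set where `ρ` does not vanish
becomes regular after multiplication with a high power of `ρ`. -/
theorem exists_forall_pow_mul_mem {W : X.Opens} (hW : IsAffineOpen W) (hne : (W : Set X).Nonempty)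
    {ρ g : X.functionField} (hρ0 : ρ ≠ 0) (hρ : ∀ x ∈ W, ρ ∈ stalkRing x)
    (hg : ∀ x ∈ W, ρ⁻¹ ∈ stalkRing x → g ∈ stalkRing x) :
    ∃ N, ∀ n, N ≤ n → ∀ x ∈ W, ρ ^ n * g ∈ stalkRing x := by
  obtain ⟨x₀, hx₀⟩ := hne
  obtain ⟨r, hr⟩ := exists_toRat_of_forall_mem W ⟨x₀, hx₀⟩ hρ
  have hr' : ∀ x : W, toRat W x r = ρ := fun x => hr
  have hη : genericPoint X ∈ X.basicOpen r := by
    by_contra hn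
    have h1 : X.basicOpen r = ⊥ := by
      ext z
      exact ⟨fun hz => hn (genericPoint_mem ⟨z, hz⟩), fun hz => hz.elim⟩
    rw [basicOpen_eq_bot_iff] at h1
    rw [← hr, h1, map_zero] at hρ0
    exact hρ0 rfl
  have h1 : ∀ x ∈ X.basicOpen r, g ∈ stalkRing x := fun x hx =>
    have hxW := X.basicOpen_le r hx
    hg x hxW (by
      have := mem_basicOpen_of_inv ⟨x, hxW⟩ hx
      rwa [hr'] at this)
  obtain ⟨v, hv⟩ := exists_toRat_of_forall_mem (X.basicOpen r) ⟨_, hη⟩ h1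
  have hloc := hW.isLocalization_basicOpen r
  obtain ⟨N, w, hw⟩ := IsLocalization.Away.surj r v
  have hw' : g * ρ ^ N = toRat W ⟨x₀, hx₀⟩ w := by
    have h2 := congrArg (toRat (X.basicOpen r) ⟨_, hη⟩) hw
    have h3 : ∀ a : Γ(X, W), toRat (X.basicOpen r) ⟨_, hη⟩ (algebraMap _ _ a) =
        toRat W ⟨x₀, hx₀⟩ a := fun a => toRat_map (homOfLE (X.basicOpen_le r)) ⟨_, hη⟩ a
    rw [map_mul, map_pow, h3, h3, hv, hr'] at h2
    exact h2
  refine ⟨N, fun n hn x hx => ?_⟩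
  obtain ⟨n, rfl⟩ : ∃ m, n = m + N := ⟨n - N, by omega⟩
  rw [pow_add, mul_assoc, mul_comm _ g, hw']
  exact mul_mem (pow_mem (hρ x hx) n) (toRat_mem_stalkRing W ⟨x₀, hx₀⟩ ⟨x, hx⟩ w)

end refinement

/-! ### Projective coordinates of the projective bundle -/

theorem exists_finset_closure {k : Type u} [Field k] {X : Scheme.{u}} (t : X ⟶ Spec (.of k))
    [LocallyOfFiniteType t] {W : X.Opens} (hW : IsAffineOpen W) : ∃ G : Finset Γ(X, W),
      ∀ a, a ∈ Subring.closure (Set.range (constSection t W) ∪ G) := by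
  have h1 : (t.appLE ⊤ W (show W ≤ t ⁻¹ᵁ ⊤ from le_top)).hom.FiniteType :=
    HasRingHomProperty.appLE @LocallyOfFiniteType t inferInstance ⟨⊤, isAffineOpen_top _⟩ ⟨W, hW⟩ _
  have h2 : (constSection t W).FiniteType :=
    h1.comp (RingHom.FiniteType.of_surjective _
      (Scheme.ΓSpecIso (.of k)).symm.commRingCatIsoToRingEquiv.surjective)
  let _ := (constSection t W).toAlgebra
  obtain ⟨G, hG⟩ : (⊤ : Subalgebra k Γ(X, W)).FG := h2.1
  refine ⟨G, fun a => ?_⟩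
  have ha : a ∈ Algebra.adjoin k (G : Set Γ(X, W)) := by rw [hG]; trivial
  induction ha using Algebra.adjoin_induction with
  | mem a ha => exact Subring.subset_closure (Or.inr ha)
  | algebraMap c => exact Subring.subset_closure (Or.inl ⟨c, rfl⟩)
  | add a b _ _ ha hb => exact add_mem ha hb
  | mul a b _ _ ha hb => exact mul_mem ha hb

section
variable {P X : Scheme.{u}} [AlgebraicGeometry.IsIntegral P] [AlgebraicGeometry.IsIntegral X]
  (π : P ⟶ X) [Algebra X.functionField P.functionField] [IsFunctionFieldExtension π]

/-- The homomorphism of local rings at `y` and `π y` is local. -/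
theorem inv_mem_stalkRing_of_inv_algebraMap_mem (y : P) {a : X.functionField}
    (ha : a ∈ stalkRing (π y)) (h : (algebraMap X.functionField P.functionField a)⁻¹ ∈ stalkRing y) :
    a⁻¹ ∈ stalkRing (π y) := by
  by_cases h0 : a = 0
  · rw [h0, inv_zero]
    exact zero_mem _
  obtain ⟨U, hU, g, rfl⟩ := exists_toRat_of_mem_stalkRing ha
  have h1 := IsFunctionFieldExtension.algebraMap_toRat (π := π) (le_refl (π ⁻¹ᵁ U)) ⟨π y, hU⟩
      (⟨y, hU⟩ : (π ⁻¹ᵁ U : P.Opens)) g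
  have h2 := mem_basicOpen_of_inv_mem (⟨y, hU⟩ : (π ⁻¹ᵁ U : P.Opens)) (g := π.app U g) (by
    rw [← Scheme.Hom.appLE_eq_app]
    exact fun h3 => (map_ne_zero (algebraMap X.functionField P.functionField)).2 h0 (h1.trans h3))
    (by
      rw [← Scheme.Hom.appLE_eq_app]
      exact (congrArg (fun z => z⁻¹ ∈ stalkRing y) h1).mp h)
  have h3 : y ∈ π ⁻¹ᵁ X.basicOpen g := by
    rw [Scheme.preimage_basicOpen]
    exact h2
  exact mem_basicOpen_of_inv ⟨π y, hU⟩ h3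

theorem algebraMap_constRat {k : Type u} [Field k] (t : X ⟶ Spec (.of k)) (a : k) :
    algebraMap X.functionField P.functionField (constRat t a) = constRat (π ≫ t) a := by
  refine (IsFunctionFieldExtension.algebraMap_toRat (π := π) (le_refl (π ⁻¹ᵁ ⊤)) _
    (⟨genericPoint P, trivial⟩ : (π ⁻¹ᵁ ⊤ : P.Opens)) _).trans ?_
  rw [Scheme.Hom.appLE_eq_app]
  have h := app_constSection π (rfl : π ≫ t = π ≫ t) ⊤ a
  exact congrArg (toRat _ _) h.symm

end

open Scheme.AffineZariskiSite in
theorem exists_common_basic_of_mem {X : Scheme.{u}} {x : X} {U U' : X.AffineZariskiSite} (hx : x ∈ U.1)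
    (hx' : x ∈ U'.1) :
    ∃ W : X.AffineZariskiSite, x ∈ W.1 ∧ Nonempty (W ⟶ U) ∧ Nonempty (W ⟶ U') := by
  obtain ⟨f, g, e, hf⟩ := exists_basicOpen_le_affine_inter U.2 U'.2 x ⟨hx, hx'⟩
  exact ⟨U.basicOpen f, hf, ⟨homOfLE ⟨f, rfl⟩⟩, ⟨homOfLE ⟨g, e.symm⟩⟩⟩

section bundleCoordinates
open Scheme.AffineZariskiSite
variable {X : Scheme.{u}} [AlgebraicGeometry.IsIntegral X] {r : ℕ} (L : Fin r → X.Modules)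
  [∀ i, IsLineBundle (L i)]

variable {L} {U U' : X.AffineZariskiSite} {b : Module.Basis (Fin r) Γ(X, U.1) Γ(⨁ L, U.1)}
  {b' : Module.Basis (Fin r) Γ(X, U'.1) Γ(⨁ L, U'.1)}

theorem mem_chartOpen_of_mem (hb : IsAdapted L b) (hb' : IsAdapted L b') {j : Fin r}
    {y : projectiveBundle (⨁ L)} (hy : y ∈ chartOpen (⨁ L) U (b j))
    (hU' : projectiveBundle.π (⨁ L) y ∈ U'.1) : y ∈ chartOpen (⨁ L) U' (b' j) := by
  obtain ⟨W, hW, ⟨i⟩, ⟨i'⟩⟩ := exists_common_basic_of_mem (chartOpen_le (⨁ L) _ hy) hU'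
  obtain ⟨c, hc, e⟩ := exists_res_basis L i hb
  obtain ⟨c', hc', e'⟩ := exists_res_basis L i' hb'
  obtain ⟨v, hv⟩ := hc.exists_unit hc'
  have h1 : y ∈ chartOpen (⨁ L) W (c j) := by
    rw [e, chartOpen_res _ i]
    exact ⟨hy, hW⟩
  rw [← chartOpen_unit_smul _ _ (v j), ← hv, e', chartOpen_res _ i'] at h1
  exact h1.1

variable [AlgebraicGeometry.IsIntegral (projectiveBundle (⨁ L))]
  [Algebra X.functionField (projectiveBundle (⨁ L)).functionField]
  [IsFunctionFieldExtension (projectiveBundle.π (⨁ L))]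

theorem exists_ratFrac_eq_mul (hb : IsAdapted L b) (hb' : IsAdapted L b') {x : X} (hx : x ∈ U.1)
    (hx' : x ∈ U'.1) (i j : Fin r) (y : chartOpen (⨁ L) U (b i)) (y' : chartOpen (⨁ L) U' (b' i)) :
    ∃ v ∈ stalkRing x, ratFrac (b' i) (b' j) y' =
      algebraMap X.functionField _ v * ratFrac (b i) (b j) y := by
  obtain ⟨W, hW, ⟨l⟩, ⟨l'⟩⟩ := exists_common_basic_of_mem hx hx'
  obtain ⟨c, hc, e⟩ := exists_res_basis L l hb
  obtain ⟨c', hc', e'⟩ := exists_res_basis L l' hb'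
  obtain ⟨v, hv⟩ := hc.exists_unit hc'
  have hη1 := genericPoint_mem_chartOpen L ⟨x, hW⟩ hc
  have hη2 := genericPoint_mem_chartOpen L ⟨x, hW⟩ hc'
  have e1 : ∀ l₁, moduleRes (⨁ L) (toOpens_mono l'.le) (b' l₁) =
      (v l₁ : Γ(X, W.1)) • moduleRes (⨁ L) (toOpens_mono l.le) (b l₁) := fun l₁ => by
    rw [← e', hv, e]
  have h1 : genericPoint _ ∈ chartOpen (⨁ L) W (moduleRes (⨁ L) (toOpens_mono l.le) (b i)) := by
    rw [← e]; exact hη1 i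
  have h2 : genericPoint _ ∈ chartOpen (⨁ L) W (moduleRes (⨁ L) (toOpens_mono l'.le) (b' i)) := by
    rw [← e']; exact hη2 i
  have h3 : genericPoint _ ∈ chartOpen (⨁ L) W
      ((v i : Γ(X, W.1)) • moduleRes (⨁ L) (toOpens_mono l.le) (b i)) := by
    rw [← e1]; exact h2
  refine ⟨toRat W.1 ⟨x, hW⟩ (v j) * toRat W.1 ⟨x, hW⟩ ↑(v i)⁻¹,
    mul_mem (toRat_mem_stalkRing W.1 _ ⟨x, hW⟩ _) (toRat_mem_stalkRing W.1 _ ⟨x, hW⟩ _), ?_⟩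
  rw [← ratFrac_res l' (b' i) (b' j) y' ⟨_, h2⟩,
    ratFrac_congr (e1 i) (e1 j) h2 h3,
    ratFrac_unit_smul _ _ ⟨x, hW⟩ (v i) (v j) ⟨_, h1⟩,
    ratFrac_res l (b i) (b j) y ⟨_, h1⟩, map_mul, div_eq_mul_inv]
  congr 2
  rw [← map_inv₀]
  congr 1
  exact (map_units_inv (toRat W.1 ⟨x, hW⟩) (v i)).symm

/-- If `f` are projective coordinates of `X`, let `b s` be forms of the same degree in them that do not
vanish precisely on affine open sets `W s` which trivialize the line bundles `L j`, with generators
`e s j`, and cover `X`. For large `N` the functions `b s ^ N * e s j`, together with their products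
with generators of the rings of functions on the sets `W s`, are projective coordinates of the
projective bundle. -/
theorem exists_isProjectiveSystem_bundle {k : Type u} [Field k] {t : X ⟶ Spec (.of k)}
    [LocallyOfFiniteType t] [CompactSpace X] {ι : Type*} {f : ι → X.functionField} {A : Set ι}
    {V : ι → X.Opens} (h : IsProjectiveSystem t f A V) (hr : 0 < r) :
    ∃ (ι' : Type u) (_ : Fintype ι') (f' : ι' → (projectiveBundle (⨁ L)).functionField)
      (A' : Set ι') (V' : ι' → (projectiveBundle (⨁ L)).Opens),
      IsProjectiveSystem (projectiveBundle.π (⨁ L) ≫ t) f' A' V' := by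
  classical
  let π := projectiveBundle.π (⨁ L)
  let α := algebraMap X.functionField (projectiveBundle (⨁ L)).functionField
  choose U hU e₀ he₀ using exists_isAdapted_basis L
  obtain ⟨S, _, b, W, hb0, hWaff, hWne, hWU, hcov, hform⟩ :=
    h.exists_refinement (fun x => (U x).1) hU
  let Ws : S → X.AffineZariskiSite := fun s => ⟨W s, hWaff s⟩
  have hbasis : ∀ s, ∃ e : Module.Basis (Fin r) Γ(X, (Ws s).1) Γ(⨁ L, (Ws s).1), IsAdapted L e :=
    fun s => by
      obtain ⟨x, hx⟩ := hWU s
      have h1 := (he₀ x).res hx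
      refine ⟨h1.basis, ?_⟩
      have h2 : (h1.basis : Fin r → _) = _ := funext h1.basis_apply
      rwa [h2]
  choose e he using hbasis
  choose G hG using fun s => exists_finset_closure t (hWaff s)
  have hη : ∀ s j, genericPoint (projectiveBundle (⨁ L)) ∈ chartOpen (⨁ L) (Ws s) (e s j) :=
    fun s => genericPoint_mem_chartOpen L (hWne s) (he s)
  have hηX : ∀ s, genericPoint X ∈ W s := fun s => genericPoint_mem ⟨_, (hWne s).some_mem⟩
  let i₀ : Fin r := ⟨0, hr⟩
  let x : S → Fin r → (projectiveBundle (⨁ L)).functionField := fun s j =>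
    ratFrac (e s i₀) (e s j) ⟨_, hη s i₀⟩
  have hx : ∀ s j, x s j ≠ 0 := fun s j => ratFrac_ne_zero _ _ _ ⟨_, hη s j⟩
  have hquot : ∀ s i j (y : chartOpen (⨁ L) (Ws s) (e s i)),
      ratFrac (e s i) (e s j) y = x s j / x s i := fun s i j y => by
    rw [eq_div_iff (hx s i), mul_comm]
    exact ratFrac_mul _ _ _ _ y
  -- the change of coordinates `e s j / e s i₀ = v * e s' j / e s' i₀`
  have hv : ∀ s s' j, ∃ v, x s j = α v * x s' j ∧ ∀ z ∈ W s, z ∈ W s' → v ∈ stalkRing z :=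
    fun s s' j => by
      have h1 := fun z (hz : z ∈ W s) (hz' : z ∈ W s') =>
        exists_ratFrac_eq_mul (he s') (he s) hz' hz i₀ j ⟨_, hη s' i₀⟩ ⟨_, hη s i₀⟩
      obtain ⟨v, -, hv⟩ := h1 _ (hηX s) (hηX s')
      refine ⟨v, hv, fun z hz hz' => ?_⟩
      obtain ⟨v', hv1, hv2⟩ := h1 z hz hz'
      have h2 := mul_right_cancel₀ (hx s' j) (hv.symm.trans hv2)
      rw [α.injective h2]
      exact hv1
  choose v hxv hv using hv
  let γ : ∀ s, Option (G s) → X.functionField := fun s o =>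
    o.elim 1 fun g => toRat (W s) ⟨_, hηX s⟩ g
  have hγ : ∀ s o, ∀ z ∈ W s, γ s o ∈ stalkRing z := fun s o z hz => by
    cases o with
    | none => exact one_mem _
    | some g => exact toRat_mem_stalkRing (W s) _ ⟨z, hz⟩ _
  have hN : ∀ i : Σ s, S × Fin r × Option (G s), ∃ N, ∀ n, N ≤ n → ∀ z ∈ W i.2.1,
      (b i.1 / b i.2.1) ^ n * (v i.1 i.2.1 i.2.2.1 * γ i.1 i.2.2.2) ∈ stalkRing z := fun i =>
    exists_forall_pow_mul_mem (hWaff _) (hWne _) (div_ne_zero (hb0 _) (hb0 _))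
      (fun z hz => (hform _ _ z hz).1) fun z hz hz' => by
        have h1 := (hform _ _ z hz).2 hz'
        exact mul_mem (hv _ _ _ z h1 hz) (hγ _ _ z h1)
  choose N₀ hN₀ using hN
  let N := Finset.univ.sup N₀
  -- one more factor `b s` ensures that the functions vanish outside the preimage of `W s`
  let f' : (Σ s, Fin r × Option (G s)) → (projectiveBundle (⨁ L)).functionField := fun i =>
    α (b i.1 ^ (N + 1) * γ i.1 i.2.2) * x i.1 i.2.1
  have hα : ∀ {a}, a ≠ 0 → α a ≠ 0 := fun ha => (map_ne_zero α).2 ha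
  have hdiv : ∀ s j o s' j', f' ⟨s, j, o⟩ / f' ⟨s', j', none⟩ = α (b s / b s') *
      (α ((b s / b s') ^ N * (v s s' j * γ s o)) * (x s' j / x s' j')) := fun s j o s' j' => by
    change α (b s ^ (N + 1) * γ s o) * x s j / (α (b s' ^ (N + 1) * 1) * x s' j') = _
    have h0 := hα (hb0 s')
    have h1 := hx s' j'
    rw [hxv s s' j]
    simp only [map_mul, map_div₀, map_pow, map_one, div_pow]
    field_simp
    ring
  have hmem1 : ∀ s s' j, ∀ y ∈ chartOpen (⨁ L) (Ws s') (e s' j),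
      α (b s / b s') ∈ stalkRing y := fun s s' j y hy =>
    algebraMap_mem_stalkRing π y (hform s s' (π y) (chartOpen_le (⨁ L) _ hy)).1
  have hmem2 : ∀ s j (o : Option (G s)) s' j', ∀ y ∈ chartOpen (⨁ L) (Ws s') (e s' j'),
      α ((b s / b s') ^ N * (v s s' j * γ s o)) ∈ stalkRing y := fun s j o s' j' y hy =>
    algebraMap_mem_stalkRing π y (hN₀ ⟨s, s', j, o⟩ N (Finset.le_sup (Finset.mem_univ _)) (π y)
      (chartOpen_le (⨁ L) _ hy))
  have hmem3 : ∀ s' j j', ∀ y ∈ chartOpen (⨁ L) (Ws s') (e s' j'),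
      x s' j / x s' j' ∈ stalkRing y := fun s' j j' y hy => by
    rw [← hquot s' j' j ⟨y, hy⟩]
    exact toRat_mem_stalkRing _ _ ⟨y, hy⟩ _
  have hf0 : ∀ s j, f' ⟨s, j, none⟩ ≠ 0 := fun s j =>
    mul_ne_zero (hα (mul_ne_zero (pow_ne_zero _ (hb0 s)) one_ne_zero)) (hx s j)
  refine ⟨_, inferInstance, f', {i | i.2.2 = none}, fun i => chartOpen (⨁ L) (Ws i.1) (e i.1 i.2.1),
    ?_, fun i _ => isAffineOpen_chartOpen (⨁ L) _, fun i _ => hη _ _, fun y => ?_, ?_, ?_, ?_⟩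
  · rintro ⟨s, j, o⟩ ho
    obtain rfl : o = none := ho
    exact hf0 s j
  · obtain ⟨s, hs⟩ := hcov (π y)
    obtain ⟨j, hj⟩ := exists_mem_chartOpen (⨁ L) (U := Ws s) (e s) (z := y) hs
    exact ⟨⟨s, j, none⟩, rfl, hj⟩
  · rintro ⟨s', j', o'⟩ ho ⟨s, j, o⟩ y hy
    obtain rfl : o' = none := ho
    rw [hdiv]
    exact mul_mem (hmem1 s s' j' y hy) (mul_mem (hmem2 s j o s' j' y hy) (hmem3 s' j j' y hy))
  · rintro ⟨s', j', o'⟩ ho' ⟨s, j, o⟩ ho y hy hinv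
    obtain rfl : o' = none := ho'
    obtain rfl : o = none := ho
    rw [hdiv] at hinv
    have h1 := hmem1 s s' j' y hy
    have h2 := hmem2 s j none s' j' y hy
    have h3 := hmem3 s' j j' y hy
    have h0 : f' ⟨s, j, none⟩ / f' ⟨s', j', none⟩ ≠ 0 := div_ne_zero (hf0 s j) (hf0 s' j')
    rw [hdiv] at h0
    have hy1 : π y ∈ W s := by
      refine (hform s s' (π y) (chartOpen_le (⨁ L) _ hy)).2 ?_
      refine inv_mem_stalkRing_of_inv_algebraMap_mem π y
        (hform s s' (π y) (chartOpen_le (⨁ L) _ hy)).1 ?_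
      rw [mul_comm] at hinv
      exact (stalkRing y).inv_mem_of_mul_inv_mem (mul_mem h2 h3) (right_ne_zero_of_mul h0) hinv
    have hy2 : y ∈ chartOpen (⨁ L) (Ws s') (e s' j) := by
      refine basicOpen_chartFrac_le (⨁ L) (e s' j') (e s' j)
        (mem_basicOpen_of_inv_mem ⟨y, hy⟩ (ratFrac_ne_zero (e s' j') (e s' j) ⟨y, hy⟩ ⟨_, hη s' j⟩) ?_)
      change (ratFrac (e s' j') (e s' j) ⟨y, hy⟩)⁻¹ ∈ _
      rw [hquot]
      rw [← mul_assoc] at hinv h0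
      exact (stalkRing y).inv_mem_of_mul_inv_mem (mul_mem h1 h2) (left_ne_zero_of_mul h0) hinv
    exact mem_chartOpen_of_mem (he s') (he s) hy2 hy1
  · rintro ⟨s, j, o⟩ ho y g
    obtain rfl : o = none := ho
    obtain ⟨p, rfl⟩ := (chartEquiv (⨁ L) (e s) j).surjective g
    have hy := chartOpen_le (⨁ L) (e s j) y.2
    rw [toRat_chartEquiv (e s) j y ⟨π y, hy⟩]
    have hself : ∀ m o, f' ⟨s, m, o⟩ / f' ⟨s, j, none⟩ = α (γ s o) * (x s m / x s j) := fun m o => by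
      change α (b s ^ (N + 1) * γ s o) * x s m / (α (b s ^ (N + 1) * 1) * x s j) = _
      have h0 := hα (hb0 s)
      have h1 := hx s j
      simp only [map_mul, map_pow, map_one]
      field_simp
    refine MvPolynomial.eval₂_mem (fun m _ => ?_) fun l => ?_
    · have h1 : Subring.closure (Set.range (constSection t (W s)) ∪ G s) ≤
          (Subring.closure (Set.range (constRat (π ≫ t)) ∪
            Set.range fun i => f' i / f' ⟨s, j, none⟩)).comap
            (α.comp (toRat (W s) ⟨π y, hy⟩)) := by
        rw [Subring.closure_le]
        rintro _ (⟨c, rfl⟩ | hg)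
        · refine Subring.subset_closure (Or.inl ⟨c, ?_⟩)
          rw [RingHom.comp_apply, toRat_constSection, ← algebraMap_constRat π]
        · rename_i g
          refine Subring.subset_closure (Or.inr ⟨⟨s, j, some ⟨g, hg⟩⟩, ?_⟩)
          dsimp only
          rw [hself, div_self (hx s j), mul_one]
          rfl
      exact h1 (hG s _)
    · refine Subring.subset_closure (Or.inr ⟨⟨s, l, none⟩, ?_⟩)
      dsimp only
      rw [hself, hquot]
      change α 1 * _ = _
      rw [map_one, one_mul]

end bundleCoordinates

/-! ### The projective bundle as a normal projective variety -/

theorem exists_isClosedImmersion_bundle {k : Type u} [Field k] {X : Scheme.{u}} (s : X ⟶ Spec (.of k))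
    [IsNormalProjectiveVariety s] {r : ℕ} (hr : 0 < r) (L : Fin r → X.Modules)
    [∀ i, IsLineBundle (L i)] :
    ∃ (n : ℕ) (i : projectiveBundle (⨁ L) ⟶
        Proj (MvPolynomial.homogeneousSubmodule (Fin (n + 1)) k)),
      IsClosedImmersion i ∧ i ≫ projToSpec (MvPolynomial.homogeneousSubmodule (Fin (n + 1)) k) =
        projectiveBundle.π (⨁ L) ≫ s := by
  have hX : IsNormalProjectiveVariety s := inferInstance
  have := hX.isIntegral
  have := hX.isNormal
  have := hX.isNoetherian
  have := isIntegral_bundle L hr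
  let _ : Algebra X.functionField (projectiveBundle (⨁ L)).functionField :=
    (functionFieldMap (projectiveBundle.π (⨁ L))).toAlgebra
  have hext : IsFunctionFieldExtension (projectiveBundle.π (⨁ L)) :=
    ⟨fun le x y a => functionFieldMap_toRat _ le x y a⟩
  obtain ⟨n, i, hi, his⟩ := hX.exists_isClosedImmersion
  have hs : IsProper s := by
    have := isProper_projToSpec_mvPolynomial (k := k) n
    rw [← his]
    infer_instance
  obtain ⟨f, A, V, hf⟩ := exists_isProjectiveSystem s i his
  obtain ⟨ι, _, f', A', V', hf'⟩ := exists_isProjectiveSystem_bundle (L := L) hf hr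
  obtain ⟨m, hm⟩ : ∃ m, Fintype.card ι = m + 1 := by
    obtain ⟨a, -⟩ := hf'.exists_mem (genericPoint _)
    have : Nonempty ι := ⟨a⟩
    exact Nat.exists_eq_succ_of_ne_zero Fintype.card_ne_zero
  exact ⟨m, (hf'.reindex (Fintype.equivFinOfCardEq hm).symm).exists_isClosedImmersion⟩

theorem charP_functionField {X : Scheme.{u}} [AlgebraicGeometry.IsIntegral X] {p : ℕ}
    [Fact p.Prime] (h : (p : Γ(X, ⊤)) = 0) : CharP X.functionField p := by
  rw [CharP.charP_iff_prime_eq_zero Fact.out]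
  have h1 := congrArg (toRat ⊤ (⟨genericPoint X, trivial⟩ : (⊤ : X.Opens))) h
  rwa [map_natCast, map_zero] at h1

theorem flatPullback_nonneg {P X : Scheme.{u}} (π : P ⟶ X) [Flat π]
    [AlgebraicGeometry.IsNoetherian P] {Δ : QDivisor X} (h : 0 ≤ Δ) : 0 ≤ flatPullback π Δ := by
  classical
  intro y
  change (0 : ℚ) ≤ if h : Order.coheight (π y.1) = 1 then _ else 0
  split_ifs with h1
  · exact mul_nonneg (Nat.cast_nonneg _) (h _)
  · exact le_rfl

theorem isNormalProjectiveVariety_bundle {k : Type u} [Field k] {X : Scheme.{u}}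
    (s : X ⟶ Spec (.of k)) [h : IsNormalProjectiveVariety s] {r : ℕ} (hr : 0 < r)
    (L : Fin r → X.Modules) [∀ i, IsLineBundle (L i)] :
    IsNormalProjectiveVariety (projectiveBundle.π (⨁ L) ≫ s) :=
  haveI := h.isIntegral
  haveI := h.isNormal
  haveI := h.isNoetherian
  ⟨isIntegral_bundle L hr, isNormalScheme_bundle L, exists_isClosedImmersion_bundle s hr L⟩

theorem proposition3p1 (p : ℕ) [Fact p.Prime] (k : Type u) [Field k] [CharP k p]
    (hk : (frobenius k p).Finite) {X : Scheme.{u}} (s : X ⟶ Spec (.of k))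
    [IsNormalProjectiveVariety s] (Δ : QDivisor X) {r : ℕ} (hr : 0 < r)
    (L : Fin r → X.Modules) [∀ i, IsLineBundle (L i)] :
    ∃ (_ : IsNormalProjectiveVariety (projectiveBundle.π (⨁ L) ≫ s))
      (_ : AlgebraicGeometry.IsNoetherian (projectiveBundle (⨁ L)))
      (_ : Flat (projectiveBundle.π (⨁ L))),
      (IsGloballyFRegular p s Δ → IsGloballyFRegular p (projectiveBundle.π (⨁ L) ≫ s)
        (flatPullback (projectiveBundle.π (⨁ L)) Δ)) ∧
      (IsGloballySharplyFSplit p s Δ → IsGloballySharplyFSplit p (projectiveBundle.π (⨁ L) ≫ s)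
        (flatPullback (projectiveBundle.π (⨁ L)) Δ)) := by
  have hX : IsNormalProjectiveVariety s := inferInstance
  have := hX.isIntegral
  have := hX.isNormal
  have := hX.isNoetherian
  have hP := isNormalProjectiveVariety_bundle s hr L
  have := hP.isIntegral
  have := hP.isNormal
  have hN := hP.isNoetherian
  have hchar : CharP X.functionField p := charP_functionField (natCast_eq_zero_of_charP s p)
  let _ : Algebra X.functionField (projectiveBundle (⨁ L)).functionField :=
    (functionFieldMap (projectiveBundle.π (⨁ L))).toAlgebra
  have hext : IsFunctionFieldExtension (projectiveBundle.π (⨁ L)) :=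
    ⟨fun le x y a => functionFieldMap_toRat _ le x y a⟩
  obtain ⟨x, i₀, h1, h2, h3, h4, h5, U₀, h6, h7⟩ := exists_coordinates L hr
  have hx : IsProjectiveCoordinates (projectiveBundle.π (⨁ L)) x i₀ U₀ :=
    ⟨h1, h2, h3, h4, h5, h6, h7⟩
  have ht := fun (y : projectiveBundle (⨁ L)) hy hy' => exists_uniformizer_bundle L (y := y) hy hy'
  have hlen := fun (y : projectiveBundle (⨁ L)) hy hy' => length_fiber_eq_one L (y := y) hy hy'
  refine ⟨hP, hN, inferInstance, fun ⟨hΔ, h⟩ => ⟨flatPullback_nonneg _ hΔ, fun D hD => ?_⟩,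
    fun ⟨hΔ, e, he, h⟩ => ⟨flatPullback_nonneg _ hΔ, e, he, ?_⟩⟩
  · obtain ⟨e, he, Ψ⟩ := exists_isSplitting_flatPullback_add (p := p) (Δ := Δ) hx ht hlen
      (fun D' hD' => by
        obtain ⟨e, he, h'⟩ := h D' hD'
        exact ⟨e, he, (isSplitMono_iff _).1 h'⟩) D
    exact ⟨e, he, (isSplitMono_iff _).2 Ψ⟩
  · obtain ⟨φ, hφ⟩ := (isSplitMono_iff _).1 h
    exact (isSplitMono_iff _).2 (hφ.flatPullback hx ht hlen)
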